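/- **Proposition 17.** Let $(\chi,\varphi)$ be smooth nonnegative functions on $\mathbb R^2$ with $\operatorname{Supp}\chi\subset\{|\xi|\le 4/3\}$, $\operatorname{Supp}\varphi\subset\{3/4\le|\xi|\le 8/3\}$ and $\chi(\xi)+\sum_{q\ge0}\varphi(2^{-q}\xi)=1$ for all $\xi$. Set $\Delta_{-1}=\chi(D)$, $\Delta_q=\varphi(2^{-q}D)$ for $q\ge0$, $S_N=\sum_{-1\le p\le N-1}\Delta_p$, and $\|u\|_{B^r_{2,\infty}}=\sup_{q\ge-1}2^{qr}\|\Delta_qu\|_{L^2}$. For time-dependent $u$ put $$\|u\|_{\widetilde L^2_t(B^r_{2,\infty})}=\sup_{q\ge-1}2^{qr}\Big(\int_0^t\|\Delta_qu(\tau)\|_{L^2}^2\,d\tau\Big)^{1/2},\qquad \|u\|_{L^2_t(B^r_{2,\infty})}=\Big(\int_0^t\|u(\tau)\|_{B^r_{2,\infty}}^2\,d\tau\Big)^{1/2}.$$ Let $s\in(-1,1)$. There is a constant $C>0$ depending only on $s$ (and on the choice of $(\chi,\varphi)$) such that the following holds. Let $\nu,T>0$, let $v\in L^1([0,T];\mathcal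 S'(\mathbb R^2))$ be a real vector field with $\operatorname{div}v=0$, and let $0\le V\in L^1([0,T])$ satisfy, for almost every $t\in[0,T]$, $$\sup_{N\ge0}\frac{\|\nabla S_Nv(t)\|_{L^\infty}}{\sqrt{1+N}}\le V(t).$$ Let $w_0\in B^s_{2,\infty}$, $f\in L^1([0,T];B^s_{2,\infty})$ and $g\in L^2([0,T];B^{s-1}_{2,\infty})$, and let $(w,\Pi)$ be a solution on $[0,T]\times\mathbb R^2$, in the sense of distributions, of the anisotropic Stokes system with convection $$\partial_tw+v\cdot\nabla w-\nu\,\partial_1^2w+\nabla\Pi=f+g\,e_2,\qquad \operatorname{div}w=0,\qquad w|_{t=0}=w_0,$$ where $e_2=(0,1)$, $v\cdot\nabla w:=\lim_{N\to\infty}S_Nv\cdot\nabla S_Nw$ in $\mathcal S'$, and where $w$ is bounded on $[0,T]$ with values in $B^\sigma_{2,\infty}$ for some $\sigma>-1$. Then for all $\varepsilon\in(0,(s+1)/2)$ and $t\in[0,T]$, $$\|w(t)\|_{B^{s-\varepsilon}_{2,\infty}}+\nu^{\frac12}\|\partial_1w\|_{\widetilde L^2_t(B^{s-\varepsilon}_{2,\infty})}\le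 C(1+\sqrt{\nu t})\,e^{\frac C\varepsilon\left(\int_0^tV(\tau)d\tau\right)^2}\Big(\|w_0\|_{B^s_{2,\infty}}+\|f\|_{L^1_t(B^s_{2,\infty})}+\nu^{-\frac12}\|g\|_{L^2_t(B^{s-1}_{2,\infty})}\Big),$$ and $$\|w(t)\|_{B^{s-\varepsilon}_{2,\infty}}+\nu^{\frac12}\|\partial_1w\|_{L^2_t(B^{s-\varepsilon}_{2,\infty})}\le \frac{C}{\sqrt\varepsilon}(1+\sqrt{\nu t})\,e^{\frac C\varepsilon\left(\int_0^tV(\tau)d\tau\right)^2}\Big(\|w_0\|_{B^s_{2,\infty}}+\|f\|_{L^1_t(B^s_{2,\infty})}+\nu^{-\frac12}\|g\|_{L^2_t(B^{s-1}_{2,\infty})}\Big).$$ -/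

import Mathlib

open MeasureTheory Set Filter Topology
open scoped SchwartzMap LineDeriv ENNReal

noncomputable section

namespace AnisotropicStokes

/-- The plane `ℝ²` with its Euclidean norm. -/
abbrev Plane : Type := EuclideanSpace ℝ (Fin 2)

/-- The space of values of vector fields. Real vector fields are those with real pairings,
see `IsRealField`. -/
abbrev CVec : Type := EuclideanSpace ℂ (Fin 2)

/-- The vectors `e₁, e₂` of the canonical basis of `ℝ²` (indexed by `0, 1`). -/
def e (i : Fin 2) : Plane := EuclideanSpace.single i (1 : ℝ)

/-! ### Littlewood-Paley decomposition and Besov norms -/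

/-- A couple `(χ, φ)` of smooth nonnegative functions with `Supp χ ⊆ {|ξ| ≤ 4/3}`,
`Supp φ ⊆ {3/4 ≤ |ξ| ≤ 8/3}` and `χ(ξ) + ∑_{q ≥ 0} φ(2^{-q} ξ) = 1` for all `ξ`. -/
structure DyadicPartition where
  chi : Plane → ℝ
  phi : Plane → ℝ
  chi_smooth : ContDiff ℝ ((⊤ : ℕ∞) : WithTop ℕ∞) chi
  phi_smooth : ContDiff ℝ ((⊤ : ℕ∞) : WithTop ℕ∞) phi
  chi_nonneg : ∀ ξ, 0 ≤ chi ξ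
  phi_nonneg : ∀ ξ, 0 ≤ phi ξ
  chi_support : tsupport chi ⊆ {ξ | ‖ξ‖ ≤ 4 / 3}
  phi_support : tsupport phi ⊆ {ξ | 3 / 4 ≤ ‖ξ‖ ∧ ‖ξ‖ ≤ 8 / 3}
  sum_eq_one : ∀ ξ, HasSum (fun q : ℕ => phi (((2 : ℝ) ^ q)⁻¹ • ξ)) (1 - chi ξ)

section Norms

variable {F : Type*} [NormedAddCommGroup F] [NormedSpace ℂ F]

/-- The partial derivative `∂_i u` in the sense of distributions. -/
def pderiv (i : Fin 2) (u : 𝓢'(Plane, F)) : 𝓢'(Plane, F) :=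
  ∂_{e i} u

/-- The Fourier multiplier `m(D)` with real symbol `m`, for the Fourier transform with kernel
`exp(-i x·ξ)`. Mathlib's Fourier transform has kernel `exp(-2πi x·ξ)`, whence the dilation. -/
def multiplier (m : Plane → ℝ) : 𝓢'(Plane, F) →L[ℂ] 𝓢'(Plane, F) :=
  TemperedDistribution.fourierMultiplierCLM F
    (fun ξ => ((m ((2 * Real.pi) • ξ) : ℝ) : ℂ))

/-- The dyadic blocks: `Δ_q = 0` for `q ≤ -2`, `Δ_{-1} = χ(D)`, `Δ_q = φ(2^{-q} D)` for
`q ≥ 0`. -/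
def block (P : DyadicPartition) (q : ℤ) : 𝓢'(Plane, F) →L[ℂ] 𝓢'(Plane, F) :=
  if q ≤ -2 then 0
  else if q = -1 then multiplier P.chi
  else multiplier (fun ξ => P.phi (((2 : ℝ) ^ q)⁻¹ • ξ))

/-- The low frequency cut-off `S_N = ∑_{p ≤ N - 1} Δ_p`, for `N ≥ 0`. -/
def lowFreq (P : DyadicPartition) (N : ℕ) : 𝓢'(Plane, F) →L[ℂ] 𝓢'(Plane, F) :=
  ∑ p ∈ Finset.Ico (-1 : ℤ) N, block P p

variable [CompleteSpace F]

/-- The `L^p` norm of a tempered distribution: the norm of the function of `L^p` that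
represents it, and `∞` if there is none. -/
def distLpNorm (p : ℝ≥0∞) [Fact (1 ≤ p)] (u : 𝓢'(Plane, F)) : ℝ≥0∞ :=
  ⨅ h : {h : Lp F p (volume : Measure Plane) // (h : 𝓢'(Plane, F)) = u}, ‖h.1‖ₑ

/-- The norm of `B^r_{2,∞}`: the supremum over `q ≥ -1` of `2^{qr} ‖Δ_q u‖_{L²}`. -/
def besovNorm (P : DyadicPartition) (r : ℝ) (u : 𝓢'(Plane, F)) : ℝ≥0∞ :=
  ⨆ (q : ℤ) (_ : -1 ≤ q), ENNReal.ofReal ((2 : ℝ) ^ ((q : ℝ) * r)) * distLpNorm 2 (block P q u)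

/-- The norm of `L¹([0,t]; B^r_{2,∞})`. -/
def timeL1Besov (P : DyadicPartition) (r t : ℝ) (u : ℝ → 𝓢'(Plane, F)) : ℝ≥0∞ :=
  ∫⁻ τ in Icc 0 t, besovNorm P r (u τ)

/-- The norm of `L²([0,t]; B^r_{2,∞})`. -/
def timeL2Besov (P : DyadicPartition) (r t : ℝ) (u : ℝ → 𝓢'(Plane, F)) : ℝ≥0∞ :=
  (∫⁻ τ in Icc 0 t, besovNorm P r (u τ) ^ 2) ^ (1 / 2 : ℝ)

/-- The variant of the norm of `L²([0,t]; B^r_{2,∞})` in which the time integration is performed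
on each dyadic block: the supremum over `q ≥ -1` of `2^{qr} ‖Δ_q u‖_{L²([0,t]; L²)}`. -/
def blockTimeL2Besov (P : DyadicPartition) (r t : ℝ) (u : ℝ → 𝓢'(Plane, F)) : ℝ≥0∞ :=
  ⨆ (q : ℤ) (_ : -1 ≤ q), ENNReal.ofReal ((2 : ℝ) ^ ((q : ℝ) * r)) *
    (∫⁻ τ in Icc 0 t, distLpNorm 2 (block P q (u τ)) ^ 2) ^ (1 / 2 : ℝ)

end Norms

/-! ### Vector fields, convection, solutions -/

/-- `u ∈ L¹([0,T]; 𝓢')`: all pairings with test functions are integrable over `[0,T]`. -/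
def WeaklyIntegrable {F : Type*} [NormedAddCommGroup F] [NormedSpace ℂ F] (T : ℝ)
    (u : ℝ → 𝓢'(Plane, F)) : Prop :=
  ∀ ψ : 𝓢(Plane, ℂ), IntegrableOn (fun t => u t ψ) (Icc 0 T)

/-- The distribution `u` is a real vector field: its pairings with real test functions are real. -/
def IsRealField (u : 𝓢'(Plane, CVec)) : Prop :=
  ∀ ψ : 𝓢(Plane, ℂ), (∀ x, (ψ x).im = 0) → ∀ i, (u ψ i).im = 0

/-- `div u = ∂₁ u¹ + ∂₂ u² = 0` in the sense of distributions. -/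
def DivFree (u : 𝓢'(Plane, CVec)) : Prop :=
  ∀ ψ : 𝓢(Plane, ℂ), ∑ i : Fin 2, (pderiv i u) ψ i = 0

/-- The pairing of the gradient of `p` with a scalar test function. -/
def gradPairing (p : 𝓢'(Plane, ℂ)) (ψ : 𝓢(Plane, ℂ)) : CVec :=
  WithLp.toLp 2 (fun i : Fin 2 => (pderiv i p) ψ)

/-- `c = v · ∇w`, where the product of distributions is the one given by the Littlewood-Paley
decomposition: `∑_j (S_N v^j) (∂_j S_N w)` tends to `c` in `𝓢'` as `N → ∞`. Here `A N` is
the smooth function with temperate growth which represents `S_N v`. -/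
def IsConvection (P : DyadicPartition) (v w c : 𝓢'(Plane, CVec)) : Prop :=
  ∃ (A : ℕ → Plane → CVec) (hA : ∀ N, (A N).HasTemperateGrowth),
    (∀ N, Function.HasTemperateGrowth.toTemperedDistribution volume (hA N) = lowFreq P N v) ∧
    ∀ ψ : 𝓢(Plane, ℂ), Tendsto
      (fun N => ∑ j : Fin 2, TemperedDistribution.smulLeftCLM CVec (fun x => A N x j)
        (pderiv j (lowFreq P N w)) ψ) atTop (𝓝 (c ψ))

/-- `(w, Π)` is a solution on `[0,T] × ℝ²` of
`∂_t w + v·∇w - ν ∂₁² w + ∇Π = f + g e₂`, `div w = 0`, with initial data `w₀`: all terms are in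
`L¹([0,T]; 𝓢')` and the equation, integrated in time from `0` to `t`, holds in `𝓢'` for all
`t ∈ [0,T]`. -/
structure IsSolution (P : DyadicPartition) (ν T : ℝ) (v w : ℝ → 𝓢'(Plane, CVec))
    (w₀ : 𝓢'(Plane, CVec)) (p : ℝ → 𝓢'(Plane, ℂ)) (f : ℝ → 𝓢'(Plane, CVec))
    (g : ℝ → 𝓢'(Plane, ℂ)) : Prop where
  w_int : WeaklyIntegrable T w
  grad_int : ∀ i, WeaklyIntegrable T (fun t => pderiv i (p t))
  f_int : WeaklyIntegrable T f
  g_int : WeaklyIntegrable T g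
  div_w : ∀ t ∈ Icc 0 T, DivFree (w t)
  equation : ∃ c : ℝ → 𝓢'(Plane, CVec), WeaklyIntegrable T c ∧
    (∀ᵐ t ∂(volume.restrict (Icc 0 T)), IsConvection P (v t) (w t) (c t)) ∧
    ∀ t ∈ Icc 0 T, ∀ ψ : 𝓢(Plane, ℂ),
      w t ψ = w₀ ψ + ∫ τ in (0 : ℝ)..t,
        (f τ ψ + (WithLp.toLp 2 ![0, g τ ψ] : CVec) - c τ ψ
          + (ν : ℂ) • (pderiv 0 (pderiv 0 (w τ))) ψ - gradPairing (p τ) ψ)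

/-- Hypotheses on the convecting field: `v` is a real divergence free vector field (integrable in
time with values in `𝓢'`), and `V ∈ L¹([0,T])` satisfies, for almost every `t`,
`sup_{N ≥ 0} ‖∇S_N v(t)‖_{L^∞} / √(1 + N) ≤ V(t)`. The columns of `∇S_N v` are bounded one by one;
all norms of the matrix give the same estimates up to the constant. -/
structure IsLosingField (P : DyadicPartition) (T : ℝ) (v : ℝ → 𝓢'(Plane, CVec)) (V : ℝ → ℝ) :
    Prop where
  v_int : WeaklyIntegrable T v
  v_real : ∀ᵐ t ∂(volume.restrict (Icc 0 T)), IsRealField (v t)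
  v_div : ∀ᵐ t ∂(volume.restrict (Icc 0 T)), DivFree (v t)
  V_int : IntegrableOn V (Icc 0 T)
  V_nonneg : ∀ᵐ t ∂(volume.restrict (Icc 0 T)), 0 ≤ V t
  grad_le : ∀ᵐ t ∂(volume.restrict (Icc 0 T)), ∀ (N : ℕ) (j : Fin 2),
    distLpNorm ∞ (pderiv j (lowFreq P N (v t))) ≤ ENNReal.ofReal (V t * √(1 + (N : ℝ)))

/-- The size of the data on `[0,t]`:
`‖w₀‖_{B^s_{2,∞}} + ‖f‖_{L¹_t(B^s_{2,∞})} + ν^{-1/2} ‖g‖_{L²_t(B^{s-1}_{2,∞})}`. -/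
def dataSize (P : DyadicPartition) (s ν t : ℝ) (w₀ : 𝓢'(Plane, CVec))
    (f : ℝ → 𝓢'(Plane, CVec)) (g : ℝ → 𝓢'(Plane, ℂ)) : ℝ≥0∞ :=
  besovNorm P s w₀ + timeL1Besov P s t f
    + ENNReal.ofReal (ν ^ (-(1 / 2) : ℝ)) * timeL2Besov P (s - 1) t g

end AnisotropicStokes

end

open AnisotropicStokes

open MeasureTheory Set Filter Topology
open scoped SchwartzMap LineDeriv ENNReal

noncomputable section

namespace AnisotropicStokes

open scoped FourierTransform

/-! ### Scalar distributions and their `L²` bounds -/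

/-! The proof is an `L²` energy estimate on each dyadic block, made with a weight that lets the
regularity decrease in time at a speed driven by `V`. Write `W(t) = ∫₀ᵗ V`, and index by `n` the
block `Δ_{n-1}`, which lives at frequencies of order `2^n`.

Localization. The Leray projection of a block removes the pressure. The convection term becomes
`B·∇` acting on the block, where `B` is the real part of `S_{n+2} v`, plus a remainder bounded in
`L²`. Since `B` is real, divergence free and Lipschitz, `B·∇` contributes nothing to the energy
(`transport_energy`). The remainder has two sources: the commutator of the block with `S_{n+2} v`,
and the increments `S_{l+1} v - S_l v` for `l ≥ n + 2`, which are of size `2^{-l} V √(3 + l)` by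
Bernstein's inequality. It is therefore at most `V √(3 + n)` times a sum of norms of blocks of `w`,
with factors `2^{n'-n}` below and `2^{n-l}` above (`exists_convection_bound`). The square root is
the one in the hypothesis on `∇S_N v`.

Weights. Let `ω_n(t) = B_n exp(-κ_n W(t))`, and let `Z` be the supremum over `n` and `t` of `ω_n`
times the norm of the block. If the weights change by a factor `2θ < 2` at most from one scale to
the next, the remainder is at most `c V √(3 + n) Z / ω_n`. Differentiating the weight produces a
damping `κ_n V`, which absorbs this remainder by Young's inequality up to `4 c² (3 + n) Z² / κ_n²`
(`weighted_energy_le`). The choice `κ_n = η (n + 1) + 12 c² / η` makes this at most `Z² / 4`, so `Z`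
is controlled by the data (`exists_weighted_estimate`). Undoing the weight costs `exp(κ_n W)`. With
`η W = ε log 2` this is `2^{ε(n+1)}`, a loss of `ε` derivatives, times `exp(C W² / ε)`
(`exists_propagation`).

The force `g e₂`. The second column of the symbol of the Leray projection is divisible by `ξ₁`. Its
contribution to the energy is thus the product of `∂₁ w` with an operator of order `-1` applied to
`g`, and the viscosity absorbs it. On the first block the operator of order `-1` is not bounded;
there `g` is estimated directly by Cauchy-Schwarz in time, whence the factor `1 + √(νt)`.

Finiteness of `Z`. Since `w` is only bounded in some `B^σ` with `σ > -1`, the weights are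
`min(2^{s(m-1)}, K 2^{α(m-1)})`, with `K` chosen so that a prescribed block sees the first term; the
bounds do not depend on `K`. A first pass, with constants depending on `σ`, brings `w` to a
regularity that depends only on `s`. A second pass then has constants depending only on `s`
(`exists_losing_estimate`).

Technicalities. The symbol of the Leray projection is singular at the origin, so the frequencies
`|ξ| ≲ 2^{-k}` are first removed from `Δ_{-1}`, with estimates uniform in `k`, and then `k → ∞`. The
field `B` grows linearly, so the transport identity is proved with spatial cut-offs. Equations are
known only against test functions, so the energy identity is derived from the weak form. For the
estimate where the time norm is outside the supremum, the supremum is dominated by an `ℓ²` sum over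
blocks; applying the block estimate with `ε / 2` makes it converge, at the price of `1/√ε`. -/

/-- Scalar test functions. -/
abbrev Test : Type := 𝓢(Plane, ℂ)

/-- Scalar tempered distributions. -/
abbrev Dist : Type := 𝓢'(Plane, ℂ)

/-- The space `L²(ℝ²; ℂ)`. -/
abbrev L2 : Type := Lp ℂ 2 (volume : Measure Plane)

/-- The components of a vector valued distribution. -/
def coord (i : Fin 2) (u : 𝓢'(Plane, CVec)) : Dist :=
  PointwiseConvergenceCLM.postcomp Test (EuclideanSpace.proj i : CVec →L[ℂ] ℂ) u

@[simp] lemma coord_apply (i : Fin 2) (u : 𝓢'(Plane, CVec)) (ψ : Test) :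
    coord i u ψ = u ψ i := rfl

/-- Complex conjugation of test functions. -/
def conjTest : Test →L[ℝ] Test :=
  SchwartzMap.postcompCLM (𝕜 := ℝ) (Complex.conjCLE : ℂ →L[ℝ] ℂ)

@[simp] lemma conjTest_apply (ψ : Test) (x : Plane) :
    conjTest ψ x = (starRingEnd ℂ) (ψ x) := rfl

@[simp] lemma conjTest_conjTest (ψ : Test) : conjTest (conjTest ψ) = ψ :=
  SchwartzMap.ext fun x => by simp

lemma norm_toLp_two_sq (ψ : Test) : ‖ψ.toLp 2 (volume : Measure Plane)‖ ^ 2 = ∫ x, ‖ψ x‖ ^ 2 := by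
  have h := SchwartzMap.inner_toL2_toL2_eq ψ ψ (volume : Measure Plane)
  rw [inner_self_eq_norm_sq_to_K] at h
  apply Complex.ofRealLI.injective
  simp only [Complex.ofRealLI_apply]
  rw [← integral_complex_ofReal]
  refine Eq.trans (by push_cast; exact h) (integral_congr_ae (ae_of_all _ fun x => ?_))
  simp [inner_self_eq_norm_sq_to_K]

lemma norm_toLp_two_le_of_le {ψ η : Test} {K : ℝ} (h : ∀ x, ‖ψ x‖ ≤ K * ‖η x‖) :
    ‖ψ.toLp 2 (volume : Measure Plane)‖ ≤ K * ‖η.toLp 2 (volume : Measure Plane)‖ := by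
  refine Lp.norm_le_mul_norm_of_ae_le_mul ?_
  filter_upwards [ψ.coeFn_toLp 2 volume, η.coeFn_toLp 2 volume] with x h1 h2
  rw [h1, h2]; exact h x

@[simp] lemma norm_toLp_conjTest (ψ : Test) :
    ‖(conjTest ψ).toLp 2 (volume : Measure Plane)‖ = ‖ψ.toLp 2 (volume : Measure Plane)‖ := by
  apply le_antisymm
  · simpa using norm_toLp_two_le_of_le (ψ := conjTest ψ) (η := ψ) (K := 1) (by simp)
  · simpa using norm_toLp_two_le_of_le (ψ := ψ) (η := conjTest ψ) (K := 1) (by simp)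

/-- The pairing is bilinear while the inner product is conjugate linear on the left, whence the
conjugate. Weak equations become equations for inner products in this way. -/
lemma toDist_apply_eq_inner (h : L2) (ψ : Test) :
    (Lp.toTemperedDistribution h : Dist) ψ
      = inner ℂ ((conjTest ψ).toLp 2 (volume : Measure Plane)) h := by
  rw [Lp.toTemperedDistribution_apply, L2.inner_def]
  apply integral_congr_ae
  filter_upwards [(conjTest ψ).coeFn_toLp 2 volume] with x hx
  rw [hx]
  simp [mul_comm]

/-- The distribution `T` is bounded by `R` for the `L²` norm of test functions. -/
def L2Bound (T : Dist) (R : ℝ) : Prop :=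
  ∀ ψ : Test, ‖T ψ‖ ≤ R * ‖ψ.toLp 2 (volume : Measure Plane)‖

lemma L2Bound.mono {T : Dist} {R R' : ℝ} (h : L2Bound T R) (hR : R ≤ R') : L2Bound T R' :=
  fun ψ => (h ψ).trans (by gcongr)

lemma L2Bound.add {T S : Dist} {R R' : ℝ} (h : L2Bound T R) (h' : L2Bound S R') :
    L2Bound (T + S) (R + R') := fun ψ => by
  rw [add_mul]
  exact (norm_add_le _ _).trans (add_le_add (h ψ) (h' ψ))

lemma L2Bound.zero : L2Bound 0 0 := fun ψ => by
  have : (0 : Dist) ψ = 0 := rfl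
  simp [this]

lemma L2Bound.sum {ι : Type*} (s : Finset ι) {T : ι → Dist} {R : ι → ℝ}
    (h : ∀ i ∈ s, L2Bound (T i) (R i)) : L2Bound (∑ i ∈ s, T i) (∑ i ∈ s, R i) := by
  classical
  induction s using Finset.induction_on with
  | empty => simpa using L2Bound.zero
  | insert a s ha ih =>
    rw [Finset.sum_insert ha, Finset.sum_insert ha]
    exact (h a (by simp)).add (ih fun i hi => h i (by simp [hi]))

lemma l2Bound_toDist (h : L2) : L2Bound (Lp.toTemperedDistribution h) ‖h‖ := fun ψ => by
  rw [toDist_apply_eq_inner, mul_comm, ← norm_toLp_conjTest]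
  exact norm_inner_le_norm _ _

lemma denseRange_toLp :
    DenseRange (fun ψ : Test => ψ.toLp 2 (volume : Measure Plane)) :=
  SchwartzMap.denseRange_toLpCLM (F := ℂ) (E := Plane) (p := 2) (μ := volume)
    ENNReal.ofNat_ne_top

/-- The Riesz representation of distributions which are bounded for the `L²` norm. -/
lemma L2Bound.exists_rep {T : Dist} {R : ℝ} (hR : 0 ≤ R) (hT : L2Bound T R) :
    ∃ h : L2, (Lp.toTemperedDistribution h : Dist) = T ∧ ‖h‖ ≤ R := by
  have hd : DenseRange (SchwartzMap.toLpCLM ℂ (E := Plane) ℂ 2 volume) :=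
    SchwartzMap.denseRange_toLpCLM ENNReal.ofNat_ne_top
  let f : Test →ₗ[ℂ] ℂ := (PointwiseConvergenceCLM.coeLM ℂ Test ℂ) T
  have hf : ∀ ψ : Test, ‖f ψ‖ ≤ R * ‖SchwartzMap.toLpCLM ℂ (E := Plane) ℂ 2 volume ψ‖ := hT
  let L : L2 →L[ℂ] ℂ := f.extendOfNorm (SchwartzMap.toLpCLM ℂ (E := Plane) ℂ 2 volume).toLinearMap
  have hL : ∀ ψ : Test, L (ψ.toLp 2 volume) = T ψ := fun ψ =>
    LinearMap.extendOfNorm_eq hd ⟨R, hf⟩ ψ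
  have hLn : ‖L‖ ≤ R := LinearMap.opNorm_extendOfNorm_le hd hR hf
  let g : L2 := (InnerProductSpace.toDual ℂ L2).symm L
  have hg : ∀ x, inner ℂ g x = L x := fun x => InnerProductSpace.toDual_symm_apply
  -- The Riesz vector represents the form through the sesquilinear product; its conjugate represents
  -- it through the bilinear pairing.
  refine ⟨star g, ?_, ?_⟩
  · ext ψ
    rw [toDist_apply_eq_inner, ← hL ψ, ← hg, L2.inner_def, L2.inner_def]
    apply integral_congr_ae
    filter_upwards [(conjTest ψ).coeFn_toLp 2 volume, ψ.coeFn_toLp 2 volume,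
      Lp.coeFn_star g] with x h1 h2 h3
    rw [h1, h2, h3]
    simp [mul_comm]
  · have h1 : ‖star g‖ ≤ ‖g‖ := by
      refine Lp.norm_le_norm_of_ae_le ?_
      filter_upwards [Lp.coeFn_star g] with x hx
      rw [hx]; simp
    refine h1.trans ?_
    simpa [g] using hLn

/-- The `L²` function which represents a distribution, and `0` if there is none. -/
def rep (T : Dist) : L2 := by
  classical
  exact if h : ∃ h : L2, (Lp.toTemperedDistribution h : Dist) = T then h.choose else 0

lemma toDist_injective : Function.Injective
    (fun h : L2 => (Lp.toTemperedDistribution h : Dist)) := by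
  intro h h' hh
  have := Lp.ker_toTemperedDistributionCLM_eq_bot (F := ℂ) (μ := (volume : Measure Plane)) (p := 2)
  have h2 := LinearMap.ker_eq_bot.mp this
  exact h2 hh

@[simp] lemma rep_toDist (h : L2) : rep (Lp.toTemperedDistribution h) = h := by
  have h' : ∃ h' : L2, (Lp.toTemperedDistribution h' : Dist) = Lp.toTemperedDistribution h :=
    ⟨h, rfl⟩
  rw [rep, dif_pos h']
  exact toDist_injective h'.choose_spec

lemma L2Bound.toDist_rep {T : Dist} {R : ℝ} (hR : 0 ≤ R) (h : L2Bound T R) :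
    (Lp.toTemperedDistribution (rep T) : Dist) = T := by
  obtain ⟨g, rfl, -⟩ := h.exists_rep hR
  rw [rep_toDist]

lemma L2Bound.norm_rep_le {T : Dist} {R : ℝ} (hR : 0 ≤ R) (h : L2Bound T R) : ‖rep T‖ ≤ R := by
  obtain ⟨g, rfl, hg⟩ := h.exists_rep hR
  rwa [rep_toDist]

/-! ### Norms of vector valued distributions -/

lemma distLpNorm_toDist_le {F : Type*} [NormedAddCommGroup F] [NormedSpace ℂ F] [CompleteSpace F]
    {p : ℝ≥0∞} [Fact (1 ≤ p)] (h : Lp F p (volume : Measure Plane)) :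
    distLpNorm p (Lp.toTemperedDistribution h : 𝓢'(Plane, F)) ≤ ‖h‖ₑ :=
  iInf_le (fun k : {k : Lp F p (volume : Measure Plane) //
    (k : 𝓢'(Plane, F)) = Lp.toTemperedDistribution h} => ‖k.1‖ₑ) ⟨h, rfl⟩

lemma exists_of_distLpNorm_lt {F : Type*} [NormedAddCommGroup F] [NormedSpace ℂ F]
    [CompleteSpace F] {p : ℝ≥0∞} [Fact (1 ≤ p)] {u : 𝓢'(Plane, F)} {K : ℝ≥0∞}
    (h : distLpNorm p u < K) :
    ∃ g : Lp F p (volume : Measure Plane), Lp.toTemperedDistribution g = u ∧ ‖g‖ₑ < K := by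
  rw [distLpNorm, iInf_lt_iff] at h
  obtain ⟨⟨g, hg⟩, hlt⟩ := h
  exact ⟨g, hg, hlt⟩

lemma L2Bound.distLpNorm_le {T : Dist} {R : ℝ} (hR : 0 ≤ R) (h : L2Bound T R) :
    distLpNorm 2 T ≤ ENNReal.ofReal R := by
  obtain ⟨g, rfl, hg⟩ := h.exists_rep hR
  refine (distLpNorm_toDist_le g).trans ?_
  rw [← ofReal_norm]
  exact ENNReal.ofReal_le_ofReal hg

/-- `distLpNorm` is an infimum, so a representative is only extracted up to an error. The value `δ /
(‖ψ‖ + 1)` of this error makes its contribution at most `δ`. -/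
lemma l2Bound_coord_of_distLpNorm_le {u : 𝓢'(Plane, CVec)} {R : ℝ} (hR : 0 ≤ R)
    (h : distLpNorm 2 u ≤ ENNReal.ofReal R) (i : Fin 2) : L2Bound (coord i u) R := by
  intro ψ
  refine le_of_forall_pos_le_add fun δ hδ => ?_
  set n := ‖ψ.toLp 2 (volume : Measure Plane)‖ with hn
  have hn0 : 0 ≤ n := norm_nonneg _
  have hlt : distLpNorm 2 u < ENNReal.ofReal (R + δ / (n + 1)) :=
    h.trans_lt ((ENNReal.ofReal_lt_ofReal_iff (by positivity)).2
      (lt_add_of_pos_right _ (by positivity)))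
  obtain ⟨g, rfl, hg⟩ := exists_of_distLpNorm_lt hlt
  rw [← ofReal_norm, ENNReal.ofReal_lt_ofReal_iff (by positivity)] at hg
  have key : coord i (Lp.toTemperedDistribution g) =
      Lp.toTemperedDistribution ((EuclideanSpace.proj i : CVec →L[ℂ] ℂ).compLp g) := by
    ext η
    rw [coord_apply, Lp.toTemperedDistribution_apply, Lp.toTemperedDistribution_apply]
    have hint : Integrable (fun x => η x • g x) (volume : Measure Plane) := by
      have := memLp_one_iff_integrable.1 ((Lp.memLp g).smul (η.memLp 2 volume) (r := 1))
      exact this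
    have := (EuclideanSpace.proj i : CVec →L[ℂ] ℂ).integral_comp_comm hint
    refine Eq.trans this.symm ?_
    apply integral_congr_ae
    filter_upwards [(EuclideanSpace.proj i : CVec →L[ℂ] ℂ).coeFn_compLp g] with x hx
    rw [hx]; simp
  rw [key]
  refine ((l2Bound_toDist _) ψ).trans ?_
  have h1 : ‖(EuclideanSpace.proj i : CVec →L[ℂ] ℂ).compLp g‖ ≤ ‖g‖ := by
    refine Lp.norm_le_norm_of_ae_le ?_
    filter_upwards [(EuclideanSpace.proj i : CVec →L[ℂ] ℂ).coeFn_compLp g] with x hx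
    rw [hx]
    exact PiLp.norm_apply_le (g x) i
  calc _ ≤ (R + δ / (n + 1)) * n := by gcongr; exact h1.trans hg.le
    _ = R * n + δ * (n / (n + 1)) := by ring
    _ ≤ R * n + δ * 1 := by
      gcongr
      rw [div_le_one (by positivity)]; linarith
    _ = R * n + δ := by ring

lemma l2Bound_of_distLpNorm_le {u : Dist} {R : ℝ} (hR : 0 ≤ R)
    (h : distLpNorm 2 u ≤ ENNReal.ofReal R) : L2Bound u R := by
  intro ψ
  refine le_of_forall_pos_le_add fun δ hδ => ?_
  set n := ‖ψ.toLp 2 (volume : Measure Plane)‖ with hn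
  have hn0 : 0 ≤ n := norm_nonneg _
  have hlt : distLpNorm 2 u < ENNReal.ofReal (R + δ / (n + 1)) :=
    h.trans_lt ((ENNReal.ofReal_lt_ofReal_iff (by positivity)).2
      (lt_add_of_pos_right _ (by positivity)))
  obtain ⟨g, rfl, hg⟩ := exists_of_distLpNorm_lt hlt
  rw [← ofReal_norm, ENNReal.ofReal_lt_ofReal_iff (by positivity)] at hg
  refine ((l2Bound_toDist _) ψ).trans ?_
  calc _ ≤ (R + δ / (n + 1)) * n := by gcongr
    _ = R * n + δ * (n / (n + 1)) := by ring
    _ ≤ R * n + δ * 1 := by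
      gcongr
      rw [div_le_one (by positivity)]; linarith
    _ = R * n + δ := by ring

lemma distLpNorm_le_of_coord {u : 𝓢'(Plane, CVec)} {R : Fin 2 → ℝ} (hR : ∀ i, 0 ≤ R i)
    (h : ∀ i, L2Bound (coord i u) (R i)) : distLpNorm 2 u ≤ ENNReal.ofReal (∑ i, R i) := by
  choose g hg hgR using fun i => (h i).exists_rep (hR i)
  let s (i : Fin 2) : ℂ →L[ℂ] CVec := (1 : ℂ →L[ℂ] ℂ).smulRight (EuclideanSpace.single i (1 : ℂ))
  have hs : ∀ i z, s i z = z • EuclideanSpace.single i (1 : ℂ) := fun i z => by simp [s]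
  let G : Lp CVec 2 (volume : Measure Plane) := ∑ i, (s i).compLp (g i)
  have hrep : ∀ i η, (Lp.toTemperedDistribution ((s i).compLp (g i)) : 𝓢'(Plane, CVec)) η =
      s i (u η i) := by
    intro i η
    rw [← coord_apply, ← hg i, Lp.toTemperedDistribution_apply, Lp.toTemperedDistribution_apply]
    have hint : Integrable (fun x => η x • g i x) (volume : Measure Plane) := by
      have := memLp_one_iff_integrable.1 ((Lp.memLp (g i)).smul (η.memLp 2 volume) (r := 1))
      exact this
    refine Eq.trans ?_ ((s i).integral_comp_comm hint)
    apply integral_congr_ae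
    filter_upwards [(s i).coeFn_compLp (g i)] with x hx
    rw [hx, map_smul]
  have hG : (Lp.toTemperedDistribution G : 𝓢'(Plane, CVec)) = u := by
    have : (Lp.toTemperedDistribution G : 𝓢'(Plane, CVec)) =
        ∑ i, (Lp.toTemperedDistribution ((s i).compLp (g i)) : 𝓢'(Plane, CVec)) :=
      map_sum (Lp.toTemperedDistributionCLM CVec (volume : Measure Plane) 2) _ _
    rw [this]
    ext η k
    rw [Fin.sum_univ_two]
    change ((Lp.toTemperedDistribution ((s 0).compLp (g 0)) : 𝓢'(Plane, CVec)) η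
      + (Lp.toTemperedDistribution ((s 1).compLp (g 1)) : 𝓢'(Plane, CVec)) η) k = _
    rw [hrep, hrep, hs, hs]
    fin_cases k <;> simp
  rw [← hG]
  refine (distLpNorm_toDist_le G).trans ?_
  rw [← ofReal_norm]
  apply ENNReal.ofReal_le_ofReal
  refine (norm_sum_le _ _).trans (Finset.sum_le_sum fun i _ => ?_)
  refine le_trans (Lp.norm_le_norm_of_ae_le ?_) (hgR i)
  filter_upwards [(s i).coeFn_compLp (g i)] with x hx
  rw [hx, hs, norm_smul]
  simp

/-- The hypothesis on `∇S_N v` is used in this dual form, as boundedness on `L¹`: multipliers with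
integrable kernels can then be moved to the test function. -/
lemma norm_coord_le_of_distLpNorm_top_le {u : 𝓢'(Plane, CVec)} {K : ℝ} (hK : 0 ≤ K)
    (h : distLpNorm ∞ u ≤ ENNReal.ofReal K) (i : Fin 2) (ψ : Test) :
    ‖coord i u ψ‖ ≤ K * ∫ x, ‖ψ x‖ := by
  refine le_of_forall_pos_le_add fun δ hδ => ?_
  set n := ∫ x, ‖ψ x‖ with hn
  have hn0 : 0 ≤ n := by positivity
  have hlt : distLpNorm ∞ u < ENNReal.ofReal (K + δ / (n + 1)) :=
    h.trans_lt ((ENNReal.ofReal_lt_ofReal_iff (by positivity)).2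
      (lt_add_of_pos_right _ (by positivity)))
  obtain ⟨g, rfl, hg⟩ := exists_of_distLpNorm_lt hlt
  rw [← ofReal_norm, ENNReal.ofReal_lt_ofReal_iff (by positivity)] at hg
  have hae : ∀ᵐ x ∂(volume : Measure Plane), ‖g x‖ ≤ ‖g‖ := by
    have := ae_le_eLpNormEssSup (f := (g : Plane → CVec)) (μ := (volume : Measure Plane))
    filter_upwards [this] with x hx
    rw [Lp.norm_def, ← toReal_enorm, eLpNorm_exponent_top]
    refine ENNReal.toReal_mono ?_ hx
    have := Lp.eLpNorm_ne_top g
    rwa [eLpNorm_exponent_top] at this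
  have h1 : ‖coord i (Lp.toTemperedDistribution g) ψ‖ ≤ ‖g‖ * n := by
    rw [coord_apply]
    refine (PiLp.norm_apply_le _ i).trans ?_
    rw [Lp.toTemperedDistribution_apply, hn, ← integral_const_mul]
    refine norm_integral_le_of_norm_le (ψ.integrable.norm.const_mul _) ?_
    filter_upwards [hae] with x hx
    rw [norm_smul, mul_comm]
    gcongr
  calc _ ≤ (K + δ / (n + 1)) * n := h1.trans (by gcongr)
    _ = K * n + δ * (n / (n + 1)) := by ring
    _ ≤ K * n + δ * 1 := by
      gcongr
      rw [div_le_one (by positivity)]; linarith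
    _ = K * n + δ := by ring

end AnisotropicStokes

namespace AnisotropicStokes

open scoped FourierTransform

/-! ### Fourier multipliers on test functions -/

/-- The transpose of the Fourier multiplier with symbol `a`. -/
def tmul (a : Plane → ℂ) : Test →L[ℂ] Test :=
  FourierTransform.fourierCLM ℂ Test ∘L (SchwartzMap.smulLeftCLM ℂ a) ∘L
    FourierTransform.fourierInvCLM ℂ Test

lemma tmul_apply (a : Plane → ℂ) (ψ : Test) :
    tmul a ψ = 𝓕 (SchwartzMap.smulLeftCLM ℂ a (𝓕⁻ ψ)) := rfl

/-- Fourier multipliers on scalar distributions. -/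
def dmul (a : Plane → ℂ) : Dist →L[ℂ] Dist := TemperedDistribution.fourierMultiplierCLM ℂ a

@[simp] lemma dmul_apply (a : Plane → ℂ) (T : Dist) (ψ : Test) : dmul a T ψ = T (tmul a ψ) := rfl

lemma coord_fourierMultiplierCLM (a : Plane → ℂ) (u : 𝓢'(Plane, CVec)) (i : Fin 2) :
    coord i (TemperedDistribution.fourierMultiplierCLM CVec a u) = dmul a (coord i u) := rfl

lemma tmul_tmul {a b : Plane → ℂ} (ha : a.HasTemperateGrowth) (hb : b.HasTemperateGrowth)
    (ψ : Test) : tmul a (tmul b ψ) = tmul (a * b) ψ := by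
  simp [tmul_apply, SchwartzMap.smulLeftCLM_smulLeftCLM_apply ha hb]

lemma tmul_comm {a b : Plane → ℂ} (ha : a.HasTemperateGrowth) (hb : b.HasTemperateGrowth)
    (ψ : Test) : tmul a (tmul b ψ) = tmul b (tmul a ψ) := by
  rw [tmul_tmul ha hb, tmul_tmul hb ha, mul_comm]

lemma tmul_add {a b : Plane → ℂ} (ha : a.HasTemperateGrowth) (hb : b.HasTemperateGrowth)
    (ψ : Test) : tmul (a + b) ψ = tmul a ψ + tmul b ψ := by
  simp [tmul_apply, SchwartzMap.smulLeftCLM_add ha hb, FourierTransform.fourier_add]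

lemma tmul_sub {a b : Plane → ℂ} (ha : a.HasTemperateGrowth) (hb : b.HasTemperateGrowth)
    (ψ : Test) : tmul (a - b) ψ = tmul a ψ - tmul b ψ := by
  have h : (a - b) + b = a := by simp
  rw [eq_sub_iff_add_eq, ← tmul_add (ha.sub hb) hb, h]

lemma tmul_smul {a : Plane → ℂ} (ha : a.HasTemperateGrowth) (c : ℂ)
    (ψ : Test) : tmul (c • a) ψ = c • tmul a ψ := by
  simp [tmul_apply, SchwartzMap.smulLeftCLM_smul ha, FourierTransform.fourier_smul]

lemma tmul_sum {ι : Type*} (s : Finset ι) {a : ι → Plane → ℂ}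
    (ha : ∀ i ∈ s, (a i).HasTemperateGrowth) (ψ : Test) :
    tmul (fun ξ => ∑ i ∈ s, a i ξ) ψ = ∑ i ∈ s, tmul (a i) ψ := by
  have h := SchwartzMap.smulLeftCLM_sum (F := ℂ) ha
  simp only [tmul_apply, h, _root_.sum_apply]
  exact map_sum (FourierTransform.fourierCLM ℂ Test) _ _

lemma tmul_zero (ψ : Test) : tmul (fun _ => 0) ψ = 0 := by
  simp only [tmul_apply, SchwartzMap.smulLeftCLM_const]
  simp [FourierTransform.fourier_zero]

lemma norm_fourierInv_toLp (ψ : Test) :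
    ‖(𝓕⁻ ψ).toLp 2 (volume : Measure Plane)‖ = ‖ψ.toLp 2 (volume : Measure Plane)‖ := by
  rw [← SchwartzMap.norm_fourier_toL2_eq (𝓕⁻ ψ), FourierTransform.fourier_fourierInv_eq]

lemma norm_tmul_le {a : Plane → ℂ} (ha : a.HasTemperateGrowth) {K : ℝ} (h : ∀ ξ, ‖a ξ‖ ≤ K)
    (ψ : Test) : ‖(tmul a ψ).toLp 2 (volume : Measure Plane)‖
      ≤ K * ‖ψ.toLp 2 (volume : Measure Plane)‖ := by
  rw [tmul_apply, SchwartzMap.norm_fourier_toL2_eq, ← norm_fourierInv_toLp ψ]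
  refine norm_toLp_two_le_of_le fun x => ?_
  rw [SchwartzMap.smulLeftCLM_apply_apply ha, norm_smul]
  gcongr; exact h x

lemma L2Bound.dmul {a : Plane → ℂ} (ha : a.HasTemperateGrowth) {K R : ℝ} (hR : 0 ≤ R)
    (h : ∀ ξ, ‖a ξ‖ ≤ K) {T : Dist} (hT : L2Bound T R) : L2Bound (dmul a T) (K * R) := fun ψ => by
  rw [dmul_apply]
  refine (hT _).trans ?_
  calc R * _ ≤ R * (K * ‖ψ.toLp 2 (volume : Measure Plane)‖) := by
        gcongr; exact norm_tmul_le ha h ψ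
    _ = _ := by ring

/-- Reflection of test functions. -/
def reflect : Test →L[ℂ] Test :=
  SchwartzMap.compCLMOfContinuousLinearEquiv ℂ (ContinuousLinearEquiv.neg ℝ (M := Plane))

@[simp] lemma reflect_apply (ψ : Test) (x : Plane) : reflect ψ x = ψ (-x) := rfl

/-- The transposed multiplier applies the two Fourier transforms in the opposite order. Reflections
restore the usual order, at the price of replacing the symbol by `a(-ξ)`. -/
lemma fourierInv_eq_reflect (ψ : Test) : 𝓕⁻ ψ = reflect (𝓕 ψ) := by
  refine SchwartzMap.ext fun x => ?_
  rw [reflect_apply, SchwartzMap.fourierInv_coe, SchwartzMap.fourier_coe,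
    Real.fourierInv_eq_fourier_neg]

lemma fourier_apply_neg (ψ : Test) (x : Plane) : (𝓕 ψ) (-x) = (𝓕⁻ ψ) x := by
  rw [fourierInv_eq_reflect, reflect_apply]

lemma fourierInv_apply_neg (ψ : Test) (x : Plane) : (𝓕⁻ ψ) (-x) = (𝓕 ψ) x := by
  rw [fourierInv_eq_reflect, reflect_apply, neg_neg]

lemma fourier_reflect (ψ : Test) : 𝓕 (reflect ψ) = 𝓕⁻ ψ := by
  have h : 𝓕⁻ (reflect ψ) = 𝓕 ψ := by
    refine SchwartzMap.ext fun x => ?_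
    rw [SchwartzMap.fourierInv_coe, SchwartzMap.fourier_coe, Real.fourierInv_eq_fourier_comp_neg]
    simp
  refine SchwartzMap.ext fun x => ?_
  rw [← fourierInv_apply_neg, h, fourier_apply_neg]

lemma fourierInv_reflect (ψ : Test) : 𝓕⁻ (reflect ψ) = 𝓕 ψ := by
  rw [fourierInv_eq_reflect, fourier_reflect, fourierInv_eq_reflect]
  refine SchwartzMap.ext fun x => by simp

/-- Multipliers expressed through the usual order of the Fourier transforms. -/
lemma tmul_eq_fourierInv {a : Plane → ℂ} (ha : a.HasTemperateGrowth) (ψ : Test) :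
    tmul a ψ = 𝓕⁻ (SchwartzMap.smulLeftCLM ℂ (fun ξ => a (-ξ)) (𝓕 ψ)) := by
  have ha' : Function.HasTemperateGrowth (fun ξ => a (-ξ)) :=
    ha.comp (ContinuousLinearEquiv.neg ℝ (M := Plane)).hasTemperateGrowth
  rw [tmul_apply, ← fourierInv_reflect]
  congr 1
  refine SchwartzMap.ext fun x => ?_
  rw [reflect_apply, SchwartzMap.smulLeftCLM_apply_apply ha, SchwartzMap.smulLeftCLM_apply_apply ha',
    fourierInv_apply_neg]

lemma HasTemperateGrowth.comp_neg {a : Plane → ℂ} (ha : a.HasTemperateGrowth) :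
    Function.HasTemperateGrowth (fun ξ => a (-ξ)) :=
  ha.comp (ContinuousLinearEquiv.neg ℝ (M := Plane)).hasTemperateGrowth

/-- Transposition changes `ξ` into `-ξ` in the symbol. The functions `χ` and `φ` are not assumed
even, so this sign has to be followed throughout. -/
lemma integral_tmul_mul {a : Plane → ℂ} (ha : a.HasTemperateGrowth) (ψ η : Test) :
    ∫ x, tmul a ψ x * η x = ∫ x, ψ x * tmul (fun ξ => a (-ξ)) η x := by
  rw [tmul_eq_fourierInv (HasTemperateGrowth.comp_neg ha), tmul_apply,
    SchwartzMap.integral_fourier_mul_eq, ← SchwartzMap.integral_fourierInv_mul_eq]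
  congr 1; ext x
  simp only [neg_neg]
  rw [SchwartzMap.smulLeftCLM_apply_apply ha, SchwartzMap.smulLeftCLM_apply_apply ha]
  simp only [smul_eq_mul]; ring

lemma conjTest_fourier (ψ : Test) : conjTest (𝓕 ψ) = 𝓕⁻ (conjTest ψ) := by
  refine SchwartzMap.ext fun x => ?_
  rw [conjTest_apply, SchwartzMap.fourierInv_coe, SchwartzMap.fourier_coe, Real.fourier_eq,
    Real.fourierInv_eq, ← integral_conj]
  congr 1; ext y
  simp only [Circle.smul_def, Real.fourierChar_apply, ← Complex.exp_conj, smul_eq_mul, map_mul,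
    conjTest_apply, Complex.conj_ofReal, Complex.conj_I]
  congr 2
  push_cast
  ring

lemma conjTest_fourierInv (ψ : Test) : conjTest (𝓕⁻ ψ) = 𝓕 (conjTest ψ) := by
  rw [← conjTest_conjTest (𝓕 (conjTest ψ)), conjTest_fourier, conjTest_conjTest]

lemma HasTemperateGrowth.conj {a : Plane → ℂ} (ha : a.HasTemperateGrowth) :
    Function.HasTemperateGrowth (fun ξ => (starRingEnd ℂ) (a ξ)) :=
  Function.HasTemperateGrowth.comp
    (Complex.conjCLE : ℂ →L[ℝ] ℂ).hasTemperateGrowth ha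

lemma conjTest_tmul {a : Plane → ℂ} (ha : a.HasTemperateGrowth) (ψ : Test) :
    conjTest (tmul a ψ) = tmul (fun ξ => (starRingEnd ℂ) (a (-ξ))) (conjTest ψ) := by
  rw [tmul_eq_fourierInv (HasTemperateGrowth.conj (HasTemperateGrowth.comp_neg ha)), tmul_apply,
    conjTest_fourier]
  congr 1
  refine SchwartzMap.ext fun x => ?_
  rw [conjTest_apply, SchwartzMap.smulLeftCLM_apply_apply ha, SchwartzMap.smulLeftCLM_apply_apply
    (by simpa using HasTemperateGrowth.conj ha), ← conjTest_fourierInv]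
  simp

/-- The symbol of `-∂_j`, seen on the side of test functions. -/
def dsym (j : Fin 2) (ξ : Plane) : ℂ := 2 * Real.pi * Complex.I * (ξ j : ℂ)

lemma hasTemperateGrowth_coord (j : Fin 2) :
    Function.HasTemperateGrowth (fun ξ : Plane => (ξ j : ℂ)) :=
  (Complex.ofRealCLM ∘L (EuclideanSpace.proj j : Plane →L[ℝ] ℝ)).hasTemperateGrowth

lemma hasTemperateGrowth_dsym (j : Fin 2) : (dsym j).HasTemperateGrowth :=
  (Function.HasTemperateGrowth.const _).mul (hasTemperateGrowth_coord j)

/-- The sign is chosen so that the distributional derivative `∂_j` is exactly the pairing with `tmul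
(dsym j)`, as in `pderiv_apply`. -/
lemma lineDeriv_eq_tmul (j : Fin 2) (ψ : Test) : ∂_{e j} ψ = -tmul (dsym j) ψ := by
  have hc : Function.HasTemperateGrowth (fun ξ : Plane => inner ℝ ξ (e j)) := by fun_prop
  have h : 𝓕⁻ (∂_{e j} ψ) = 𝓕⁻ (-tmul (dsym j) ψ) := by
    have h2 : -tmul (dsym j) ψ = 𝓕 (-(SchwartzMap.smulLeftCLM ℂ (dsym j) (𝓕⁻ ψ))) := by
      rw [tmul_apply]; exact (map_neg (FourierTransform.fourierCLM ℂ Test) _).symm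
    rw [SchwartzMap.fourierInv_lineDerivOp_eq, h2, FourierTransform.fourierInv_fourier_eq]
    refine SchwartzMap.ext fun x => ?_
    have h3 : (-(SchwartzMap.smulLeftCLM ℂ (dsym j) (𝓕⁻ ψ))) x =
      -((SchwartzMap.smulLeftCLM ℂ (dsym j) (𝓕⁻ ψ)) x) := rfl
    rw [h3, SchwartzMap.smulLeftCLM_apply_apply (hasTemperateGrowth_dsym j)]
    change (-(2 * Real.pi * Complex.I)) •
      (SchwartzMap.smulLeftCLM ℂ (fun ξ : Plane => inner ℝ ξ (e j)) (𝓕⁻ ψ) x) = _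
    rw [SchwartzMap.smulLeftCLM_apply_apply hc]
    simp only [dsym, e, EuclideanSpace.inner_single_right, smul_eq_mul, Complex.real_smul]
    simp
    ring
  calc ∂_{e j} ψ = 𝓕 (𝓕⁻ (∂_{e j} ψ)) := (FourierTransform.fourier_fourierInv_eq _).symm
    _ = _ := by rw [h, FourierTransform.fourier_fourierInv_eq]

lemma pderiv_apply (j : Fin 2) {F : Type*} [NormedAddCommGroup F] [NormedSpace ℂ F]
    (u : 𝓢'(Plane, F)) (ψ : Test) : pderiv j u ψ = u (tmul (dsym j) ψ) := by
  rw [pderiv, TemperedDistribution.lineDerivOp_apply_apply, lineDeriv_eq_tmul, neg_neg]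

lemma pderiv_eq_dmul (j : Fin 2) (T : Dist) : pderiv j T = dmul (dsym j) T := by
  ext ψ; rw [pderiv_apply, dmul_apply]

@[simp] lemma coord_pderiv (i j : Fin 2) (u : 𝓢'(Plane, CVec)) :
    coord i (pderiv j u) = pderiv j (coord i u) := by
  ext ψ; rw [coord_apply, pderiv_apply, pderiv_apply, coord_apply]

end AnisotropicStokes

namespace AnisotropicStokes

open scoped FourierTransform

/-! ### Convolution kernels of multipliers -/

/-- The double transform `𝓕 (𝓕 a)` is the reflection of `a`. It cancels the reflection in
`tmul_eq_fourierInv`, so the convolution kernel is `𝓕 a`. -/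
lemma tmul_eq_integral (a : Test) (ψ : Test) (x : Plane) :
    tmul a ψ x = ∫ t, 𝓕 a t * ψ (x - t) := by
  have h : tmul a ψ = SchwartzMap.convolution (ContinuousLinearMap.mul ℂ ℂ) (𝓕 a) ψ := by
    rw [tmul_eq_fourierInv a.hasTemperateGrowth]
    change 𝓕⁻ _ = 𝓕⁻ (SchwartzMap.pairing (ContinuousLinearMap.mul ℂ ℂ) (𝓕 (𝓕 a)) (𝓕 ψ))
    congr 1
    refine SchwartzMap.ext fun ξ => ?_
    rw [SchwartzMap.smulLeftCLM_apply_apply (HasTemperateGrowth.comp_neg a.hasTemperateGrowth),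
      SchwartzMap.pairing_apply_apply]
    have h2 : 𝓕 (𝓕 a) ξ = a (-ξ) := by
      rw [← fourierInv_apply_neg, FourierTransform.fourierInv_fourier_eq]
    rw [h2]
    rfl
  rw [h, SchwartzMap.convolution_apply]
  rfl

/-- The `L¹` norm of the kernel of a multiplier. -/
def kerL1 (a : Test) : ℝ := ∫ x, ‖𝓕 a x‖

/-- The first moment of the kernel of a multiplier. -/
def kerMom (a : Test) : ℝ := ∫ x, ‖x‖ * ‖𝓕 a x‖

lemma kerL1_nonneg (a : Test) : 0 ≤ kerL1 a := integral_nonneg fun _ => norm_nonneg _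

lemma kerMom_nonneg (a : Test) : 0 ≤ kerMom a := integral_nonneg fun _ => by positivity

lemma integrable_kerMom (a : Test) : Integrable (fun x => ‖x‖ * ‖𝓕 a x‖) := by
  simpa using SchwartzMap.integrable_pow_mul volume (𝓕 a) 1

lemma fourier_dilate {a b : Test} {r : ℝ} (hr : 0 < r) (h : ∀ ξ, b ξ = a (r • ξ)) (x : Plane) :
    𝓕 b x = (r ^ 2)⁻¹ • 𝓕 a (r⁻¹ • x) := by
  rw [SchwartzMap.fourier_coe, SchwartzMap.fourier_coe, Real.fourier_eq, Real.fourier_eq]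
  have := Measure.integral_comp_smul (volume : Measure Plane)
    (fun ξ => Real.fourierChar (-inner ℝ ξ (r⁻¹ • x)) • a ξ) r
  rw [finrank_euclideanSpace_fin, abs_of_pos (by positivity)] at this
  rw [← this]
  congr 1; ext ξ
  rw [h, inner_smul_left, inner_smul_right]
  simp [mul_inv_cancel_left₀ hr.ne']

lemma kerL1_dilate {a b : Test} {r : ℝ} (hr : 0 < r) (h : ∀ ξ, b ξ = a (r • ξ)) :
    kerL1 b = kerL1 a := by
  have := Measure.integral_comp_smul (volume : Measure Plane) (fun x => ‖𝓕 a x‖) r⁻¹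
  rw [finrank_euclideanSpace_fin, abs_of_pos (by positivity)] at this
  simp only [kerL1, fourier_dilate hr h, norm_smul, integral_const_mul]
  rw [this, Real.norm_of_nonneg (by positivity), smul_eq_mul, ← mul_assoc]
  rw [inv_pow, inv_inv, inv_mul_cancel₀ (by positivity), one_mul]

/-- The first moment is a length, whereas the `L¹` norm of the kernel is scale invariant. For a
symbol living at frequency `2^n` the moment is `O(2^{-n})`, which is the derivative gained by
commutators. -/
lemma kerMom_dilate {a b : Test} {r : ℝ} (hr : 0 < r) (h : ∀ ξ, b ξ = a (r • ξ)) :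
    kerMom b = r * kerMom a := by
  have := Measure.integral_comp_smul (volume : Measure Plane) (fun x => ‖x‖ * ‖𝓕 a x‖) r⁻¹
  rw [finrank_euclideanSpace_fin, abs_of_pos (by positivity)] at this
  have h2 : ∀ x : Plane, ‖x‖ * ‖𝓕 b x‖ = (r ^ 2)⁻¹ * r * (‖r⁻¹ • x‖ * ‖𝓕 a (r⁻¹ • x)‖) := by
    intro x
    rw [fourier_dilate hr h, norm_smul, norm_smul, Real.norm_of_nonneg (by positivity),
      Real.norm_of_nonneg (by positivity)]
    field_simp
  simp only [kerMom, h2, integral_const_mul]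
  rw [this, smul_eq_mul, inv_pow, inv_inv]
  field_simp

/-! ### Young's inequality -/

lemma enorm_toLp_eq (ψ : Test) :
    ENNReal.ofReal ‖ψ.toLp 2 (volume : Measure Plane)‖ =
      (∫⁻ x, ‖ψ x‖ₑ ^ (2 : ℝ)) ^ (1 / 2 : ℝ) := by
  rw [SchwartzMap.norm_toLp, ENNReal.ofReal_toReal (ψ.memLp 2 volume).2.ne,
    eLpNorm_eq_lintegral_rpow_enorm_toReal (by simp) (by simp)]
  simp

lemma lintegral_mul_le_norm (η ψ : Test) (t : Plane) :
    ∫⁻ x, ‖η x‖ₑ * ‖ψ (x - t)‖ₑ ≤ ENNReal.ofReal ‖η.toLp 2 (volume : Measure Plane)‖ *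
      ENNReal.ofReal ‖ψ.toLp 2 (volume : Measure Plane)‖ := by
  have h := ENNReal.lintegral_mul_le_Lp_mul_Lq (volume : Measure Plane) Real.HolderConjugate.two_two
    (f := fun x => ‖η x‖ₑ) (g := fun x => ‖ψ (x - t)‖ₑ)
    (by fun_prop) (by fun_prop)
  refine h.trans ?_
  rw [enorm_toLp_eq, enorm_toLp_eq]
  refine mul_le_mul_right (ENNReal.rpow_le_rpow ?_ (by norm_num)) _
  exact (lintegral_sub_right_eq_self (μ := (volume : Measure Plane)) (fun x => ‖ψ x‖ₑ ^ (2 : ℝ)) t).le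

/-- Duality with `η` itself: `‖η‖²` is at most the double integral of `h(t) |η(x)| |ψ(x - t)|`.
Cauchy-Schwarz in `x` for each `t` gives `‖η‖² ≤ (∫ h) ‖η‖ ‖ψ‖`, and one divides by `‖η‖`. -/
lemma norm_toLp_le_of_conv {η ψ : Test} {h : Plane → ℝ} (hc : Continuous h) (h0 : ∀ t, 0 ≤ h t)
    (hi : Integrable h) (H : ∀ x, ‖η x‖ ≤ ∫ t, h t * ‖ψ (x - t)‖) :
    ‖η.toLp 2 (volume : Measure Plane)‖
      ≤ (∫ t, h t) * ‖ψ.toLp 2 (volume : Measure Plane)‖ := by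
  set N := ‖η.toLp 2 (volume : Measure Plane)‖ with hN
  set P := ‖ψ.toLp 2 (volume : Measure Plane)‖ with hP
  have hN0 : 0 ≤ N := norm_nonneg _
  have hP0 : 0 ≤ P := norm_nonneg _
  have hH0 : 0 ≤ ∫ t, h t := integral_nonneg h0
  have hHe : ∫⁻ t, ‖h t‖ₑ = ENNReal.ofReal (∫ t, h t) := by
    rw [ofReal_integral_eq_lintegral_ofReal hi (ae_of_all _ h0)]
    congr 1; ext t
    rw [Real.enorm_eq_ofReal (h0 t)]
  have key : ∫⁻ x, ‖η x‖ₑ ^ (2 : ℝ) ≤ ENNReal.ofReal ((∫ t, h t) * (N * P)) := by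
    calc ∫⁻ x, ‖η x‖ₑ ^ (2 : ℝ)
        ≤ ∫⁻ x, ∫⁻ t, ‖h t‖ₑ * (‖η x‖ₑ * ‖ψ (x - t)‖ₑ) := by
          refine lintegral_mono fun x => ?_
          have h1 : ‖η x‖ₑ ≤ ∫⁻ t, ‖h t‖ₑ * ‖ψ (x - t)‖ₑ := by
            rw [← ofReal_norm]
            refine (ENNReal.ofReal_le_ofReal (H x)).trans ?_
            rw [← Real.enorm_eq_ofReal (integral_nonneg fun t => mul_nonneg (h0 t) (norm_nonneg _))]
            refine (enorm_integral_le_lintegral_enorm _).trans ?_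
            simp [enorm_mul]
          calc ‖η x‖ₑ ^ (2 : ℝ) = ‖η x‖ₑ * ‖η x‖ₑ := by
                rw [ENNReal.rpow_two, sq]
            _ ≤ ‖η x‖ₑ * ∫⁻ t, ‖h t‖ₑ * ‖ψ (x - t)‖ₑ := by gcongr
            _ = _ := by
              rw [← lintegral_const_mul' _ _ enorm_ne_top]
              congr 1; ext t; ring
      _ = ∫⁻ t, ∫⁻ x, ‖h t‖ₑ * (‖η x‖ₑ * ‖ψ (x - t)‖ₑ) := by
          refine lintegral_lintegral_swap (Measurable.aemeasurable ?_)
          have h3 : Continuous fun p : Plane × Plane => ψ (p.1 - p.2) :=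
            ψ.continuous.comp (continuous_fst.sub continuous_snd)
          have h4 : Continuous fun p : Plane × Plane => η p.1 := η.continuous.comp continuous_fst
          have h5 : Continuous fun p : Plane × Plane => h p.2 := hc.comp continuous_snd
          exact h5.measurable.enorm.mul (h4.measurable.enorm.mul h3.measurable.enorm)
      _ ≤ ∫⁻ t, ‖h t‖ₑ * (ENNReal.ofReal N * ENNReal.ofReal P) := by
          refine lintegral_mono fun t => ?_
          rw [lintegral_const_mul' _ _ enorm_ne_top]
          gcongr
          exact lintegral_mul_le_norm η ψ t
      _ = _ := by
          rw [lintegral_mul_const _ hc.measurable.enorm, hHe, ENNReal.ofReal_mul hH0,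
            ENNReal.ofReal_mul hN0]
  have h2 : ENNReal.ofReal N * ENNReal.ofReal N ≤ ENNReal.ofReal ((∫ t, h t) * (N * P)) := by
    refine le_trans (le_of_eq ?_) key
    rw [hN, enorm_toLp_eq, ← ENNReal.rpow_add_of_nonneg _ _ (by norm_num) (by norm_num)]
    norm_num
  rw [← ENNReal.ofReal_mul hN0, ENNReal.ofReal_le_ofReal_iff (by positivity)] at h2
  rcases hN0.eq_or_lt with h0' | hpos
  · rw [← h0']; positivity
  · nlinarith

/-- The commutator of a multiplier and of the product by a Lipschitz function. -/
lemma norm_commutator_le (a : Test) {A : Plane → ℂ} (hA : A.HasTemperateGrowth) {L : ℝ}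
    (hL0 : 0 ≤ L) (hL : ∀ x y, ‖A x - A y‖ ≤ L * ‖x - y‖) (ψ : Test) :
    ‖(SchwartzMap.smulLeftCLM ℂ A (tmul a ψ) -
        tmul a (SchwartzMap.smulLeftCLM ℂ A ψ)).toLp 2 (volume : Measure Plane)‖
      ≤ L * kerMom a * ‖ψ.toLp 2 (volume : Measure Plane)‖ := by
  have hint : ∫ t, L * (‖t‖ * ‖𝓕 a t‖) = L * kerMom a := integral_const_mul _ _
  rw [← hint]
  refine norm_toLp_le_of_conv (h := fun t => L * (‖t‖ * ‖𝓕 a t‖)) (by fun_prop)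
    (fun t => by positivity) ((integrable_kerMom a).const_mul _) fun x => ?_
  have i1 : ∀ φ : Test, Integrable fun t => 𝓕 a t * φ (x - t) := by
    intro φ
    refine Integrable.mul_bdd (c := SchwartzMap.seminorm ℝ 0 0 φ) (𝓕 a).integrable ?_ ?_
    · exact (φ.continuous.comp (continuous_const.sub continuous_id)).aestronglyMeasurable
    · exact ae_of_all _ fun t => SchwartzMap.norm_le_seminorm ℝ φ _
  -- The difference `A x - A (x - t)` appears under the integral; the Lipschitz bound turns it into
  -- the factor `‖t‖` of `kerMom`.
  have h1 : (SchwartzMap.smulLeftCLM ℂ A (tmul a ψ) - tmul a (SchwartzMap.smulLeftCLM ℂ A ψ)) x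
      = ∫ t, 𝓕 a t * ((A x - A (x - t)) * ψ (x - t)) := by
    have : (SchwartzMap.smulLeftCLM ℂ A (tmul a ψ) - tmul a (SchwartzMap.smulLeftCLM ℂ A ψ)) x
      = (SchwartzMap.smulLeftCLM ℂ A (tmul a ψ)) x - tmul a (SchwartzMap.smulLeftCLM ℂ A ψ) x := rfl
    rw [this, SchwartzMap.smulLeftCLM_apply_apply hA, tmul_eq_integral, tmul_eq_integral,
      smul_eq_mul, ← integral_const_mul, ← integral_sub ((i1 ψ).const_mul _) (i1 _)]
    congr 1; ext t
    rw [SchwartzMap.smulLeftCLM_apply_apply hA, smul_eq_mul]; ring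
  rw [h1]
  have hb : Integrable fun t => L * (‖t‖ * ‖𝓕 a t‖) * ‖ψ (x - t)‖ := by
    refine Integrable.mul_bdd (c := SchwartzMap.seminorm ℝ 0 0 ψ)
      ((integrable_kerMom a).const_mul _) ?_ ?_
    · exact (ψ.continuous.comp (continuous_const.sub continuous_id)).norm.aestronglyMeasurable
    · exact ae_of_all _ fun t => by
        rw [norm_norm]; exact SchwartzMap.norm_le_seminorm ℝ ψ _
  refine norm_integral_le_of_norm_le hb (ae_of_all _ fun t => ?_)
  rw [norm_mul, norm_mul]
  have := hL x (x - t)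
  rw [sub_sub_cancel] at this
  calc _ ≤ ‖𝓕 a t‖ * (L * ‖t‖ * ‖ψ (x - t)‖) := by gcongr
    _ = _ := by ring

lemma integral_norm_tmul_le (a ψ : Test) :
    ∫ x, ‖tmul a ψ x‖ ≤ kerL1 a * ∫ x, ‖ψ x‖ := by
  have hn : Integrable (fun x => ‖𝓕 a x‖) := (𝓕 a).integrable.norm
  have hψ : Integrable (fun x => ‖ψ x‖) := ψ.integrable.norm
  have h1 : Integrable (fun p : Plane × Plane => ‖𝓕 a p.2‖ * ‖ψ (p.1 - p.2)‖)
      ((volume : Measure Plane).prod (volume : Measure Plane)) := by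
    have h := MeasureTheory.Integrable.convolution_integrand (μ := (volume : Measure Plane))
      (ν := (volume : Measure Plane)) (ContinuousLinearMap.mul ℝ ℝ) hn hψ
    exact h
  calc ∫ x, ‖tmul a ψ x‖ ≤ ∫ x, ∫ t, ‖𝓕 a t‖ * ‖ψ (x - t)‖ := by
        refine integral_mono (μ := (volume : Measure Plane)) (tmul a ψ).integrable.norm
          h1.integral_prod_left fun x => ?_
        change ‖tmul a ψ x‖ ≤ ∫ t, ‖𝓕 a t‖ * ‖ψ (x - t)‖
        rw [tmul_eq_integral]
        refine (norm_integral_le_integral_norm _).trans (le_of_eq ?_)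
        simp
    _ = ∫ t, ∫ x, ‖𝓕 a t‖ * ‖ψ (x - t)‖ := integral_integral_swap h1
    _ = kerL1 a * ∫ x, ‖ψ x‖ := by
        simp_rw [integral_const_mul]
        rw [kerL1, ← integral_mul_const]
        congr 1; ext t
        rw [integral_sub_right_eq_self (fun x => ‖ψ x‖)]

/-- A continuous function which is bounded by `K` as a linear form on `L¹` is bounded by `K`. -/
lemma norm_le_of_forall_integral_le {B : Plane → ℂ} (hB : Continuous B) {K : ℝ}
    (h : ∀ ψ : Test, ‖∫ x, ψ x * B x‖ ≤ K * ∫ x, ‖ψ x‖) (x : Plane) : ‖B x‖ ≤ K := by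
  refine le_of_forall_pos_le_add fun δ hδ => ?_
  obtain ⟨r, hr, hball⟩ := Metric.continuous_iff.1 hB x δ hδ
  -- An unnormalized approximation of the Dirac mass at `x`, supported where `B` varies by less than
  -- `δ`.
  obtain ⟨φ, hφ⟩ : ∃ φ : ContDiffBump x, φ.rOut = r / 2 :=
    ⟨⟨r / 4, r / 2, by positivity, by linarith⟩, rfl⟩
  have hc : HasCompactSupport fun y => ((φ y : ℝ) : ℂ) :=
    HasCompactSupport.comp_left (g := Complex.ofReal) (f := (φ : Plane → ℝ)) φ.hasCompactSupport
      Complex.ofReal_zero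
  have hs : ContDiff ℝ ((⊤ : ℕ∞) : WithTop ℕ∞) fun y => ((φ y : ℝ) : ℂ) :=
    Complex.ofRealCLM.contDiff.comp φ.contDiff
  obtain ⟨ψ, hψ⟩ : ∃ ψ : Test, ∀ y, ψ y = ((φ y : ℝ) : ℂ) := ⟨hc.toSchwartzMap hs, fun y => rfl⟩
  have hI : ∫ y, ‖ψ y‖ = ∫ y, φ y := by
    congr 1; ext y; rw [hψ, Complex.norm_real, Real.norm_of_nonneg φ.nonneg]
  have hpos : 0 < ∫ y, φ y := φ.integral_pos
  have hIc : ∫ y, ψ y = ((∫ y, φ y : ℝ) : ℂ) := by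
    simp_rw [hψ]; exact integral_ofReal
  have hiB : Integrable fun y => ψ y * B y := by
    refine Continuous.integrable_of_hasCompactSupport (ψ.continuous.mul hB) ?_
    have : (ψ : Plane → ℂ) = fun y => ((φ y : ℝ) : ℂ) := funext hψ
    rw [this]
    exact hc.mul_right
  have h1 : ‖∫ y, (ψ y * B x - ψ y * B y)‖ ≤ δ * ∫ y, φ y := by
    rw [← hI, ← integral_const_mul]
    refine norm_integral_le_of_norm_le (ψ.integrable.norm.const_mul _) (ae_of_all _ fun y => ?_)
    rw [← mul_sub, norm_mul, mul_comm]
    by_cases hy : y ∈ Metric.ball x r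
    · gcongr
      have := (hball y hy).le
      rwa [dist_comm, dist_eq_norm] at this
    · have : φ y = 0 := φ.zero_of_le_dist (by
        simp only [Metric.mem_ball, not_lt] at hy
        rw [hφ]
        linarith)
      rw [hψ, this]; simp
  rw [integral_sub (ψ.integrable.mul_const _) hiB, integral_mul_const, hIc] at h1
  have h2 := h ψ
  rw [hI] at h2
  have h3 : ‖((∫ y, φ y : ℝ) : ℂ) * B x‖ ≤ K * (∫ y, φ y) + δ * ∫ y, φ y := by
    have := norm_add_le (((∫ y, φ y : ℝ) : ℂ) * B x - ∫ y, ψ y * B y) (∫ y, ψ y * B y)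
    rw [sub_add_cancel] at this
    linarith
  rw [norm_mul, Complex.norm_real, Real.norm_of_nonneg hpos.le] at h3
  nlinarith

end AnisotropicStokes

namespace AnisotropicStokes

open scoped FourierTransform

/-! ### Products and spectral supports -/

lemma test_eq_zero_of_forall_integral {f : Test} (h : ∀ η : Test, ∫ x, f x * η x = 0) : f = 0 := by
  have h1 := norm_toLp_two_sq f
  have h2 : ∫ x, ‖f x‖ ^ 2 = 0 := by
    have h3 := h (conjTest f)
    have h4 : ∀ x, f x * conjTest f x = ((‖f x‖ ^ 2 : ℝ) : ℂ) := fun x => by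
      rw [conjTest_apply, Complex.mul_conj, Complex.normSq_eq_norm_sq]
    simp_rw [h4] at h3
    rw [integral_complex_ofReal] at h3
    exact_mod_cast h3
  rw [h2] at h1
  have h5 : f.toLp 2 (volume : Measure Plane) = 0 := by
    rw [← norm_eq_zero]; exact pow_eq_zero_iff (two_ne_zero) |>.1 h1
  refine SchwartzMap.injective_toLp (F := ℂ) (E := Plane) 2 volume ?_
  change f.toLp 2 (volume : Measure Plane) = (0 : Test).toLp 2 (volume : Measure Plane)
  rw [h5]; rfl

lemma fourier_tmul {a : Plane → ℂ} (ha : a.HasTemperateGrowth) (ψ : Test) (t : Plane) :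
    𝓕 (tmul a ψ) t = a (-t) * 𝓕⁻ ψ (-t) := by
  rw [← fourierInv_apply_neg, tmul_apply, FourierTransform.fourierInv_fourier_eq,
    SchwartzMap.smulLeftCLM_apply_apply ha, smul_eq_mul]

lemma fourierInv_mul_apply (f g : Test) (ξ : Plane) :
    𝓕⁻ (SchwartzMap.smulLeftCLM ℂ f g) ξ = ∫ t, 𝓕 f t * 𝓕 g (-ξ - t) := by
  rw [← fourier_apply_neg, ← tmul_eq_integral, tmul_apply, FourierTransform.fourierInv_fourier_eq]

/-- Spectral support of a product: `A` is `α(D) V`, and `hs` says that no frequencies `ξ`, `η` and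
`ξ + η` are seen together by `α`, `β` and `m`. Tested against an arbitrary function, the product is
a convolution in frequency whose integrand vanishes identically. -/
lemma tmul_mul_eq_zero {α β m : Plane → ℂ} (hα : α.HasTemperateGrowth)
    (hβ : β.HasTemperateGrowth) (hm : m.HasTemperateGrowth)
    (hs : ∀ ξ η, α ξ * (β η * m (ξ + η)) = 0) {A : Plane → ℂ} (hA : A.HasTemperateGrowth)
    {V : Dist} (hV : ∀ ψ : Test, ∫ x, ψ x * A x = V (tmul α ψ)) (ψ : Test) :
    tmul β (SchwartzMap.smulLeftCLM ℂ A (tmul m ψ)) = 0 := by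
  refine test_eq_zero_of_forall_integral fun η => ?_
  have hβ' := HasTemperateGrowth.comp_neg hβ
  rw [integral_tmul_mul hβ]
  set f := tmul m ψ with hf
  set g := tmul (fun ξ => β (-ξ)) η with hg
  have h1 : ∀ x, (SchwartzMap.smulLeftCLM ℂ A f) x * g x
      = (SchwartzMap.smulLeftCLM ℂ f g) x * A x := fun x => by
    rw [SchwartzMap.smulLeftCLM_apply_apply hA, SchwartzMap.smulLeftCLM_apply_apply
      f.hasTemperateGrowth]
    simp only [smul_eq_mul]; ring
  simp_rw [h1]
  rw [hV]
  have h2 : tmul α (SchwartzMap.smulLeftCLM ℂ f g) = 0 := by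
    rw [tmul_apply]
    have : SchwartzMap.smulLeftCLM ℂ α (𝓕⁻ (SchwartzMap.smulLeftCLM ℂ f g)) = 0 := by
      refine SchwartzMap.ext fun ξ => ?_
      rw [SchwartzMap.smulLeftCLM_apply_apply hα, fourierInv_mul_apply, smul_eq_mul,
        ← integral_const_mul]
      refine Eq.trans (integral_congr_ae (ae_of_all _ fun t => ?_)) (integral_zero _ _)
      change α ξ * (𝓕 f t * 𝓕 g (-ξ - t)) = 0
      rw [hf, hg, fourier_tmul hm, fourier_tmul hβ', neg_neg]
      have := hs ξ (-ξ - t)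
      rw [show ξ + (-ξ - t) = -t by abel] at this
      calc _ = (α ξ * (β (-ξ - t) * m (-t))) * (𝓕⁻ ψ (-t) * 𝓕⁻ η (-(-ξ - t))) := by ring
        _ = 0 := by rw [this, zero_mul]
    rw [this]
    exact map_zero (FourierTransform.fourierCLM ℂ Test)
  rw [h2, map_zero]

/-! ### Symbols divided by `|ξ|²` -/

lemma exists_test {f : Plane → ℂ} (hs : ContDiff ℝ ((⊤ : ℕ∞) : WithTop ℕ∞) f)
    (hc : HasCompactSupport f) : ∃ a : Test, ∀ ξ, a ξ = f ξ :=
  ⟨hc.toSchwartzMap hs, fun _ => rfl⟩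

/-- The singularity of `|ξ|⁻²` lies where `a` vanishes identically, so smoothness is not lost. -/
lemma exists_test_div {a : Test} (hc : HasCompactSupport a) {r : ℝ} (hr : 0 < r)
    (h0 : ∀ ξ, ‖ξ‖ < r → a ξ = 0) : ∃ b : Test, ∀ ξ, b ξ = a ξ * (((‖ξ‖ ^ 2)⁻¹ : ℝ) : ℂ) := by
  have hs : ContDiff ℝ ((⊤ : ℕ∞) : WithTop ℕ∞) fun ξ => a ξ * (((‖ξ‖ ^ 2)⁻¹ : ℝ) : ℂ) := by
    rw [contDiff_iff_contDiffAt]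
    intro ξ
    by_cases hξ : ξ = 0
    · subst hξ
      have : (fun ξ => a ξ * (((‖ξ‖ ^ 2)⁻¹ : ℝ) : ℂ)) =ᶠ[𝓝 0] fun _ => 0 := by
        filter_upwards [Metric.ball_mem_nhds (0 : Plane) hr] with ξ hξ
        rw [h0 ξ (by simpa using hξ), zero_mul]
      exact contDiffAt_const.congr_of_eventuallyEq this
    · refine (a.smooth ⊤).contDiffAt.mul ?_
      refine Complex.ofRealCLM.contDiff.contDiffAt.comp ξ ?_
      exact (contDiff_norm_sq ℝ).contDiffAt.inv (by simpa using hξ)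
  exact exists_test hs (HasCompactSupport.mul_right hc)

lemma sum_dsym_sq (ξ : Plane) :
    ∑ j, dsym j ξ * dsym j ξ = (2 * Real.pi * Complex.I) ^ 2 * ((‖ξ‖ ^ 2 : ℝ) : ℂ) := by
  rw [EuclideanSpace.norm_sq_eq, Fin.sum_univ_two, Fin.sum_univ_two]
  simp only [dsym, Real.norm_eq_abs, sq_abs]
  push_cast
  ring

lemma dsym_smul (j : Fin 2) (r : ℝ) (ξ : Plane) : dsym j (r • ξ) = r * dsym j ξ := by
  simp [dsym]; ring

/-- Bernstein's inequality for symbols supported away from the origin. -/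
lemma exists_bernstein {b₀ : Test} (hc : HasCompactSupport b₀) {r₀ : ℝ} (hr₀ : 0 < r₀)
    (h0 : ∀ ξ, ‖ξ‖ < r₀ → b₀ ξ = 0) :
    ∃ C : ℝ, 0 ≤ C ∧ ∀ (r : ℝ) (b : Test) (s : Plane → ℂ) (V : Dist) (K : ℝ),
      0 < r → (∀ ξ, b ξ = b₀ (r • ξ)) → s.HasTemperateGrowth → (∀ ξ, s ξ * b ξ = b ξ) → 0 ≤ K →
      (∀ (j : Fin 2) (ψ : Test), ‖pderiv j (dmul s V) ψ‖ ≤ K * ∫ x, ‖ψ x‖) →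
      ∀ ψ : Test, ‖dmul b V ψ‖ ≤ C * r * K * ∫ x, ‖ψ x‖ := by
  obtain ⟨d₀, hd₀⟩ := exists_test_div hc hr₀ h0
  set c : ℂ := ((2 * Real.pi * Complex.I) ^ 2)⁻¹ with hcdef
  have hc0 : (2 * Real.pi * Complex.I : ℂ) ^ 2 ≠ 0 := by
    simp [Real.pi_ne_zero]
  let κ₀ (j : Fin 2) : Test := c • SchwartzMap.smulLeftCLM ℂ (dsym j) d₀
  have hκ₀ : ∀ j ξ, κ₀ j ξ = c * (dsym j ξ * d₀ ξ) := fun j ξ => by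
    change c • (SchwartzMap.smulLeftCLM ℂ (dsym j) d₀ ξ) = _
    rw [SchwartzMap.smulLeftCLM_apply_apply (hasTemperateGrowth_dsym j)]; rfl
  refine ⟨∑ j, kerL1 (κ₀ j), Finset.sum_nonneg fun j _ => kerL1_nonneg _, ?_⟩
  intro r b s V K hr hb hs hsb hK hV ψ
  let D : Plane ≃L[ℝ] Plane := ContinuousLinearEquiv.smulLeft (Units.mk0 r hr.ne')
  let κ₁ (j : Fin 2) : Test := SchwartzMap.compCLMOfContinuousLinearEquiv ℂ D (κ₀ j)
  have hκ₁ : ∀ j ξ, κ₁ j ξ = κ₀ j (r • ξ) := fun j ξ => rfl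
  -- Inserting `∑ ξ_j² / |ξ|² = 1` writes `b` as a combination of the `ξ_j`. After dilation the
  -- quotients `ξ_j / |ξ|²` produce the factor `r`.
  have hsum : ∀ ξ, b ξ = r * ∑ j, dsym j ξ * κ₁ j ξ := by
    intro ξ
    have h1 : ∀ j, dsym j ξ * κ₁ j ξ = (dsym j ξ * dsym j ξ) * (c * r * d₀ (r • ξ)) := by
      intro j; rw [hκ₁, hκ₀, dsym_smul]; ring
    simp_rw [h1]
    rw [← Finset.sum_mul, sum_dsym_sq, hb, hd₀]
    by_cases hξ : ξ = 0
    · subst hξ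
      rw [smul_zero, h0 0 (by simpa using hr₀)]; simp
    · have hn : (‖ξ‖ : ℂ) ≠ 0 := by simpa using hξ
      have hr' : (r : ℂ) ≠ 0 := by exact_mod_cast hr.ne'
      rw [norm_smul, Real.norm_of_nonneg hr.le, hcdef]
      push_cast
      field_simp
  have h2 : tmul b ψ = (r : ℂ) • ∑ j, tmul s (tmul (dsym j) (tmul (κ₁ j) ψ)) := by
    -- The symbol `s` equals one wherever `b` is nonzero. Inserting it lets the hypothesis concern
    -- only the gradient of the regularized distribution `s(D) V`.
    have e1 : tmul b ψ = tmul s (tmul b ψ) := by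
      rw [tmul_tmul hs b.hasTemperateGrowth]
      congr 2; ext ξ; exact (hsb ξ).symm
    have e2 : tmul b ψ = (r : ℂ) • ∑ j, tmul (dsym j) (tmul (κ₁ j) ψ) := by
      have hg : ∀ j ∈ Finset.univ, (dsym j * κ₁ j).HasTemperateGrowth := fun j _ =>
        (hasTemperateGrowth_dsym j).mul (κ₁ j).hasTemperateGrowth
      simp_rw [fun j => tmul_tmul (hasTemperateGrowth_dsym j) (κ₁ j).hasTemperateGrowth ψ]
      rw [← tmul_sum _ hg, ← tmul_smul (Function.HasTemperateGrowth.sum hg)]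
      congr 2; ext ξ; rw [hsum]; rfl
    rw [e1, e2, map_smul, map_sum]
  have h3 : dmul b V ψ = (r : ℂ) * ∑ j, pderiv j (dmul s V) (tmul (κ₁ j) ψ) := by
    rw [dmul_apply, h2, map_smul, map_sum]
    simp only [pderiv_apply, dmul_apply, smul_eq_mul]
  rw [h3, norm_mul, Complex.norm_real, Real.norm_of_nonneg hr.le]
  calc r * ‖∑ j, pderiv j (dmul s V) (tmul (κ₁ j) ψ)‖
      ≤ r * ∑ j, K * (kerL1 (κ₀ j) * ∫ x, ‖ψ x‖) := by
        gcongr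
        refine (norm_sum_le _ _).trans (Finset.sum_le_sum fun j _ => ?_)
        refine (hV j _).trans ?_
        gcongr
        rw [← kerL1_dilate hr (hκ₁ j)]
        exact integral_norm_tmul_le _ _
    _ = _ := by rw [← Finset.mul_sum, ← Finset.sum_mul]; ring

end AnisotropicStokes

namespace AnisotropicStokes

open scoped FourierTransform

/-! ### The symbols of the dyadic partition -/

namespace DyadicPartition

variable (P : DyadicPartition)

lemma chi_eq_zero {ξ : Plane} (h : 4 / 3 < ‖ξ‖) : P.chi ξ = 0 := by
  by_contra h0
  have := P.chi_support (subset_tsupport _ h0)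
  simp only [mem_ofPred_eq] at this
  linarith

lemma phi_eq_zero_of_lt {ξ : Plane} (h : ‖ξ‖ < 3 / 4) : P.phi ξ = 0 := by
  by_contra h0
  have := P.phi_support (subset_tsupport _ h0)
  simp only [mem_ofPred_eq] at this
  linarith [this.1]

lemma phi_eq_zero_of_gt {ξ : Plane} (h : 8 / 3 < ‖ξ‖) : P.phi ξ = 0 := by
  by_contra h0
  have := P.phi_support (subset_tsupport _ h0)
  simp only [mem_ofPred_eq] at this
  linarith [this.2]

lemma chi_eq_one {ξ : Plane} (h : ‖ξ‖ < 3 / 4) : P.chi ξ = 1 := by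
  have h1 : ∀ q : ℕ, P.phi (((2 : ℝ) ^ q)⁻¹ • ξ) = 0 := fun q => by
    refine P.phi_eq_zero_of_lt ?_
    rw [norm_smul, Real.norm_of_nonneg (by positivity)]
    have : ((2 : ℝ) ^ q)⁻¹ ≤ 1 := inv_le_one_of_one_le₀ (one_le_pow₀ (by norm_num))
    nlinarith [norm_nonneg ξ]
  have h2 := P.sum_eq_one ξ
  simp_rw [h1] at h2
  have := h2.unique hasSum_zero
  linarith

/-- The partitions of unity at `ξ` and at `ξ / 2` differ by a shift of the series. This telescoping
identifies `S_N` with `χ(2^{-N} D)`, and positivity then bounds the symbols by one. -/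
lemma chi_half (ξ : Plane) : P.chi ((2 : ℝ)⁻¹ • ξ) = P.chi ξ + P.phi ξ := by
  have h1 := P.sum_eq_one ξ
  have h2 := P.sum_eq_one ((2 : ℝ)⁻¹ • ξ)
  rw [← hasSum_nat_add_iff' 1] at h1
  have h3 : (fun n : ℕ => P.phi (((2 : ℝ) ^ (n + 1))⁻¹ • ξ)) =
      fun q : ℕ => P.phi (((2 : ℝ) ^ q)⁻¹ • (2 : ℝ)⁻¹ • ξ) := by
    ext n; rw [smul_smul, pow_succ, mul_inv]
  rw [h3] at h1
  have := h1.unique h2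
  simp at this
  linarith

lemma chi_le_one (ξ : Plane) : P.chi ξ ≤ 1 := by
  have h := (P.sum_eq_one ξ).nonneg fun q => P.phi_nonneg _
  linarith

lemma phi_le_one (ξ : Plane) : P.phi ξ ≤ 1 := by
  have h := P.chi_half ξ
  have := P.chi_le_one ((2 : ℝ)⁻¹ • ξ)
  have := P.chi_nonneg ξ
  linarith

end DyadicPartition

lemma hasCompactSupport_of_norm {f : Plane → ℂ} {R : ℝ} (h : ∀ ξ, R < ‖ξ‖ → f ξ = 0) :
    HasCompactSupport f := by
  refine HasCompactSupport.of_support_subset_isCompact (isCompact_closedBall (0 : Plane) R) ?_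
  intro ξ hξ
  rw [mem_closedBall_zero_iff]
  by_contra hc
  exact hξ (h ξ (not_le.1 hc))

lemma norm_two_pi_smul (ξ : Plane) : ‖(2 * Real.pi) • ξ‖ = 2 * Real.pi * ‖ξ‖ := by
  rw [norm_smul, Real.norm_of_nonneg (by positivity)]

/-- Smooth compactly supported real functions as complex symbols, with dilated argument. -/
lemma exists_test_scaled {f : Plane → ℝ} (hf : ContDiff ℝ ((⊤ : ℕ∞) : WithTop ℕ∞) f) {R : ℝ}
    (h : ∀ ξ, R < ‖ξ‖ → f ξ = 0) :
    ∃ a : Test, ∀ ξ, a ξ = ((f ((2 * Real.pi) • ξ) : ℝ) : ℂ) := by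
  refine exists_test ?_ (hasCompactSupport_of_norm (R := R / (2 * Real.pi)) fun ξ hξ => ?_)
  · exact Complex.ofRealCLM.contDiff.comp (hf.comp (contDiff_const_smul _))
  · rw [h _ ?_, Complex.ofReal_zero]
    rw [norm_two_pi_smul]
    rwa [div_lt_iff₀' (by positivity)] at hξ

/-- The symbol of `Δ_{-1}`. -/
def chiT (P : DyadicPartition) : Test :=
  (exists_test_scaled P.chi_smooth fun _ => P.chi_eq_zero).choose

/-- The symbol of `Δ_0`. -/
def phiT (P : DyadicPartition) : Test :=
  (exists_test_scaled P.phi_smooth fun _ => P.phi_eq_zero_of_gt).choose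

lemma chiT_apply (P : DyadicPartition) (ξ : Plane) :
    chiT P ξ = ((P.chi ((2 * Real.pi) • ξ) : ℝ) : ℂ) :=
  (exists_test_scaled P.chi_smooth fun _ => P.chi_eq_zero).choose_spec ξ

lemma phiT_apply (P : DyadicPartition) (ξ : Plane) :
    phiT P ξ = ((P.phi ((2 * Real.pi) • ξ) : ℝ) : ℂ) :=
  (exists_test_scaled P.phi_smooth fun _ => P.phi_eq_zero_of_gt).choose_spec ξ

/-- The dilation `ξ ↦ 2^{-N} ξ` of symbols. -/
def dil (N : ℕ) : Test →L[ℂ] Test :=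
  SchwartzMap.compCLMOfContinuousLinearEquiv ℂ
    (ContinuousLinearEquiv.smulLeft (Units.mk0 (((2 : ℝ) ^ N)⁻¹) (by positivity)) :
      Plane ≃L[ℝ] Plane)

lemma dil_apply (N : ℕ) (a : Test) (ξ : Plane) : dil N a ξ = a (((2 : ℝ) ^ N)⁻¹ • ξ) := rfl

/-- The symbol of the low frequency cut-off `S_N`. -/
def lowT (P : DyadicPartition) (N : ℕ) : Test := dil N (chiT P)

/-- The symbol of the block `Δ_{n-1}`. -/
def blockT (P : DyadicPartition) : ℕ → Test
  | 0 => chiT P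
  | n + 1 => dil n (phiT P)

section Symbols

variable (P : DyadicPartition)

lemma lowT_apply (N : ℕ) (ξ : Plane) :
    lowT P N ξ = ((P.chi (((2 : ℝ) ^ N)⁻¹ • (2 * Real.pi) • ξ) : ℝ) : ℂ) := by
  rw [lowT, dil_apply, chiT_apply, smul_comm]

lemma blockT_succ_apply (n : ℕ) (ξ : Plane) :
    blockT P (n + 1) ξ = ((P.phi (((2 : ℝ) ^ n)⁻¹ • (2 * Real.pi) • ξ) : ℝ) : ℂ) := by
  rw [blockT, dil_apply, phiT_apply, smul_comm]

lemma lowT_zero : lowT P 0 = blockT P 0 := SchwartzMap.ext fun ξ => by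
  rw [lowT_apply, blockT, chiT_apply]; simp

lemma lowT_succ (N : ℕ) : lowT P (N + 1) = lowT P N + blockT P (N + 1) :=
  SchwartzMap.ext fun ξ => by
    change _ = lowT P N ξ + blockT P (N + 1) ξ
    rw [lowT_apply, lowT_apply, blockT_succ_apply, ← Complex.ofReal_add, ← P.chi_half,
      smul_smul (2 : ℝ)⁻¹, ← mul_inv, ← pow_succ']

lemma lowT_eq_sum (N : ℕ) : lowT P N = ∑ n ∈ Finset.range (N + 1), blockT P n := by
  induction N with
  | zero => simp [lowT_zero]
  | succ N ih => rw [lowT_succ, Finset.sum_range_succ, ih]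

lemma norm_scaled (N : ℕ) (ξ : Plane) :
    ‖((2 : ℝ) ^ N)⁻¹ • (2 * Real.pi) • ξ‖ = (2 * Real.pi * ‖ξ‖) / 2 ^ N := by
  rw [norm_smul, norm_two_pi_smul, Real.norm_of_nonneg (by positivity), div_eq_inv_mul]

lemma lowT_eq_one {N : ℕ} {ξ : Plane} (h : 2 * Real.pi * ‖ξ‖ < 3 / 4 * 2 ^ N) :
    lowT P N ξ = 1 := by
  rw [lowT_apply, P.chi_eq_one, Complex.ofReal_one]
  rwa [norm_scaled, div_lt_iff₀ (by positivity)]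

lemma lowT_eq_zero {N : ℕ} {ξ : Plane} (h : 4 / 3 * 2 ^ N < 2 * Real.pi * ‖ξ‖) :
    lowT P N ξ = 0 := by
  rw [lowT_apply, P.chi_eq_zero, Complex.ofReal_zero]
  rwa [norm_scaled, lt_div_iff₀ (by positivity)]

lemma blockT_eq_zero_of_gt {n : ℕ} {ξ : Plane} (h : 4 / 3 * 2 ^ n < 2 * Real.pi * ‖ξ‖) :
    blockT P n ξ = 0 := by
  cases n with
  | zero => rw [← lowT_zero]; exact lowT_eq_zero P h
  | succ n =>
    rw [blockT_succ_apply, P.phi_eq_zero_of_gt, Complex.ofReal_zero]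
    rw [norm_scaled, lt_div_iff₀ (by positivity)]
    refine lt_of_eq_of_lt ?_ h
    ring

lemma blockT_succ_eq_zero_of_lt {n : ℕ} {ξ : Plane} (h : 2 * Real.pi * ‖ξ‖ < 3 / 4 * 2 ^ n) :
    blockT P (n + 1) ξ = 0 := by
  rw [blockT_succ_apply, P.phi_eq_zero_of_lt, Complex.ofReal_zero]
  rwa [norm_scaled, div_lt_iff₀ (by positivity)]

lemma norm_lowT_le (N : ℕ) (ξ : Plane) : ‖lowT P N ξ‖ ≤ 1 := by
  rw [lowT_apply, Complex.norm_real, Real.norm_of_nonneg (P.chi_nonneg _)]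
  exact P.chi_le_one _

lemma norm_blockT_le (n : ℕ) (ξ : Plane) : ‖blockT P n ξ‖ ≤ 1 := by
  cases n with
  | zero => rw [← lowT_zero]; exact norm_lowT_le P 0 ξ
  | succ n =>
    rw [blockT_succ_apply, Complex.norm_real, Real.norm_of_nonneg (P.phi_nonneg _)]
    exact P.phi_le_one _

/-- From here on blocks carry the index `n = q + 1 ≥ 0`: the block `n` lives at frequencies at most
`4/3 · 2^n`, and for `n ≥ 1` at least `3/8 · 2^n`. -/
lemma block_eq {F : Type*} [NormedAddCommGroup F] [NormedSpace ℂ F] (n : ℕ) :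
    (block P ((n : ℤ) - 1) : 𝓢'(Plane, F) →L[ℂ] 𝓢'(Plane, F)) =
      TemperedDistribution.fourierMultiplierCLM F (blockT P n) := by
  cases n with
  | zero =>
    rw [block, if_neg (by simp), if_pos (by simp), multiplier]
    congr 1; ext ξ
    rw [blockT, chiT_apply]
  | succ n =>
    rw [block, if_neg (by push_cast; omega), if_neg (by push_cast; omega), multiplier]
    congr 1; ext ξ
    rw [blockT_succ_apply]
    have : ((n + 1 : ℕ) : ℤ) - 1 = (n : ℤ) := by push_cast; ring
    rw [this, zpow_natCast]

lemma coord_block (n : ℕ) (u : 𝓢'(Plane, CVec)) (i : Fin 2) :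
    coord i (block P ((n : ℤ) - 1) u) = dmul (blockT P n) (coord i u) := by
  rw [block_eq, coord_fourierMultiplierCLM]

lemma block_scalar (n : ℕ) (u : Dist) :
    block P ((n : ℤ) - 1) u = dmul (blockT P n) u := by
  rw [block_eq]; rfl

lemma dmul_add {a b : Plane → ℂ} (ha : a.HasTemperateGrowth) (hb : b.HasTemperateGrowth)
    (T : Dist) : dmul (a + b) T = dmul a T + dmul b T := by
  ext ψ
  change T (tmul (a + b) ψ) = T (tmul a ψ) + T (tmul b ψ)
  rw [tmul_add ha hb, map_add]

lemma lowFreq_eq_sum (N : ℕ) (u : 𝓢'(Plane, CVec)) :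
    lowFreq P N u = ∑ n ∈ Finset.range (N + 1), block P ((n : ℤ) - 1) u := by
  rw [lowFreq, _root_.sum_apply]
  refine (Finset.sum_bij (fun (n : ℕ) _ => (n : ℤ) - 1) ?_ ?_ ?_ ?_).symm
  · intro n hn; simp at hn ⊢; omega
  · intro a _ b _ hab; simpa using hab
  · intro b hb
    simp at hb
    exact ⟨(b + 1).toNat, by simp; omega, by omega⟩
  · intros; rfl

lemma coord_lowFreq (N : ℕ) (u : 𝓢'(Plane, CVec)) (i : Fin 2) :
    coord i (lowFreq P N u) = dmul (lowT P N) (coord i u) := by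
  rw [lowFreq_eq_sum]
  induction N with
  | zero => rw [zero_add, Finset.sum_range_one, lowT_zero, coord_block]
  | succ N ih =>
    rw [Finset.sum_range_succ, lowT_succ]
    have h2 : ((lowT P N + blockT P (N + 1) : Test) : Plane → ℂ) =
      (lowT P N : Plane → ℂ) + (blockT P (N + 1) : Plane → ℂ) := rfl
    rw [h2, dmul_add (lowT P N).hasTemperateGrowth (blockT P _).hasTemperateGrowth, ← ih,
      ← coord_block]
    ext ψ; rfl

end Symbols

end AnisotropicStokes

namespace AnisotropicStokes

open scoped FourierTransform

/-! ### The convecting field at a fixed time -/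

lemma lineDeriv_apply (j : Fin 2) (ψ : Test) (x : Plane) :
    (∂_{e j} ψ : Test) x = fderiv ℝ ψ x (e j) :=
  SchwartzMap.lineDerivOp_apply_eq_fderiv _ _ _

lemma smulLeft_apply {B : Plane → ℂ} (hB : B.HasTemperateGrowth) (ψ : Test) (x : Plane) :
    SchwartzMap.smulLeftCLM ℂ B ψ x = B x * ψ x := by
  rw [SchwartzMap.smulLeftCLM_apply_apply hB, smul_eq_mul]

lemma integral_lineDeriv (j : Fin 2) (ψ : Test) : ∫ x, (∂_{e j} ψ : Test) x = 0 := by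
  have h := fourier_tmul (hasTemperateGrowth_dsym j) ψ 0
  rw [SchwartzMap.fourier_coe, Real.fourier_eq] at h
  simp only [inner_zero_right, neg_zero, AddChar.map_zero_eq_one, one_smul] at h
  rw [lineDeriv_eq_tmul]
  change ∫ x, -(tmul (dsym j) ψ x) = 0
  rw [integral_neg, h]
  simp [dsym]

lemma lineDeriv_smulLeft {B : Plane → ℂ} (hB : B.HasTemperateGrowth) (j : Fin 2) (ψ : Test)
    (x : Plane) : (∂_{e j} (SchwartzMap.smulLeftCLM ℂ B ψ) : Test) x =
      B x * (∂_{e j} ψ : Test) x + ψ x * fderiv ℝ B x (e j) := by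
  rw [lineDeriv_apply, lineDeriv_apply]
  have h1 : (SchwartzMap.smulLeftCLM ℂ B ψ : Plane → ℂ) = fun y => B y * ψ y := by
    ext y; exact smulLeft_apply hB ψ y
  have hd : DifferentiableAt ℝ B x := (hB.1.differentiable (by simp)) x
  rw [h1, fderiv_fun_mul hd ψ.differentiableAt]
  simp

lemma integrable_mul_fderiv {B : Plane → ℂ} (hB : B.HasTemperateGrowth) (j : Fin 2) (ψ : Test) :
    Integrable (fun x => ψ x * fderiv ℝ B x (e j)) := by
  have h1 := (∂_{e j} (SchwartzMap.smulLeftCLM ℂ B ψ) : Test).integrable (μ := volume)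
  have h2 := (SchwartzMap.smulLeftCLM ℂ B (∂_{e j} ψ : Test)).integrable (μ := volume)
  refine (h1.sub h2).congr (ae_of_all _ fun x => ?_)
  simp only [Pi.sub_apply, lineDeriv_smulLeft hB, smulLeft_apply hB]
  ring

lemma integral_mul_fderiv {B : Plane → ℂ} (hB : B.HasTemperateGrowth) (j : Fin 2) (ψ : Test) :
    ∫ x, ψ x * fderiv ℝ B x (e j) = ∫ x, tmul (dsym j) ψ x * B x := by
  have h1 := integral_lineDeriv j (SchwartzMap.smulLeftCLM ℂ B ψ)
  have h2 := (SchwartzMap.smulLeftCLM ℂ B (∂_{e j} ψ : Test)).integrable (μ := volume)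
  simp only [lineDeriv_smulLeft hB] at h1
  rw [integral_add (h2.congr (ae_of_all _ fun x => smulLeft_apply hB _ x))
    (integrable_mul_fderiv hB j ψ)] at h1
  rw [← neg_eq_iff_add_eq_zero] at h1
  rw [← h1, ← integral_neg]
  congr 1; ext x
  rw [lineDeriv_eq_tmul]
  change -(B x * -(tmul (dsym j) ψ x)) = _
  ring

lemma norm_apply_le_sum (B : Plane →L[ℝ] ℂ) {K : ℝ} (h : ∀ j, ‖B (e j)‖ ≤ K) :
    ‖B‖ ≤ 2 * K := by
  have hK : 0 ≤ K := (norm_nonneg _).trans (h 0)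
  refine B.opNorm_le_bound (by positivity) fun x => ?_
  have hx : x = x 0 • e 0 + x 1 • e 1 := by
    ext i; fin_cases i <;> simp [e]
  have h1 : ∀ j, ‖x j‖ ≤ ‖x‖ := fun j => PiLp.norm_apply_le x j
  calc ‖B x‖ = ‖x 0 • B (e 0) + x 1 • B (e 1)‖ := by
        conv_lhs => rw [hx]
        rw [map_add, map_smul, map_smul]
    _ ≤ ‖x 0‖ * ‖B (e 0)‖ + ‖x 1‖ * ‖B (e 1)‖ := by
        refine (norm_add_le _ _).trans ?_
        rw [norm_smul, norm_smul]
    _ ≤ ‖x‖ * K + ‖x‖ * K := by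
        gcongr <;> [exact h1 0; exact h 0; exact h1 1; exact h 1]
    _ = 2 * K * ‖x‖ := by ring

lemma lipschitz_of_fderiv {B : Plane → ℂ} (hB : B.HasTemperateGrowth) {K : ℝ}
    (h : ∀ j x, ‖fderiv ℝ B x (e j)‖ ≤ K) (x y : Plane) : ‖B x - B y‖ ≤ 2 * K * ‖x - y‖ :=
  Convex.norm_image_sub_le_of_norm_fderiv_le (𝕜 := ℝ) (s := univ)
    (fun z _ => (hB.1.differentiable (by simp)) z)
    (fun z _ => norm_apply_le_sum _ fun j => h j z) convex_univ (mem_univ _) (mem_univ _)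

lemma continuous_fderiv_apply {B : Plane → ℂ} (hB : B.HasTemperateGrowth) (j : Fin 2) :
    Continuous (fun x => fderiv ℝ B x (e j)) :=
  (hB.1.continuous_fderiv (by simp)).clm_apply continuous_const

/-- The regularizations `A N` of a divergence free field `v`, with the bounds that they satisfy
when `v` is real and `∇ S_N v = O(V √(N + 1))`. -/
structure GoodField (P : DyadicPartition) (K V : ℝ) (v : Fin 2 → Dist)
    (A : ℕ → Fin 2 → Plane → ℂ) : Prop where
  temperate : ∀ N j, (A N j).HasTemperateGrowth
  integral_eq : ∀ N j (ψ : Test), ∫ x, ψ x * A N j x = v j (tmul (lowT P N) ψ)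
  fderiv_le : ∀ N i j x, ‖fderiv ℝ (A N i) x (e j)‖ ≤ V * √(1 + (N : ℝ))
  -- Here `√(3 + N)` is `√(1 + (N + 2))`: the cut-off `S_{N+2}` is the identity on the spectrum of
  -- the increment `Δ_N v`.
  incr_le : ∀ N j x, ‖A (N + 1) j x - A N j x‖ ≤ K * ((2 : ℝ) ^ N)⁻¹ * (V * √(3 + (N : ℝ)))
  -- Since `χ` need not be even, `S_N v` may fail to be real for a real `v`. The defect obeys the
  -- same bound as an increment.
  im_le : ∀ N j x, |(A N j x).im| ≤ K * ((2 : ℝ) ^ N)⁻¹ * (V * √(3 + (N : ℝ)))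
  div_eq : ∀ N x, ∑ j, fderiv ℝ (A N j) x (e j) = 0

lemma integrable_mul_temperate {B : Plane → ℂ} (hB : B.HasTemperateGrowth) (ψ : Test) :
    Integrable (fun x => ψ x * B x) :=
  ((SchwartzMap.smulLeftCLM ℂ B ψ).integrable (μ := volume)).congr
    (ae_of_all _ fun x => by rw [smulLeft_apply hB, mul_comm])

/-- A real distribution commutes with complex conjugation. -/
lemma apply_conjTest {u : Dist} (hu : ∀ ψ : Test, (∀ x, (ψ x).im = 0) → (u ψ).im = 0)
    (ψ : Test) : u (conjTest ψ) = (starRingEnd ℂ) (u ψ) := by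
  have h1 : (u (ψ + conjTest ψ)).im = 0 := hu _ fun x => by
    change (ψ x + conjTest ψ x).im = 0
    simp [conjTest_apply]
  have h2 : (u (Complex.I • (ψ - conjTest ψ))).im = 0 := hu _ fun x => by
    change (Complex.I * (ψ x - conjTest ψ x)).im = 0
    simp [conjTest_apply]
  rw [map_add, Complex.add_im] at h1
  rw [map_smul, map_sub, smul_eq_mul, Complex.mul_im] at h2
  apply Complex.ext <;> simp at * <;> linarith

end AnisotropicStokes

/-! ### Bernstein bounds for the regularizations of the convecting field -/

namespace AnisotropicStokes

open scoped FourierTransform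

/-- The symbol of `Δ_N` avoids the origin, so Bernstein's inequality trades the gradient for a
factor `2^{-N}`; `S_{N+2}` plays the role of the auxiliary cut-off. -/
lemma exists_increment_bound (P : DyadicPartition) : ∃ C : ℝ, 0 ≤ C ∧
    ∀ (N : ℕ) (V : Dist) (K : ℝ), 0 ≤ K →
      (∀ (j : Fin 2) (ψ : Test), ‖pderiv j (dmul (lowT P (N + 2)) V) ψ‖ ≤ K * ∫ x, ‖ψ x‖) →
      ∀ ψ : Test, ‖dmul (blockT P (N + 1)) V ψ‖ ≤ C * ((2 : ℝ) ^ N)⁻¹ * K * ∫ x, ‖ψ x‖ := by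
  have hpi := Real.pi_pos
  obtain ⟨C, hC, H⟩ := exists_bernstein (b₀ := phiT P)
    (hasCompactSupport_of_norm (R := 4 / 3 * 2 / (2 * Real.pi)) fun ξ hξ => by
      have := blockT_eq_zero_of_gt P (n := 1) (ξ := ξ) (by
        rw [div_lt_iff₀' (by positivity)] at hξ; simpa using hξ)
      simpa [blockT, dil_apply] using this)
    (r₀ := 3 / 4 / (2 * Real.pi)) (by positivity) (fun ξ hξ => by
      have := blockT_succ_eq_zero_of_lt P (n := 0) (ξ := ξ) (by
        rw [lt_div_iff₀' (by positivity)] at hξ; simpa using hξ)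
      simpa [blockT, dil_apply] using this)
  refine ⟨C, hC, fun N V K hK h => H _ _ _ V K (by positivity) (fun ξ => rfl)
    (lowT P (N + 2)).hasTemperateGrowth (fun ξ => ?_) hK h⟩
  by_cases hξ : 4 / 3 * 2 ^ (N + 1) < 2 * Real.pi * ‖ξ‖
  · rw [blockT_eq_zero_of_gt P hξ, mul_zero]
  · rw [lowT_eq_one P, one_mul]
    rw [not_lt] at hξ
    have : (0 : ℝ) < 2 ^ N := by positivity
    rw [pow_succ] at hξ
    rw [pow_add]
    linarith

/-- The odd part of the symbol of `S_N`. -/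
def oddT (P : DyadicPartition) (N : ℕ) : Test := dil N (chiT P - reflect (chiT P))

lemma oddT_apply (P : DyadicPartition) (N : ℕ) (ξ : Plane) :
    oddT P N ξ = lowT P N ξ - lowT P N (-ξ) := by
  rw [oddT, lowT, dil_apply, dil_apply, dil_apply]
  change chiT P _ - reflect (chiT P) _ = chiT P _ - chiT P _
  rw [reflect_apply, smul_neg]

/-- Because `χ = 1` near the origin, its odd part is supported in an annulus. Bernstein's inequality
therefore applies to it, although `S_N` itself contains all low frequencies. -/
lemma exists_odd_bound (P : DyadicPartition) : ∃ C : ℝ, 0 ≤ C ∧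
    ∀ (N : ℕ) (V : Dist) (K : ℝ), 0 ≤ K →
      (∀ (j : Fin 2) (ψ : Test), ‖pderiv j (dmul (lowT P (N + 1)) V) ψ‖ ≤ K * ∫ x, ‖ψ x‖) →
      ∀ ψ : Test, ‖dmul (oddT P N) V ψ‖ ≤ C * ((2 : ℝ) ^ N)⁻¹ * K * ∫ x, ‖ψ x‖ := by
  have hpi := Real.pi_pos
  have hz : ∀ N ξ, 4 / 3 * 2 ^ N < 2 * Real.pi * ‖ξ‖ → oddT P N ξ = 0 := fun N ξ h => by
    rw [oddT_apply, lowT_eq_zero P h, lowT_eq_zero P (by rwa [norm_neg]), sub_zero]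
  have h0 : oddT P 0 = chiT P - reflect (chiT P) := SchwartzMap.ext fun ξ => by
    simp [oddT, dil_apply]
  obtain ⟨C, hC, H⟩ := exists_bernstein (b₀ := chiT P - reflect (chiT P))
    (hasCompactSupport_of_norm (R := 4 / 3 / (2 * Real.pi)) fun ξ hξ => by
      have := hz 0 ξ (by rw [div_lt_iff₀' (by positivity)] at hξ; simpa using hξ)
      rwa [h0] at this)
    (r₀ := 3 / 4 / (2 * Real.pi)) (by positivity) (fun ξ hξ => by
      rw [lt_div_iff₀' (by positivity)] at hξ
      rw [← h0, oddT_apply, lowT_eq_one P (by simpa using hξ),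
        lowT_eq_one P (by rw [norm_neg]; simpa using hξ), sub_self])
  refine ⟨C, hC, fun N V K hK h => H _ _ _ V K (by positivity) (fun ξ => rfl)
    (lowT P (N + 1)).hasTemperateGrowth (fun ξ => ?_) hK h⟩
  by_cases hξ : 4 / 3 * 2 ^ N < 2 * Real.pi * ‖ξ‖
  · rw [hz _ _ hξ, mul_zero]
  · rw [lowT_eq_one P, one_mul]
    rw [not_lt] at hξ
    have : (0 : ℝ) < 2 ^ N := by positivity
    rw [pow_succ]
    linarith

lemma conj_lowT (P : DyadicPartition) (N : ℕ) (ξ : Plane) :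
    (starRingEnd ℂ) (lowT P N ξ) = lowT P N ξ := by
  rw [lowT_apply, Complex.conj_ofReal]

/-- The regularizations of the convecting field, together with the description of `v · ∇ w`. -/
theorem exists_goodField (P : DyadicPartition) : ∃ K : ℝ, 0 ≤ K ∧
    ∀ (V : ℝ) (v w c : 𝓢'(Plane, CVec)), 0 ≤ V → IsConvection P v w c → IsRealField v →
      DivFree v → (∀ (N : ℕ) (j : Fin 2),
        distLpNorm ∞ (pderiv j (lowFreq P N v)) ≤ ENNReal.ofReal (V * √(1 + (N : ℝ)))) →
      ∃ A : ℕ → Fin 2 → Plane → ℂ, GoodField P K V (fun i => coord i v) A ∧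
        ∀ i ψ, Tendsto (fun N => ∑ j, coord i w (tmul (lowT P N)
          (tmul (dsym j) (SchwartzMap.smulLeftCLM ℂ (A N j) ψ)))) atTop (𝓝 (coord i c ψ)) := by
  obtain ⟨C₁, hC₁, H₁⟩ := exists_increment_bound P
  obtain ⟨C₂, hC₂, H₂⟩ := exists_odd_bound P
  refine ⟨C₁ + C₂, by positivity, fun V v w c hV ⟨A, hA, hAv, hc⟩ hr hd hg => ?_⟩
  have hT : ∀ N j, Function.HasTemperateGrowth (fun x => A N x j) := fun N j =>
    (EuclideanSpace.proj (𝕜 := ℂ) j : CVec →L[ℂ] ℂ).restrictScalars ℝ |>.hasTemperateGrowth.comp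
      (hA N)
  have hint : ∀ N j (ψ : Test), ∫ x, ψ x * A N x j = coord j v (tmul (lowT P N) ψ) := by
    intro N j ψ
    have h1 := congrArg (fun u => coord j u ψ) (hAv N)
    rw [coord_lowFreq] at h1
    rw [← dmul_apply, ← h1, coord_apply,
      Function.HasTemperateGrowth.toTemperedDistribution_apply volume]
    have h2 : Integrable (fun x => ψ x • A N x) := by
      have : ∀ i, Integrable (fun x => (ψ x • A N x) i) := fun i => by
        simpa using integrable_mul_temperate (hT N i) ψ
      exact Integrable.of_eval_piLp this
    have h3 := (EuclideanSpace.proj (𝕜 := ℂ) j : CVec →L[ℂ] ℂ).integral_comp_comm h2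
    simpa using h3
  have hgr : ∀ N i j (ψ : Test), ‖pderiv j (dmul (lowT P N) (coord i v)) ψ‖ ≤
      V * √(1 + (N : ℝ)) * ∫ x, ‖ψ x‖ := fun N i j ψ => by
    have := norm_coord_le_of_distLpNorm_top_le (by positivity) (hg N j) i ψ
    rwa [coord_pderiv, coord_lowFreq] at this
  have h12 : ∀ N : ℕ, √(1 + ((N + 1 : ℕ) : ℝ)) ≤ √(3 + (N : ℝ)) := fun N =>
    Real.sqrt_le_sqrt (by push_cast; linarith)
  have h22 : ∀ N : ℕ, √(1 + ((N + 2 : ℕ) : ℝ)) ≤ √(3 + (N : ℝ)) := fun N =>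
    Real.sqrt_le_sqrt (by push_cast; linarith)
  refine ⟨fun N j x => A N x j, ⟨hT, hint, ?_, ?_, ?_, ?_⟩, fun i ψ => ?_⟩
  · intro N i j x
    refine norm_le_of_forall_integral_le (continuous_fderiv_apply (hT N i) j) (fun ψ => ?_) x
    rw [integral_mul_fderiv (hT N i), hint, ← dmul_apply, ← pderiv_apply]
    exact hgr N i j ψ
  · intro N j x
    have hct : ∀ N, Continuous (fun x => A N x j) := fun N => (hT N j).1.continuous
    have h := norm_le_of_forall_integral_le ((hct (N + 1)).sub (hct N))
      (K := C₁ * ((2 : ℝ) ^ N)⁻¹ * (V * √(3 + (N : ℝ)))) (fun ψ => ?_) x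
    · refine h.trans ?_
      gcongr
      linarith
    · simp only [Pi.sub_apply, mul_sub]
      rw [integral_sub (integrable_mul_temperate (hT _ j) ψ)
        (integrable_mul_temperate (hT _ j) ψ), hint, hint, ← map_sub, ← tmul_sub
        (lowT P _).hasTemperateGrowth (lowT P _).hasTemperateGrowth]
      have h2 : (lowT P (N + 1) : Plane → ℂ) - lowT P N = blockT P (N + 1) := by
        rw [lowT_succ]; ext ξ
        change lowT P N ξ + blockT P (N + 1) ξ - lowT P N ξ = _
        ring
      rw [h2]
      refine H₁ N (coord j v) _ (by positivity) (fun i ψ => (hgr _ j i ψ).trans ?_) ψ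
      exact mul_le_mul_of_nonneg_right (mul_le_mul_of_nonneg_left (h22 N) hV)
        (integral_nonneg fun x => norm_nonneg (ψ x))
  · intro N j x
    have hct : Continuous (fun x => A N x j) := (hT N j).1.continuous
    have h := norm_le_of_forall_integral_le
      (B := fun x => A N x j - (starRingEnd ℂ) (A N x j))
      (hct.sub (Complex.continuous_conj.comp hct))
      (K := C₂ * ((2 : ℝ) ^ N)⁻¹ * (V * √(3 + (N : ℝ)))) (fun ψ => ?_) x
    · rw [Complex.sub_conj] at h
      simp only [Complex.norm_mul, Complex.norm_real, Complex.norm_I, Real.norm_eq_abs, abs_mul,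
        abs_two, mul_one] at h
      have h5 : 0 ≤ |(A N x j).im| := abs_nonneg _
      calc |(A N x j).im| ≤ C₂ * ((2 : ℝ) ^ N)⁻¹ * (V * √(3 + (N : ℝ))) := by linarith
        _ ≤ _ := by gcongr; linarith
    -- As `v` is real, conjugating `S_N v` reflects the symbol of `S_N`. Twice the imaginary part is
    -- thus, up to a factor `i`, the multiplier with the odd symbol `oddT` applied to `v`.
    · have h6 : ∫ x, ψ x * (starRingEnd ℂ) (A N x j) =
          coord j v (tmul (fun ξ => lowT P N (-ξ)) ψ) := by
        have h7 : ∫ x, ψ x * (starRingEnd ℂ) (A N x j) =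
            (starRingEnd ℂ) (∫ x, conjTest ψ x * A N x j) := by
          rw [← integral_conj]; congr 1; ext x
          simp [conjTest_apply]
        rw [h7, hint, ← apply_conjTest (fun ψ h => hr ψ h j),
          conjTest_tmul (lowT P N).hasTemperateGrowth, conjTest_conjTest]
        simp only [conj_lowT]
      have h8 : Integrable (fun x => ψ x * (starRingEnd ℂ) (A N x j)) := by
        have := (integrable_mul_temperate (hT N j) (conjTest ψ))
        refine (Complex.conjCLE.toContinuousLinearMap.integrable_comp this).congr
          (ae_of_all _ fun x => ?_)
        simp [conjTest_apply]
      simp only [mul_sub]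
      rw [integral_sub (integrable_mul_temperate (hT _ j) ψ) h8, hint, h6, ← map_sub, ← tmul_sub
        (lowT P _).hasTemperateGrowth (HasTemperateGrowth.comp_neg (lowT P _).hasTemperateGrowth)]
      have h2 : (lowT P N : Plane → ℂ) - (fun ξ => lowT P N (-ξ)) = oddT P N := by
        ext ξ; rw [oddT_apply]; rfl
      rw [h2]
      refine H₂ N (coord j v) _ (by positivity) (fun i ψ => (hgr _ j i ψ).trans ?_) ψ
      exact mul_le_mul_of_nonneg_right (mul_le_mul_of_nonneg_left (h12 N) hV)
        (integral_nonneg fun x => norm_nonneg (ψ x))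
  · intro N x
    have h := norm_le_of_forall_integral_le (K := 0)
      (continuous_finsetSum (Finset.univ : Finset (Fin 2))
        fun j _ => continuous_fderiv_apply (hT N j) j) (fun ψ => ?_) x
    · simpa using h
    · simp only [Finset.mul_sum]
      rw [integral_finsetSum _ fun j _ => integrable_mul_fderiv (hT N j) j ψ]
      simp only [integral_mul_fderiv (hT N _), hint]
      have h3 := hd (tmul (lowT P N) ψ)
      simp only [pderiv_apply] at h3
      simp only [tmul_comm (lowT P N).hasTemperateGrowth (hasTemperateGrowth_dsym _), coord_apply]
      rw [h3]; simp
  · have h := ((EuclideanSpace.proj (𝕜 := ℂ) i : CVec →L[ℂ] ℂ).continuous.tendsto _).comp (hc ψ)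
    refine h.congr fun N => ?_
    simp only [Function.comp_apply, map_sum]
    refine Finset.sum_congr rfl fun j _ => ?_
    change (coord i (pderiv j (lowFreq P N w)))
      (SchwartzMap.smulLeftCLM ℂ (fun x => A N x j) ψ) = _
    rw [coord_pderiv, coord_lowFreq, pderiv_apply, dmul_apply]

end AnisotropicStokes

namespace AnisotropicStokes

open scoped FourierTransform

/-! ### Structure of the convection term at a fixed time -/

namespace GoodField

variable {P : DyadicPartition} {K V : ℝ} {v : Fin 2 → Dist} {A : ℕ → Fin 2 → Plane → ℂ}

lemma lipschitz (h : GoodField P K V v A) (N : ℕ) (i : Fin 2) (x y : Plane) :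
    ‖A N i x - A N i y‖ ≤ 2 * (V * √(1 + (N : ℝ))) * ‖x - y‖ :=
  lipschitz_of_fderiv (h.temperate N i) (h.fderiv_le N i) x y

/-- This is `div (A η) = A · ∇η` for a divergence free field. It allows the derivative to be placed
on whichever side of the product has the lower frequency. -/
lemma sum_tmul_dsym (h : GoodField P K V v A) (N : ℕ) (η : Test) :
    ∑ j, tmul (dsym j) (SchwartzMap.smulLeftCLM ℂ (A N j) η) =
      ∑ j, SchwartzMap.smulLeftCLM ℂ (A N j) (tmul (dsym j) η) := by
  rw [← sub_eq_zero, ← Finset.sum_sub_distrib]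
  refine SchwartzMap.ext fun x => ?_
  rw [_root_.sum_apply]
  have h1 : ∀ j, (tmul (dsym j) (SchwartzMap.smulLeftCLM ℂ (A N j) η) -
      SchwartzMap.smulLeftCLM ℂ (A N j) (tmul (dsym j) η) : Test) x =
      - (η x * fderiv ℝ (A N j) x (e j)) := fun j => by
    have h2 := lineDeriv_smulLeft (h.temperate N j) j η x
    rw [lineDeriv_eq_tmul, lineDeriv_eq_tmul] at h2
    change -(tmul (dsym j) _ x) = A N j x * -(tmul (dsym j) η x) + _ at h2
    change tmul (dsym j) _ x - SchwartzMap.smulLeftCLM ℂ (A N j) _ x = _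
    rw [smulLeft_apply (h.temperate N j)]
    linear_combination -h2
  simp only [h1]
  rw [Finset.sum_neg_distrib, ← Finset.mul_sum, h.div_eq, mul_zero, neg_zero]
  rfl

end GoodField

lemma norm_dsym_le (j : Fin 2) (ξ : Plane) : ‖dsym j ξ‖ ≤ 2 * Real.pi * ‖ξ‖ := by
  have h1 : ‖ξ j‖ ≤ ‖ξ‖ := PiLp.norm_apply_le ξ j
  have hpi := Real.pi_pos
  simp only [dsym, norm_mul, Complex.norm_real, Complex.norm_I, RCLike.norm_ofNat,
    Real.norm_eq_abs, abs_of_pos hpi, mul_one]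
  rw [Real.norm_eq_abs] at h1
  gcongr

lemma norm_tmul_dsym_tmul_le {m : Plane → ℂ} (hm : m.HasTemperateGrowth) {n : ℕ}
    (hb : ∀ ξ, ‖m ξ‖ ≤ 1) (hs : ∀ ξ, 4 / 3 * 2 ^ n < 2 * Real.pi * ‖ξ‖ → m ξ = 0)
    (j : Fin 2) (ψ : Test) :
    ‖(tmul (dsym j) (tmul m ψ)).toLp 2 (volume : Measure Plane)‖ ≤
      4 / 3 * 2 ^ n * ‖ψ.toLp 2 (volume : Measure Plane)‖ := by
  rw [tmul_tmul (hasTemperateGrowth_dsym j) hm]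
  refine norm_tmul_le ((hasTemperateGrowth_dsym j).mul hm) (fun ξ => ?_) ψ
  by_cases hξ : 4 / 3 * 2 ^ n < 2 * Real.pi * ‖ξ‖
  · rw [Pi.mul_apply, hs ξ hξ, mul_zero, norm_zero]; positivity
  · rw [Pi.mul_apply, norm_mul]
    calc ‖dsym j ξ‖ * ‖m ξ‖ ≤ 4 / 3 * 2 ^ n * 1 :=
          mul_le_mul ((norm_dsym_le j ξ).trans (not_lt.1 hξ)) (hb ξ) (norm_nonneg _)
            (by positivity)
      _ = _ := mul_one _

lemma tmul_lowT_eq_sum (P : DyadicPartition) (N : ℕ) (ψ : Test) :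
    tmul (lowT P N) ψ = ∑ n ∈ Finset.range (N + 1), tmul (blockT P n) ψ := by
  rw [← tmul_sum _ fun n _ => (blockT P n).hasTemperateGrowth]
  congr 1; congr 1; ext ξ
  rw [lowT_eq_sum, _root_.sum_apply]

section Structure

variable {P : DyadicPartition} {K V : ℝ} {v : Fin 2 → Dist} {A : ℕ → Fin 2 → Plane → ℂ}
  {m : Plane → ℂ} {n : ℕ}

/-- The two factors have frequencies at most `4/3 · 2^{n+2}` and `4/3 · 2^n`, together `20/3 · 2^n`,
whereas the block `n' ≥ n + 5` starts at `3/4 · 2^{n+4} = 12 · 2^n`. -/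
lemma tmul_blockT_low_eq_zero (h : GoodField P K V v A) (hm : m.HasTemperateGrowth)
    (hs : ∀ ξ, 4 / 3 * 2 ^ n < 2 * Real.pi * ‖ξ‖ → m ξ = 0) (j : Fin 2) {n' : ℕ}
    (hn : n + 5 ≤ n') (ψ : Test) :
    tmul (blockT P n') (SchwartzMap.smulLeftCLM ℂ (A (n + 2) j) (tmul m ψ)) = 0 := by
  refine tmul_mul_eq_zero (lowT P (n + 2)).hasTemperateGrowth (blockT P n').hasTemperateGrowth hm
    (fun ξ η => ?_) (h.temperate _ j) (h.integral_eq _ j) ψ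
  by_contra hc
  obtain ⟨n'', rfl⟩ : ∃ k, n' = k + 1 := ⟨n' - 1, by omega⟩
  have h1 : ¬ (4 / 3 * 2 ^ (n + 2) < 2 * Real.pi * ‖ξ‖) := fun h' => by
    rw [lowT_eq_zero P h'] at hc; simp at hc
  have h2 : ¬ (2 * Real.pi * ‖η‖ < 3 / 4 * 2 ^ n'') := fun h' => by
    rw [blockT_succ_eq_zero_of_lt P h'] at hc; simp at hc
  have h3 : ¬ (4 / 3 * 2 ^ n < 2 * Real.pi * ‖ξ + η‖) := fun h' => by
    rw [hs _ h'] at hc; simp at hc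
  rw [not_lt] at h1 h2 h3
  have h4 : ‖η‖ ≤ ‖ξ‖ + ‖ξ + η‖ := by
    have := norm_sub_le (ξ + η) ξ
    rw [add_sub_cancel_left] at this; linarith
  have h5 : (2 : ℝ) ^ (n + 4) ≤ 2 ^ n'' := pow_le_pow_right₀ (by norm_num) (by omega)
  have h6 := mul_le_mul_of_nonneg_left h4 (by positivity : 0 ≤ 2 * Real.pi)
  have h7 : (0 : ℝ) < 2 ^ n := by positivity
  rw [pow_add] at h1 h5
  nlinarith

/-- The increment has frequencies between `3/4 · 2^k` and `8/3 · 2^k`, and the other factor at most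
`4/3 · 2^n ≤ 2^k / 3`. The product therefore stays in an annulus of size `2^k`, which meets the
blocks from `k - 1` to `k + 3` only. -/
lemma tmul_blockT_incr_eq_zero (h : GoodField P K V v A) (hm : m.HasTemperateGrowth)
    (hs : ∀ ξ, 4 / 3 * 2 ^ n < 2 * Real.pi * ‖ξ‖ → m ξ = 0) (j : Fin 2) {k n' : ℕ}
    (hk : n + 2 ≤ k) (hn : n' < k - 1 ∨ k + 3 < n') (ψ : Test) :
    tmul (blockT P n') (SchwartzMap.smulLeftCLM ℂ (A (k + 1) j) (tmul m ψ) -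
      SchwartzMap.smulLeftCLM ℂ (A k j) (tmul m ψ)) = 0 := by
  have hA : (A (k + 1) j - A k j).HasTemperateGrowth :=
    (h.temperate _ j).sub (h.temperate _ j)
  have h0 : SchwartzMap.smulLeftCLM ℂ (A (k + 1) j) (tmul m ψ) -
      SchwartzMap.smulLeftCLM ℂ (A k j) (tmul m ψ) =
      SchwartzMap.smulLeftCLM ℂ (A (k + 1) j - A k j) (tmul m ψ) :=
    SchwartzMap.ext fun x => by
      change SchwartzMap.smulLeftCLM ℂ (A (k + 1) j) (tmul m ψ) x -
        SchwartzMap.smulLeftCLM ℂ (A k j) (tmul m ψ) x = _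
      rw [smulLeft_apply hA, smulLeft_apply (h.temperate _ j), smulLeft_apply (h.temperate _ j),
        Pi.sub_apply, sub_mul]
  rw [h0]
  refine tmul_mul_eq_zero (blockT P (k + 1)).hasTemperateGrowth (blockT P n').hasTemperateGrowth
    hm (V := v j) (fun ξ η => ?_) hA (fun ψ => ?_) ψ
  · by_contra hc
    have h1 : ¬ (4 / 3 * 2 ^ (k + 1) < 2 * Real.pi * ‖ξ‖) := fun h' => by
      rw [blockT_eq_zero_of_gt P h'] at hc; simp at hc
    have h1' : ¬ (2 * Real.pi * ‖ξ‖ < 3 / 4 * 2 ^ k) := fun h' => by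
      rw [blockT_succ_eq_zero_of_lt P h'] at hc; simp at hc
    have h2 : ¬ (4 / 3 * 2 ^ n' < 2 * Real.pi * ‖η‖) := fun h' => by
      rw [blockT_eq_zero_of_gt P h'] at hc; simp at hc
    have h3 : ¬ (4 / 3 * 2 ^ n < 2 * Real.pi * ‖ξ + η‖) := fun h' => by
      rw [hs _ h'] at hc; simp at hc
    rw [not_lt] at h1 h1' h2 h3
    have hkk : (2 : ℝ) ^ (n + 2) ≤ 2 ^ k := pow_le_pow_right₀ (by norm_num) hk
    have h7 : (0 : ℝ) < 2 ^ k := by positivity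
    rw [pow_succ] at h1
    rw [pow_add] at hkk
    rcases hn with hn | hn
    · have h4 : ‖ξ‖ ≤ ‖ξ + η‖ + ‖η‖ := by
        have := norm_sub_le (ξ + η) η
        rwa [add_sub_cancel_right] at this
      have h6 := mul_le_mul_of_nonneg_left h4 (by positivity : 0 ≤ 2 * Real.pi)
      have h8 : (2 : ℝ) ^ (n' + 2) ≤ 2 ^ k := pow_le_pow_right₀ (by norm_num) (by omega)
      rw [pow_add] at h8
      nlinarith
    · obtain ⟨n'', rfl⟩ : ∃ k, n' = k + 1 := ⟨n' - 1, by omega⟩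
      have h2 : ¬ (2 * Real.pi * ‖η‖ < 3 / 4 * 2 ^ n'') := fun h' => by
        rw [blockT_succ_eq_zero_of_lt P h'] at hc; simp at hc
      rw [not_lt] at h2
      have h4 : ‖η‖ ≤ ‖ξ‖ + ‖ξ + η‖ := by
        have := norm_sub_le (ξ + η) ξ
        rw [add_sub_cancel_left] at this; linarith
      have h6 := mul_le_mul_of_nonneg_left h4 (by positivity : 0 ≤ 2 * Real.pi)
      have h8 : (2 : ℝ) ^ (k + 3) ≤ 2 ^ n'' := pow_le_pow_right₀ (by norm_num) (by omega)
      rw [pow_add] at h8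
      nlinarith
  · simp only [Pi.sub_apply, mul_sub]
    rw [integral_sub (integrable_mul_temperate (h.temperate _ j) ψ)
      (integrable_mul_temperate (h.temperate _ j) ψ), h.integral_eq, h.integral_eq, ← map_sub,
      ← tmul_sub (lowT P _).hasTemperateGrowth (lowT P _).hasTemperateGrowth]
    have h2 : (lowT P (k + 1) : Plane → ℂ) - lowT P k = blockT P (k + 1) := by
      rw [lowT_succ]; ext ξ
      change lowT P k ξ + blockT P (k + 1) ξ - lowT P k ξ = _
      ring
    rw [h2]

/-- The contribution of the increment of the regularizations between the scales `k` and `k + 1`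
to a block of the convection term. -/
lemma norm_incr_le (h : GoodField P K V v A) (hK : 0 ≤ K) (hV : 0 ≤ V)
    (hm : m.HasTemperateGrowth) (hb : ∀ ξ, ‖m ξ‖ ≤ 1)
    (hs : ∀ ξ, 4 / 3 * 2 ^ n < 2 * Real.pi * ‖ξ‖ → m ξ = 0) {w : Dist} {U : ℕ → ℝ}
    (hU0 : ∀ n, 0 ≤ U n) (hU : ∀ n, L2Bound (dmul (blockT P n) w) (U n)) {k : ℕ}
    (hk : n + 2 ≤ k) (N : ℕ) (ψ : Test) :
    ‖∑ j, w (tmul (lowT P N) (tmul (dsym j) (SchwartzMap.smulLeftCLM ℂ (A (k + 1) j)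
        (tmul m ψ)))) - ∑ j, w (tmul (lowT P N) (tmul (dsym j)
          (SchwartzMap.smulLeftCLM ℂ (A k j) (tmul m ψ))))‖ ≤
      (∑ n' ∈ Finset.Icc (k - 1) (k + 3), U n') * (8 / 3 * 2 ^ n *
        (K * ((2 : ℝ) ^ k)⁻¹ * (V * √(3 + (k : ℝ)))) * ‖ψ.toLp 2 (volume : Measure Plane)‖) := by
  set B := K * ((2 : ℝ) ^ k)⁻¹ * (V * √(3 + (k : ℝ))) with hB
  have hB0 : 0 ≤ B := by positivity
  set δ : Fin 2 → Test → Test := fun j η => SchwartzMap.smulLeftCLM ℂ (A (k + 1) j) η -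
    SchwartzMap.smulLeftCLM ℂ (A k j) η with hδ
  have hδn : ∀ j η, ‖(δ j η).toLp 2 (volume : Measure Plane)‖ ≤
      B * ‖η.toLp 2 (volume : Measure Plane)‖ := fun j η => by
    refine norm_toLp_two_le_of_le fun x => ?_
    change ‖SchwartzMap.smulLeftCLM ℂ (A (k + 1) j) η x -
      SchwartzMap.smulLeftCLM ℂ (A k j) η x‖ ≤ _
    rw [smulLeft_apply (h.temperate _ j), smulLeft_apply (h.temperate _ j), ← sub_mul, norm_mul]
    exact mul_le_mul_of_nonneg_right (h.incr_le k j x) (norm_nonneg _)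
  have h1 : ∑ j, w (tmul (lowT P N) (tmul (dsym j) (SchwartzMap.smulLeftCLM ℂ (A (k + 1) j)
        (tmul m ψ)))) - ∑ j, w (tmul (lowT P N) (tmul (dsym j)
          (SchwartzMap.smulLeftCLM ℂ (A k j) (tmul m ψ)))) =
      ∑ n' ∈ Finset.range (N + 1), w (tmul (blockT P n') (∑ j, tmul (dsym j)
        (δ j (tmul m ψ)))) := by
    rw [← map_sum w (fun n' => tmul (blockT P n') _), ← tmul_lowT_eq_sum]
    simp only [hδ, map_sub, map_sum, Finset.sum_sub_distrib]
  have h2 : ∀ n', n' < k - 1 ∨ k + 3 < n' → w (tmul (blockT P n') (∑ j, tmul (dsym j)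
        (δ j (tmul m ψ)))) = 0 := fun n' hn' => by
    rw [map_sum]
    have : ∀ j, tmul (blockT P n') (tmul (dsym j) (δ j (tmul m ψ))) = 0 := fun j => by
      rw [tmul_comm (blockT P n').hasTemperateGrowth (hasTemperateGrowth_dsym j),
        tmul_blockT_incr_eq_zero h hm hs j hk hn', map_zero]
    simp [this]
  have h3 : ∀ n', ‖w (tmul (blockT P n') (∑ j, tmul (dsym j) (δ j (tmul m ψ))))‖ ≤
      U n' * (8 / 3 * 2 ^ n * B * ‖ψ.toLp 2 (volume : Measure Plane)‖) := fun n' => by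
    -- The derivative is moved from the product, of frequency `2^k`, to `m(D) ψ`, of frequency
    -- `2^n`. Combined with the size `2^{-k}` of the increment, this gives the decay `2^{n-k}` of
    -- the contribution of high frequencies.
    have h4 : ∑ j, tmul (dsym j) (δ j (tmul m ψ)) = ∑ j, δ j (tmul (dsym j) (tmul m ψ)) := by
      simp only [hδ, map_sub, Finset.sum_sub_distrib]
      rw [h.sum_tmul_dsym, h.sum_tmul_dsym]
    rw [h4, map_sum, map_sum]
    calc ‖∑ j, w (tmul (blockT P n') (δ j (tmul (dsym j) (tmul m ψ))))‖
        ≤ ∑ j : Fin 2, U n' * (B * (4 / 3 * 2 ^ n *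
            ‖ψ.toLp 2 (volume : Measure Plane)‖)) := by
          refine (norm_sum_le _ _).trans (Finset.sum_le_sum fun j _ => ?_)
          refine (hU n' _).trans (mul_le_mul_of_nonneg_left ((hδn j _).trans ?_) (hU0 n'))
          exact mul_le_mul_of_nonneg_left (norm_tmul_dsym_tmul_le hm hb hs j ψ) hB0
      _ = _ := by
          simp only [Finset.sum_const, Finset.card_univ, Fintype.card_fin, nsmul_eq_mul]
          push_cast; ring
  rw [h1]
  refine (norm_sum_le _ _).trans ?_
  rw [Finset.sum_mul, ← Finset.sum_filter_of_ne (p := fun n' => n' ∈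
    Finset.Icc (k - 1) (k + 3)) fun n' _ hn' => ?_]
  · refine (Finset.sum_le_sum fun n' _ => h3 n').trans (Finset.sum_le_sum_of_subset_of_nonneg
      (fun n' hn' => (Finset.mem_filter.1 hn').2) fun n' _ _ => by have := hU0 n'; positivity)
  · by_contra hc
    rw [Finset.mem_Icc] at hc
    exact hn' (by rw [h2 n' (by omega), norm_zero])

/-- Up to an error which is bounded in `L²`, the convection term filtered by `m(D)` is the
transport of `m(D) w` by a regularization of the convecting field. -/
theorem norm_convection_sub_le (h : GoodField P K V v A) (hK : 0 ≤ K) (hV : 0 ≤ V)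
    (hm : m.HasTemperateGrowth) (hb : ∀ ξ, ‖m ξ‖ ≤ 1)
    (hs : ∀ ξ, 4 / 3 * 2 ^ n < 2 * Real.pi * ‖ξ‖ → m ξ = 0) {w c : Dist} {U : ℕ → ℝ}
    (hU0 : ∀ n, 0 ≤ U n) (hU : ∀ n, L2Bound (dmul (blockT P n) w) (U n))
    (hc : ∀ ψ, Tendsto (fun N => ∑ j, w (tmul (lowT P N)
          (tmul (dsym j) (SchwartzMap.smulLeftCLM ℂ (A N j) ψ)))) atTop (𝓝 (c ψ)))
    {R₁ R₂ : ℝ}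
    (hR₁ : ∀ ψ, ‖w (tmul (lowT P (n + 4)) (∑ j, tmul (dsym j)
      (SchwartzMap.smulLeftCLM ℂ (A (n + 2) j) (tmul m ψ) -
        tmul m (SchwartzMap.smulLeftCLM ℂ (A (n + 2) j) ψ))))‖ ≤
          R₁ * ‖ψ.toLp 2 (volume : Measure Plane)‖)
    (hR₂ : ∀ N, ∑ k ∈ Finset.Ico (n + 2) N, (∑ n' ∈ Finset.Icc (k - 1) (k + 3), U n') *
      (8 / 3 * 2 ^ n * (K * ((2 : ℝ) ^ k)⁻¹ * (V * √(3 + (k : ℝ))))) ≤ R₂) (ψ : Test) :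
    ‖c (tmul m ψ) - ∑ j, w (tmul m (tmul (dsym j)
      (SchwartzMap.smulLeftCLM ℂ (A (n + 2) j) ψ)))‖ ≤
        (R₁ + R₂) * ‖ψ.toLp 2 (volume : Measure Plane)‖ := by
  set Y : ℕ → ℕ → ℂ := fun N k => ∑ j, w (tmul (lowT P N)
    (tmul (dsym j) (SchwartzMap.smulLeftCLM ℂ (A k j) (tmul m ψ)))) with hY
  set X := ∑ j, w (tmul m (tmul (dsym j) (SchwartzMap.smulLeftCLM ℂ (A (n + 2) j) ψ))) with hX
  set Q := ‖ψ.toLp 2 (volume : Measure Plane)‖ with hQ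
  -- Telescoping from `S_{n+2} v` to `S_N v`. The increments are controlled by `R₂`; in the term
  -- with `S_{n+2} v` the product has no frequency beyond the block `n + 4`, so `S_N` can be
  -- replaced by `S_{n+4}`, and the commutator bound `R₁` applies.
  have h1 : ∀ N, n + 4 ≤ N → ‖Y N N - X‖ ≤ (R₁ + R₂) * Q := fun N hN => by
    have h2 : ∀ L, n + 2 ≤ L → ‖Y N L - Y N (n + 2)‖ ≤ (∑ k ∈ Finset.Ico (n + 2) L,
        (∑ n' ∈ Finset.Icc (k - 1) (k + 3), U n') *
        (8 / 3 * 2 ^ n * (K * ((2 : ℝ) ^ k)⁻¹ * (V * √(3 + (k : ℝ)))))) * Q := by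
      intro L hL
      induction L, hL using Nat.le_induction with
      | base => simp
      | succ L hL ih =>
        rw [Finset.sum_Ico_succ_top hL, add_mul]
        calc ‖Y N (L + 1) - Y N (n + 2)‖
            = ‖(Y N L - Y N (n + 2)) + (Y N (L + 1) - Y N L)‖ := by congr 1; ring
          _ ≤ _ := (norm_add_le _ _).trans (add_le_add ih
              ((norm_incr_le h hK hV hm hb hs hU0 hU hL N ψ).trans (le_of_eq (by ring))))
    have h3 : ‖Y N (n + 2) - X‖ ≤ R₁ * Q := by
      refine le_of_eq_of_le ?_ (hR₁ ψ)
      congr 1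
      have h4 : ∀ j, tmul (lowT P N) (tmul (dsym j) (SchwartzMap.smulLeftCLM ℂ (A (n + 2) j)
          (tmul m ψ))) = tmul (lowT P (n + 4)) (tmul (dsym j)
            (SchwartzMap.smulLeftCLM ℂ (A (n + 2) j) (tmul m ψ))) := fun j => by
        rw [tmul_lowT_eq_sum, tmul_lowT_eq_sum, eq_comm]
        refine Finset.sum_subset (by simpa using hN) fun n' _ hn' => ?_
        rw [tmul_comm (blockT P n').hasTemperateGrowth (hasTemperateGrowth_dsym j),
          tmul_blockT_low_eq_zero h hm hs j (by rw [Finset.mem_range] at hn'; omega), map_zero]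
      have h5 : ∀ j, tmul m (tmul (dsym j) (SchwartzMap.smulLeftCLM ℂ (A (n + 2) j) ψ)) =
          tmul (lowT P (n + 4)) (tmul (dsym j)
            (tmul m (SchwartzMap.smulLeftCLM ℂ (A (n + 2) j) ψ))) := fun j => by
        rw [tmul_comm (hasTemperateGrowth_dsym j) hm, tmul_tmul (lowT P _).hasTemperateGrowth hm]
        congr 2
        ext ξ
        rw [Pi.mul_apply]
        by_cases hξ : 4 / 3 * 2 ^ n < 2 * Real.pi * ‖ξ‖
        · rw [hs _ hξ, mul_zero]
        · rw [lowT_eq_one P, one_mul]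
          rw [not_lt] at hξ
          have : (0 : ℝ) < 2 ^ n := by positivity
          rw [pow_add]; linarith
      simp only [hY, hX, h4, h5]
      simp only [map_sum, map_sub, Finset.sum_sub_distrib]
    calc ‖Y N N - X‖ = ‖(Y N (n + 2) - X) + (Y N N - Y N (n + 2))‖ := by congr 1; ring
      _ ≤ R₁ * Q + _ := (norm_add_le _ _).trans (add_le_add h3 (h2 N (by omega)))
      _ ≤ _ := by
        rw [add_mul]
        exact add_le_add le_rfl (mul_le_mul_of_nonneg_right (hR₂ N) (norm_nonneg _))
  exact le_of_tendsto (((hc (tmul m ψ)).sub_const X).norm)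
    (eventually_atTop.2 ⟨n + 4, fun N hN => h1 N hN⟩)

end Structure

end AnisotropicStokes

namespace AnisotropicStokes

open scoped FourierTransform

/-! ### Bounds for the commutators -/

lemma kerMom_smul (c : ℂ) (a : Test) : kerMom (c • a) = ‖c‖ * kerMom a := by
  rw [kerMom, kerMom, ← integral_const_mul]
  congr 1; ext x
  have : 𝓕 (c • a) = c • 𝓕 a := FourierTransform.fourier_smul _ _
  rw [this]
  change ‖x‖ * ‖c * 𝓕 a x‖ = _
  rw [norm_mul]; ring

lemma kerMom_sub_le (a b : Test) : kerMom (a - b) ≤ kerMom a + kerMom b := by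
  rw [kerMom, kerMom, kerMom, ← integral_add (integrable_kerMom a) (integrable_kerMom b)]
  refine integral_mono (integrable_kerMom _) ((integrable_kerMom a).add (integrable_kerMom b))
    fun x => ?_
  have : 𝓕 (a - b) = 𝓕 a - 𝓕 b := by
    have := map_sub (FourierTransform.fourierCLM ℂ Test) a b
    exact this
  change ‖x‖ * ‖𝓕 (a - b) x‖ ≤ ‖x‖ * ‖𝓕 a x‖ + ‖x‖ * ‖𝓕 b x‖
  rw [this, ← mul_add]
  exact mul_le_mul_of_nonneg_left (norm_sub_le _ _) (norm_nonneg _)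

/-- The contraction `ξ ↦ 2^k ξ` of symbols. -/
def contr (k : ℕ) : Test →L[ℂ] Test :=
  SchwartzMap.compCLMOfContinuousLinearEquiv ℂ
    (ContinuousLinearEquiv.smulLeft (Units.mk0 ((2 : ℝ) ^ k) (by positivity)) :
      Plane ≃L[ℝ] Plane)

lemma contr_apply (k : ℕ) (a : Test) (ξ : Plane) : contr k a ξ = a ((2 : ℝ) ^ k • ξ) := rfl

/-- The symbols used to localize: those of the blocks, the low frequencies `|ξ| ≲ 2^{-k}` being
removed from the first one. -/
def symb (P : DyadicPartition) (k : ℕ) : ℕ → Test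
  | 0 => chiT P - contr k (chiT P)
  | n + 1 => blockT P (n + 1)

section Symb

variable (P : DyadicPartition) (k : ℕ)

lemma contr_chiT_apply (ξ : Plane) : contr k (chiT P) ξ =
    ((P.chi ((2 : ℝ) ^ k • (2 * Real.pi) • ξ) : ℝ) : ℂ) := by
  rw [contr_apply, chiT_apply, smul_comm]

lemma symb_zero_apply (ξ : Plane) : symb P k 0 ξ = chiT P ξ - contr k (chiT P) ξ := rfl

lemma norm_symb_le (n : ℕ) (ξ : Plane) : ‖symb P k n ξ‖ ≤ 1 := by
  cases n with
  | succ n => exact norm_blockT_le P (n + 1) ξ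
  | zero =>
    rw [symb_zero_apply, contr_chiT_apply, chiT_apply, ← Complex.ofReal_sub, Complex.norm_real,
      Real.norm_eq_abs, abs_le]
    have h1 := P.chi_le_one ((2 * Real.pi) • ξ)
    have h2 := P.chi_le_one ((2 : ℝ) ^ k • (2 * Real.pi) • ξ)
    have h3 := P.chi_nonneg ((2 * Real.pi) • ξ)
    have h4 := P.chi_nonneg ((2 : ℝ) ^ k • (2 * Real.pi) • ξ)
    constructor <;> linarith

lemma contr_chiT_eq_zero {ξ : Plane} (h : 4 / 3 < 2 ^ k * (2 * Real.pi * ‖ξ‖)) :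
    contr k (chiT P) ξ = 0 := by
  rw [contr_chiT_apply, P.chi_eq_zero, Complex.ofReal_zero]
  rwa [norm_smul, norm_two_pi_smul, Real.norm_of_nonneg (by positivity)]

lemma symb_eq_zero_of_gt {n : ℕ} {ξ : Plane} (h : 4 / 3 * 2 ^ n < 2 * Real.pi * ‖ξ‖) :
    symb P k n ξ = 0 := by
  cases n with
  | succ n => exact blockT_eq_zero_of_gt P h
  | zero =>
    have h1 := blockT_eq_zero_of_gt P h
    rw [blockT] at h1
    rw [symb_zero_apply, h1, contr_chiT_eq_zero, sub_zero]
    have : (1 : ℝ) ≤ 2 ^ k := one_le_pow₀ (by norm_num)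
    have h0 : 0 ≤ 2 * Real.pi * ‖ξ‖ := by positivity
    rw [pow_zero, mul_one] at h
    nlinarith

lemma symb_eq_zero_of_lt {n : ℕ} {ξ : Plane} (h : 2 ^ k * (2 * Real.pi * ‖ξ‖) < 3 / 4) :
    symb P k n ξ = 0 := by
  have h1 : (1 : ℝ) ≤ 2 ^ k := one_le_pow₀ (by norm_num)
  have h0 : 0 ≤ 2 * Real.pi * ‖ξ‖ := by positivity
  have h2 : 2 * Real.pi * ‖ξ‖ < 3 / 4 := by nlinarith
  cases n with
  | succ n =>
    refine blockT_succ_eq_zero_of_lt P (h2.trans_le ?_)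
    have : (1 : ℝ) ≤ 2 ^ n := one_le_pow₀ (by norm_num)
    linarith
  | zero =>
    rw [symb_zero_apply, contr_chiT_apply, chiT_apply, P.chi_eq_one, P.chi_eq_one, sub_self]
    · rwa [norm_smul, norm_two_pi_smul, Real.norm_of_nonneg (by positivity)]
    · rwa [norm_two_pi_smul]

/-- The symbols factor through those of the blocks. -/
lemma exists_symb_eq_mul {k : ℕ} (hk : 1 ≤ k) (n : ℕ) : ∃ b : Plane → ℂ,
    b.HasTemperateGrowth ∧ (∀ ξ, ‖b ξ‖ ≤ 1) ∧ ∀ ξ, symb P k n ξ = b ξ * blockT P n ξ := by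
  cases n with
  | succ n => exact ⟨fun _ => 1, .const 1, by simp, fun ξ => by simp [symb]⟩
  | zero =>
    refine ⟨fun ξ => 1 - contr k (chiT P) ξ,
      (Function.HasTemperateGrowth.const 1).sub (contr k (chiT P)).hasTemperateGrowth,
      fun ξ => ?_, fun ξ => ?_⟩
    · dsimp only
      rw [contr_chiT_apply, ← Complex.ofReal_one, ← Complex.ofReal_sub, Complex.norm_real,
        Real.norm_eq_abs, abs_le]
      have h2 := P.chi_le_one ((2 : ℝ) ^ k • (2 * Real.pi) • ξ)
      have h4 := P.chi_nonneg ((2 : ℝ) ^ k • (2 * Real.pi) • ξ)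
      constructor <;> linarith
    · rw [symb_zero_apply, sub_mul, one_mul, blockT]
      congr 1
      by_cases h : 4 / 3 < 2 ^ k * (2 * Real.pi * ‖ξ‖)
      · rw [contr_chiT_eq_zero P k h, zero_mul]
      · rw [chiT_apply, P.chi_eq_one, Complex.ofReal_one, mul_one]
        rw [not_lt] at h
        have : (2 : ℝ) ^ 1 ≤ 2 ^ k := pow_le_pow_right₀ (by norm_num) hk
        have h0 : 0 ≤ 2 * Real.pi * ‖ξ‖ := by positivity
        rw [norm_two_pi_smul]
        nlinarith

lemma kerMom_blockT_succ (n : ℕ) :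
    kerMom (blockT P (n + 1)) = ((2 : ℝ) ^ n)⁻¹ * kerMom (phiT P) :=
  kerMom_dilate (by positivity) fun _ => rfl

/-- The contraction by `2^k` multiplies the first moment by `2^k`, while the extra factor `ξ_j`
brings `2^{-k}`. The moment of the symbol with a derivative is thus bounded uniformly in `k`, which
is not available for the symbol alone. -/
lemma kerMom_dsym_symb_zero_le (j : Fin 2) :
    kerMom (SchwartzMap.smulLeftCLM ℂ (dsym j) (symb P k 0)) ≤
      2 * kerMom (SchwartzMap.smulLeftCLM ℂ (dsym j) (chiT P)) := by
  set D := SchwartzMap.smulLeftCLM ℂ (dsym j) (chiT P) with hD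
  have hd := hasTemperateGrowth_dsym j
  have h1 : SchwartzMap.smulLeftCLM ℂ (dsym j) (symb P k 0) =
      D - ((((2 : ℝ) ^ k)⁻¹ : ℝ) : ℂ) • contr k D := SchwartzMap.ext fun ξ => by
    change _ = D ξ - ((((2 : ℝ) ^ k)⁻¹ : ℝ) : ℂ) * contr k D ξ
    rw [contr_apply, hD, smulLeft_apply hd, smulLeft_apply hd, smulLeft_apply hd,
      symb_zero_apply, dsym_smul, contr_apply]
    have : ((2 : ℂ) ^ k) ≠ 0 := pow_ne_zero k two_ne_zero
    push_cast
    field_simp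
  have h2 : kerMom (contr k D) = 2 ^ k * kerMom D :=
    kerMom_dilate (by positivity) fun ξ => rfl
  rw [h1]
  refine (kerMom_sub_le _ _).trans ?_
  rw [kerMom_smul, h2, Complex.norm_real, Real.norm_of_nonneg (by positivity), ← mul_assoc,
    inv_mul_cancel₀ (by positivity), one_mul, two_mul]

end Symb

/-- `S_{n+1}` is the identity on the support of `m`. Inserting it bounds the derivative by `4/3 ·
2^{n+1}`. -/
lemma norm_apply_blockT_dsym_le {P : DyadicPartition} {w : Dist} {n : ℕ} {R : ℝ} (hR : 0 ≤ R)
    {m : Plane → ℂ} (hm : m.HasTemperateGrowth)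
    (hs : ∀ ξ, 4 / 3 * 2 ^ n < 2 * Real.pi * ‖ξ‖ → m ξ = 0)
    (h : L2Bound (dmul m w) R) (j : Fin 2) (ψ : Test) :
    ‖w (tmul m (tmul (dsym j) ψ))‖ ≤
      R * (8 / 3 * 2 ^ n * ‖ψ.toLp 2 (volume : Measure Plane)‖) := by
  have h1 : tmul m (tmul (dsym j) ψ) = tmul m (tmul (dsym j) (tmul (lowT P (n + 1)) ψ)) := by
    have hl := (lowT P (n + 1)).hasTemperateGrowth
    rw [tmul_comm hm (hasTemperateGrowth_dsym j), tmul_comm hm (hasTemperateGrowth_dsym j),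
      tmul_tmul hm hl]
    suffices h : m = m * (lowT P (n + 1) : Plane → ℂ) by rw [← h]
    ext ξ
    rw [Pi.mul_apply]
    by_cases hξ : 4 / 3 * 2 ^ n < 2 * Real.pi * ‖ξ‖
    · rw [hs ξ hξ, zero_mul]
    · rw [lowT_eq_one P, mul_one]
      rw [not_lt] at hξ
      have : (0 : ℝ) < 2 ^ n := by positivity
      rw [pow_succ]; linarith
  rw [h1]
  refine (h _).trans (mul_le_mul_of_nonneg_left ?_ hR)
  refine (norm_tmul_dsym_tmul_le (lowT P (n + 1)).hasTemperateGrowth (norm_lowT_le P _)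
    (fun ξ => lowT_eq_zero P) j ψ).trans (le_of_eq ?_)
  rw [pow_succ]; ring

lemma dmul_dmul {a b : Plane → ℂ} (ha : a.HasTemperateGrowth) (hb : b.HasTemperateGrowth)
    (T : Dist) : dmul a (dmul b T) = dmul (a * b) T := by
  ext ψ
  rw [dmul_apply, dmul_apply, dmul_apply, tmul_tmul hb ha, mul_comm]

lemma l2Bound_symb {P : DyadicPartition} {k n : ℕ} (hk : 1 ≤ k) {w : Dist} {R : ℝ} (hR : 0 ≤ R)
    (h : L2Bound (dmul (blockT P n) w) R) : L2Bound (dmul (symb P k n) w) R := by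
  obtain ⟨b, hb, hb1, hbe⟩ := exists_symb_eq_mul P hk n
  have hbm : (symb P k n : Plane → ℂ) = b * (blockT P n : Plane → ℂ) := by
    ext ξ; exact hbe ξ
  rw [hbm, ← dmul_dmul hb (blockT P n).hasTemperateGrowth]
  have := h.dmul hb hR hb1
  rwa [one_mul] at this

section Commutator

variable {P : DyadicPartition} {K V : ℝ} {v : Fin 2 → Dist} {A : ℕ → Fin 2 → Plane → ℂ}

/-- The derivative falls on the blocks of `w`, costing `2^n` each. This suits the blocks other than
the first, where `kerMom m` compensates. -/
lemma norm_commutator_sum_le (h : GoodField P K V v A) (hV : 0 ≤ V) (m : Test) {w : Dist}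
    {U : ℕ → ℝ} (hU0 : ∀ n, 0 ≤ U n) (hU : ∀ n, L2Bound (dmul (blockT P n) w) (U n)) (N M : ℕ)
    (ψ : Test) :
    ‖w (tmul (lowT P N) (∑ j, tmul (dsym j) (SchwartzMap.smulLeftCLM ℂ (A M j) (tmul m ψ) -
        tmul m (SchwartzMap.smulLeftCLM ℂ (A M j) ψ))))‖ ≤
      32 / 3 * (V * √(1 + (M : ℝ))) * kerMom m * (∑ n ∈ Finset.range (N + 1), 2 ^ n * U n) *
        ‖ψ.toLp 2 (volume : Measure Plane)‖ := by
  have hker := kerMom_nonneg m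
  rw [tmul_lowT_eq_sum, map_sum]
  simp only [map_sum]
  refine (norm_sum_le _ _).trans ?_
  rw [Finset.mul_sum, Finset.sum_mul]
  refine Finset.sum_le_sum fun n _ => (norm_sum_le _ _).trans ?_
  have h1 : ∀ j : Fin 2, ‖w (tmul (blockT P n) (tmul (dsym j)
      (SchwartzMap.smulLeftCLM ℂ (A M j) (tmul m ψ) -
        tmul m (SchwartzMap.smulLeftCLM ℂ (A M j) ψ))))‖ ≤
      U n * (8 / 3 * 2 ^ n * (2 * (V * √(1 + (M : ℝ))) * kerMom m *
        ‖ψ.toLp 2 (volume : Measure Plane)‖)) := fun j => by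
    refine (norm_apply_blockT_dsym_le (P := P) (hU0 n) (blockT P n).hasTemperateGrowth
      (fun ξ => blockT_eq_zero_of_gt P) (hU n) j _).trans ?_
    have := hU0 n
    gcongr
    exact norm_commutator_le m (h.temperate M j) (by positivity) (h.lipschitz M j) ψ
  refine (Finset.sum_le_sum fun j _ => h1 j).trans (le_of_eq ?_)
  simp only [Finset.sum_const, Finset.card_univ, Fintype.card_fin, nsmul_eq_mul]
  push_cast; ring

/-- Thanks to the vanishing divergence the derivative can be absorbed in the multiplier, leaving
commutators with `∂_j m(D)`. This version serves for the first block, with bounds uniform in `k` by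
`kerMom_dsym_symb_zero_le`. -/
lemma norm_commutator_div_le (h : GoodField P K V v A) (hV : 0 ≤ V) (m : Test) {w : Dist}
    {U : ℕ → ℝ} (hU0 : ∀ n, 0 ≤ U n) (hU : ∀ n, L2Bound (dmul (blockT P n) w) (U n)) (N M : ℕ)
    (ψ : Test) :
    ‖w (tmul (lowT P N) (∑ j, tmul (dsym j) (SchwartzMap.smulLeftCLM ℂ (A M j) (tmul m ψ) -
        tmul m (SchwartzMap.smulLeftCLM ℂ (A M j) ψ))))‖ ≤
      2 * (V * √(1 + (M : ℝ))) * (∑ j, kerMom (SchwartzMap.smulLeftCLM ℂ (dsym j) m)) *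
        (∑ n ∈ Finset.range (N + 1), U n) * ‖ψ.toLp 2 (volume : Measure Plane)‖ := by
  have h1 : ∑ j, tmul (dsym j) (SchwartzMap.smulLeftCLM ℂ (A M j) (tmul m ψ) -
        tmul m (SchwartzMap.smulLeftCLM ℂ (A M j) ψ)) =
      ∑ j, (SchwartzMap.smulLeftCLM ℂ (A M j) (tmul (SchwartzMap.smulLeftCLM ℂ (dsym j) m) ψ) -
        tmul (SchwartzMap.smulLeftCLM ℂ (dsym j) m) (SchwartzMap.smulLeftCLM ℂ (A M j) ψ)) := by
    have h2 : ∀ j η, tmul (SchwartzMap.smulLeftCLM ℂ (dsym j) m) η =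
        tmul (dsym j) (tmul m η) := fun j η => by
      rw [tmul_tmul (hasTemperateGrowth_dsym j) m.hasTemperateGrowth]
      congr 2; ext ξ
      rw [smulLeft_apply (hasTemperateGrowth_dsym j)]; rfl
    simp only [h2, map_sub, Finset.sum_sub_distrib]
    rw [h.sum_tmul_dsym]
  rw [h1, tmul_lowT_eq_sum, map_sum]
  simp only [map_sum]
  refine (norm_sum_le _ _).trans ?_
  rw [Finset.mul_sum, Finset.sum_mul]
  refine Finset.sum_le_sum fun n _ => (norm_sum_le _ _).trans ?_
  rw [Finset.mul_sum, Finset.sum_mul, Finset.sum_mul]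
  refine Finset.sum_le_sum fun j _ => (hU n _).trans ?_
  calc _ ≤ U n * (2 * (V * √(1 + (M : ℝ))) * kerMom (SchwartzMap.smulLeftCLM ℂ (dsym j) m) *
        ‖ψ.toLp 2 (volume : Measure Plane)‖) :=
        mul_le_mul_of_nonneg_left (norm_commutator_le _ (h.temperate M j) (by positivity)
          (h.lipschitz M j) ψ) (hU0 n)
    _ = _ := by ring

/-- The real parts of the regularizations of the convecting field. -/
def reField (A : ℕ → Fin 2 → Plane → ℂ) (N : ℕ) (j : Fin 2) (x : Plane) : ℂ :=
  ((A N j x).re : ℂ)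

lemma GoodField.temperate_reField (h : GoodField P K V v A) (N : ℕ) (j : Fin 2) :
    (reField A N j).HasTemperateGrowth :=
  (Complex.ofRealCLM.comp Complex.reCLM).hasTemperateGrowth.comp (h.temperate N j)

lemma norm_commutator_symb_le (h : GoodField P K V v A) (hV : 0 ≤ V) {w : Dist}
    {U : ℕ → ℝ} (hU0 : ∀ n, 0 ≤ U n) (hU : ∀ n, L2Bound (dmul (blockT P n) w) (U n)) (k n : ℕ)
    (ψ : Test) :
    ‖w (tmul (lowT P (n + 4)) (∑ j, tmul (dsym j)
      (SchwartzMap.smulLeftCLM ℂ (A (n + 2) j) (tmul (symb P k n) ψ) -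
        tmul (symb P k n) (SchwartzMap.smulLeftCLM ℂ (A (n + 2) j) ψ))))‖ ≤
      (64 / 3 * kerMom (phiT P) +
        2 * (∑ j, 2 * kerMom (SchwartzMap.smulLeftCLM ℂ (dsym j) (chiT P)))) * V *
        √(3 + (n : ℝ)) * (∑ n' ∈ Finset.range (n + 5), 2 ^ n' * ((2 : ℝ) ^ n)⁻¹ * U n') *
          ‖ψ.toLp 2 (volume : Measure Plane)‖ := by
  set C₁ := 64 / 3 * kerMom (phiT P) +
    2 * (∑ j, 2 * kerMom (SchwartzMap.smulLeftCLM ℂ (dsym j) (chiT P))) with hC₁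
  have hφ := kerMom_nonneg (phiT P)
  have hχ : 0 ≤ ∑ j : Fin 2, 2 * kerMom (SchwartzMap.smulLeftCLM ℂ (dsym j) (chiT P)) :=
    Finset.sum_nonneg fun j _ => mul_nonneg zero_le_two (kerMom_nonneg _)
  have h23 : √(1 + ((n + 2 : ℕ) : ℝ)) = √(3 + (n : ℝ)) := by congr 1; push_cast; ring
  have hle₁ : 64 / 3 * kerMom (phiT P) ≤ C₁ := le_add_of_nonneg_right (mul_nonneg zero_le_two hχ)
  have hle₂ : 2 * (∑ j, 2 * kerMom (SchwartzMap.smulLeftCLM ℂ (dsym j) (chiT P))) ≤ C₁ :=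
    le_add_of_nonneg_left (mul_nonneg (by norm_num) hφ)
  clear_value C₁
  set σ := ∑ n' ∈ Finset.range (n + 5), 2 ^ n' * ((2 : ℝ) ^ n)⁻¹ * U n' with hσ
  have hσ0 : 0 ≤ σ := Finset.sum_nonneg fun i _ => by have := hU0 i; positivity
  cases n with
  | succ n =>
    refine (norm_commutator_sum_le h hV _ hU0 hU _ _ ψ).trans ?_
    have h1 : kerMom (symb P k (n + 1)) * (∑ i ∈ Finset.range (n + 1 + 4 + 1), 2 ^ i * U i) =
        2 * kerMom (phiT P) * σ := by
      rw [symb, kerMom_blockT_succ, hσ, Finset.mul_sum, Finset.mul_sum]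
      refine Finset.sum_congr rfl fun i _ => ?_
      rw [pow_succ, mul_inv]; ring
    have h2 : 32 / 3 * (V * √(1 + ((n + 1 + 2 : ℕ) : ℝ))) * kerMom (symb P k (n + 1)) *
        (∑ i ∈ Finset.range (n + 1 + 4 + 1), 2 ^ i * U i) =
        64 / 3 * kerMom (phiT P) * (V * √(3 + ((n + 1 : ℕ) : ℝ)) * σ) := by
      rw [mul_assoc, h1, h23]; ring
    rw [h2]
    refine mul_le_mul_of_nonneg_right ?_ (norm_nonneg _)
    have hp : 0 ≤ V * √(3 + ((n + 1 : ℕ) : ℝ)) * σ :=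
      mul_nonneg (mul_nonneg hV (Real.sqrt_nonneg _)) hσ0
    exact (mul_le_mul_of_nonneg_right hle₁ hp).trans (le_of_eq (by ring))
  | zero =>
    refine (norm_commutator_div_le h hV _ hU0 hU _ _ ψ).trans ?_
    refine mul_le_mul_of_nonneg_right ?_ (norm_nonneg _)
    have h1 : ∑ i ∈ Finset.range (0 + 4 + 1), U i ≤ σ := by
      refine Finset.sum_le_sum fun i _ => le_mul_of_one_le_left (hU0 i) ?_
      rw [pow_zero, inv_one, mul_one]
      exact one_le_pow₀ (by norm_num)
    have h2 : ∑ j, kerMom (SchwartzMap.smulLeftCLM ℂ (dsym j) (symb P k 0)) ≤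
        ∑ j, 2 * kerMom (SchwartzMap.smulLeftCLM ℂ (dsym j) (chiT P)) :=
      Finset.sum_le_sum fun j _ => kerMom_dsym_symb_zero_le P k j
    rw [h23]
    have hp : 0 ≤ V * √(3 + ((0 : ℕ) : ℝ)) * σ :=
      mul_nonneg (mul_nonneg hV (Real.sqrt_nonneg _)) hσ0
    have hp' : 0 ≤ 2 * (V * √(3 + ((0 : ℕ) : ℝ))) :=
      mul_nonneg zero_le_two (mul_nonneg hV (Real.sqrt_nonneg _))
    calc _ ≤ 2 * (V * √(3 + ((0 : ℕ) : ℝ))) *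
          (∑ j, 2 * kerMom (SchwartzMap.smulLeftCLM ℂ (dsym j) (chiT P))) * σ :=
          mul_le_mul (mul_le_mul_of_nonneg_left h2 hp') h1
            (Finset.sum_nonneg fun i _ => hU0 i) (mul_nonneg hp' hχ)
      _ = 2 * (∑ j, 2 * kerMom (SchwartzMap.smulLeftCLM ℂ (dsym j) (chiT P))) *
          (V * √(3 + ((0 : ℕ) : ℝ)) * σ) := by ring
      _ ≤ C₁ * (V * √(3 + ((0 : ℕ) : ℝ)) * σ) := mul_le_mul_of_nonneg_right hle₂ hp
      _ = _ := by ring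

lemma exists_commutator_bound (P : DyadicPartition) : ∃ C : ℝ, 0 ≤ C ∧
    ∀ {K V : ℝ} {v : Fin 2 → Dist} {A : ℕ → Fin 2 → Plane → ℂ}, GoodField P K V v A → 0 ≤ V →
    ∀ {w : Dist} {U : ℕ → ℝ}, (∀ n, 0 ≤ U n) → (∀ n, L2Bound (dmul (blockT P n) w) (U n)) →
    ∀ (k n : ℕ) (ψ : Test),
    ‖w (tmul (lowT P (n + 4)) (∑ j, tmul (dsym j)
      (SchwartzMap.smulLeftCLM ℂ (A (n + 2) j) (tmul (symb P k n) ψ) -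
        tmul (symb P k n) (SchwartzMap.smulLeftCLM ℂ (A (n + 2) j) ψ))))‖ ≤
      C * V * √(3 + (n : ℝ)) * (∑ n' ∈ Finset.range (n + 5), 2 ^ n' * ((2 : ℝ) ^ n)⁻¹ * U n') *
          ‖ψ.toLp 2 (volume : Measure Plane)‖ := by
  refine ⟨_, ?_, fun h hV _ _ hU0 hU k n ψ => norm_commutator_symb_le h hV hU0 hU k n ψ⟩
  exact add_nonneg (mul_nonneg (by norm_num) (kerMom_nonneg _)) (mul_nonneg zero_le_two
    (Finset.sum_nonneg fun j _ => mul_nonneg zero_le_two (kerMom_nonneg _)))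

/-- Structure of the localized convection term. -/
theorem exists_convection_bound (P : DyadicPartition) {K : ℝ} (hK : 0 ≤ K) :
    ∃ C : ℝ, 0 ≤ C ∧ ∀ (V : ℝ) (v : Fin 2 → Dist) (A : ℕ → Fin 2 → Plane → ℂ) (k n : ℕ)
      (w c : Dist) (U : ℕ → ℝ) (S : ℝ), 0 ≤ V → GoodField P K V v A → 1 ≤ k →
      (∀ n, 0 ≤ U n) → (∀ n, L2Bound (dmul (blockT P n) w) (U n)) →
      (∀ ψ, Tendsto (fun N => ∑ j, w (tmul (lowT P N)
          (tmul (dsym j) (SchwartzMap.smulLeftCLM ℂ (A N j) ψ)))) atTop (𝓝 (c ψ))) →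
      (∀ N, ∑ l ∈ Finset.Ico (n + 2) N, 2 ^ n * ((2 : ℝ) ^ l)⁻¹ * √(3 + (l : ℝ)) *
        (∑ n' ∈ Finset.Icc (l - 1) (l + 3), U n') ≤ S) →
      ∀ ψ, ‖c (tmul (symb P k n) ψ) - ∑ j, dmul (symb P k n) w (tmul (dsym j)
        (SchwartzMap.smulLeftCLM ℂ (reField A (n + 2) j) ψ))‖ ≤
          C * V * (√(3 + (n : ℝ)) * (∑ n' ∈ Finset.range (n + 5), 2 ^ n' * ((2 : ℝ) ^ n)⁻¹ * U n')
            + S) * ‖ψ.toLp 2 (volume : Measure Plane)‖ := by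
  obtain ⟨C₁, hC₁0, hC₁⟩ := exists_commutator_bound P
  refine ⟨C₁ + 8 / 3 * K + 8 / 3 * K, by positivity,
    fun V v A k n w c U S hV h hk hU0 hU hc hS ψ => ?_⟩
  set m := symb P k n with hm
  set Q := ‖ψ.toLp 2 (volume : Measure Plane)‖ with hQ
  set σ := ∑ n' ∈ Finset.range (n + 5), 2 ^ n' * ((2 : ℝ) ^ n)⁻¹ * U n' with hσ
  have hσ0 : 0 ≤ σ := Finset.sum_nonneg fun i _ => by have := hU0 i; positivity
  have hS0 : 0 ≤ S := by simpa using hS 0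
  have hQ0 : 0 ≤ Q := norm_nonneg _
  have hs : ∀ ξ, 4 / 3 * 2 ^ n < 2 * Real.pi * ‖ξ‖ → m ξ = 0 :=
    fun ξ => symb_eq_zero_of_gt P k
  have hUm : L2Bound (dmul m w) (U n) := l2Bound_symb hk (hU0 n) (hU n)
  have h23 : √(1 + ((n + 2 : ℕ) : ℝ)) = √(3 + (n : ℝ)) := by congr 1; push_cast; ring
  have hR₁ : ∀ ψ : Test, ‖w (tmul (lowT P (n + 4)) (∑ j, tmul (dsym j)
      (SchwartzMap.smulLeftCLM ℂ (A (n + 2) j) (tmul m ψ) -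
        tmul m (SchwartzMap.smulLeftCLM ℂ (A (n + 2) j) ψ))))‖ ≤
          C₁ * V * √(3 + (n : ℝ)) * σ * ‖ψ.toLp 2 (volume : Measure Plane)‖ :=
    hC₁ h hV hU0 hU k n
  have hR₂ : ∀ N, ∑ l ∈ Finset.Ico (n + 2) N, (∑ n' ∈ Finset.Icc (l - 1) (l + 3), U n') *
      (8 / 3 * 2 ^ n * (K * ((2 : ℝ) ^ l)⁻¹ * (V * √(3 + (l : ℝ))))) ≤ 8 / 3 * K * V * S := by
    intro N
    refine le_of_eq_of_le ?_ (mul_le_mul_of_nonneg_left (hS N) (by positivity))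
    rw [Finset.mul_sum]
    exact Finset.sum_congr rfl fun l _ => by ring
  have h1 := norm_convection_sub_le h hK hV m.hasTemperateGrowth (norm_symb_le P k n) hs hU0 hU
    hc hR₁ hR₂ ψ
  -- Only a real field cancels in the energy, so the imaginary part of `S_{n+2} v` is moved to the
  -- remainder. Its size `2^{-n-2}` compensates the derivative acting at frequency `2^n`.
  have him : ∀ j, Function.HasTemperateGrowth
      (fun x => Complex.I * ((A (n + 2) j x).im : ℂ)) := fun j =>
    (Function.HasTemperateGrowth.const Complex.I).mul
      ((Complex.ofRealCLM.comp Complex.imCLM).hasTemperateGrowth.comp (h.temperate _ j))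
  have h2 : ∀ j, SchwartzMap.smulLeftCLM ℂ (A (n + 2) j) ψ =
      SchwartzMap.smulLeftCLM ℂ (reField A (n + 2) j) ψ +
        SchwartzMap.smulLeftCLM ℂ (fun x => Complex.I * ((A (n + 2) j x).im : ℂ)) ψ :=
    fun j => SchwartzMap.ext fun x => by
      change _ = SchwartzMap.smulLeftCLM ℂ (reField A (n + 2) j) ψ x +
        SchwartzMap.smulLeftCLM ℂ (fun x => Complex.I * ((A (n + 2) j x).im : ℂ)) ψ x
      rw [smulLeft_apply (h.temperate _ j), smulLeft_apply (h.temperate_reField _ j),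
        smulLeft_apply (him j), ← add_mul, reField]
      congr 1
      rw [mul_comm Complex.I, Complex.re_add_im]
  have h3 : ∀ j, ‖w (tmul m (tmul (dsym j) (SchwartzMap.smulLeftCLM ℂ
      (fun x => Complex.I * ((A (n + 2) j x).im : ℂ)) ψ)))‖ ≤
      U n * (8 / 3 * 2 ^ n * (K * ((2 : ℝ) ^ (n + 2))⁻¹ *
        (V * √(3 + ((n + 2 : ℕ) : ℝ))) * Q)) := fun j => by
    refine (norm_apply_blockT_dsym_le (P := P) (hU0 n) m.hasTemperateGrowth hs hUm j _).trans ?_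
    have := hU0 n
    gcongr
    refine norm_toLp_two_le_of_le fun x => ?_
    rw [smulLeft_apply (him j), norm_mul, norm_mul, Complex.norm_I, one_mul, Complex.norm_real]
    exact mul_le_mul_of_nonneg_right (h.im_le _ j x) (norm_nonneg _)
  have hsq : √(3 + ((n + 2 : ℕ) : ℝ)) ≤ 2 * √(3 + (n : ℝ)) := by
    rw [show (2 : ℝ) = √4 by rw [show (4 : ℝ) = 2 ^ 2 by norm_num]; simp,
      ← Real.sqrt_mul (by norm_num)]
    refine Real.sqrt_le_sqrt ?_
    push_cast
    have : (0 : ℝ) ≤ n := by positivity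
    linarith
  have hUσ : U n ≤ σ := by
    refine le_of_eq_of_le ?_ (Finset.single_le_sum
      (f := fun n' => 2 ^ n' * ((2 : ℝ) ^ n)⁻¹ * U n')
      (fun i _ => by have := hU0 i; positivity) (Finset.mem_range.2 (by omega : n < n + 5)))
    rw [mul_inv_cancel₀ (by positivity), one_mul]
  have h4 : ∑ j : Fin 2, ‖w (tmul m (tmul (dsym j) (SchwartzMap.smulLeftCLM ℂ
      (fun x => Complex.I * ((A (n + 2) j x).im : ℂ)) ψ)))‖ ≤
      8 / 3 * K * V * √(3 + (n : ℝ)) * σ * Q := by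
    refine (Finset.sum_le_sum fun j _ => h3 j).trans ?_
    simp only [Finset.sum_const, Finset.card_univ, Fintype.card_fin, nsmul_eq_mul]
    have e1 : (2 : ℝ) ^ n * ((2 : ℝ) ^ (n + 2))⁻¹ = 1 / 4 := by
      rw [pow_add]; field_simp; norm_num
    calc _ = U n * (8 / 3 * (2 * ((2 : ℝ) ^ n * ((2 : ℝ) ^ (n + 2))⁻¹)) * (K *
        (V * √(3 + ((n + 2 : ℕ) : ℝ))) * Q)) := by push_cast; ring
      _ ≤ σ * (8 / 3 * (2 * ((2 : ℝ) ^ n * ((2 : ℝ) ^ (n + 2))⁻¹)) * (K *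
        (V * (2 * √(3 + (n : ℝ)))) * Q)) := by
          gcongr
      _ = _ := by rw [e1]; ring
  have h5 : ∑ j, dmul m w (tmul (dsym j)
        (SchwartzMap.smulLeftCLM ℂ (reField A (n + 2) j) ψ)) =
      ∑ j, w (tmul m (tmul (dsym j) (SchwartzMap.smulLeftCLM ℂ (A (n + 2) j) ψ))) -
      ∑ j, w (tmul m (tmul (dsym j) (SchwartzMap.smulLeftCLM ℂ
        (fun x => Complex.I * ((A (n + 2) j x).im : ℂ)) ψ))) := by
    rw [← Finset.sum_sub_distrib]
    refine Finset.sum_congr rfl fun j _ => ?_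
    rw [h2, map_add, map_add, map_add, add_sub_cancel_right, dmul_apply]
  rw [h5, ← sub_add]
  calc _ ≤ (C₁ * V * √(3 + (n : ℝ)) * σ + 8 / 3 * K * V * S) * Q +
        8 / 3 * K * V * √(3 + (n : ℝ)) * σ * Q :=
        (norm_add_le _ _).trans (add_le_add h1 ((norm_sum_le _ _).trans h4))
    _ ≤ _ := by
        have e1 : 0 ≤ 8 / 3 * K * V * √(3 + (n : ℝ)) * σ * Q := by positivity
        have e2 : 0 ≤ C₁ * V * S * Q := by positivity
        have e3 : 0 ≤ 8 / 3 * K * V * S * Q := by positivity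
        linarith

end Commutator

end AnisotropicStokes

namespace AnisotropicStokes

/-! ### Primitives of integrable functions -/

lemma AbsolutelyContinuousOnInterval.of_dist_le {f g : ℝ → ℝ} {a b K : ℝ}
    (hf : AbsolutelyContinuousOnInterval f a b)
    (h : ∀ x ∈ uIcc a b, ∀ y ∈ uIcc a b, dist (g x) (g y) ≤ K * dist (f x) (f y)) :
    AbsolutelyContinuousOnInterval g a b := by
  have h1 := (hf.const_mul K)
  unfold AbsolutelyContinuousOnInterval at hf ⊢
  have h2 := hf.const_mul K
  rw [mul_zero] at h2
  refine squeeze_zero' (Eventually.of_forall fun _ => Finset.sum_nonneg fun _ _ => dist_nonneg) ?_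
    h2
  rw [eventually_inf_principal]
  refine Eventually.of_forall fun E hE => ?_
  rw [Finset.mul_sum]
  exact Finset.sum_le_sum fun i hi => h _ (hE.1 i hi).1 _ (hE.1 i hi).2

/-- Primitives of integrable functions are absolutely continuous, and the product rule then holds
almost everywhere and integrates. No better regularity in time is at hand, as `V` and `f` are merely
integrable. -/
lemma primitive_mul {α β : ℝ → ℝ} {t : ℝ} (hα : IntervalIntegrable α volume 0 t)
    (hβ : IntervalIntegrable β volume 0 t) (a₀ b₀ : ℝ) :
    (a₀ + ∫ τ in (0 : ℝ)..t, α τ) * (b₀ + ∫ τ in (0 : ℝ)..t, β τ) =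
      a₀ * b₀ + ∫ τ in (0 : ℝ)..t, (α τ * (b₀ + ∫ σ in (0 : ℝ)..τ, β σ) +
        (a₀ + ∫ σ in (0 : ℝ)..τ, α σ) * β τ) := by
  have h0 : (0 : ℝ) ∈ uIcc 0 t := left_mem_uIcc
  have hc : ∀ c : ℝ, AbsolutelyContinuousOnInterval (fun _ => c) 0 t := fun c =>
    (LipschitzWith.const c).lipschitzOnWith.absolutelyContinuousOnInterval
  have hA := (hc a₀).add (hα.absolutelyContinuousOnInterval_intervalIntegral h0)
  have hB := (hc b₀).add (hβ.absolutelyContinuousOnInterval_intervalIntegral h0)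
  have h := hA.integral_deriv_mul_eq_sub hB
  simp only [Pi.add_apply, intervalIntegral.integral_same, add_zero] at h
  rw [eq_sub_iff_add_eq'] at h
  rw [← h]
  congr 1
  refine intervalIntegral.integral_congr_ae ?_
  filter_upwards [hα.ae_hasDerivAt_integral, hβ.ae_hasDerivAt_integral] with x hx hy hxt
  have hxt' := uIoc_subset_uIcc hxt
  have e1 := ((hx hxt' 0 h0).const_add a₀).deriv
  have e2 := ((hy hxt' 0 h0).const_add b₀).deriv
  change deriv (fun x => a₀ + ∫ τ in (0 : ℝ)..x, α τ) x * _ +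
    _ * deriv (fun x => b₀ + ∫ τ in (0 : ℝ)..x, β τ) x = _
  rw [e1, e2]

/-- The exponential of a primitive is a primitive. -/
lemma exp_primitive {V : ℝ → ℝ} {t : ℝ} (hV : IntervalIntegrable V volume 0 t) (κ : ℝ) :
    Real.exp (κ * ∫ τ in (0 : ℝ)..t, V τ) =
      1 + ∫ τ in (0 : ℝ)..t, κ * V τ * Real.exp (κ * ∫ σ in (0 : ℝ)..τ, V σ) := by
  have h0 : (0 : ℝ) ∈ uIcc 0 t := left_mem_uIcc
  have hA := (hV.absolutelyContinuousOnInterval_intervalIntegral h0).const_mul κ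
  obtain ⟨R, hR⟩ := hA.exists_bound
  have hB : AbsolutelyContinuousOnInterval
      (fun t => Real.exp (κ * ∫ τ in (0 : ℝ)..t, V τ)) 0 t := by
    refine AbsolutelyContinuousOnInterval.of_dist_le (K := Real.exp R) hA fun x hx y hy => ?_
    have hx' := (le_abs_self _).trans (hR x hx)
    have hy' := (le_abs_self _).trans (hR y hy)
    simp only [Real.dist_eq]
    refine Convex.norm_image_sub_le_of_norm_deriv_le (s := Iic R) (f := Real.exp)
      (fun z _ => Real.differentiableAt_exp) (fun z hz => ?_) (convex_Iic R) hy' hx'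
    rw [Real.deriv_exp, Real.norm_eq_abs, Real.abs_exp]
    exact Real.exp_le_exp.2 hz
  have h := hB.integral_deriv_eq_sub
  simp only [intervalIntegral.integral_same, mul_zero, Real.exp_zero] at h
  rw [eq_sub_iff_add_eq'] at h
  rw [← h]
  congr 1
  refine intervalIntegral.integral_congr_ae ?_
  filter_upwards [hV.ae_hasDerivAt_integral] with x hx hxt
  have e1 := ((hx (uIoc_subset_uIcc hxt) 0 h0).const_mul κ).exp.deriv
  rw [e1]; ring

/-- The scalar energy identity, from the product rule for the real and imaginary parts; it will be
applied to each coordinate in a Hilbert basis. -/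
lemma norm_sq_primitive {g : ℝ → ℂ} {t : ℝ} (hg : IntervalIntegrable g volume 0 t) (z₀ : ℂ) :
    ‖z₀ + ∫ τ in (0 : ℝ)..t, g τ‖ ^ 2 = ‖z₀‖ ^ 2 + 2 * ∫ τ in (0 : ℝ)..t,
      ((starRingEnd ℂ) (z₀ + ∫ σ in (0 : ℝ)..τ, g σ) * g τ).re := by
  have hre : IntervalIntegrable (fun τ => (g τ).re) volume 0 t := ⟨hg.1.re, hg.2.re⟩
  have him : IntervalIntegrable (fun τ => (g τ).im) volume 0 t := ⟨hg.1.im, hg.2.im⟩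
  have hsub : ∀ τ ∈ uIcc 0 t, IntervalIntegrable g volume 0 τ := fun τ hτ =>
    hg.mono_set (uIcc_subset_uIcc left_mem_uIcc hτ)
  have er : ∀ τ ∈ uIcc 0 t, (∫ σ in (0 : ℝ)..τ, g σ).re = ∫ σ in (0 : ℝ)..τ, (g σ).re :=
    fun τ hτ => (intervalIntegral.intervalIntegral_re (hsub τ hτ)).symm
  have ei : ∀ τ ∈ uIcc 0 t, (∫ σ in (0 : ℝ)..τ, g σ).im = ∫ σ in (0 : ℝ)..τ, (g σ).im :=
    fun τ hτ => (intervalIntegral.intervalIntegral_im (hsub τ hτ)).symm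
  have h1 := primitive_mul hre hre z₀.re z₀.re
  have h2 := primitive_mul him him z₀.im z₀.im
  rw [Complex.sq_norm, Complex.normSq_apply, Complex.add_re, Complex.add_im,
    er t right_mem_uIcc, ei t right_mem_uIcc, h1, h2, Complex.sq_norm, Complex.normSq_apply]
  have hcr : ∀ (f : ℝ → ℝ), IntervalIntegrable f volume 0 t → ∀ c : ℝ,
      ContinuousOn (fun τ => c + ∫ σ in (0 : ℝ)..τ, f σ) (uIcc 0 t) := fun f hf c =>
    continuousOn_const.add
      (hf.absolutelyContinuousOnInterval_intervalIntegral left_mem_uIcc).continuousOn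
  have hi1 := (hre.mul_continuousOn (hcr _ hre z₀.re)).add
    (hre.continuousOn_mul (hcr _ hre z₀.re))
  have hi2 := (him.mul_continuousOn (hcr _ him z₀.im)).add
    (him.continuousOn_mul (hcr _ him z₀.im))
  have h3 := intervalIntegral.integral_add hi1 hi2
  rw [add_add_add_comm, ← h3]
  congr 1
  rw [← intervalIntegral.integral_const_mul]
  refine intervalIntegral.integral_congr fun τ hτ => ?_
  simp only [Complex.mul_re, Complex.conj_re, Complex.conj_im, Complex.add_re, Complex.add_im,
    er τ hτ, ei τ hτ]
  ring

/-! ### The energy identity in a Hilbert space -/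

section Hilbert

variable {E : Type*} [NormedAddCommGroup E] [InnerProductSpace ℂ E]

/-- The weak form of `y' = F` extends from a dense family of test vectors to all vectors. -/
lemma weak_equation_of_dense {ι : Type*} {d : ι → E} (hd : DenseRange d) {y F : ℝ → E}
    {ρ : ℝ → ℝ} {T : ℝ} (hT : 0 ≤ T) (hρ : IntervalIntegrable ρ volume 0 T)
    (hF : ∀ᵐ τ ∂volume.restrict (Ioc 0 T), ‖F τ‖ ≤ ρ τ)
    (hint : ∀ i, IntervalIntegrable (fun τ => inner ℂ (d i) (F τ)) volume 0 T)
    (heq : ∀ t ∈ Icc 0 T, ∀ i, inner ℂ (d i) (y t) =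
      inner ℂ (d i) (y 0) + ∫ τ in (0 : ℝ)..t, inner ℂ (d i) (F τ)) (φ : E) :
    IntervalIntegrable (fun τ => inner ℂ φ (F τ)) volume 0 T ∧
      ∀ t ∈ Icc 0 T, inner ℂ φ (y t) =
        inner ℂ φ (y 0) + ∫ τ in (0 : ℝ)..t, inner ℂ φ (F τ) := by
  obtain ⟨x, hx, hxt⟩ := mem_closure_iff_seq_limit.1 (hd φ)
  choose i hi using hx
  have hxt' : Tendsto (fun n => d (i n)) atTop (𝓝 φ) := by simpa only [hi] using hxt
  obtain ⟨B, hB⟩ := hxt'.norm.bddAbove_range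
  have hB' : ∀ n, ‖d (i n)‖ ≤ B := fun n => hB ⟨n, rfl⟩
  have hlim : ∀ z : E, Tendsto (fun n => inner ℂ (d (i n)) z) atTop (𝓝 (inner ℂ φ z)) :=
    fun z => hxt'.inner tendsto_const_nhds
  have hmeas : AEStronglyMeasurable (fun τ => inner ℂ φ (F τ)) (volume.restrict (Ioc 0 T)) := by
    refine aestronglyMeasurable_of_tendsto_ae atTop (fun n => ?_)
      (ae_of_all _ fun τ => hlim (F τ))
    exact ((intervalIntegrable_iff_integrableOn_Ioc_of_le hT).1 (hint _)).aestronglyMeasurable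
  have hρ' := (intervalIntegrable_iff_integrableOn_Ioc_of_le hT).1 hρ
  refine ⟨(intervalIntegrable_iff_integrableOn_Ioc_of_le hT).2
    ((hρ'.const_mul ‖φ‖).mono' hmeas ?_), fun t ht => ?_⟩
  · filter_upwards [hF] with τ hτ
    exact (norm_inner_le_norm _ _).trans (mul_le_mul_of_nonneg_left hτ (norm_nonneg _))
  · have hsub : Ioc 0 t ⊆ Ioc 0 T := Ioc_subset_Ioc_right ht.2
    have h1 : Tendsto (fun n => ∫ τ in (0 : ℝ)..t, inner ℂ (d (i n)) (F τ)) atTop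
        (𝓝 (∫ τ in (0 : ℝ)..t, inner ℂ φ (F τ))) := by
      refine intervalIntegral.tendsto_integral_filter_of_dominated_convergence
        (fun τ => B * ρ τ) (Eventually.of_forall fun n => ?_) (Eventually.of_forall fun n => ?_)
        ?_ (ae_of_all _ fun τ _ => hlim _)
      · rw [uIoc_of_le ht.1]
        exact ((intervalIntegrable_iff_integrableOn_Ioc_of_le hT).1
          (hint _)).aestronglyMeasurable.mono_set hsub
      · rw [uIoc_of_le ht.1]
        rw [← ae_restrict_iff' measurableSet_Ioc]
        filter_upwards [ae_restrict_of_ae_restrict_of_subset hsub hF] with τ hτ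
        exact (norm_inner_le_norm _ _).trans (mul_le_mul (hB' n) hτ (norm_nonneg _)
          ((norm_nonneg _).trans (hB' n)))
      · exact (intervalIntegrable_iff_integrableOn_Ioc_of_le ht.1).2
          ((hρ'.mono_set hsub).const_mul B)
    refine tendsto_nhds_unique (hlim (y t)) ?_
    refine ((hlim (y 0)).add h1).congr fun n => ?_
    exact (heq t ht (i n)).symm

lemma norm_sum_inner_mul_inner_le {ι : Type*} {b : ι → E} (hb : Orthonormal ℂ b) (s : Finset ι)
    (x z : E) : ‖∑ i ∈ s, inner ℂ x (b i) * inner ℂ (b i) z‖ ≤ ‖x‖ * ‖z‖ := by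
  refine (norm_sum_le _ _).trans ?_
  simp only [norm_mul]
  refine (Real.sum_mul_le_sqrt_mul_sqrt s _ _).trans ?_
  refine mul_le_mul ?_ ?_ (Real.sqrt_nonneg _) (norm_nonneg _)
  · rw [Real.sqrt_le_left (norm_nonneg _)]
    refine le_of_eq_of_le (Finset.sum_congr rfl fun i _ => ?_) (hb.sum_inner_products_le x (s := s))
    rw [norm_inner_symm]
  · rw [Real.sqrt_le_left (norm_nonneg _)]
    exact hb.sum_inner_products_le z (s := s)

variable [CompleteSpace E] [SecondCountableTopology E]

/-- The energy identity for the weak form of `y' = F`. -/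
theorem hilbert_energy {ι : Type*} {d : ι → E} (hd : DenseRange d) {y F : ℝ → E}
    {ρ : ℝ → ℝ} {T M : ℝ} (hT : 0 ≤ T) (hρ : IntervalIntegrable ρ volume 0 T)
    (hF : ∀ᵐ τ ∂volume.restrict (Ioc 0 T), ‖F τ‖ ≤ ρ τ) (hy : ∀ t ∈ Icc 0 T, ‖y t‖ ≤ M)
    (hint : ∀ i, IntervalIntegrable (fun τ => inner ℂ (d i) (F τ)) volume 0 T)
    (heq : ∀ t ∈ Icc 0 T, ∀ i, inner ℂ (d i) (y t) =
      inner ℂ (d i) (y 0) + ∫ τ in (0 : ℝ)..t, inner ℂ (d i) (F τ)) :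
    IntervalIntegrable (fun τ => (inner ℂ (y τ) (F τ)).re) volume 0 T ∧
      ∀ t ∈ Icc 0 T, ‖y t‖ ^ 2 =
        ‖y 0‖ ^ 2 + 2 * ∫ τ in (0 : ℝ)..t, (inner ℂ (y τ) (F τ)).re := by
  -- Nothing is known about the strong measurability of `F`, so the identity is summed over the
  -- coordinates in a Hilbert basis. Separability makes the basis countable, as dominated
  -- convergence along finite sets of indices requires.
  obtain ⟨w, b, -⟩ := exists_hilbertBasis ℂ E
  have hcount : Countable w := by
    have hsep : Pairwise fun i j : w => 1 ≤ dist (b i) (b j) := fun i j hij => by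
      have h1 : ‖b i - b j‖ ^ 2 = 2 := by
        rw [@norm_sub_sq ℂ, b.orthonormal.2 hij, b.orthonormal.1, b.orthonormal.1]
        norm_num
      dsimp only
      rw [dist_eq_norm]
      nlinarith [norm_nonneg (b i - b j)]
    by_contra hc
    obtain ⟨s, hs, hsd⟩ := TopologicalSpace.exists_countable_dense E
    have : ∀ i : w, ∃ x ∈ s, dist (b i) x < 1 / 2 := fun i =>
      hsd.exists_dist_lt (b i) (by norm_num)
    choose x hx hxd using this
    have hinj : Function.Injective (fun i => (⟨x i, hx i⟩ : s)) := fun i j hij => by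
      by_contra hne
      have h1 := hsep hne
      have h2 : x i = x j := congrArg Subtype.val hij
      have h3 := dist_triangle_right (b i) (b j) (x i)
      have h4 := hxd i
      have h5 := hxd j
      rw [← h2] at h5
      linarith
    have := hs.to_subtype
    exact hc hinj.countable
  have hweak := fun φ => weak_equation_of_dense hd hT hρ hF hint heq φ
  have hρ' := (intervalIntegrable_iff_integrableOn_Ioc_of_le hT).1 hρ
  set G : Finset w → ℝ → ℝ := fun s τ =>
    (∑ i ∈ s, inner ℂ (y τ) (b i) * inner ℂ (b i) (F τ)).re with hG
  have hyc : ∀ φ, ContinuousOn (fun τ => inner ℂ φ (y τ)) (Icc 0 T) := fun φ => by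
    have h1 : ContinuousOn (fun t => inner ℂ φ (y 0) + ∫ τ in (0 : ℝ)..t, inner ℂ φ (F τ))
        (Icc 0 T) := by
      refine continuousOn_const.add ?_
      have := intervalIntegral.continuousOn_primitive_interval
        ((intervalIntegrable_iff_integrableOn_Icc_of_le hT).1 (hweak φ).1 |>.mono_set
          (by rw [uIcc_of_le hT]))
      rwa [uIcc_of_le hT] at this
    exact h1.congr fun t ht => (hweak φ).2 t ht
  have hGi : ∀ s, IntervalIntegrable (G s) volume 0 T := fun s => by
    have h1 : IntervalIntegrable
        (fun τ => ∑ i ∈ s, inner ℂ (y τ) (b i) * inner ℂ (b i) (F τ)) volume 0 T := by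
      have h2 := IntervalIntegrable.sum s (μ := volume) (a := 0) (b := T)
        (f := fun i τ => inner ℂ (y τ) (b i) * inner ℂ (b i) (F τ)) fun i _ => by
          refine (hweak (b i)).1.continuousOn_mul ?_
          rw [uIcc_of_le hT]
          refine (Complex.continuous_conj.comp_continuousOn (hyc (b i))).congr fun τ _ => ?_
          simp
      refine h2.congr fun τ _ => ?_
      simp
    exact ⟨h1.1.re, h1.2.re⟩
  have hlim : ∀ τ, Tendsto (fun s => G s τ) atTop (𝓝 (inner ℂ (y τ) (F τ)).re) := fun τ =>
    (Complex.continuous_re.tendsto _).comp (b.hasSum_inner_mul_inner (y τ) (F τ))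
  have hbound : ∀ s, ∀ᵐ τ ∂volume.restrict (Ioc 0 T), ‖G s τ‖ ≤ M * ρ τ := fun s => by
    filter_upwards [hF, self_mem_ae_restrict measurableSet_Ioc] with τ hτ hτT
    have hyτ := hy τ (Ioc_subset_Icc_self hτT)
    refine (Complex.abs_re_le_norm _).trans
      ((norm_sum_inner_mul_inner_le b.orthonormal s _ _).trans ?_)
    exact mul_le_mul hyτ hτ (norm_nonneg _) ((norm_nonneg _).trans hyτ)
  refine ⟨(intervalIntegrable_iff_integrableOn_Ioc_of_le hT).2
    ((hρ'.const_mul M).mono' ?_ ?_), fun t ht => ?_⟩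
  · exact aestronglyMeasurable_of_tendsto_ae atTop (fun s =>
      ((intervalIntegrable_iff_integrableOn_Ioc_of_le hT).1 (hGi s)).aestronglyMeasurable)
      (ae_of_all _ hlim)
  · filter_upwards [hF, self_mem_ae_restrict measurableSet_Ioc] with τ hτ hτT
    have hyτ := hy τ (Ioc_subset_Icc_self hτT)
    refine (Complex.abs_re_le_norm _).trans ((norm_inner_le_norm _ _).trans ?_)
    exact mul_le_mul hyτ hτ (norm_nonneg _) ((norm_nonneg _).trans hyτ)
  · have hsub : Ioc 0 t ⊆ Ioc 0 T := Ioc_subset_Ioc_right ht.2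
    have h1 : Tendsto (fun s => ∫ τ in (0 : ℝ)..t, G s τ) atTop
        (𝓝 (∫ τ in (0 : ℝ)..t, (inner ℂ (y τ) (F τ)).re)) := by
      refine intervalIntegral.tendsto_integral_filter_of_dominated_convergence
        (fun τ => M * ρ τ) (Eventually.of_forall fun s => ?_) (Eventually.of_forall fun s => ?_)
        ?_ (ae_of_all _ fun τ _ => hlim τ)
      · rw [uIoc_of_le ht.1]
        exact ((intervalIntegrable_iff_integrableOn_Ioc_of_le hT).1
          (hGi _)).aestronglyMeasurable.mono_set hsub
      · rw [uIoc_of_le ht.1, ← ae_restrict_iff' measurableSet_Ioc]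
        exact ae_restrict_of_ae_restrict_of_subset hsub (hbound s)
      · exact (intervalIntegrable_iff_integrableOn_Ioc_of_le ht.1).2
          ((hρ'.mono_set hsub).const_mul M)
    have h2 : ∀ z : E, Tendsto (fun s => ∑ i ∈ s, ‖inner ℂ (b i) z‖ ^ 2) atTop (𝓝 (‖z‖ ^ 2)) :=
      fun z => by
        have h3 := (Complex.continuous_re.tendsto _).comp (b.hasSum_inner_mul_inner z z)
        have h4 : (inner ℂ z z : ℂ).re = ‖z‖ ^ 2 := inner_self_eq_norm_sq (𝕜 := ℂ) z
        rw [h4] at h3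
        refine h3.congr fun s => ?_
        simp only [Function.comp_apply, Complex.re_sum]
        refine Finset.sum_congr rfl fun i _ => ?_
        rw [← inner_conj_symm z (b i), ← Complex.normSq_eq_conj_mul_self, Complex.ofReal_re,
          Complex.sq_norm]
    refine tendsto_nhds_unique (h2 (y t)) (((h2 (y 0)).add (h1.const_mul 2)).congr fun s => ?_)
    have h5 : ∀ i, ‖inner ℂ (b i) (y t)‖ ^ 2 = ‖inner ℂ (b i) (y 0)‖ ^ 2 +
        2 * ∫ τ in (0 : ℝ)..t, (inner ℂ (y τ) (b i) * inner ℂ (b i) (F τ)).re := fun i => by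
      rw [(hweak (b i)).2 t ht, norm_sq_primitive ((hweak (b i)).1.mono_set (by
        rw [uIcc_of_le hT, uIcc_of_le ht.1]; exact Icc_subset_Icc_right ht.2))]
      congr 2
      refine intervalIntegral.integral_congr fun τ hτ => ?_
      rw [uIcc_of_le ht.1] at hτ
      rw [← (hweak (b i)).2 τ ⟨hτ.1, hτ.2.trans ht.2⟩, inner_conj_symm]
    simp only [h5, Finset.sum_add_distrib, ← Finset.mul_sum]
    congr 2
    rw [← intervalIntegral.integral_finsetSum]
    · refine intervalIntegral.integral_congr fun τ _ => ?_
      simp only [hG, Complex.re_sum]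
    · intro i _
      have h6 := hGi {i}
      simp only [hG, Finset.sum_singleton] at h6
      exact h6.mono_set (by
        rw [uIcc_of_le hT, uIcc_of_le ht.1]; exact Icc_subset_Icc_right ht.2)

end Hilbert

end AnisotropicStokes

namespace AnisotropicStokes

open scoped FourierTransform

/-! ### Bounded operators on `L²` defined by duality -/

lemma exists_dualOp (T : Test →L[ℂ] Test) {K : ℝ} (hK : 0 ≤ K)
    (hT : ∀ ψ : Test, ‖(T ψ).toLp 2 (volume : Measure Plane)‖ ≤
      K * ‖ψ.toLp 2 (volume : Measure Plane)‖) :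
    ∃ S : L2 →L[ℂ] L2, (∀ (h : L2) (ψ : Test),
      (Lp.toTemperedDistribution (S h) : Dist) ψ = (Lp.toTemperedDistribution h : Dist) (T ψ)) := by
  have key : ∀ h : L2, ∃ g : L2, (∀ ψ : Test, (Lp.toTemperedDistribution g : Dist) ψ =
      (Lp.toTemperedDistribution h : Dist) (T ψ)) ∧ ‖g‖ ≤ K * ‖h‖ := fun h => by
    let D : Dist := PointwiseConvergenceCLM.precomp ℂ T (Lp.toTemperedDistribution h : Dist)
    have hD : ∀ ψ, D ψ = (Lp.toTemperedDistribution h : Dist) (T ψ) := fun _ => rfl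
    have hb : L2Bound D (K * ‖h‖) := fun ψ => by
      rw [hD]
      refine (l2Bound_toDist h _).trans ?_
      refine (mul_le_mul_of_nonneg_left (hT ψ) (norm_nonneg h)).trans (le_of_eq (by ring))
    obtain ⟨g, hg, hgn⟩ := hb.exists_rep (by positivity)
    exact ⟨g, fun ψ => by rw [hg, hD], hgn⟩
  choose S hS hSn using key
  have hinj : ∀ g g' : L2, (∀ ψ, (Lp.toTemperedDistribution g : Dist) ψ =
      (Lp.toTemperedDistribution g' : Dist) ψ) → g = g' := fun g g' h =>
    toDist_injective (by ext ψ; exact h ψ)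
  have hadd : ∀ (g g' : L2) (ψ : Test), (Lp.toTemperedDistribution (g + g') : Dist) ψ =
      (Lp.toTemperedDistribution g : Dist) ψ + (Lp.toTemperedDistribution g' : Dist) ψ :=
    fun g g' ψ => by simp only [toDist_apply_eq_inner, inner_add_right]
  have hsm : ∀ (c : ℂ) (g : L2) (ψ : Test), (Lp.toTemperedDistribution (c • g) : Dist) ψ =
      c * (Lp.toTemperedDistribution g : Dist) ψ :=
    fun c g ψ => by simp only [toDist_apply_eq_inner, inner_smul_right]
  refine ⟨LinearMap.mkContinuous
    { toFun := S
      map_add' := fun g g' => hinj _ _ fun ψ => by rw [hS, hadd, hadd, hS, hS]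
      map_smul' := fun c g => hinj _ _ fun ψ => by
        rw [hS, hsm, RingHom.id_apply, hsm, hS] } K hSn, hS⟩

open Classical in
/-- The operator on `L²` which is dual to a bounded operator on test functions. -/
def dualOp (T : Test →L[ℂ] Test) : L2 →L[ℂ] L2 :=
  if h : ∃ S : L2 →L[ℂ] L2, (∀ (h : L2) (ψ : Test),
    (Lp.toTemperedDistribution (S h) : Dist) ψ = (Lp.toTemperedDistribution h : Dist) (T ψ))
  then h.choose else 0

section DualOp

variable {T : Test →L[ℂ] Test} {K : ℝ}

lemma toDist_dualOp (hK : 0 ≤ K) (hT : ∀ ψ : Test, ‖(T ψ).toLp 2 (volume : Measure Plane)‖ ≤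
      K * ‖ψ.toLp 2 (volume : Measure Plane)‖) (h : L2) (ψ : Test) :
    (Lp.toTemperedDistribution (dualOp T h) : Dist) ψ =
      (Lp.toTemperedDistribution h : Dist) (T ψ) := by
  have := exists_dualOp T hK hT
  rw [dualOp, dif_pos this]
  exact this.choose_spec h ψ

lemma norm_le_of_l2Bound {h : L2} {R : ℝ} (hR : 0 ≤ R)
    (hh : L2Bound (Lp.toTemperedDistribution h) R) : ‖h‖ ≤ R := by
  obtain ⟨g, hg, hgn⟩ := hh.exists_rep hR
  rwa [toDist_injective hg] at hgn

lemma norm_dualOp_le (hK : 0 ≤ K) (hT : ∀ ψ : Test, ‖(T ψ).toLp 2 (volume : Measure Plane)‖ ≤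
      K * ‖ψ.toLp 2 (volume : Measure Plane)‖) (h : L2) : ‖dualOp T h‖ ≤ K * ‖h‖ := by
  refine norm_le_of_l2Bound (by positivity) fun ψ => ?_
  rw [toDist_dualOp hK hT]
  refine (l2Bound_toDist h _).trans ?_
  refine (mul_le_mul_of_nonneg_left (hT ψ) (norm_nonneg h)).trans (le_of_eq (by ring))

end DualOp

lemma toDist_toLp_apply (η ψ : Test) :
    (Lp.toTemperedDistribution (η.toLp 2 (volume : Measure Plane)) : Dist) ψ =
      ∫ x, ψ x * η x := by
  rw [Lp.toTemperedDistribution_apply]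
  refine integral_congr_ae ?_
  filter_upwards [η.coeFn_toLp 2 (volume : Measure Plane)] with x hx
  rw [hx, smul_eq_mul]

/-- The Fourier multiplier with symbol `a` on `L²`. -/
def fop (a : Plane → ℂ) : L2 →L[ℂ] L2 := dualOp (tmul a)

/-- The multiplication by `b` on `L²`. -/
def mop (b : Plane → ℂ) : L2 →L[ℂ] L2 := dualOp (SchwartzMap.smulLeftCLM ℂ b)

section FopMop

variable {a b : Plane → ℂ} {K : ℝ}

lemma toDist_fop (ha : a.HasTemperateGrowth) (hK : ∀ ξ, ‖a ξ‖ ≤ K) (h : L2) :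
    (Lp.toTemperedDistribution (fop a h) : Dist) = dmul a (Lp.toTemperedDistribution h) := by
  ext ψ
  exact toDist_dualOp ((norm_nonneg _).trans (hK 0)) (norm_tmul_le ha hK) h ψ

lemma norm_fop_le (ha : a.HasTemperateGrowth) (hK : ∀ ξ, ‖a ξ‖ ≤ K) (h : L2) :
    ‖fop a h‖ ≤ K * ‖h‖ :=
  norm_dualOp_le ((norm_nonneg _).trans (hK 0)) (norm_tmul_le ha hK) h

lemma fop_toLp (ha : a.HasTemperateGrowth) (hK : ∀ ξ, ‖a ξ‖ ≤ K) (η : Test) :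
    fop a (η.toLp 2 (volume : Measure Plane)) =
      (tmul (fun ξ => a (-ξ)) η).toLp 2 (volume : Measure Plane) := by
  apply toDist_injective
  dsimp only
  rw [toDist_fop ha hK]
  ext ψ
  rw [dmul_apply, toDist_toLp_apply, toDist_toLp_apply, integral_tmul_mul ha]

lemma norm_smulLeft_toLp_le (hb : b.HasTemperateGrowth) (hK : ∀ ξ, ‖b ξ‖ ≤ K) (ψ : Test) :
    ‖(SchwartzMap.smulLeftCLM ℂ b ψ).toLp 2 (volume : Measure Plane)‖ ≤
      K * ‖ψ.toLp 2 (volume : Measure Plane)‖ :=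
  norm_toLp_two_le_of_le fun x => by
    rw [smulLeft_apply hb, norm_mul]
    exact mul_le_mul_of_nonneg_right (hK x) (norm_nonneg _)

lemma toDist_mop (hb : b.HasTemperateGrowth) (hK : ∀ ξ, ‖b ξ‖ ≤ K) (h : L2) (ψ : Test) :
    (Lp.toTemperedDistribution (mop b h) : Dist) ψ =
      (Lp.toTemperedDistribution h : Dist) (SchwartzMap.smulLeftCLM ℂ b ψ) :=
  toDist_dualOp ((norm_nonneg _).trans (hK 0)) (norm_smulLeft_toLp_le hb hK) h ψ

lemma norm_mop_le (hb : b.HasTemperateGrowth) (hK : ∀ ξ, ‖b ξ‖ ≤ K) (h : L2) :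
    ‖mop b h‖ ≤ K * ‖h‖ :=
  norm_dualOp_le ((norm_nonneg _).trans (hK 0)) (norm_smulLeft_toLp_le hb hK) h

lemma mop_toLp (hb : b.HasTemperateGrowth) (hK : ∀ ξ, ‖b ξ‖ ≤ K) (η : Test) :
    mop b (η.toLp 2 (volume : Measure Plane)) =
      (SchwartzMap.smulLeftCLM ℂ b η).toLp 2 (volume : Measure Plane) := by
  apply toDist_injective
  dsimp only
  ext ψ
  rw [toDist_mop hb hK, toDist_toLp_apply, toDist_toLp_apply]
  congr 1; ext x
  rw [smulLeft_apply hb, smulLeft_apply hb]; ring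

lemma l2_eq_of_forall_apply {g g' : L2} (h : ∀ ψ, (Lp.toTemperedDistribution g : Dist) ψ =
    (Lp.toTemperedDistribution g' : Dist) ψ) : g = g' :=
  toDist_injective (by ext ψ; exact h ψ)

lemma toDist_add (g g' : L2) : (Lp.toTemperedDistribution (g + g') : Dist) =
    Lp.toTemperedDistribution g + Lp.toTemperedDistribution g' := by
  ext ψ
  change _ = (Lp.toTemperedDistribution g : Dist) ψ + (Lp.toTemperedDistribution g' : Dist) ψ
  simp only [toDist_apply_eq_inner, inner_add_right]

lemma toDist_sub (g g' : L2) : (Lp.toTemperedDistribution (g - g') : Dist) =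
    Lp.toTemperedDistribution g - Lp.toTemperedDistribution g' := by
  ext ψ
  change _ = (Lp.toTemperedDistribution g : Dist) ψ - (Lp.toTemperedDistribution g' : Dist) ψ
  simp only [toDist_apply_eq_inner, inner_sub_right]

lemma toDist_sum {ι : Type*} (s : Finset ι) (g : ι → L2) :
    (Lp.toTemperedDistribution (∑ i ∈ s, g i) : Dist) =
      ∑ i ∈ s, (Lp.toTemperedDistribution (g i) : Dist) := by
  ext ψ
  rw [_root_.sum_apply]
  simp only [toDist_apply_eq_inner, inner_sum]

lemma toDist_zero : (Lp.toTemperedDistribution (0 : L2) : Dist) = 0 := by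
  ext ψ
  rw [toDist_apply_eq_inner, inner_zero_right]; rfl

lemma inner_toLp (η ζ : Test) : inner ℂ (η.toLp 2 (volume : Measure Plane))
    (ζ.toLp 2 (volume : Measure Plane)) = ∫ x, (starRingEnd ℂ) (η x) * ζ x := by
  have h := toDist_apply_eq_inner (ζ.toLp 2 (volume : Measure Plane)) (conjTest η)
  rw [conjTest_conjTest] at h
  rw [← h, toDist_toLp_apply]
  simp [conjTest_apply]

/-- The adjoint of a Fourier multiplier. -/
lemma inner_fop (ha : a.HasTemperateGrowth) (hK : ∀ ξ, ‖a ξ‖ ≤ K) (g h : L2) :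
    inner ℂ (fop a g) h = inner ℂ g (fop (fun ξ => (starRingEnd ℂ) (a ξ)) h) := by
  have hK' : ∀ ξ, ‖(starRingEnd ℂ) (a ξ)‖ ≤ K := fun ξ => by rw [RCLike.norm_conj]; exact hK ξ
  have hc := HasTemperateGrowth.conj ha
  refine DenseRange.induction_on denseRange_toLp g ?_ fun η => ?_
  · exact isClosed_eq ((fop a).continuous.inner continuous_const)
      (continuous_id.inner continuous_const)
  · have h1 := toDist_apply_eq_inner (fop (fun ξ => (starRingEnd ℂ) (a ξ)) h) (conjTest η)
    rw [conjTest_conjTest] at h1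
    rw [← h1, toDist_fop hc hK', dmul_apply, toDist_apply_eq_inner, conjTest_tmul hc,
      conjTest_conjTest, fop_toLp ha hK]
    simp

lemma tendsto_smulLeft_toLp {b : ℕ → Plane → ℂ} (hb : ∀ n, (b n).HasTemperateGrowth)
    (hK : ∀ n ξ, ‖b n ξ‖ ≤ K)
    (h0 : ∀ᵐ x ∂(volume : Measure Plane), Tendsto (fun n => b n x) atTop (𝓝 0)) (η : Test) :
    Tendsto (fun n => (SchwartzMap.smulLeftCLM ℂ (b n) η).toLp 2 (volume : Measure Plane))
      atTop (𝓝 0) := by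
  rw [tendsto_zero_iff_norm_tendsto_zero]
  have h2 : Tendsto (fun n => ∫ x, ‖b n x * η x‖ ^ 2) atTop (𝓝 (∫ x : Plane, (0 : ℝ))) := by
    have hint : Integrable (fun x => ‖η x‖ ^ 2) (volume : Measure Plane) := by
      have := (η.memLp 2 (volume : Measure Plane)).integrable_norm_pow (by norm_num)
      simpa using this
    refine tendsto_integral_of_dominated_convergence (fun x => K ^ 2 * ‖η x‖ ^ 2)
      (fun n => ?_) (hint.const_mul _) (fun n => ae_of_all _ fun x => ?_)
      (h0.mono fun x hx => ?_)
    · exact (((hb n).1.continuous.mul η.continuous).norm.pow 2).aestronglyMeasurable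
    · rw [Real.norm_of_nonneg (by positivity), norm_mul, mul_pow]
      gcongr
      exact hK n x
    · have := (hx.mul_const (η x)).norm.pow 2
      simpa using this
  rw [integral_zero] at h2
  have h3 := h2.sqrt
  rw [Real.sqrt_zero] at h3
  refine h3.congr fun n => ?_
  rw [← Real.sqrt_sq (norm_nonneg (SchwartzMap.toLp _ _ _)), norm_toLp_two_sq]
  congr 2; ext x
  rw [smulLeft_apply (hb n)]

lemma tendsto_zero_of_test {A : ℕ → L2 →L[ℂ] L2} (hK0 : 0 ≤ K) (hK : ∀ n h, ‖A n h‖ ≤ K * ‖h‖)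
    (h1 : ∀ η : Test, Tendsto (fun n => A n (η.toLp 2 (volume : Measure Plane))) atTop (𝓝 0))
    (h : L2) : Tendsto (fun n => A n h) atTop (𝓝 0) := by
  rw [Metric.tendsto_atTop]
  intro ε hε
  obtain ⟨η, hη⟩ := denseRange_toLp.exists_dist_lt h (ε := ε / (2 * (K + 1))) (by positivity)
  obtain ⟨N, hN⟩ := Metric.tendsto_atTop.1 (h1 η) (ε / 2) (by positivity)
  refine ⟨N, fun n hn => ?_⟩
  have h4 := hN n hn
  rw [dist_zero_right] at h4 ⊢
  rw [dist_eq_norm] at hη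
  calc ‖A n h‖ = ‖A n (h - η.toLp 2 volume) + A n (η.toLp 2 volume)‖ := by
        rw [← map_add, sub_add_cancel]
    _ ≤ K * ‖h - η.toLp 2 volume‖ + ‖A n (η.toLp 2 volume)‖ :=
        (norm_add_le _ _).trans (add_le_add (hK n _) le_rfl)
    _ < ε / 2 + ε / 2 := by
        refine add_lt_add_of_le_of_lt ?_ h4
        calc K * ‖h - η.toLp 2 volume‖ ≤ (K + 1) * (ε / (2 * (K + 1))) := by
              gcongr
              linarith
          _ = ε / 2 := by field_simp
    _ = ε := by ring

/-- Multiplications by bounded functions which converge pointwise to zero. -/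
lemma tendsto_mop_zero {b : ℕ → Plane → ℂ} (hb : ∀ n, (b n).HasTemperateGrowth)
    (hK : ∀ n ξ, ‖b n ξ‖ ≤ K) (h0 : ∀ x, Tendsto (fun n => b n x) atTop (𝓝 0)) (h : L2) :
    Tendsto (fun n => mop (b n) h) atTop (𝓝 0) :=
  tendsto_zero_of_test ((norm_nonneg _).trans (hK 0 0)) (fun n => norm_mop_le (hb n) (hK n))
    (fun η => (tendsto_smulLeft_toLp hb hK (ae_of_all _ h0) η).congr fun n =>
      (mop_toLp (hb n) (hK n) η).symm) h

/-- Fourier multipliers with bounded symbols which converge almost everywhere to zero. -/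
lemma tendsto_fop_zero {a : ℕ → Plane → ℂ} (ha : ∀ n, (a n).HasTemperateGrowth)
    (hK : ∀ n ξ, ‖a n ξ‖ ≤ K)
    (h0 : ∀ᵐ x ∂(volume : Measure Plane), Tendsto (fun n => a n (-x)) atTop (𝓝 0)) (h : L2) :
    Tendsto (fun n => fop (a n) h) atTop (𝓝 0) := by
  refine tendsto_zero_of_test ((norm_nonneg _).trans (hK 0 0))
    (fun n => norm_fop_le (ha n) (hK n)) (fun η => ?_) h
  have h1 := (tendsto_smulLeft_toLp (fun n => HasTemperateGrowth.comp_neg (ha n))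
    (fun n x => hK n (-x)) h0 (𝓕⁻ η)).norm
  rw [norm_zero] at h1
  rw [tendsto_zero_iff_norm_tendsto_zero]
  refine h1.congr fun n => ?_
  rw [fop_toLp (ha n) (hK n), tmul_apply, ← norm_fourierInv_toLp (𝓕 _),
    FourierTransform.fourierInv_fourier_eq]

end FopMop

end AnisotropicStokes

namespace AnisotropicStokes

open scoped FourierTransform

/-! ### Transport by a Lipschitz divergence free field -/

/-- Real, divergence free and Lipschitz vector fields. -/
structure TransportField (B : Fin 2 → Plane → ℂ) (b L : ℝ) : Prop where
  temperate : ∀ j, (B j).HasTemperateGrowth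
  conj_eq : ∀ j x, (starRingEnd ℂ) (B j x) = B j x
  lipschitz : ∀ j x y, ‖B j x - B j y‖ ≤ L * ‖x - y‖
  norm_zero_le : ∀ j, ‖B j 0‖ ≤ b
  div_eq : ∀ x, ∑ j, fderiv ℝ (B j) x (e j) = 0

lemma dsym_neg (j : Fin 2) (ξ : Plane) : dsym j (-ξ) = -dsym j ξ := by
  simp [dsym]

lemma conj_dsym (j : Fin 2) (ξ : Plane) : (starRingEnd ℂ) (dsym j ξ) = -dsym j ξ := by
  have h2 : (starRingEnd ℂ) 2 = 2 := map_ofNat _ 2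
  simp [dsym, h2]

lemma lineDeriv_conjTest (j : Fin 2) (ζ : Test) (x : Plane) :
    (∂_{e j} (conjTest ζ) : Test) x = (starRingEnd ℂ) ((∂_{e j} ζ : Test) x) := by
  have h1 : (fun ξ => (starRingEnd ℂ) (dsym j (-ξ))) = dsym j := by
    ext ξ; rw [conj_dsym, dsym_neg, neg_neg]
  have h2 := conjTest_tmul (hasTemperateGrowth_dsym j) ζ
  rw [h1] at h2
  rw [lineDeriv_eq_tmul, lineDeriv_eq_tmul, ← h2]
  change -(conjTest (tmul (dsym j) ζ) x) = (starRingEnd ℂ) (-(tmul (dsym j) ζ x))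
  rw [conjTest_apply, map_neg]

section Transport

variable {P : DyadicPartition} {B : Fin 2 → Plane → ℂ} {b L : ℝ}

/-- The field `B` tested against the gradient of the square of a cut-off. -/
def cutGrad (θ : Test) (B : Fin 2 → Plane → ℂ) (x : Plane) : ℂ :=
  ∑ j, B j x * (2 * θ x * (∂_{e j} θ : Test) x)

lemma hasTemperateGrowth_cutGrad (hB : TransportField B b L) (θ : Test) :
    (cutGrad θ B).HasTemperateGrowth := by
  refine Function.HasTemperateGrowth.sum fun j _ => (hB.temperate j).mul ?_
  exact ((Function.HasTemperateGrowth.const 2).mul θ.hasTemperateGrowth).mul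
    (∂_{e j} θ : Test).hasTemperateGrowth

/-- The integral of the divergence of `θ² |ζ|² B` is zero. Expanding it with `θ` and `B` real and
`div B = 0` leaves twice the real part of the transport term and the gradient of the cut-off. -/
lemma transport_identity_test (hB : TransportField B b L) (θ : Test)
    (hθ : ∀ x, (starRingEnd ℂ) (θ x) = θ x) (ζ : Test) :
    2 * (∑ j, inner ℂ ((SchwartzMap.smulLeftCLM ℂ θ ζ).toLp 2 (volume : Measure Plane))
      ((SchwartzMap.smulLeftCLM ℂ (fun x => θ x * B j x) (∂_{e j} ζ : Test)).toLp 2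
        (volume : Measure Plane)) : ℂ).re =
      -(inner ℂ (ζ.toLp 2 (volume : Measure Plane))
        ((SchwartzMap.smulLeftCLM ℂ (cutGrad θ B) ζ).toLp 2 (volume : Measure Plane)) : ℂ).re := by
  have hθt := θ.hasTemperateGrowth
  have hζt := ζ.hasTemperateGrowth
  have hθB : ∀ j, Function.HasTemperateGrowth (fun x => θ x * B j x) := fun j =>
    hθt.mul (hB.temperate j)
  have hβ := hasTemperateGrowth_cutGrad hB θ
  set X : Fin 2 → Test := fun j => SchwartzMap.smulLeftCLM ℂ (B j) (SchwartzMap.smulLeftCLM ℂ θ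
    (SchwartzMap.smulLeftCLM ℂ θ (SchwartzMap.smulLeftCLM ℂ ζ (conjTest ζ)))) with hX
  set f : Fin 2 → Plane → ℂ := fun j x =>
    (starRingEnd ℂ) (SchwartzMap.smulLeftCLM ℂ θ ζ x) *
      SchwartzMap.smulLeftCLM ℂ (fun x => θ x * B j x) (∂_{e j} ζ : Test) x with hf
  set g : Plane → ℂ := fun x => (starRingEnd ℂ) (ζ x) *
    SchwartzMap.smulLeftCLM ℂ (cutGrad θ B) ζ x with hg
  have hmul : ∀ φ η : Test, Integrable (fun x => (starRingEnd ℂ) (φ x) * η x) := fun φ η => by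
    have := (SchwartzMap.smulLeftCLM ℂ (conjTest φ) η).integrable (μ := volume)
    refine this.congr (ae_of_all _ fun x => ?_)
    rw [smulLeft_apply (conjTest φ).hasTemperateGrowth, conjTest_apply]
  have hfi : ∀ j, Integrable (f j) := fun j => hmul _ _
  have hgi : Integrable g := hmul _ _
  have h1 : ∀ x, ∑ j, (∂_{e j} (X j) : Test) x =
      (∑ j, (f j x + (starRingEnd ℂ) (f j x))) + g x := fun x => by
    have h2 : ∀ j, (∂_{e j} (X j) : Test) x = (f j x + (starRingEnd ℂ) (f j x)) +
        (starRingEnd ℂ) (ζ x) * (B j x * (2 * θ x * (∂_{e j} θ : Test) x) * ζ x) +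
        (θ x * (θ x * (ζ x * (starRingEnd ℂ) (ζ x)))) * fderiv ℝ (B j) x (e j) := fun j => by
      have hct : (SchwartzMap.smulLeftCLM ℂ ζ (conjTest ζ) : Test) x =
          ζ x * (starRingEnd ℂ) (ζ x) := by
        rw [smulLeft_apply hζt, conjTest_apply]
      simp only [hX, hf]
      rw [lineDeriv_smulLeft (hB.temperate j), lineDeriv_smulLeft hθt, lineDeriv_smulLeft hθt,
        lineDeriv_smulLeft hζt, lineDeriv_conjTest]
      simp only [smulLeft_apply hθt, hct, smulLeft_apply (hθB j), map_mul, hθ, hB.conj_eq,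
        conjTest_apply, Complex.conj_conj, ← lineDeriv_apply]
      ring
    have h0 : ∑ j, (θ x * (θ x * (ζ x * (starRingEnd ℂ) (ζ x)))) *
        fderiv ℝ (B j) x (e j) = 0 := by
      rw [← Finset.mul_sum, hB.div_eq, mul_zero]
    rw [Finset.sum_congr rfl fun j _ => h2 j, Finset.sum_add_distrib, Finset.sum_add_distrib, h0,
      add_zero]
    congr 1
    simp only [hg]
    rw [smulLeft_apply hβ, cutGrad, Finset.sum_mul, Finset.mul_sum]
  have h3 : ∫ x, ∑ j, (∂_{e j} (X j) : Test) x = 0 := by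
    rw [integral_finsetSum _ fun j _ => (∂_{e j} (X j) : Test).integrable]
    exact Finset.sum_eq_zero fun j _ => integral_lineDeriv j (X j)
  have hci : ∀ j, Integrable (fun x => (starRingEnd ℂ) (f j x)) := fun j =>
    Complex.conjCLE.toContinuousLinearMap.integrable_comp (hfi j)
  have hfc : ∀ j, Integrable (fun x => f j x + (starRingEnd ℂ) (f j x)) := fun j =>
    (hfi j).add (hci j)
  simp only [h1] at h3
  rw [integral_add (integrable_finsetSum _ fun j _ => hfc j) hgi,
    integral_finsetSum _ fun j _ => hfc j] at h3
  simp only [integral_add (hfi _) (hci _), integral_conj] at h3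
  have h4 := congrArg Complex.re h3
  simp only [Complex.add_re, Complex.re_sum, Complex.conj_re, Complex.zero_re,
    Finset.sum_add_distrib] at h4
  simp only [inner_toLp, Complex.re_sum]
  change 2 * ∑ j, (∫ x, f j x).re = -(∫ x, g x).re
  linarith

lemma norm_dsym_mul_lowT_le (P : DyadicPartition) (N : ℕ) (j : Fin 2) (ξ : Plane) :
    ‖dsym j ξ * lowT P N ξ‖ ≤ 4 / 3 * 2 ^ N := by
  by_cases hξ : 4 / 3 * 2 ^ N < 2 * Real.pi * ‖ξ‖
  · rw [lowT_eq_zero P hξ, mul_zero, norm_zero]; positivity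
  · rw [norm_mul]
    calc ‖dsym j ξ‖ * ‖lowT P N ξ‖ ≤ 4 / 3 * 2 ^ N * 1 :=
          mul_le_mul ((norm_dsym_le j ξ).trans (not_lt.1 hξ)) (norm_lowT_le P N ξ)
            (norm_nonneg _) (by positivity)
      _ = _ := mul_one _

lemma hasTemperateGrowth_dsym_mul_lowT (P : DyadicPartition) (N : ℕ) (j : Fin 2) :
    Function.HasTemperateGrowth (fun ξ => dsym j ξ * lowT P N ξ) :=
  (hasTemperateGrowth_dsym j).mul (lowT P N).hasTemperateGrowth

/-- The cut-offs in space and in frequency make both sides continuous on `L²`, so the identity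
extends from test functions by density. -/
lemma transport_identity (P : DyadicPartition) (hB : TransportField B b L) (N : ℕ) (θ : Test)
    (hθ : ∀ x, (starRingEnd ℂ) (θ x) = θ x) {K₀ K₁ K₂ : ℝ} (h0 : ∀ x, ‖θ x‖ ≤ K₀)
    (h1 : ∀ j x, ‖θ x * B j x‖ ≤ K₁) (h2 : ∀ x, ‖cutGrad θ B x‖ ≤ K₂) (h : L2) :
    2 * (∑ j, inner ℂ (mop θ (fop (lowT P N) h))
      (mop (fun x => θ x * B j x) (fop (fun ξ => dsym j ξ * lowT P N ξ) h)) : ℂ).re =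
      -(inner ℂ (fop (lowT P N) h) (mop (cutGrad θ B) (fop (lowT P N) h)) : ℂ).re := by
  have hθB : ∀ j, Function.HasTemperateGrowth (fun x => θ x * B j x) := fun j =>
    θ.hasTemperateGrowth.mul (hB.temperate j)
  refine DenseRange.induction_on denseRange_toLp h ?_ fun η => ?_
  · refine isClosed_eq (continuous_const.mul (Complex.continuous_re.comp
      (continuous_finsetSum _ fun j _ => ?_))) (Complex.continuous_re.comp ?_).neg
    · exact ((mop _).continuous.comp (fop _).continuous).inner
        ((mop _).continuous.comp (fop _).continuous)
    · exact (fop _).continuous.inner ((mop _).continuous.comp (fop _).continuous)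
  · have hl := (lowT P N).hasTemperateGrowth
    set ζ := tmul (fun ξ => lowT P N (-ξ)) η with hζ
    have e1 : fop (lowT P N) (η.toLp 2 (volume : Measure Plane)) =
        ζ.toLp 2 (volume : Measure Plane) := fop_toLp hl (norm_lowT_le P N) η
    have e2 : ∀ j, fop (fun ξ => dsym j ξ * lowT P N ξ) (η.toLp 2 (volume : Measure Plane)) =
        (∂_{e j} ζ : Test).toLp 2 (volume : Measure Plane) := fun j => by
      rw [fop_toLp (hasTemperateGrowth_dsym_mul_lowT P N j) (norm_dsym_mul_lowT_le P N j),
        lineDeriv_eq_tmul, hζ, tmul_tmul (hasTemperateGrowth_dsym j)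
          (HasTemperateGrowth.comp_neg hl)]
      congr 1
      have e3 : (fun ξ => dsym j (-ξ) * lowT P N (-ξ)) =
          (-1 : ℂ) • (dsym j * fun ξ => lowT P N (-ξ)) := by
        ext ξ; rw [dsym_neg]; simp
      rw [e3, tmul_smul ((hasTemperateGrowth_dsym j).mul (HasTemperateGrowth.comp_neg hl)),
        neg_one_smul]
    rw [e1, mop_toLp θ.hasTemperateGrowth h0,
      mop_toLp (hasTemperateGrowth_cutGrad hB θ) h2]
    simp only [e2, mop_toLp (hθB _) (h1 _)]
    exact transport_identity_test hB θ hθ ζ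

lemma exists_norm_test_le (ψ : Test) : ∃ C : ℝ, 0 ≤ C ∧ ∀ x, ‖ψ x‖ ≤ C := by
  obtain ⟨C, hC⟩ := ψ.decay 0 0
  refine ⟨C, hC.1.le, fun x => ?_⟩
  simpa using hC.2 x

/-- The function `lowT P r` is reused here as a cut-off in the space variable, at scale `2^r`. -/
lemma lineDeriv_lowT (P : DyadicPartition) (r : ℕ) (j : Fin 2) (x : Plane) :
    (∂_{e j} (lowT P r) : Test) x =
      ((2 : ℝ) ^ r)⁻¹ • (∂_{e j} (chiT P) : Test) (((2 : ℝ) ^ r)⁻¹ • x) := by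
  rw [lineDeriv_apply, lineDeriv_apply]
  have h1 : (lowT P r : Plane → ℂ) = fun y => chiT P (((2 : ℝ) ^ r)⁻¹ • y) := rfl
  rw [h1, fderiv_comp_smul, _root_.smul_apply]

lemma norm_lt_of_lowT_ne_zero {r : ℕ} {x : Plane} (h : lowT P r x ≠ 0) : ‖x‖ ≤ 2 ^ r := by
  by_contra hc
  rw [not_le] at hc
  refine h (lowT_eq_zero P ?_)
  have h1 := Real.pi_gt_three
  have h2 : (0 : ℝ) < 2 ^ r := by positivity
  nlinarith

lemma TransportField.norm_le (hB : TransportField B b L) (hL : 0 ≤ L) {j : Fin 2} {x : Plane}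
    {R : ℝ} (hx : ‖x‖ ≤ R) : ‖B j x‖ ≤ b + L * R := by
  have h1 := hB.lipschitz j x 0
  rw [sub_zero] at h1
  calc ‖B j x‖ = ‖B j 0 + (B j x - B j 0)‖ := by congr 1; ring
    _ ≤ b + L * R := (norm_add_le _ _).trans (add_le_add (hB.norm_zero_le j)
        (h1.trans (mul_le_mul_of_nonneg_left hx hL)))

lemma norm_lowT_mul_field_le (hB : TransportField B b L) (hL : 0 ≤ L) (r : ℕ) (j : Fin 2)
    (x : Plane) : ‖lowT P r x * B j x‖ ≤ b + L * 2 ^ r := by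
  have hb : 0 ≤ b := (norm_nonneg _).trans (hB.norm_zero_le j)
  by_cases h : lowT P r x = 0
  · rw [h, zero_mul, norm_zero]; positivity
  · rw [norm_mul, ← one_mul (b + L * 2 ^ r)]
    exact mul_le_mul (norm_lowT_le P r x) (hB.norm_le hL (norm_lt_of_lowT_ne_zero h))
      (norm_nonneg _) zero_le_one

/-- A Lipschitz field is `O(b + L 2^r)` on the support of the cut-off, whose gradient is
`O(2^{-r})`. The product is bounded uniformly in `r`. -/
lemma exists_norm_cutGrad_le (P : DyadicPartition) : ∃ C : ℝ, 0 ≤ C ∧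
    ∀ {B : Fin 2 → Plane → ℂ} {b L : ℝ}, TransportField B b L → 0 ≤ L → ∀ r x,
      ‖cutGrad (lowT P r) B x‖ ≤ C * (b + L) := by
  obtain ⟨C₀, hC₀, h₀⟩ := exists_norm_test_le (∂_{e 0} (chiT P) : Test)
  obtain ⟨C₁, hC₁, h₁⟩ := exists_norm_test_le (∂_{e 1} (chiT P) : Test)
  have hj : ∀ j x, ‖(∂_{e j} (chiT P) : Test) x‖ ≤ C₀ + C₁ := fun j x => by
    fin_cases j
    · exact (h₀ x).trans (by linarith)
    · exact (h₁ x).trans (by linarith)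
  refine ⟨4 * (C₀ + C₁), by positivity, fun {B b L} hB hL r x => ?_⟩
  have hb : 0 ≤ b := (norm_nonneg _).trans (hB.norm_zero_le 0)
  by_cases h : lowT P r x = 0
  · simp only [cutGrad, h, mul_zero, zero_mul, Finset.sum_const_zero, norm_zero]
    positivity
  · have h2 : ∀ j, ‖B j x * (2 * lowT P r x * (∂_{e j} (lowT P r) : Test) x)‖ ≤
        2 * (C₀ + C₁) * (b + L) := fun j => by
      have hr : (1 : ℝ) ≤ 2 ^ r := one_le_pow₀ (by norm_num)
      have hr1 : ((2 : ℝ) ^ r)⁻¹ ≤ 1 := inv_le_one_of_one_le₀ hr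
      rw [lineDeriv_lowT, norm_mul, norm_mul, norm_mul, norm_smul,
        Real.norm_of_nonneg (by positivity : (0 : ℝ) ≤ ((2 : ℝ) ^ r)⁻¹), RCLike.norm_ofNat]
      calc _ ≤ (b + L * 2 ^ r) * (2 * 1 * (((2 : ℝ) ^ r)⁻¹ * (C₀ + C₁))) := by
            gcongr
            · exact hB.norm_le hL (norm_lt_of_lowT_ne_zero h)
            · exact norm_lowT_le P r x
            · exact hj j _
        _ = 2 * (C₀ + C₁) * (b * ((2 : ℝ) ^ r)⁻¹ + L * (2 ^ r * ((2 : ℝ) ^ r)⁻¹)) := by ring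
        _ ≤ _ := by
            rw [mul_inv_cancel₀ (by positivity), mul_one]
            gcongr
            exact mul_le_of_le_one_right hb hr1
    refine (norm_sum_le _ _).trans ((Finset.sum_le_sum fun j _ => h2 j).trans (le_of_eq ?_))
    simp only [Finset.sum_const, Finset.card_univ, Fintype.card_fin, nsmul_eq_mul]
    push_cast; ring

lemma eventually_lowT_eq_one (P : DyadicPartition) (x : Plane) :
    ∀ᶠ r in atTop, ∀ᶠ y in 𝓝 x, lowT P r y = 1 := by
  obtain ⟨r₀, hr₀⟩ := pow_unbounded_of_one_lt (4 / 3 * (2 * Real.pi * (‖x‖ + 1)))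
    (by norm_num : (1 : ℝ) < 2)
  filter_upwards [eventually_ge_atTop r₀] with r hr
  filter_upwards [Metric.ball_mem_nhds x zero_lt_one] with y hy
  refine lowT_eq_one P ?_
  have h1 : ‖y‖ ≤ ‖x‖ + 1 := by
    rw [mem_ball_iff_norm] at hy
    have := norm_sub_norm_le y x
    linarith
  have h2 : (2 : ℝ) ^ r₀ ≤ 2 ^ r := pow_le_pow_right₀ (by norm_num) hr
  have h3 := mul_le_mul_of_nonneg_left h1 (by positivity : 0 ≤ 2 * Real.pi)
  linarith

lemma tendsto_cutGrad (P : DyadicPartition) (B : Fin 2 → Plane → ℂ) (x : Plane) :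
    Tendsto (fun r => cutGrad (lowT P r) B x) atTop (𝓝 0) := by
  refine tendsto_const_nhds.congr' ?_
  filter_upwards [eventually_lowT_eq_one P x] with r hr
  have h1 : ∀ j, (∂_{e j} (lowT P r) : Test) x = 0 := fun j => by
    rw [lineDeriv_apply]
    have : (lowT P r : Plane → ℂ) =ᶠ[𝓝 x] fun _ => 1 := hr
    rw [this.fderiv_eq]; simp
  simp [cutGrad, h1]

end Transport

end AnisotropicStokes

/-! ### Energy identity for transport equations -/

namespace AnisotropicStokes

open scoped FourierTransform

lemma tendsto_mop_lowT (P : DyadicPartition) (h : L2) :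
    Tendsto (fun r => mop (lowT P r) h) atTop (𝓝 h) := by
  have hb : ∀ r, Function.HasTemperateGrowth (fun x => lowT P r x - 1) := fun r =>
    (lowT P r).hasTemperateGrowth.sub (Function.HasTemperateGrowth.const 1)
  have hK : ∀ r x, ‖lowT P r x - 1‖ ≤ 2 := fun r x => by
    refine (norm_sub_le _ _).trans ?_
    have := norm_lowT_le P r x
    rw [norm_one]; linarith
  have h0 : ∀ x, Tendsto (fun r => lowT P r x - 1) atTop (𝓝 0) := fun x => by
    refine tendsto_const_nhds.congr' ?_
    filter_upwards [eventually_lowT_eq_one P x] with r hr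
    rw [hr.self_of_nhds, sub_self]
  have h1 := (tendsto_mop_zero hb hK h0 h).add_const h
  rw [zero_add] at h1
  refine h1.congr fun r => l2_eq_of_forall_apply fun ψ => ?_
  rw [toDist_add]
  change (Lp.toTemperedDistribution (mop (fun x => lowT P r x - 1) h) : Dist) ψ +
    (Lp.toTemperedDistribution h : Dist) ψ = _
  rw [toDist_mop (hb r) (hK r), toDist_mop (lowT P r).hasTemperateGrowth (norm_lowT_le P r),
    ← map_add]
  congr 1
  refine SchwartzMap.ext fun x => ?_
  change SchwartzMap.smulLeftCLM ℂ (fun x => lowT P r x - 1) ψ x + ψ x = _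
  rw [smulLeft_apply (hb r), smulLeft_apply (lowT P r).hasTemperateGrowth]
  ring

lemma inner_toLp_eq (ψ : Test) (h : L2) : inner ℂ (ψ.toLp 2 (volume : Measure Plane)) h =
    (Lp.toTemperedDistribution h : Dist) (conjTest ψ) := by
  rw [toDist_apply_eq_inner, conjTest_conjTest]

section TransportEnergy

variable {P : DyadicPartition} {N : ℕ}

/-- The localized right-hand side of a transport equation. -/
def cutRhs (P : DyadicPartition) (N r : ℕ) (B : Fin 2 → Plane → ℂ) (u H : L2) : L2 :=
  mop (lowT P r) H - ∑ j, mop (fun x => lowT P r x * B j x)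
    (fop (fun ξ => dsym j ξ * lowT P N ξ) u)

variable {B : Fin 2 → Plane → ℂ} {b L : ℝ} {u H : L2}

lemma toDist_cutRhs (hB : TransportField B b L) (hL : 0 ≤ L) (hu : fop (lowT P N) u = u) (r : ℕ)
    (φ : Test) : (Lp.toTemperedDistribution (cutRhs P N r B u H) : Dist) φ =
      (Lp.toTemperedDistribution H : Dist) (SchwartzMap.smulLeftCLM ℂ (lowT P r) φ) -
      ∑ j, (Lp.toTemperedDistribution u : Dist) (tmul (dsym j)
        (SchwartzMap.smulLeftCLM ℂ (B j) (SchwartzMap.smulLeftCLM ℂ (lowT P r) φ))) := by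
  have hl := (lowT P N).hasTemperateGrowth
  have hθ := (lowT P r).hasTemperateGrowth
  rw [cutRhs, toDist_sub, toDist_sum]
  change (Lp.toTemperedDistribution (mop (lowT P r) H) : Dist) φ -
    (∑ j, (Lp.toTemperedDistribution (mop (fun x => lowT P r x * B j x)
      (fop (fun ξ => dsym j ξ * lowT P N ξ) u)) : Dist)) φ = _
  rw [_root_.sum_apply, toDist_mop hθ (norm_lowT_le P r)]
  congr 1
  refine Finset.sum_congr rfl fun j _ => ?_
  have hθB : Function.HasTemperateGrowth (fun x => lowT P r x * B j x) := hθ.mul (hB.temperate j)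
  rw [toDist_mop hθB (norm_lowT_mul_field_le hB hL r j),
    toDist_fop (hasTemperateGrowth_dsym_mul_lowT P N j) (norm_dsym_mul_lowT_le P N j), dmul_apply]
  have h1 : SchwartzMap.smulLeftCLM ℂ (fun x => lowT P r x * B j x) φ =
      SchwartzMap.smulLeftCLM ℂ (B j) (SchwartzMap.smulLeftCLM ℂ (lowT P r) φ) :=
    SchwartzMap.ext fun x => by
      rw [smulLeft_apply hθB, smulLeft_apply (hB.temperate j),
        smulLeft_apply hθ]
      ring
  rw [h1]
  have h2 : ∀ X, (Lp.toTemperedDistribution u : Dist) X =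
      (Lp.toTemperedDistribution u : Dist) (tmul (lowT P N) X) := fun X => by
    have := congrArg (fun z : L2 => (Lp.toTemperedDistribution z : Dist) X) hu
    rw [toDist_fop hl (norm_lowT_le P N), dmul_apply] at this
    exact this.symm
  rw [h2 (tmul (dsym j) _), tmul_comm hl (hasTemperateGrowth_dsym j),
    tmul_tmul (hasTemperateGrowth_dsym j) hl]
  rfl

lemma norm_cutRhs_le (hB : TransportField B b L) (hL : 0 ≤ L) (r : ℕ) :
    ‖cutRhs P N r B u H‖ ≤ ‖H‖ + 2 * ((b + L * 2 ^ r) * (4 / 3 * 2 ^ N * ‖u‖)) := by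
  have hb : 0 ≤ b := (norm_nonneg _).trans (hB.norm_zero_le 0)
  have hθ := (lowT P r).hasTemperateGrowth
  refine (norm_sub_le _ _).trans (add_le_add ?_ ?_)
  · simpa using norm_mop_le hθ (norm_lowT_le P r) H
  · refine (norm_sum_le _ _).trans ?_
    refine (Finset.sum_le_sum fun j _ => (norm_mop_le (hθ.mul (hB.temperate j))
      (norm_lowT_mul_field_le hB hL r j) _).trans (mul_le_mul_of_nonneg_left
        (norm_fop_le (hasTemperateGrowth_dsym_mul_lowT P N j)
          (norm_dsym_mul_lowT_le P N j) u) (by positivity))).trans (le_of_eq ?_)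
    simp

/-- The only trace of the transport term in the energy is the gradient of the cut-off, so the
identity loses nothing when `r → ∞`. -/
lemma inner_cutRhs (hB : TransportField B b L) (hL : 0 ≤ L) {C : ℝ}
    (hC : ∀ r x, ‖cutGrad (lowT P r) B x‖ ≤ C * (b + L)) (hu : fop (lowT P N) u = u) (r : ℕ) :
    (inner ℂ (mop (lowT P r) u) (cutRhs P N r B u H)).re =
      (inner ℂ (mop (lowT P r) u) (mop (lowT P r) H)).re +
        1 / 2 * (inner ℂ u (mop (cutGrad (lowT P r) B) u)).re := by
  have h := transport_identity P hB N (lowT P r) (conj_lowT P r) (norm_lowT_le P r)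
    (norm_lowT_mul_field_le hB hL r) (hC r) u
  rw [hu] at h
  rw [cutRhs, inner_sub_right, inner_sum, Complex.sub_re]
  linarith

end TransportEnergy

/-- The energy identity for the transport equation `∂_t u + B · ∇ u = H`. -/
theorem transport_energy (P : DyadicPartition) {u H : ℝ → L2} {B : ℝ → Fin 2 → Plane → ℂ}
    {ρ b L : ℝ → ℝ} {T M : ℝ} {N : ℕ} (hT : 0 ≤ T) (hρ : IntervalIntegrable ρ volume 0 T)
    (hb : IntervalIntegrable b volume 0 T) (hL : IntervalIntegrable L volume 0 T)
    (hu : ∀ t ∈ Icc 0 T, fop (lowT P N) (u t) = u t) (hM : ∀ t ∈ Icc 0 T, ‖u t‖ ≤ M)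
    (hH : ∀ᵐ τ ∂volume.restrict (Ioc 0 T), ‖H τ‖ ≤ ρ τ)
    (hB : ∀ᵐ τ ∂volume.restrict (Ioc 0 T), TransportField (B τ) (b τ) (L τ) ∧ 0 ≤ L τ)
    (hint : ∀ ψ, IntervalIntegrable (fun τ => (Lp.toTemperedDistribution (H τ) : Dist) ψ -
      ∑ j, (Lp.toTemperedDistribution (u τ) : Dist)
        (tmul (dsym j) (SchwartzMap.smulLeftCLM ℂ (B τ j) ψ))) volume 0 T)
    (heq : ∀ t ∈ Icc 0 T, ∀ ψ, (Lp.toTemperedDistribution (u t) : Dist) ψ =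
      (Lp.toTemperedDistribution (u 0) : Dist) ψ +
      ∫ τ in (0 : ℝ)..t, ((Lp.toTemperedDistribution (H τ) : Dist) ψ -
        ∑ j, (Lp.toTemperedDistribution (u τ) : Dist)
          (tmul (dsym j) (SchwartzMap.smulLeftCLM ℂ (B τ j) ψ)))) :
    IntervalIntegrable (fun τ => (inner ℂ (u τ) (H τ)).re) volume 0 T ∧
      ∀ t ∈ Icc 0 T, ‖u t‖ ^ 2 =
        ‖u 0‖ ^ 2 + 2 * ∫ τ in (0 : ℝ)..t, (inner ℂ (u τ) (H τ)).re := by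
  obtain ⟨C, hC0, hC⟩ := exists_norm_cutGrad_le P
  have hM0 : 0 ≤ M := (norm_nonneg _).trans (hM 0 ⟨le_rfl, hT⟩)
  set F : ℕ → ℝ → L2 := fun r τ => cutRhs P N r (B τ) (u τ) (H τ) with hF
  have hFd : ∀ r φ, ∀ᵐ τ ∂volume.restrict (Ioc 0 T),
      (Lp.toTemperedDistribution (H τ) : Dist) (SchwartzMap.smulLeftCLM ℂ (lowT P r) φ) -
        ∑ j, (Lp.toTemperedDistribution (u τ) : Dist) (tmul (dsym j)
          (SchwartzMap.smulLeftCLM ℂ (B τ j) (SchwartzMap.smulLeftCLM ℂ (lowT P r) φ))) =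
      (Lp.toTemperedDistribution (F r τ) : Dist) φ := fun r φ => by
    filter_upwards [hB, self_mem_ae_restrict measurableSet_Ioc] with τ hτ hτT
    exact (toDist_cutRhs hτ.1 hτ.2 (hu τ (Ioc_subset_Icc_self hτT)) r φ).symm
  -- For fixed `r`, the function `θ_r u` solves an ordinary differential equation in `L²` with
  -- integrable right-hand side: `θ_r B` is bounded and `u` has bounded frequencies. These bounds
  -- blow up with `r`, but by `inner_cutRhs` those of the energy production do not, which allows
  -- dominated convergence.
  have henergy : ∀ r, IntervalIntegrable
        (fun τ => (inner ℂ (mop (lowT P r) (u τ)) (F r τ)).re) volume 0 T ∧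
      ∀ t ∈ Icc 0 T, ‖mop (lowT P r) (u t)‖ ^ 2 = ‖mop (lowT P r) (u 0)‖ ^ 2 +
        2 * ∫ τ in (0 : ℝ)..t, (inner ℂ (mop (lowT P r) (u τ)) (F r τ)).re := fun r => by
    have : Fact ((2 : ℝ≥0∞) ≠ ∞) := ⟨by simp⟩
    refine hilbert_energy denseRange_toLp (y := fun t => mop (lowT P r) (u t)) (F := F r)
      (ρ := fun τ => ρ τ + 2 * ((b τ + L τ * 2 ^ r) * (4 / 3 * 2 ^ N * M))) (M := M) hT ?_ ?_ ?_
      (fun ψ => ?_) (fun t ht ψ => ?_)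
    · exact hρ.add (((hb.add (hL.mul_const _)).mul_const _).const_mul 2)
    · filter_upwards [hB, hH, self_mem_ae_restrict measurableSet_Ioc] with τ hτ hτH hτT
      refine (norm_cutRhs_le hτ.1 hτ.2 r).trans ?_
      have hbτ : 0 ≤ b τ := (norm_nonneg _).trans (hτ.1.norm_zero_le 0)
      have hLτ := hτ.2
      have hMτ := hM τ (Ioc_subset_Icc_self hτT)
      gcongr
    · intro t ht
      refine (norm_mop_le (lowT P r).hasTemperateGrowth (norm_lowT_le P r) _).trans ?_
      rw [one_mul]; exact hM t ht
    · refine (hint (SchwartzMap.smulLeftCLM ℂ (lowT P r) (conjTest ψ))).congr_ae ?_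
      rw [uIoc_of_le hT]
      filter_upwards [hFd r (conjTest ψ)] with τ hτ
      rw [inner_toLp_eq, hτ]
    · have hθ := (lowT P r).hasTemperateGrowth
      rw [inner_toLp_eq, inner_toLp_eq, toDist_mop hθ (norm_lowT_le P r),
        toDist_mop hθ (norm_lowT_le P r), heq t ht]
      congr 1
      refine intervalIntegral.integral_congr_ae ?_
      rw [uIoc_of_le ht.1, ← ae_restrict_iff' measurableSet_Ioc]
      filter_upwards [ae_restrict_of_ae_restrict_of_subset (Ioc_subset_Ioc_right ht.2)
        (hFd r (conjTest ψ))] with τ hτ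
      rw [inner_toLp_eq, hτ]
  have hlim : ∀ᵐ τ ∂volume.restrict (Ioc 0 T), Tendsto
      (fun r => (inner ℂ (mop (lowT P r) (u τ)) (F r τ)).re) atTop
        (𝓝 (inner ℂ (u τ) (H τ)).re) := by
    filter_upwards [hB, self_mem_ae_restrict measurableSet_Ioc] with τ hτ hτT
    simp only [hF, inner_cutRhs hτ.1 hτ.2 (hC hτ.1 hτ.2) (hu τ (Ioc_subset_Icc_self hτT))]
    have h1 := (Complex.continuous_re.tendsto _).comp
      ((tendsto_mop_lowT P (u τ)).inner (𝕜 := ℂ) (tendsto_mop_lowT P (H τ)))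
    have h2 := (Complex.continuous_re.tendsto _).comp ((tendsto_const_nhds (x := u τ)).inner (𝕜 := ℂ)
      (tendsto_mop_zero (fun r => hasTemperateGrowth_cutGrad hτ.1 (lowT P r))
        (hC hτ.1 hτ.2) (tendsto_cutGrad P (B τ)) (u τ)))
    have h3 := h1.add (h2.const_mul (1 / 2))
    rw [inner_zero_right, Complex.zero_re, mul_zero, add_zero] at h3
    exact h3
  have hbound : ∀ r, ∀ᵐ τ ∂volume.restrict (Ioc 0 T),
      ‖(inner ℂ (mop (lowT P r) (u τ)) (F r τ)).re‖ ≤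
        M * ρ τ + 1 / 2 * (M * (C * (b τ + L τ) * M)) := fun r => by
    filter_upwards [hB, hH, self_mem_ae_restrict measurableSet_Ioc] with τ hτ hτH hτT
    have hbτ : 0 ≤ b τ := (norm_nonneg _).trans (hτ.1.norm_zero_le 0)
    have hLτ := hτ.2
    have hMτ := hM τ (Ioc_subset_Icc_self hτT)
    have hθ := (lowT P r).hasTemperateGrowth
    have h1 : ∀ z, ‖mop (lowT P r) z‖ ≤ ‖z‖ := fun z => by
      simpa using norm_mop_le hθ (norm_lowT_le P r) z
    simp only [hF, inner_cutRhs hτ.1 hτ.2 (hC hτ.1 hτ.2) (hu τ (Ioc_subset_Icc_self hτT))]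
    refine (norm_add_le _ _).trans (add_le_add ?_ ?_)
    · refine (Complex.abs_re_le_norm _).trans ((norm_inner_le_norm _ _).trans ?_)
      exact mul_le_mul ((h1 _).trans hMτ) ((h1 _).trans hτH) (norm_nonneg _) hM0
    · rw [norm_mul, Real.norm_of_nonneg (by norm_num : (0 : ℝ) ≤ 1 / 2)]
      refine mul_le_mul_of_nonneg_left ?_ (by norm_num)
      refine (Complex.abs_re_le_norm _).trans ((norm_inner_le_norm _ _).trans ?_)
      refine mul_le_mul hMτ ?_ (norm_nonneg _) hM0
      refine (norm_mop_le (hasTemperateGrowth_cutGrad hτ.1 (lowT P r))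
        (hC hτ.1 hτ.2 r) _).trans ?_
      exact mul_le_mul_of_nonneg_left hMτ (by positivity)
  have hbi : IntervalIntegrable (fun τ => M * ρ τ + 1 / 2 * (M * (C * (b τ + L τ) * M)))
      volume 0 T :=
    (hρ.const_mul M).add (((((hb.add hL).const_mul C).mul_const M).const_mul M).const_mul (1 / 2))
  have hIoc : ∀ {f : ℝ → ℝ}, IntervalIntegrable f volume 0 T → IntegrableOn f (Ioc 0 T) :=
    fun hf => (intervalIntegrable_iff_integrableOn_Ioc_of_le hT).1 hf
  refine ⟨(intervalIntegrable_iff_integrableOn_Ioc_of_le hT).2 ((hIoc hbi).mono'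
    (aestronglyMeasurable_of_tendsto_ae atTop
      (fun r => (hIoc (henergy r).1).aestronglyMeasurable) hlim) ?_), fun t ht => ?_⟩
  · filter_upwards [hlim, ae_all_iff.2 hbound] with τ hτ hτb
    exact le_of_tendsto hτ.norm (Eventually.of_forall hτb)
  · have hsub : Ioc 0 t ⊆ Ioc 0 T := Ioc_subset_Ioc_right ht.2
    have h1 : Tendsto (fun r => ∫ τ in (0 : ℝ)..t,
        (inner ℂ (mop (lowT P r) (u τ)) (F r τ)).re) atTop
        (𝓝 (∫ τ in (0 : ℝ)..t, (inner ℂ (u τ) (H τ)).re)) := by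
      refine intervalIntegral.tendsto_integral_filter_of_dominated_convergence
        (fun τ => M * ρ τ + 1 / 2 * (M * (C * (b τ + L τ) * M)))
        (Eventually.of_forall fun r => ?_) (Eventually.of_forall fun r => ?_) ?_ ?_
      · rw [uIoc_of_le ht.1]
        exact (hIoc (henergy r).1).aestronglyMeasurable.mono_set hsub
      · rw [uIoc_of_le ht.1, ← ae_restrict_iff' measurableSet_Ioc]
        exact ae_restrict_of_ae_restrict_of_subset hsub (hbound r)
      · exact (intervalIntegrable_iff_integrableOn_Ioc_of_le ht.1).2 ((hIoc hbi).mono_set hsub)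
      · rw [uIoc_of_le ht.1, ← ae_restrict_iff' measurableSet_Ioc]
        exact ae_restrict_of_ae_restrict_of_subset hsub hlim
    have h2 : ∀ z, Tendsto (fun r => ‖mop (lowT P r) z‖ ^ 2) atTop (𝓝 (‖z‖ ^ 2)) := fun z =>
      (tendsto_mop_lowT P z).norm.pow 2
    exact tendsto_nhds_unique (h2 (u t)) (((h2 (u 0)).add (h1.const_mul 2)).congr fun r =>
      ((henergy r).2 t ht).symm)

end AnisotropicStokes

namespace AnisotropicStokes

open scoped FourierTransform

/-! ### Leray projections of the blocks -/

/-- A symbol which is equal to `1` on the support of `symb P k n`. -/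
def fat (P : DyadicPartition) (k : ℕ) : ℕ → Test
  | 0 => lowT P 1 - contr (k + 1) (chiT P)
  | n + 1 => lowT P (n + 2) - dil n (contr 1 (chiT P))

section Fat

variable (P : DyadicPartition) (k n : ℕ)

lemma fat_zero_apply (ξ : Plane) :
    fat P k 0 ξ = lowT P 1 ξ - contr (k + 1) (chiT P) ξ := rfl

lemma fat_succ_apply (ξ : Plane) :
    fat P k (n + 1) ξ = lowT P (n + 2) ξ - contr 1 (chiT P) (((2 : ℝ) ^ n)⁻¹ • ξ) := rfl

lemma exists_ofReal_sub_eq_fat (ξ : Plane) : ∃ a b : ℝ, 0 ≤ a ∧ a ≤ 1 ∧ 0 ≤ b ∧ b ≤ 1 ∧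
    fat P k n ξ = ((a - b : ℝ) : ℂ) := by
  cases n with
  | zero =>
    refine ⟨P.chi (((2 : ℝ) ^ 1)⁻¹ • (2 * Real.pi) • ξ), P.chi ((2 : ℝ) ^ (k + 1) • (2 * Real.pi) • ξ),
      P.chi_nonneg _, P.chi_le_one _, P.chi_nonneg _, P.chi_le_one _, ?_⟩
    rw [fat_zero_apply, lowT_apply, contr_chiT_apply, Complex.ofReal_sub]
  | succ n =>
    refine ⟨P.chi (((2 : ℝ) ^ (n + 2))⁻¹ • (2 * Real.pi) • ξ),
      P.chi ((2 : ℝ) ^ 1 • (2 * Real.pi) • ((2 : ℝ) ^ n)⁻¹ • ξ),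
      P.chi_nonneg _, P.chi_le_one _, P.chi_nonneg _, P.chi_le_one _, ?_⟩
    rw [fat_succ_apply, lowT_apply, contr_chiT_apply, Complex.ofReal_sub]

lemma norm_fat_le (ξ : Plane) : ‖fat P k n ξ‖ ≤ 1 := by
  obtain ⟨a, b, h1, h2, h3, h4, h⟩ := exists_ofReal_sub_eq_fat P k n ξ
  rw [h, Complex.norm_real, Real.norm_eq_abs, abs_le]
  constructor <;> linarith

lemma conj_fat (ξ : Plane) : (starRingEnd ℂ) (fat P k n ξ) = fat P k n ξ := by
  obtain ⟨a, b, -, -, -, -, h⟩ := exists_ofReal_sub_eq_fat P k n ξ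
  rw [h, Complex.conj_ofReal]

lemma norm_inv_two_pow_smul (ξ : Plane) : ‖((2 : ℝ) ^ n)⁻¹ • ξ‖ = ((2 : ℝ) ^ n)⁻¹ * ‖ξ‖ := by
  rw [norm_smul, Real.norm_of_nonneg (by positivity)]

lemma symb_mul_fat (ξ : Plane) : symb P k n ξ * fat P k n ξ = symb P k n ξ := by
  by_cases h : 4 / 3 * 2 ^ n < 2 * Real.pi * ‖ξ‖
  · rw [symb_eq_zero_of_gt P k h, zero_mul]
  rw [not_lt] at h
  have hp : (0 : ℝ) < 2 ^ n := by positivity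
  cases n with
  | zero =>
    by_cases h' : 2 ^ k * (2 * Real.pi * ‖ξ‖) < 3 / 4
    · rw [symb_eq_zero_of_lt P k h', zero_mul]
    · rw [not_lt] at h'
      rw [fat_zero_apply, lowT_eq_one P (by norm_num at h ⊢; linarith),
        contr_chiT_eq_zero, sub_zero, mul_one]
      rw [pow_succ]; linarith
  | succ n =>
    by_cases h' : 2 * Real.pi * ‖ξ‖ < 3 / 4 * 2 ^ n
    · rw [symb, blockT_succ_eq_zero_of_lt P h', zero_mul]
    · rw [not_lt] at h'
      have hp' : (0 : ℝ) < 2 ^ n := by positivity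
      rw [fat_succ_apply, lowT_eq_one P (by rw [pow_succ] at h ⊢; rw [pow_succ]; linarith),
        contr_chiT_eq_zero, sub_zero, mul_one]
      rw [norm_inv_two_pow_smul, pow_one]
      have h2 : 3 / 4 ≤ ((2 : ℝ) ^ n)⁻¹ * (2 * Real.pi * ‖ξ‖) := by
        rw [inv_mul_eq_div, le_div_iff₀ hp']; exact h'
      calc (4 : ℝ) / 3 < 2 * (3 / 4) := by norm_num
        _ ≤ 2 * (((2 : ℝ) ^ n)⁻¹ * (2 * Real.pi * ‖ξ‖)) := by linarith
        _ = _ := by ring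

lemma fat_zero_eq_zero_of_lt {ξ : Plane} (h : 2 ^ (k + 1) * (2 * Real.pi * ‖ξ‖) < 3 / 4) :
    fat P k 0 ξ = 0 := by
  have h1 : (1 : ℝ) ≤ 2 ^ (k + 1) := one_le_pow₀ (by norm_num)
  have h0 : 0 ≤ 2 * Real.pi * ‖ξ‖ := by positivity
  rw [fat_zero_apply, lowT_eq_one P (by nlinarith), contr_chiT_apply, P.chi_eq_one,
    Complex.ofReal_one, sub_self]
  rwa [norm_smul, norm_two_pi_smul, Real.norm_of_nonneg (by positivity)]

lemma fat_succ_eq_zero_of_lt {ξ : Plane} (h : 2 * Real.pi * ‖ξ‖ < 3 / 8 * 2 ^ n) :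
    fat P k (n + 1) ξ = 0 := by
  have hp : (0 : ℝ) < 2 ^ n := by positivity
  rw [fat_succ_apply, lowT_eq_one P (by rw [pow_add]; linarith), contr_chiT_apply, P.chi_eq_one,
    Complex.ofReal_one, sub_self]
  rw [norm_smul, norm_two_pi_smul, Real.norm_of_nonneg (by positivity), norm_inv_two_pow_smul]
  have h2 : ((2 : ℝ) ^ n)⁻¹ * (2 * Real.pi * ‖ξ‖) < 3 / 8 := by
    rw [inv_mul_eq_div, div_lt_iff₀ hp]; exact h
  calc 2 ^ 1 * (2 * Real.pi * (((2 : ℝ) ^ n)⁻¹ * ‖ξ‖)) =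
      2 * (((2 : ℝ) ^ n)⁻¹ * (2 * Real.pi * ‖ξ‖)) := by ring
    _ < 3 / 4 := by linarith

lemma exists_fat_eq_zero_near : ∃ r : ℝ, 0 < r ∧ ∀ ξ : Plane, ‖ξ‖ < r → fat P k n ξ = 0 := by
  have hpi := Real.pi_pos
  cases n with
  | zero =>
    refine ⟨3 / 4 / (2 ^ (k + 1) * (2 * Real.pi)), by positivity, fun ξ h => ?_⟩
    rw [lt_div_iff₀' (by positivity)] at h
    exact fat_zero_eq_zero_of_lt P k (by linarith)
  | succ n =>
    refine ⟨3 / 8 * 2 ^ n / (2 * Real.pi), by positivity, fun ξ h => ?_⟩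
    rw [lt_div_iff₀' (by positivity)] at h
    exact fat_succ_eq_zero_of_lt P k n h

lemma hasCompactSupport_fat : HasCompactSupport (fat P k n) := by
  have hpi := Real.pi_pos
  refine hasCompactSupport_of_norm (R := 4 / 3 * 2 ^ (n + 1) / (2 * Real.pi)) fun ξ h => ?_
  rw [div_lt_iff₀' (by positivity)] at h
  have hp : (0 : ℝ) < 2 ^ n := by positivity
  cases n with
  | zero =>
    rw [fat_zero_apply, lowT_eq_zero P (by simpa using h), contr_chiT_eq_zero, sub_zero]
    have h1 : (1 : ℝ) ≤ 2 ^ (k + 1) := one_le_pow₀ (by norm_num)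
    have h0 : 0 ≤ 2 * Real.pi * ‖ξ‖ := by positivity
    norm_num at h
    nlinarith
  | succ n =>
    have hp' : (0 : ℝ) < 2 ^ n := by positivity
    rw [fat_succ_apply, lowT_eq_zero P h, contr_chiT_eq_zero, sub_zero]
    rw [norm_inv_two_pow_smul]
    have h2 : 4 / 3 * 4 < ((2 : ℝ) ^ n)⁻¹ * (2 * Real.pi * ‖ξ‖) := by
      rw [inv_mul_eq_div, lt_div_iff₀ hp']
      rw [pow_succ, pow_succ] at h
      linarith
    calc (4 : ℝ) / 3 < 2 * (((2 : ℝ) ^ n)⁻¹ * (2 * Real.pi * ‖ξ‖)) := by linarith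
      _ = _ := by ring

/-- The symbol `fat P k n ξ / |ξ|²`. -/
def fatDiv : Test :=
  (exists_test_div (hasCompactSupport_fat P k n) (exists_fat_eq_zero_near P k n).choose_spec.1
    (exists_fat_eq_zero_near P k n).choose_spec.2).choose

lemma fatDiv_apply (ξ : Plane) :
    fatDiv P k n ξ = fat P k n ξ * (((‖ξ‖ ^ 2)⁻¹ : ℝ) : ℂ) :=
  (exists_test_div (hasCompactSupport_fat P k n) (exists_fat_eq_zero_near P k n).choose_spec.1
    (exists_fat_eq_zero_near P k n).choose_spec.2).choose_spec ξ

lemma fat_zero_vec : fat P k n 0 = 0 := by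
  obtain ⟨r, hr, h⟩ := exists_fat_eq_zero_near P k n
  exact h 0 (by simpa using hr)

lemma fatDiv_mul_norm_sq (ξ : Plane) :
    fatDiv P k n ξ * ((‖ξ‖ ^ 2 : ℝ) : ℂ) = fat P k n ξ := by
  by_cases h : ξ = 0
  · rw [h, fatDiv_apply, fat_zero_vec, zero_mul, zero_mul]
  · rw [fatDiv_apply, mul_assoc, ← Complex.ofReal_mul, inv_mul_cancel₀ (by positivity),
      Complex.ofReal_one, mul_one]

/-- The entries of the symbol of the Leray projection, cut off by `fat P k n`. -/
def leray (i l : Fin 2) : Test :=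
  (if i = l then fat P k n else 0) - SchwartzMap.smulLeftCLM ℂ (fun ξ : Plane => (ξ i : ℂ))
    (SchwartzMap.smulLeftCLM ℂ (fun ξ : Plane => (ξ l : ℂ)) (fatDiv P k n))

lemma leray_apply (i l : Fin 2) (ξ : Plane) : leray P k n i l ξ =
    (if i = l then fat P k n ξ else 0) - (ξ i : ℂ) * ((ξ l : ℂ) * fatDiv P k n ξ) := by
  have h1 : leray P k n i l ξ = (if i = l then fat P k n else 0 : Test) ξ -
      SchwartzMap.smulLeftCLM ℂ (fun ξ : Plane => (ξ i : ℂ))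
        (SchwartzMap.smulLeftCLM ℂ (fun ξ : Plane => (ξ l : ℂ)) (fatDiv P k n)) ξ := rfl
  rw [h1, smulLeft_apply (hasTemperateGrowth_coord i), smulLeft_apply (hasTemperateGrowth_coord l)]
  split_ifs <;> rfl

lemma norm_sq_plane (ξ : Plane) : ‖ξ‖ ^ 2 = ξ 0 ^ 2 + ξ 1 ^ 2 := by
  rw [EuclideanSpace.norm_sq_eq, Fin.sum_univ_two, Real.norm_eq_abs, Real.norm_eq_abs, sq_abs,
    sq_abs]

lemma leray_eq_fat_mul (i l : Fin 2) (ξ : Plane) : leray P k n i l ξ =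
    fat P k n ξ * (((if i = l then 1 else 0) - ξ i * ξ l * (‖ξ‖ ^ 2)⁻¹ : ℝ) : ℂ) := by
  rw [leray_apply, fatDiv_apply]
  split_ifs <;> (push_cast; ring)

lemma norm_leray_le (i l : Fin 2) (ξ : Plane) : ‖leray P k n i l ξ‖ ≤ 1 := by
  by_cases h : ξ = 0
  · rw [leray_eq_fat_mul, h, fat_zero_vec, zero_mul, norm_zero]; exact zero_le_one
  have hn : 0 < ‖ξ‖ ^ 2 := by positivity
  have h1 := norm_sq_plane ξ
  have key : ‖(((if i = l then 1 else 0) - ξ i * ξ l * (‖ξ‖ ^ 2)⁻¹ : ℝ) : ℂ)‖ ≤ 1 := by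
    rw [Complex.norm_real, Real.norm_eq_abs,
      show (if i = l then (1 : ℝ) else 0) - ξ i * ξ l * (‖ξ‖ ^ 2)⁻¹ =
        ((if i = l then (1 : ℝ) else 0) * ‖ξ‖ ^ 2 - ξ i * ξ l) / ‖ξ‖ ^ 2 by field_simp,
      abs_div, abs_of_pos hn, div_le_one hn, abs_le, h1]
    fin_cases i <;> fin_cases l <;>
      simp only [Fin.zero_eta, Fin.mk_one, Fin.isValue, if_true, zero_ne_one, one_ne_zero,
        if_false] <;> constructor <;>
      nlinarith [sq_nonneg (ξ 0 - ξ 1), sq_nonneg (ξ 0 + ξ 1), sq_nonneg (ξ 0), sq_nonneg (ξ 1)]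
  rw [leray_eq_fat_mul, norm_mul]
  exact (mul_le_mul (norm_fat_le P k n ξ) key (norm_nonneg _) zero_le_one).trans_eq (one_mul 1)

lemma conj_leray (i l : Fin 2) (ξ : Plane) :
    (starRingEnd ℂ) (leray P k n i l ξ) = leray P k n i l ξ := by
  rw [leray_eq_fat_mul, map_mul, conj_fat, Complex.conj_ofReal]

lemma leray_symm (i l : Fin 2) : leray P k n i l = leray P k n l i :=
  SchwartzMap.ext fun ξ => by
    rw [leray_apply, leray_apply]
    simp only [eq_comm (a := i)]
    ring

lemma sum_leray_dsym (i : Fin 2) (ξ : Plane) : ∑ l, leray P k n i l ξ * dsym l ξ = 0 := by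
  have h1 := fatDiv_mul_norm_sq P k n ξ
  rw [norm_sq_plane] at h1
  simp only [Fin.sum_univ_two, leray_apply, dsym]
  push_cast at h1
  fin_cases i <;>
    simp only [Fin.zero_eta, Fin.mk_one, Fin.isValue, if_true, zero_ne_one, one_ne_zero, if_false,
      ← h1] <;> ring

lemma conj_symb (ξ : Plane) : (starRingEnd ℂ) (symb P k n ξ) = symb P k n ξ := by
  cases n with
  | zero => rw [symb_zero_apply, map_sub, contr_chiT_apply, chiT_apply, Complex.conj_ofReal,
      Complex.conj_ofReal]
  | succ n => rw [symb, blockT_succ_apply, Complex.conj_ofReal]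

/-- The second column of the Leray projection is a derivative in the first variable. -/
def lerayAnti (i : Fin 2) : Test :=
  (2 * Real.pi * Complex.I)⁻¹ • (if i = 0 then
    -SchwartzMap.smulLeftCLM ℂ (fun ξ : Plane => (ξ 1 : ℂ)) (fatDiv P k n)
    else SchwartzMap.smulLeftCLM ℂ (fun ξ : Plane => (ξ 0 : ℂ)) (fatDiv P k n))

lemma lerayAnti_zero_apply (ξ : Plane) : lerayAnti P k n 0 ξ =
    (2 * Real.pi * Complex.I)⁻¹ * -((ξ 1 : ℂ) * fatDiv P k n ξ) := by
  rw [← smulLeft_apply (hasTemperateGrowth_coord 1)]; rfl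

lemma lerayAnti_one_apply (ξ : Plane) : lerayAnti P k n 1 ξ =
    (2 * Real.pi * Complex.I)⁻¹ * ((ξ 0 : ℂ) * fatDiv P k n ξ) := by
  rw [← smulLeft_apply (hasTemperateGrowth_coord 0)]; rfl

/-- The entries of the second column are `-ξ₁ ξ₂ / |ξ|²` and `1 - ξ₂² / |ξ|² = ξ₁² / |ξ|²`, both
divisible by `ξ₁`. This is where the direction `e₂` of the force matters: the dissipation of `∂₁ w`
can absorb it. -/
lemma leray_one_eq (i : Fin 2) (ξ : Plane) :
    leray P k n i 1 ξ = dsym 0 ξ * lerayAnti P k n i ξ := by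
  have h1 := fatDiv_mul_norm_sq P k n ξ
  rw [norm_sq_plane] at h1
  push_cast at h1
  have hpi : (2 * Real.pi * Complex.I : ℂ) ≠ 0 := Complex.two_pi_I_ne_zero
  rw [leray_apply, dsym]
  fin_cases i
  · simp only [Fin.zero_eta, Fin.isValue, zero_ne_one, if_false]
    rw [lerayAnti_zero_apply]
    field_simp
    ring
  · simp only [Fin.mk_one, Fin.isValue, if_true]
    rw [lerayAnti_one_apply, ← h1]
    field_simp
    ring

/-- The symbol is of order `-1`. The first block is excluded: there `|ξ|⁻¹` is of order `2^k` near
the removed frequencies, and `g` is treated without integration by parts. -/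
lemma norm_lerayAnti_le (i : Fin 2) (ξ : Plane) :
    ‖lerayAnti P k (n + 1) i ξ‖ ≤ 8 / 3 * ((2 : ℝ) ^ n)⁻¹ := by
  have hpi := Real.pi_pos
  by_cases h : 2 * Real.pi * ‖ξ‖ < 3 / 8 * 2 ^ n
  · have h0 : fatDiv P k (n + 1) ξ = 0 := by
      rw [fatDiv_apply, fat_succ_eq_zero_of_lt P k n h, zero_mul]
    have : lerayAnti P k (n + 1) i ξ = 0 := by
      fin_cases i
      · exact (lerayAnti_zero_apply P k (n + 1) ξ).trans (by rw [h0]; ring)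
      · exact (lerayAnti_one_apply P k (n + 1) ξ).trans (by rw [h0]; ring)
    rw [this, norm_zero]; positivity
  · rw [not_lt] at h
    have hp : (0 : ℝ) < 2 ^ n := by positivity
    have hξ : 0 < ‖ξ‖ := by
      by_contra hc
      have : ‖ξ‖ = 0 := le_antisymm (not_lt.1 hc) (norm_nonneg _)
      rw [this] at h; nlinarith
    have hcoord : ∀ j : Fin 2, ‖(ξ j : ℂ) * fatDiv P k (n + 1) ξ‖ ≤ ‖ξ‖⁻¹ := fun j => by
      rw [fatDiv_apply, norm_mul, norm_mul, Complex.norm_real, Complex.norm_real,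
        Real.norm_of_nonneg (by positivity : 0 ≤ (‖ξ‖ ^ 2)⁻¹)]
      calc _ ≤ ‖ξ‖ * (1 * (‖ξ‖ ^ 2)⁻¹) := by
            gcongr
            · exact PiLp.norm_apply_le ξ j
            · exact norm_fat_le P k (n + 1) ξ
        _ = ‖ξ‖⁻¹ := by field_simp
    have h1 : ‖lerayAnti P k (n + 1) i ξ‖ ≤ (2 * Real.pi)⁻¹ * ‖ξ‖⁻¹ := by
      have h2 : ‖(2 * Real.pi * Complex.I : ℂ)⁻¹‖ = (2 * Real.pi)⁻¹ := by
        simp [abs_of_pos hpi]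
      fin_cases i
      · refine (congrArg norm (lerayAnti_zero_apply P k (n + 1) ξ)).trans_le ?_
        rw [norm_mul, norm_neg, h2]
        exact mul_le_mul_of_nonneg_left (hcoord 1) (by positivity)
      · refine (congrArg norm (lerayAnti_one_apply P k (n + 1) ξ)).trans_le ?_
        rw [norm_mul, h2]
        exact mul_le_mul_of_nonneg_left (hcoord 0) (by positivity)
    refine h1.trans ?_
    rw [← mul_inv, show (8 : ℝ) / 3 * ((2 : ℝ) ^ n)⁻¹ = (3 / 8 * 2 ^ n)⁻¹ by
      rw [mul_inv]; norm_num]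
    exact inv_anti₀ (by positivity) h

end Fat

end AnisotropicStokes

namespace AnisotropicStokes

open scoped FourierTransform

/-! ### The equation of a block at a fixed time -/

lemma toDist_fop_apply (a : Test) (h : L2) (ψ : Test) :
    (Lp.toTemperedDistribution (fop a h) : Dist) ψ =
      (Lp.toTemperedDistribution h : Dist) (tmul a ψ) := by
  obtain ⟨K, -, hK⟩ := exists_norm_test_le a
  rw [toDist_fop a.hasTemperateGrowth hK, dmul_apply]

lemma fop_fop_eq {a b c d : Test} (h : ∀ ξ, a ξ * b ξ = c ξ * d ξ) (g : L2) :
    fop a (fop b g) = fop c (fop d g) := l2_eq_of_forall_apply fun ψ => by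
  simp only [toDist_fop_apply]
  rw [tmul_tmul b.hasTemperateGrowth a.hasTemperateGrowth,
    tmul_tmul d.hasTemperateGrowth c.hasTemperateGrowth]
  have : (b : Plane → ℂ) * a = (d : Plane → ℂ) * c := funext fun ξ => by
    simp only [Pi.mul_apply, mul_comm _ (a ξ), mul_comm _ (c ξ), h]
  rw [this]

lemma fop_fop {a b c : Test} (h : ∀ ξ, a ξ * b ξ = c ξ) (g : L2) :
    fop a (fop b g) = fop c g := l2_eq_of_forall_apply fun ψ => by
  simp only [toDist_fop_apply]
  rw [tmul_tmul b.hasTemperateGrowth a.hasTemperateGrowth]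
  have : (b : Plane → ℂ) * a = c := funext fun ξ => by
    simp only [Pi.mul_apply, mul_comm _ (a ξ), h]
  rw [this]

lemma inner_fop_real {a : Test} (ha : ∀ ξ, (starRingEnd ℂ) (a ξ) = a ξ) (g h : L2) :
    inner ℂ (fop a g) h = inner ℂ g (fop a h) := by
  obtain ⟨K, -, hK⟩ := exists_norm_test_le a
  rw [inner_fop a.hasTemperateGrowth hK]
  simp only [ha]

/-- The distribution `B · ∇ T`. -/
def advect (B : Fin 2 → Plane → ℂ) (T : Dist) : Dist :=
  ∑ j, TemperedDistribution.smulLeftCLM ℂ (B j) (dmul (dsym j) T)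

lemma advect_apply (B : Fin 2 → Plane → ℂ) (T : Dist) (ψ : Test) :
    advect B T ψ = ∑ j, T (tmul (dsym j) (SchwartzMap.smulLeftCLM ℂ (B j) ψ)) := by
  rw [advect, _root_.sum_apply]; rfl

lemma sum_leray_mul_leray (P : DyadicPartition) (k n : ℕ) (s l : Fin 2) (ξ : Plane) :
    ∑ i, leray P k n s i ξ * leray P k n i l ξ = fat P k n ξ * leray P k n s l ξ := by
  have h1 := fatDiv_mul_norm_sq P k n ξ
  rw [norm_sq_plane] at h1
  push_cast at h1
  simp only [Fin.sum_univ_two, leray_apply]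
  fin_cases s <;> fin_cases l <;>
    simp only [Fin.zero_eta, Fin.mk_one, Fin.isValue, if_true, zero_ne_one, one_ne_zero, if_false,
      ← h1] <;> ring

section FixedTime

variable {P : DyadicPartition} {k n : ℕ} {w : Fin 2 → Dist} {W : Fin 2 → L2}

lemma symb_mul_lowT (P : DyadicPartition) (k n : ℕ) (ξ : Plane) :
    symb P k n ξ * lowT P (n + 2) ξ = symb P k n ξ := by
  by_cases h : 4 / 3 * 2 ^ n < 2 * Real.pi * ‖ξ‖
  · rw [symb_eq_zero_of_gt P k h, zero_mul]
  · have hp : (0 : ℝ) < 2 ^ n := by positivity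
    rw [lowT_eq_one P (by rw [pow_add]; linarith), mul_one]

lemma lowT_mul_symb (P : DyadicPartition) (k n : ℕ) (ξ : Plane) :
    lowT P (n + 1) ξ * symb P k n ξ = symb P k n ξ := by
  by_cases h : 4 / 3 * 2 ^ n < 2 * Real.pi * ‖ξ‖
  · rw [symb_eq_zero_of_gt P k h, mul_zero]
  · have hp : (0 : ℝ) < 2 ^ n := by positivity
    rw [lowT_eq_one P (by rw [pow_add]; linarith), one_mul]

lemma toDist_fop_symb (hW : ∀ i, (Lp.toTemperedDistribution (W i) : Dist) =
    dmul (lowT P (n + 2)) (w i)) (i : Fin 2) :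
    (Lp.toTemperedDistribution (fop (symb P k n) (W i)) : Dist) = dmul (symb P k n) (w i) := by
  ext ψ
  rw [toDist_fop_apply, hW, dmul_apply, dmul_apply, tmul_tmul (lowT P _).hasTemperateGrowth
    (symb P k n).hasTemperateGrowth]
  have : (lowT P (n + 2) : Plane → ℂ) * symb P k n = symb P k n := funext fun ξ => by
    rw [Pi.mul_apply, mul_comm, symb_mul_lowT]
  rw [this]

/-- On the support of `symb P k n` the projection differs from the identity by `ξ_i ξ_l / |ξ|²`; the
factor `ξ_l`, summed against `w`, is a divergence. -/
lemma sum_apply_leray (hdiv : ∀ ψ : Test, ∑ l, w l (tmul (dsym l) ψ) = 0) (i : Fin 2) (ψ : Test) :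
    ∑ l, w l (tmul (symb P k n) (tmul (leray P k n i l) ψ)) = w i (tmul (symb P k n) ψ) := by
  set c : ℂ := (2 * Real.pi * Complex.I)⁻¹ with hc
  set θ : Test := c • SchwartzMap.smulLeftCLM ℂ (fun ξ : Plane => (ξ i : ℂ))
    (SchwartzMap.smulLeftCLM ℂ (symb P k n) (fatDiv P k n)) with hθ
  have hθa : ∀ ξ, θ ξ = c * ((ξ i : ℂ) * (symb P k n ξ * fatDiv P k n ξ)) := fun ξ => by
    rw [hθ, ← smulLeft_apply (symb P k n).hasTemperateGrowth,
      ← smulLeft_apply (hasTemperateGrowth_coord i)]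
    rfl
  have hpi : (2 * Real.pi * Complex.I : ℂ) ≠ 0 := Complex.two_pi_I_ne_zero
  have key : ∀ l, tmul (symb P k n) (tmul (leray P k n i l) ψ) =
      (if i = l then tmul (symb P k n) ψ else 0) - tmul (dsym l) (tmul θ ψ) := fun l => by
    have h1 : (symb P k n : Plane → ℂ) * leray P k n i l =
        (if i = l then (symb P k n : Plane → ℂ) else fun _ => 0) -
          dsym l * (θ : Plane → ℂ) := funext fun ξ => by
      have h2 := symb_mul_fat P k n ξ
      have h3 : dsym l ξ * θ ξ = ξ i * (symb P k n ξ * fatDiv P k n ξ) * ξ l := by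
        rw [hθa, dsym, hc]; field_simp
      rw [Pi.sub_apply, Pi.mul_apply, Pi.mul_apply, h3, leray_apply]
      split_ifs
      · linear_combination h2
      · ring
    rw [tmul_tmul (symb P k n).hasTemperateGrowth (leray P k n i l).hasTemperateGrowth, h1,
      tmul_tmul (hasTemperateGrowth_dsym l) θ.hasTemperateGrowth]
    rw [tmul_sub _ ((hasTemperateGrowth_dsym l).mul θ.hasTemperateGrowth)]
    · split_ifs
      · rfl
      · rw [tmul_zero]
    · split_ifs
      · exact (symb P k n).hasTemperateGrowth
      · exact Function.HasTemperateGrowth.const 0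
  simp only [key, map_sub, Finset.sum_sub_distrib, hdiv, sub_zero]
  rw [Finset.sum_eq_single i]
  · rw [if_pos rfl]
  · intro l _ hl; rw [if_neg hl.symm, map_zero]
  · intro h; exact absurd (Finset.mem_univ i) h

lemma sum_fop_leray (hW : ∀ i, (Lp.toTemperedDistribution (W i) : Dist) =
    dmul (lowT P (n + 2)) (w i)) (hdiv : ∀ ψ : Test, ∑ l, w l (tmul (dsym l) ψ) = 0) (i : Fin 2) :
    ∑ l, fop (leray P k n i l) (fop (symb P k n) (W l)) = fop (symb P k n) (W i) :=
  l2_eq_of_forall_apply fun ψ => by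
    rw [toDist_sum, _root_.sum_apply]
    simp only [toDist_fop_apply _ _ ψ, toDist_fop_symb hW, dmul_apply]
    rw [sum_apply_leray hdiv, ← dmul_apply, ← toDist_fop_symb hW, toDist_fop_apply]

/-- The commutators of the Leray projection with the transport operator. -/
def lerayComm (P : DyadicPartition) (k n : ℕ) (B : Fin 2 → Plane → ℂ) (u : Fin 2 → Dist)
    (i : Fin 2) : Dist :=
  ∑ l, dmul (leray P k n i l) (advect B (u l)) - advect B (u i)

lemma lerayComm_apply (B : Fin 2 → Plane → ℂ) (u : Fin 2 → Dist) (i : Fin 2) (ψ : Test) :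
    lerayComm P k n B u i ψ = ∑ l, advect B (u l) (tmul (leray P k n i l) ψ) -
      advect B (u i) ψ := by
  rw [lerayComm]
  change (∑ l, dmul (leray P k n i l) (advect B (u l))) ψ - _ = _
  rw [_root_.sum_apply]; rfl

/-- The constant depends on `k` through the kernels of the projection. This is harmless: the term
must belong to `L²`, but by `sum_inner_lerayComm` it does not contribute to the energy. -/
lemma l2Bound_lerayComm {B : Fin 2 → Plane → ℂ} {b L : ℝ} (hB : TransportField B b L)
    (hL : 0 ≤ L) {R : ℝ} (hR : 0 ≤ R) (hu : ∀ l, L2Bound (dmul (symb P k n) (w l)) R)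
    (hdiv : ∀ ψ : Test, ∑ l, w l (tmul (dsym l) ψ) = 0) (i : Fin 2) :
    L2Bound (lerayComm P k n B (fun l => dmul (symb P k n) (w l)) i)
      (R * (8 / 3 * 2 ^ n) * L * ∑ l, 2 * kerMom (leray P k n i l)) := fun ψ => by
  have h1 : advect B (dmul (symb P k n) (w i)) ψ = ∑ l, ∑ j, w l (tmul (symb P k n)
      (tmul (dsym j) (tmul (leray P k n i l) (SchwartzMap.smulLeftCLM ℂ (B j) ψ)))) := by
    rw [advect_apply, Finset.sum_comm]
    refine Finset.sum_congr rfl fun j _ => ?_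
    rw [dmul_apply, ← sum_apply_leray hdiv]
    refine Finset.sum_congr rfl fun l _ => ?_
    rw [tmul_comm (leray P k n i l).hasTemperateGrowth (hasTemperateGrowth_dsym j)]
  have h2 : lerayComm P k n B (fun l => dmul (symb P k n) (w l)) i ψ =
      ∑ l, ∑ j, w l (tmul (symb P k n) (tmul (dsym j)
        (SchwartzMap.smulLeftCLM ℂ (B j) (tmul (leray P k n i l) ψ) -
          tmul (leray P k n i l) (SchwartzMap.smulLeftCLM ℂ (B j) ψ)))) := by
    rw [lerayComm_apply, h1]
    simp only [advect_apply, dmul_apply, ← Finset.sum_sub_distrib, map_sub]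
  rw [h2]
  refine (norm_sum_le _ _).trans ?_
  rw [Finset.mul_sum, Finset.sum_mul]
  refine Finset.sum_le_sum fun l _ => (norm_sum_le _ _).trans ?_
  rw [Fin.sum_univ_two]
  have h3 : ∀ j, ‖w l (tmul (symb P k n) (tmul (dsym j)
        (SchwartzMap.smulLeftCLM ℂ (B j) (tmul (leray P k n i l) ψ) -
          tmul (leray P k n i l) (SchwartzMap.smulLeftCLM ℂ (B j) ψ))))‖ ≤
      R * (8 / 3 * 2 ^ n * (L * kerMom (leray P k n i l) *
        ‖ψ.toLp 2 (volume : Measure Plane)‖)) := fun j => by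
    refine (norm_apply_blockT_dsym_le (P := P) hR (symb P k n).hasTemperateGrowth
      (fun ξ h => symb_eq_zero_of_gt P k h) (hu l) j _).trans ?_
    gcongr
    exact norm_commutator_le _ (hB.temperate j) hL (hB.lipschitz j) ψ
  refine (add_le_add (h3 0) (h3 1)).trans (le_of_eq ?_)
  ring

lemma sum_lerayComm (B : Fin 2 → Plane → ℂ) (u : Fin 2 → Dist) (s : Fin 2) (ψ : Test) :
    ∑ i, lerayComm P k n B u i (tmul (leray P k n s i) (tmul (symb P k n) ψ)) = 0 := by
  simp only [lerayComm_apply, Finset.sum_sub_distrib]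
  rw [Finset.sum_comm, sub_eq_zero]
  refine Finset.sum_congr rfl fun l _ => ?_
  rw [← map_sum]
  congr 1
  have h1 : ∀ i, tmul (leray P k n i l) (tmul (leray P k n s i) (tmul (symb P k n) ψ)) =
      tmul (((leray P k n s i : Plane → ℂ) * leray P k n i l) * (symb P k n : Plane → ℂ)) ψ :=
    fun i => by
      rw [tmul_tmul (leray P k n i l).hasTemperateGrowth (leray P k n s i).hasTemperateGrowth,
        tmul_tmul ((leray P k n i l).hasTemperateGrowth.mul (leray P k n s i).hasTemperateGrowth)
          (symb P k n).hasTemperateGrowth, mul_comm (leray P k n i l : Plane → ℂ)]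
  simp only [h1]
  rw [← tmul_sum _ (fun i _ => ((leray P k n s i).hasTemperateGrowth.mul
    (leray P k n i l).hasTemperateGrowth).mul (symb P k n).hasTemperateGrowth),
    tmul_tmul (leray P k n s l).hasTemperateGrowth (symb P k n).hasTemperateGrowth]
  congr 1
  refine congrArg tmul (funext fun ξ => ?_)
  simp only [Pi.mul_apply]
  rw [← Finset.sum_mul, sum_leray_mul_leray]
  linear_combination leray P k n s l ξ * symb_mul_fat P k n ξ

/-- The localized field is in the range of the projection `ℙ`, which is self-adjoint, and `ℙ (ℙ - 1)
= 0` kills `ℙ(B·∇u) - B·∇u`. -/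
lemma sum_inner_lerayComm (B : Fin 2 → Plane → ℂ) (u : Fin 2 → Dist) {N : Fin 2 → L2}
    (hN : ∀ i, (Lp.toTemperedDistribution (N i) : Dist) = lerayComm P k n B u i)
    (hW : ∀ i, (Lp.toTemperedDistribution (W i) : Dist) = dmul (lowT P (n + 2)) (w i))
    (hdiv : ∀ ψ : Test, ∑ l, w l (tmul (dsym l) ψ) = 0) :
    ∑ i, inner ℂ (fop (symb P k n) (W i)) (N i) = 0 := by
  have h1 : ∀ i, inner ℂ (fop (symb P k n) (W i)) (N i) =
      ∑ s, inner ℂ (W s) (fop (symb P k n) (fop (leray P k n s i) (N i))) := fun i => by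
    rw [← sum_fop_leray hW hdiv i, sum_inner]
    refine Finset.sum_congr rfl fun s _ => ?_
    rw [inner_fop_real (conj_leray P k n i s), inner_fop_real (conj_symb P k n), leray_symm]
  simp only [h1]
  rw [Finset.sum_comm]
  refine Finset.sum_eq_zero fun s _ => ?_
  rw [← inner_sum]
  have h2 : ∑ i, fop (symb P k n) (fop (leray P k n s i) (N i)) = 0 :=
    l2_eq_of_forall_apply fun ψ => by
      rw [toDist_sum, _root_.sum_apply, toDist_zero]
      simp only [toDist_fop_apply (symb P k n)]
      simp only [toDist_fop_apply (leray P k n _ _), hN]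
      exact sum_lerayComm B u s ψ
  rw [h2, inner_zero_right]

end FixedTime

end AnisotropicStokes

/-! ### Projected right-hand side of a block and its contribution to the energy -/

namespace AnisotropicStokes

open scoped FourierTransform

lemma toDist_smul (c : ℂ) (g : L2) : (Lp.toTemperedDistribution (c • g) : Dist) =
    c • (Lp.toTemperedDistribution g : Dist) :=
  map_smul (Lp.toTemperedDistributionCLM ℂ (volume : Measure Plane) 2) c g

lemma inner_fop_skew {a : Test} (ha : ∀ ξ, (starRingEnd ℂ) (a ξ) = -a ξ) (g h : L2) :
    inner ℂ (fop a g) h = -inner ℂ g (fop a h) := by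
  obtain ⟨K, -, hK⟩ := exists_norm_test_le a
  rw [inner_fop a.hasTemperateGrowth hK, ← inner_neg_right]
  congr 1
  refine l2_eq_of_forall_apply fun ψ => ?_
  have h1 : (fun ξ => (starRingEnd ℂ) (a ξ)) = ((-a : Test) : Plane → ℂ) := funext ha
  have h2 : tmul ((-a : Test) : Plane → ℂ) ψ = -tmul a ψ := by
    have := tmul_smul a.hasTemperateGrowth (-1) ψ
    rw [neg_one_smul, neg_one_smul] at this
    exact this
  have h3 : (Lp.toTemperedDistribution (-fop a h) : Dist) =
      -(Lp.toTemperedDistribution (fop a h) : Dist) := by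
    have := toDist_smul (-1) (fop a h)
    rwa [neg_one_smul, neg_one_smul] at this
  rw [h1, toDist_fop_apply, h2, map_neg, h3]
  change _ = -((Lp.toTemperedDistribution (fop a h) : Dist) ψ)
  rw [toDist_fop_apply]

/-- The symbol of `∂₁`, cut off at frequencies of size `2^n`. -/
def dsymT (P : DyadicPartition) (n : ℕ) : Test :=
  SchwartzMap.smulLeftCLM ℂ (dsym 0) (lowT P (n + 1))

lemma dsymT_apply (P : DyadicPartition) (n : ℕ) (ξ : Plane) :
    dsymT P n ξ = dsym 0 ξ * lowT P (n + 1) ξ := smulLeft_apply (hasTemperateGrowth_dsym 0) _ ξ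

lemma norm_dsymT_le (P : DyadicPartition) (n : ℕ) (ξ : Plane) :
    ‖dsymT P n ξ‖ ≤ 4 / 3 * 2 ^ (n + 1) := by
  rw [dsymT_apply]; exact norm_dsym_mul_lowT_le P (n + 1) 0 ξ

lemma conj_dsymT (P : DyadicPartition) (n : ℕ) (ξ : Plane) :
    (starRingEnd ℂ) (dsymT P n ξ) = -dsymT P n ξ := by
  rw [dsymT_apply, map_mul, conj_dsym, conj_lowT, neg_mul]

lemma norm_fop_test_le {a : Test} {K : ℝ} (h : ∀ ξ, ‖a ξ‖ ≤ K) (g : L2) :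
    ‖fop a g‖ ≤ K * ‖g‖ := norm_fop_le a.hasTemperateGrowth h g

lemma tmul_dsymT_symb (P : DyadicPartition) (k n : ℕ) (ψ : Test) :
    tmul (symb P k n) (tmul (dsymT P n) ψ) = tmul (symb P k n) (tmul (dsym 0) ψ) := by
  rw [tmul_tmul (symb P k n).hasTemperateGrowth (dsymT P n).hasTemperateGrowth,
    tmul_tmul (symb P k n).hasTemperateGrowth (hasTemperateGrowth_dsym 0)]
  have : (symb P k n : Plane → ℂ) * dsymT P n = (symb P k n : Plane → ℂ) * dsym 0 :=
    funext fun ξ => by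
      rw [Pi.mul_apply, Pi.mul_apply, dsymT_apply]
      linear_combination dsym 0 ξ * lowT_mul_symb P k n ξ
  rw [this]

/-- The projected equation is put in the form `∂_t u + B·∇u = H`, where `H` collects the projections
of `f`, of `g e₂` and of the convection remainder, the commutator of the projection, and `ν ∂₁² u`.
The constant `K`, which depends on `k` and `n`, enters only the crude bound of `H` used for
integrability; the energy inequality is free of it. The number `G` is the work of `g`, estimated
either directly or, beyond the first block, after an integration by parts in `x₁`. -/
theorem exists_block_rhs (P : DyadicPartition) (k n : ℕ) : ∃ K : ℝ, 0 ≤ K ∧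
    ∀ {w c f : Fin 2 → Dist} {g : Dist} {W : Fin 2 → L2} {B : Fin 2 → Plane → ℂ}
      {ν b L Ru Rf Rg Rr : ℝ}, 0 ≤ ν → 0 ≤ L → 0 ≤ Ru → 0 ≤ Rf → 0 ≤ Rg → 0 ≤ Rr →
      (∀ i, (Lp.toTemperedDistribution (W i) : Dist) = dmul (lowT P (n + 2)) (w i)) →
      (∀ ψ : Test, ∑ l, w l (tmul (dsym l) ψ) = 0) → TransportField B b L →
      (∀ l, L2Bound (dmul (symb P k n) (w l)) Ru) →
      (∀ l, L2Bound (dmul (symb P k n) (f l)) Rf) → L2Bound (dmul (symb P k n) g) Rg →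
      (∀ l ψ, ‖c l (tmul (symb P k n) ψ) - ∑ j, dmul (symb P k n) (w l) (tmul (dsym j)
        (SchwartzMap.smulLeftCLM ℂ (B j) ψ))‖ ≤ Rr * ‖ψ.toLp 2 (volume : Measure Plane)‖) →
      ∃ (H : Fin 2 → L2) (G : ℝ),
        (∀ i ψ, (Lp.toTemperedDistribution (H i) : Dist) ψ -
            ∑ j, (Lp.toTemperedDistribution (fop (symb P k n) (W i)) : Dist)
              (tmul (dsym j) (SchwartzMap.smulLeftCLM ℂ (B j) ψ)) =
          ∑ l, (f l (tmul (symb P k n) (tmul (leray P k n i l) ψ)) +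
            (if l = 1 then g (tmul (symb P k n) (tmul (leray P k n i l) ψ)) else 0) -
            c l (tmul (symb P k n) (tmul (leray P k n i l) ψ)) +
            ν * w l (tmul (dsym 0) (tmul (dsym 0)
              (tmul (symb P k n) (tmul (leray P k n i l) ψ)))))) ∧
        (∀ i, ‖H i‖ ≤ 2 * Rf + Rg + 2 * Rr + K * (L + ν) * Ru) ∧
        ∑ i, (inner ℂ (fop (symb P k n) (W i)) (H i)).re ≤
          (∑ i, ‖fop (symb P k n) (W i)‖) * (2 * Rf + 2 * Rr) + G -
            ν * ∑ i, ‖fop (dsymT P n) (fop (symb P k n) (W i))‖ ^ 2 ∧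
        G ≤ (∑ i, ‖fop (symb P k n) (W i)‖) * Rg ∧
        ∀ n', n = n' + 1 → G ≤ (∑ i, ‖fop (dsymT P n) (fop (symb P k n) (W i))‖) *
          (8 / 3 * ((2 : ℝ) ^ n')⁻¹ * Rg) := by
  obtain ⟨K₀, hK₀, hK₀'⟩ : ∃ K₀ : ℝ, 0 ≤ K₀ ∧ ∀ i,
      8 / 3 * 2 ^ n * ∑ l, 2 * kerMom (leray P k n i l) ≤ K₀ := by
    have h0 : ∀ i, 0 ≤ 8 / 3 * 2 ^ n * ∑ l, 2 * kerMom (leray P k n i l) := fun i =>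
      mul_nonneg (by positivity) (Finset.sum_nonneg fun l _ =>
        mul_nonneg zero_le_two (kerMom_nonneg _))
    exact ⟨∑ i, 8 / 3 * 2 ^ n * ∑ l, 2 * kerMom (leray P k n i l),
      Finset.sum_nonneg fun i _ => h0 i, fun i =>
      Finset.single_le_sum (f := fun i => 8 / 3 * 2 ^ n * ∑ l, 2 * kerMom (leray P k n i l))
        (fun i _ => h0 i) (Finset.mem_univ i)⟩
  refine ⟨K₀ + (4 / 3 * 2 ^ (n + 1)) * (4 / 3 * 2 ^ (n + 1)), by positivity, ?_⟩
  intro w c f g W B ν b L Ru Rf Rg Rr hν hL hRu hRf hRg hRr hW hdiv hB hu hf hg hr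
  set m := symb P k n with hm
  set D := dsymT P n with hD
  set u : Fin 2 → L2 := fun i => fop m (W i) with hudef
  have hud : ∀ i, (Lp.toTemperedDistribution (u i) : Dist) = dmul m (w i) :=
    toDist_fop_symb hW
  have hun : ∀ i, ‖u i‖ ≤ Ru := fun i => norm_le_of_l2Bound hRu (by rw [hud]; exact hu i)
  have hN := fun i => l2Bound_lerayComm hB hL hRu hu hdiv i
  have hNR : ∀ i, Ru * (8 / 3 * 2 ^ n) * L * ∑ l, 2 * kerMom (leray P k n i l) ≤
      K₀ * L * Ru := fun i => by
    calc _ = 8 / 3 * 2 ^ n * (∑ l, 2 * kerMom (leray P k n i l)) * (L * Ru) := by ring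
      _ ≤ K₀ * (L * Ru) := mul_le_mul_of_nonneg_right (hK₀' i) (by positivity)
      _ = _ := by ring
  have hN' := fun i => (hN i).mono (hNR i)
  have hNR0 : 0 ≤ K₀ * L * Ru := by positivity
  set Nd : Fin 2 → Dist := fun i => lerayComm P k n B (fun l => dmul m (w l)) i with hNd
  have hr' : ∀ l, L2Bound (dmul m (c l) - advect B (dmul m (w l))) Rr := fun l ψ => by
    refine le_trans (le_of_eq ?_) (hr l ψ)
    rw [← advect_apply]; rfl
  set rd : Fin 2 → Dist := fun l => dmul m (c l) - advect B (dmul m (w l)) with hrd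
  have hF1 := fun l => (hf l).toDist_rep hRf
  have hF2 := fun l => (hf l).norm_rep_le hRf
  have hG1 := hg.toDist_rep hRg
  have hG2 := hg.norm_rep_le hRg
  have hN1 := fun i => (hN' i).toDist_rep hNR0
  have hN2 := fun i => (hN' i).norm_rep_le hNR0
  have hr1 := fun l => (hr' l).toDist_rep hRr
  have hr2 := fun l => (hr' l).norm_rep_le hRr
  set F : Fin 2 → L2 := fun l => rep (dmul m (f l)) with hFdef
  set G₀ : L2 := rep (dmul m g) with hGdef
  set N : Fin 2 → L2 := fun i => rep (Nd i) with hNdef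
  set r : Fin 2 → L2 := fun l => rep (rd l) with hrdef
  have hler : ∀ i l (h : L2), ‖fop (leray P k n i l) h‖ ≤ ‖h‖ := fun i l h =>
    (norm_fop_test_le (norm_leray_le P k n i l) h).trans_eq (one_mul _)
  have hsum : ∀ i (h : Fin 2 → L2) (R : ℝ), (∀ l, ‖h l‖ ≤ R) →
      ‖∑ l, fop (leray P k n i l) (h l)‖ ≤ 2 * R := fun i h R hR => by
    refine (norm_sum_le _ _).trans ?_
    rw [Fin.sum_univ_two]
    linarith [hler i 0 (h 0), hler i 1 (h 1), hR 0, hR 1]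
  have hDn : ∀ h : L2, ‖fop D h‖ ≤ 4 / 3 * 2 ^ (n + 1) * ‖h‖ := fun h =>
    norm_fop_test_le (norm_dsymT_le P n) h
  refine ⟨fun i => ∑ l, fop (leray P k n i l) (F l) + fop (leray P k n i 1) G₀ - N i -
    ∑ l, fop (leray P k n i l) (r l) + (ν : ℂ) • fop D (fop D (u i)),
    ∑ i, (inner ℂ (u i) (fop (leray P k n i 1) G₀)).re, fun i ψ => ?_, fun i => ?_, ?_, ?_, ?_⟩
  · rw [toDist_add, toDist_sub, toDist_sub, toDist_add, toDist_sum, toDist_sum, toDist_smul]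
    change (∑ l, (Lp.toTemperedDistribution (fop (leray P k n i l) (F l)) : Dist)) ψ +
      (Lp.toTemperedDistribution (fop (leray P k n i 1) G₀) : Dist) ψ -
      (Lp.toTemperedDistribution (N i) : Dist) ψ -
      (∑ l, (Lp.toTemperedDistribution (fop (leray P k n i l) (r l)) : Dist)) ψ +
      ν * (Lp.toTemperedDistribution (fop D (fop D (u i))) : Dist) ψ -
      ∑ j, (Lp.toTemperedDistribution (u i) : Dist)
        (tmul (dsym j) (SchwartzMap.smulLeftCLM ℂ (B j) ψ)) = _
    rw [_root_.sum_apply, _root_.sum_apply, hN1, lerayComm_apply]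
    have hF1' : ∀ l, (Lp.toTemperedDistribution (F l) : Dist) = dmul m (f l) := hF1
    have hr1' : ∀ l, (Lp.toTemperedDistribution (r l) : Dist) = rd l := hr1
    simp only [toDist_fop_apply, hud, hF1', hG1, hr1', ← hm]
    rw [← advect_apply]
    have e1 : ∀ l φ, rd l φ = c l (tmul m φ) - advect B (dmul m (w l)) φ := fun l φ => rfl
    have e2 : dmul m (w i) (tmul D (tmul D ψ)) = ∑ l, w l (tmul (dsym 0) (tmul (dsym 0)
              (tmul m (tmul (leray P k n i l) ψ)))) := by
      have hmg := m.hasTemperateGrowth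
      have hdg := hasTemperateGrowth_dsym 0
      have hDg := D.hasTemperateGrowth
      rw [dmul_apply, tmul_dsymT_symb, tmul_comm hdg hDg, tmul_dsymT_symb, ← sum_apply_leray hdiv]
      refine Finset.sum_congr rfl fun l _ => ?_
      have hlg := (leray P k n i l).hasTemperateGrowth
      rw [tmul_comm hlg hdg, tmul_comm hlg hdg, tmul_comm hmg hdg, tmul_comm hmg hdg]
    rw [e2]
    simp only [e1, dmul_apply, Finset.sum_sub_distrib, Finset.sum_add_distrib, Finset.mul_sum,
      Finset.sum_ite_eq', Finset.mem_univ, if_true]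
    ring
  · have h1 := hsum i F Rf hF2
    have h2 := (hler i 1 G₀).trans hG2
    have h3 := hN2 i
    have h4 := hsum i r Rr hr2
    have h5 : ‖(ν : ℂ) • fop D (fop D (u i))‖ ≤
        (4 / 3 * 2 ^ (n + 1)) * (4 / 3 * 2 ^ (n + 1)) * ν * Ru := by
      rw [norm_smul, Complex.norm_real, Real.norm_of_nonneg hν]
      calc _ ≤ ν * (4 / 3 * 2 ^ (n + 1) * (4 / 3 * 2 ^ (n + 1) * Ru)) := by
            gcongr
            exact (hDn _).trans (by gcongr; exact (hDn _).trans (by gcongr; exact hun i))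
        _ = _ := by ring
    refine (norm_add_le _ _).trans ?_
    refine (add_le_add ((norm_sub_le _ _).trans (add_le_add ((norm_sub_le _ _).trans
      (add_le_add ((norm_add_le _ _).trans (add_le_add h1 h2)) h3)) h4)) h5).trans ?_
    have h6 : 0 ≤ K₀ * ν * Ru := by positivity
    have h7 : 0 ≤ (4 / 3 * 2 ^ (n + 1)) * (4 / 3 * 2 ^ (n + 1)) * L * Ru := by positivity
    linarith
  · have hNz : ∑ i, (inner ℂ (u i) (N i)).re = 0 := by
      rw [← Complex.re_sum, sum_inner_lerayComm B _ hN1 hW hdiv, Complex.zero_re]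
    have key : ∀ i, (inner ℂ (u i) (∑ l, fop (leray P k n i l) (F l) + fop (leray P k n i 1) G₀ -
        N i - ∑ l, fop (leray P k n i l) (r l) + (ν : ℂ) • fop D (fop D (u i)))).re ≤
        ‖u i‖ * (2 * Rf + 2 * Rr) + (inner ℂ (u i) (fop (leray P k n i 1) G₀)).re -
          (inner ℂ (u i) (N i)).re - ν * ‖fop D (u i)‖ ^ 2 := fun i => by
      rw [inner_add_right, inner_sub_right, inner_sub_right, inner_add_right, inner_smul_right]
      have e1 : (inner ℂ (u i) (fop D (fop D (u i)))) = -((‖fop D (u i)‖ ^ 2 : ℝ) : ℂ) := by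
        have := inner_fop_skew (conj_dsymT P n) (u i) (fop D (u i))
        rw [inner_self_eq_norm_sq_to_K] at this
        rw [← neg_eq_iff_eq_neg, ← this]
        push_cast; rfl
      rw [e1]
      have h1 : (inner ℂ (u i) (∑ l, fop (leray P k n i l) (F l))).re ≤ ‖u i‖ * (2 * Rf) :=
        (Complex.re_le_norm _).trans ((norm_inner_le_norm _ _).trans
          (mul_le_mul_of_nonneg_left (hsum i F Rf hF2) (norm_nonneg _)))
      have h2 : -(inner ℂ (u i) (∑ l, fop (leray P k n i l) (r l))).re ≤ ‖u i‖ * (2 * Rr) :=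
        (neg_le_abs _).trans ((Complex.abs_re_le_norm _).trans ((norm_inner_le_norm _ _).trans
          (mul_le_mul_of_nonneg_left (hsum i r Rr hr2) (norm_nonneg _))))
      have h3 : ((ν : ℂ) * -((‖fop D (u i)‖ ^ 2 : ℝ) : ℂ)).re = -(ν * ‖fop D (u i)‖ ^ 2) := by
        rw [← Complex.ofReal_neg, ← Complex.ofReal_mul, Complex.ofReal_re]; ring
      simp only [Complex.add_re, Complex.sub_re]
      rw [h3]
      linarith
    refine (Finset.sum_le_sum fun i _ => key i).trans (le_of_eq ?_)
    rw [Finset.sum_sub_distrib, Finset.sum_sub_distrib, Finset.sum_add_distrib, hNz,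
      ← Finset.sum_mul, ← Finset.mul_sum, sub_zero]
  · rw [Finset.sum_mul]
    refine Finset.sum_le_sum fun i _ => (Complex.re_le_norm _).trans ((norm_inner_le_norm _ _).trans
      (mul_le_mul_of_nonneg_left ((hler i 1 G₀).trans hG2) (norm_nonneg _)))
  · intro n' hn'
    rw [Finset.sum_mul]
    refine Finset.sum_le_sum fun i _ => ?_
    -- The cut-off `S_{n+1}`, which is the identity on `u`, is inserted so that the derivative `∂₁`
    -- taken out of the projection appears as the bounded skew-adjoint operator with symbol `dsymT`.
    have e1 : inner ℂ (u i) (fop (leray P k n i 1) G₀) =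
        -inner ℂ (fop D (u i)) (fop (lerayAnti P k n i) G₀) := by
      have h1 : u i = fop (lowT P (n + 1)) (u i) := (fop_fop (lowT_mul_symb P k n) (W i)).symm
      rw [inner_fop_skew (conj_dsymT P n), neg_neg]
      conv_lhs => rw [h1]
      rw [inner_fop_real (conj_lowT P (n + 1))]
      congr 1
      exact fop_fop_eq (fun ξ => by rw [leray_one_eq, dsymT_apply]; ring) G₀
    rw [e1]
    refine (Complex.re_le_norm _).trans ?_
    rw [norm_neg]
    refine (norm_inner_le_norm _ _).trans (mul_le_mul_of_nonneg_left ?_ (norm_nonneg _))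
    subst hn'
    exact (norm_fop_test_le (norm_lerayAnti_le P k n' i) G₀).trans
      (mul_le_mul_of_nonneg_left hG2 (by positivity))

end AnisotropicStokes

namespace AnisotropicStokes

open scoped FourierTransform

/-! ### Measurability of `L²` norms -/

lemma finiteDimensional_multilinear (n : ℕ) :
    FiniteDimensional ℝ (ContinuousMultilinearMap ℝ (fun _ : Fin n => Plane) ℂ) :=
  Module.Finite.of_injective (⟨⟨ContinuousMultilinearMap.toMultilinearMap, fun _ _ => rfl⟩,
    fun _ _ => rfl⟩ : ContinuousMultilinearMap ℝ (fun _ : Fin n => Plane) ℂ →ₗ[ℝ]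
      MultilinearMap ℝ (fun _ : Fin n => Plane) ℂ)
    fun _ _ h => ContinuousMultilinearMap.toMultilinearMap_injective h

lemma secondCountable_multilinear (n : ℕ) :
    SecondCountableTopology (ContinuousMultilinearMap ℝ (fun _ : Fin n => Plane) ℂ) := by
  have := finiteDimensional_multilinear n
  have : ProperSpace (ContinuousMultilinearMap ℝ (fun _ : Fin n => Plane) ℂ) :=
    FiniteDimensional.proper ℝ _
  infer_instance

/-- The derivatives of order `≤ K`, as a continuous function. -/
def jet (K : ℕ) (ψ : Test) :
    C(Plane, (n : Fin (K + 1)) → ContinuousMultilinearMap ℝ (fun _ : Fin n => Plane) ℂ) where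
  toFun x n := iteratedFDeriv ℝ n ψ x
  continuous_toFun := continuous_pi fun n =>
    (ψ.smooth (n : ℕ)).continuous_iteratedFDeriv (by exact_mod_cast le_refl _)

/-- A bounded set of test functions is separable for the locally uniform convergence of finitely
many derivatives, and one spare power of `|x|` in the bound controls the exterior of a large ball.
The aim is the separability of the Schwartz space, which gives the measurability in time of `L²`
norms of blocks. -/
lemma exists_countable_near (K : ℕ) (M : ℝ) : ∃ t : Set Test, t.Countable ∧
    ∀ ψ : Test, (∀ k ≤ K + 1, ∀ n ≤ K, SchwartzMap.seminorm ℂ k n ψ ≤ M) → ∀ ε > 0,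
      ∃ η ∈ t, ∀ k ≤ K, ∀ n ≤ K, SchwartzMap.seminorm ℂ k n (ψ - η) ≤ ε := by
  set S : Set Test := {ψ | ∀ k ≤ K + 1, ∀ n ≤ K, SchwartzMap.seminorm ℂ k n ψ ≤ M} with hS
  have hsc : ∀ n : Fin (K + 1),
      SecondCountableTopology (ContinuousMultilinearMap ℝ (fun _ : Fin n => Plane) ℂ) :=
    fun n => secondCountable_multilinear n
  let τ : TopologicalSpace S := TopologicalSpace.induced (fun ψ : S => jet K ψ) inferInstance
  have : SecondCountableTopology S :=
    TopologicalSpace.secondCountableTopology_induced S _ (fun ψ : S => jet K ψ)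
  obtain ⟨t, htc, htd⟩ := TopologicalSpace.exists_countable_dense S
  refine ⟨Subtype.val '' t, htc.image _, fun ψ hψ ε hε => ?_⟩
  have hM : 0 ≤ M := (apply_nonneg _ _).trans (hψ 0 (Nat.zero_le _) 0 (Nat.zero_le _))
  -- Outside this radius the spare power of `|x|` makes the seminorm of the difference at most `2 M
  -- / R ≤ ε`.
  set R : ℝ := 2 * M / ε + 1 with hR
  have hR1 : 1 ≤ R := by rw [hR]; linarith [div_nonneg (mul_nonneg zero_le_two hM) hε.le]
  have hRε : 2 * M ≤ R * ε := by
    rw [hR, add_mul, div_mul_cancel₀ _ hε.ne']; linarith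
  have hu := (ContinuousMap.tendsto_iff_forall_isCompact_tendstoUniformlyOn
    (f := jet K ψ)).1 (tendsto_id (α := C(Plane, (n : Fin (K + 1)) →
      ContinuousMultilinearMap ℝ (fun _ : Fin n => Plane) ℂ)))
    (Metric.closedBall 0 R) (isCompact_closedBall 0 R)
  rw [Metric.tendstoUniformlyOn_iff] at hu
  have hu' := hu (ε / R ^ K) (by positivity)
  have hcont : Continuous (fun ψ : S => jet K ψ) := continuous_induced_dom
  have hmem := hcont.tendsto ⟨ψ, hψ⟩ |>.eventually hu'
  obtain ⟨η, hηt, hη⟩ := htd.inter_nhds_nonempty hmem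
  refine ⟨η, ⟨η, hηt, rfl⟩, fun k hk n hn => ?_⟩
  refine SchwartzMap.seminorm_le_bound ℂ k n _ hε.le fun x => ?_
  have hsub : iteratedFDeriv ℝ n (⇑(ψ - (η : Test))) x =
      iteratedFDeriv ℝ n ψ x - iteratedFDeriv ℝ n (η : Test) x :=
    iteratedFDeriv_sub_apply (ψ.smooth n).contDiffAt ((η : Test).smooth n).contDiffAt
  rw [hsub]
  by_cases hx : ‖x‖ ≤ R
  · have h1 := hη x (by simpa using hx)
    have h2 : ‖iteratedFDeriv ℝ n ψ x - iteratedFDeriv ℝ n (η : Test) x‖ ≤ ε / R ^ K := by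
      rw [← dist_eq_norm]
      exact (dist_le_pi_dist (jet K ψ x) (jet K η x) ⟨n, Nat.lt_succ_of_le hn⟩).trans h1.le
    calc _ ≤ R ^ K * (ε / R ^ K) := by
          refine mul_le_mul ?_ h2 (norm_nonneg _) (by positivity)
          exact (pow_le_pow_left₀ (norm_nonneg _) hx k).trans (pow_le_pow_right₀ hR1 hk)
      _ = ε := by field_simp
  · rw [not_le] at hx
    have h1 := (SchwartzMap.le_seminorm ℂ (k + 1) n ψ x).trans (hψ _ (Nat.succ_le_succ hk) n hn)
    have h2 := (SchwartzMap.le_seminorm ℂ (k + 1) n (η : Test) x).trans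
      (η.2 _ (Nat.succ_le_succ hk) n hn)
    have h3 : ‖x‖ * (‖x‖ ^ k * ‖iteratedFDeriv ℝ n ψ x - iteratedFDeriv ℝ n (η : Test) x‖) ≤
        2 * M := by
      calc _ ≤ ‖x‖ * (‖x‖ ^ k * (‖iteratedFDeriv ℝ n ψ x‖ +
            ‖iteratedFDeriv ℝ n (η : Test) x‖)) := by
            gcongr; exact norm_sub_le _ _
        _ = ‖x‖ ^ (k + 1) * ‖iteratedFDeriv ℝ n ψ x‖ +
            ‖x‖ ^ (k + 1) * ‖iteratedFDeriv ℝ n (η : Test) x‖ := by ring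
        _ ≤ 2 * M := by linarith
    have h4 : 0 < ‖x‖ := by linarith
    refine le_of_mul_le_mul_left (h3.trans (hRε.trans ?_)) h4
    exact mul_le_mul_of_nonneg_right hx.le hε.le

lemma exists_countable_dense_test : ∃ t : Set Test, t.Countable ∧ Dense t := by
  choose t htc ht using fun (p : ℕ × ℕ) => exists_countable_near p.1 p.2
  refine ⟨⋃ p, t p, countable_iUnion htc, fun ψ => ?_⟩
  rw [mem_closure_iff_nhds_basis (schwartz_withSeminorms ℂ Plane ℂ).hasBasis_ball]
  rintro ⟨s, r⟩ hr
  simp only at hr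
  obtain ⟨K, hK⟩ : ∃ K : ℕ, ∀ p ∈ s, p.1 ≤ K ∧ p.2 ≤ K :=
    ⟨s.sup (fun p => max p.1 p.2), fun p hp =>
      ⟨(le_max_left _ _).trans (Finset.le_sup (f := fun p : ℕ × ℕ => max p.1 p.2) hp),
        (le_max_right _ _).trans (Finset.le_sup (f := fun p : ℕ × ℕ => max p.1 p.2) hp)⟩⟩
  obtain ⟨M, hM⟩ := exists_nat_ge
    (∑ k ∈ Finset.range (K + 2), ∑ n ∈ Finset.range (K + 1), SchwartzMap.seminorm ℂ k n ψ)
  have hψ : ∀ k ≤ K + 1, ∀ n ≤ K, SchwartzMap.seminorm ℂ k n ψ ≤ M := fun k hk n hn => by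
    refine le_trans ?_ hM
    refine le_trans ?_ (Finset.single_le_sum (f := fun k => ∑ n ∈ Finset.range (K + 1),
      SchwartzMap.seminorm ℂ k n ψ) (fun i _ => Finset.sum_nonneg fun j _ => apply_nonneg _ _)
      (Finset.mem_range.2 (Nat.lt_succ_of_le hk)))
    exact Finset.single_le_sum (f := fun n => SchwartzMap.seminorm ℂ k n ψ)
      (fun i _ => apply_nonneg _ _) (Finset.mem_range.2 (Nat.lt_succ_of_le hn))
  obtain ⟨η, hη, h⟩ := ht (K, M) ψ hψ (r / 2) (half_pos hr)
  refine ⟨η, mem_iUnion.2 ⟨_, hη⟩, ?_⟩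
  rw [Seminorm.mem_ball, map_sub_rev]
  refine Seminorm.finset_sup_apply_lt hr fun p hp => ?_
  exact (h p.1 (hK p hp).1 p.2 (hK p hp).2).trans_lt (half_lt_self hr)

lemma exists_denseRange_test : ∃ d : ℕ → Test, DenseRange d := by
  obtain ⟨t, htc, htd⟩ := exists_countable_dense_test
  obtain ⟨d, hd⟩ := htc.exists_eq_range htd.nonempty
  exact ⟨d, by rw [DenseRange, ← hd]; exact htd⟩

lemma norm_toLp_eq_zero {ψ : Test} (h : ‖ψ.toLp 2 (volume : Measure Plane)‖ = 0) : ψ = 0 := by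
  have h1 : ψ.toLp 2 (volume : Measure Plane) = (0 : Test).toLp 2 (volume : Measure Plane) := by
    rw [norm_eq_zero.1 h]
    exact (map_zero (SchwartzMap.toLpCLM ℂ ℂ 2 (volume : Measure Plane))).symm
  exact SchwartzMap.injective_toLp 2 volume h1

/-- Duality on a countable dense family; a zero test function contributes `0 / 0 = 0`. A countable
supremum preserves measurability, although no measurable choice of representatives is made. -/
lemma distLpNorm_two_eq_iSup {d : ℕ → Test} (hd : DenseRange d) (T : Dist) :
    distLpNorm 2 T = ⨆ j, ‖T (d j)‖ₑ / ‖(d j).toLp 2 (volume : Measure Plane)‖ₑ := by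
  apply le_antisymm
  · set s := ⨆ j, ‖T (d j)‖ₑ / ‖(d j).toLp 2 (volume : Measure Plane)‖ₑ with hs
    by_cases hs' : s = ∞
    · rw [hs']; exact le_top
    have h1 : ∀ j, ‖T (d j)‖ ≤ s.toReal * ‖(d j).toLp 2 (volume : Measure Plane)‖ := fun j => by
      by_cases h0 : ‖(d j).toLp 2 (volume : Measure Plane)‖ = 0
      · rw [norm_toLp_eq_zero h0, map_zero, norm_zero]; positivity
      · have h2 : ‖T (d j)‖ₑ / ‖(d j).toLp 2 (volume : Measure Plane)‖ₑ ≤ s :=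
          le_iSup (fun j => ‖T (d j)‖ₑ / ‖(d j).toLp 2 (volume : Measure Plane)‖ₑ) j
        rw [ENNReal.div_le_iff (by rwa [Ne, enorm_eq_zero, ← norm_eq_zero])
          enorm_ne_top] at h2
        have h3 := ENNReal.toReal_mono (ENNReal.mul_ne_top hs' enorm_ne_top) h2
        rwa [ENNReal.toReal_mul, toReal_enorm, toReal_enorm] at h3
    have h2 : L2Bound T s.toReal := by
      have hc : IsClosed {ψ : Test | ‖T ψ‖ ≤ s.toReal * ‖ψ.toLp 2 (volume : Measure Plane)‖} := by
        refine isClosed_le T.continuous.norm (continuous_const.mul ?_)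
        exact (SchwartzMap.toLpCLM ℂ ℂ 2 (volume : Measure Plane)).continuous.norm
      intro ψ
      exact hc.closure_subset_iff.2 (by rintro _ ⟨j, rfl⟩; exact h1 j) (hd ψ)
    exact (h2.distLpNorm_le ENNReal.toReal_nonneg).trans_eq (ENNReal.ofReal_toReal hs')
  · refine le_of_forall_gt fun K hK => ?_
    obtain ⟨g, hg, hgK⟩ := exists_of_distLpNorm_lt hK
    refine lt_of_le_of_lt (iSup_le fun j => ?_) hgK
    refine ENNReal.div_le_of_le_mul ?_
    rw [← hg, ← ofReal_norm, ← ofReal_norm, ← ofReal_norm, ← ENNReal.ofReal_mul (norm_nonneg _)]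
    exact ENNReal.ofReal_le_ofReal (l2Bound_toDist g (d j))

lemma aemeasurable_distLpNorm {X : Type*} [MeasurableSpace X] {μ : Measure X} {T : X → Dist}
    (hT : ∀ ψ, AEMeasurable (fun τ => T τ ψ) μ) :
    AEMeasurable (fun τ => distLpNorm 2 (T τ)) μ := by
  obtain ⟨d, hd⟩ := exists_denseRange_test
  simp only [distLpNorm_two_eq_iSup hd]
  exact AEMeasurable.iSup fun j => (hT (d j)).enorm.div_const _

lemma distLpNorm_toDist (h : L2) : distLpNorm 2 (Lp.toTemperedDistribution h : Dist) = ‖h‖ₑ := by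
  refine le_antisymm (distLpNorm_toDist_le h) (le_of_forall_gt fun K hK => ?_)
  obtain ⟨g, hg, hgK⟩ := exists_of_distLpNorm_lt hK
  rwa [← toDist_injective hg]

lemma aemeasurable_norm_of_weak {X : Type*} [MeasurableSpace X] {μ : Measure X} {h : X → L2}
    (hT : ∀ ψ, AEMeasurable (fun τ => (Lp.toTemperedDistribution (h τ) : Dist) ψ) μ) :
    AEMeasurable (fun τ => ‖h τ‖) μ := by
  have h1 := (aemeasurable_distLpNorm hT).ennreal_toReal
  simpa only [distLpNorm_toDist, toReal_enorm] using h1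

end AnisotropicStokes

namespace AnisotropicStokes

open scoped FourierTransform

/-! ### The localized equation -/

lemma DivFree.sum_eq_zero {u : 𝓢'(Plane, CVec)} (h : DivFree u) (ψ : Test) :
    ∑ l, coord l u (tmul (dsym l) ψ) = 0 := by
  rw [← h ψ]
  exact Finset.sum_congr rfl fun l _ => by rw [pderiv_apply]; rfl

lemma WeaklyIntegrable.intervalIntegrable {F : Type*} [NormedAddCommGroup F] [NormedSpace ℂ F]
    {T : ℝ} (hT : 0 ≤ T) {u : ℝ → 𝓢'(Plane, F)} (h : WeaklyIntegrable T u) (ψ : Test) :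
    IntervalIntegrable (fun t => u t ψ) volume 0 T :=
  (intervalIntegrable_iff_integrableOn_Icc_of_le hT).2 (h ψ)

lemma WeaklyIntegrable.coord {T : ℝ} {u : ℝ → 𝓢'(Plane, CVec)} (h : WeaklyIntegrable T u)
    (i : Fin 2) : WeaklyIntegrable T (fun t => coord i (u t)) := fun ψ =>
  (EuclideanSpace.proj i : CVec →L[ℂ] ℂ).integrable_comp (h ψ)

/-- The right-hand side of the equation of the component `i`, without the pressure. -/
def forcing (ν : ℝ) (f : Fin 2 → Dist) (g : Dist) (c w : Fin 2 → Dist) (l : Fin 2) (ψ : Test) : ℂ :=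
  f l ψ + (if l = 1 then g ψ else 0) - c l ψ + ν * w l (tmul (dsym 0) (tmul (dsym 0) ψ))

variable {P : DyadicPartition} {ν T : ℝ} {v w f c : ℝ → 𝓢'(Plane, CVec)} {w₀ : 𝓢'(Plane, CVec)}
  {p g : ℝ → 𝓢'(Plane, ℂ)}

lemma forcing_intervalIntegrable (hT : 0 ≤ T) (h : IsSolution P ν T v w w₀ p f g)
    (hc : WeaklyIntegrable T c) (l : Fin 2) (ψ : Test) :
    IntervalIntegrable (fun τ => forcing ν (fun i => coord i (f τ)) (g τ) (fun i => coord i (c τ))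
      (fun i => coord i (w τ)) l ψ) volume 0 T := by
  have h1 := (h.f_int.coord l).intervalIntegrable hT ψ
  have h2 := h.g_int.intervalIntegrable hT ψ
  have h3 := (hc.coord l).intervalIntegrable hT ψ
  have h4 := (h.w_int.coord l).intervalIntegrable hT (tmul (dsym 0) (tmul (dsym 0) ψ))
  refine ((h1.add ?_).sub h3).add (h4.const_mul (ν : ℂ))
  split_ifs
  · exact h2
  · exact intervalIntegrable_const

lemma coord_equation (hT : 0 ≤ T) (h : IsSolution P ν T v w w₀ p f g)
    (hc : WeaklyIntegrable T c) (heq : ∀ t ∈ Icc 0 T, ∀ ψ : 𝓢(Plane, ℂ),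
      w t ψ = w₀ ψ + ∫ τ in (0 : ℝ)..t,
        (f τ ψ + (WithLp.toLp 2 ![0, g τ ψ] : CVec) - c τ ψ
          + (ν : ℂ) • (pderiv 0 (pderiv 0 (w τ))) ψ - gradPairing (p τ) ψ))
    {t : ℝ} (ht : t ∈ Icc 0 T) (l : Fin 2) (ψ : Test) :
    coord l (w t) ψ = coord l (w 0) ψ + ∫ τ in (0 : ℝ)..t,
      (forcing ν (fun i => coord i (f τ)) (g τ) (fun i => coord i (c τ))
        (fun i => coord i (w τ)) l ψ - p τ (tmul (dsym l) ψ)) := by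
  have h0 : w 0 ψ = w₀ ψ := by
    rw [heq 0 ⟨le_rfl, hT⟩, intervalIntegral.integral_same, add_zero]
  have hsub : uIcc 0 t ⊆ uIcc 0 T := by
    rw [uIcc_of_le ht.1, uIcc_of_le hT]; exact Icc_subset_Icc_right ht.2
  have hg : IntervalIntegrable (fun τ => (WithLp.toLp 2 ![0, g τ ψ] : CVec)) volume 0 t := by
    have h1 := (h.g_int.intervalIntegrable hT ψ).mono_set hsub
    have h2 : (fun τ => (WithLp.toLp 2 ![0, g τ ψ] : CVec)) =
        fun τ => g τ ψ • (EuclideanSpace.single 1 1 : CVec) := by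
      funext τ; ext i; fin_cases i <;> simp
    rw [h2]
    exact ⟨h1.1.smul_const _, h1.2.smul_const _⟩
  have hp : IntervalIntegrable (fun τ => gradPairing (p τ) ψ) volume 0 t := by
    have h1 := fun i => ((h.grad_int i).intervalIntegrable hT ψ).mono_set hsub
    have h2 : (fun τ => gradPairing (p τ) ψ) =
        fun τ => pderiv 0 (p τ) ψ • (EuclideanSpace.single 0 1 : CVec) +
          pderiv 1 (p τ) ψ • (EuclideanSpace.single 1 1 : CVec) := by
      funext τ; ext i; fin_cases i <;> simp [gradPairing]
    rw [h2]
    exact IntervalIntegrable.add ⟨(h1 0).1.smul_const _, (h1 0).2.smul_const _⟩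
      ⟨(h1 1).1.smul_const _, (h1 1).2.smul_const _⟩
  have hw : IntervalIntegrable (fun τ => (ν : ℂ) • (pderiv 0 (pderiv 0 (w τ))) ψ) volume 0 t := by
    have h1 := (h.w_int.intervalIntegrable hT (tmul (dsym 0) (tmul (dsym 0) ψ))).mono_set hsub
    simp only [pderiv_apply]
    exact h1.smul (ν : ℂ)
  have hint := (((((h.f_int.intervalIntegrable hT ψ).mono_set hsub).add hg).sub
    ((hc.intervalIntegrable hT ψ).mono_set hsub)).add hw).sub hp
  have key := (EuclideanSpace.proj l : CVec →L[ℂ] ℂ).intervalIntegral_comp_comm hint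
  rw [coord_apply, coord_apply, heq t ht, h0]
  rw [PiLp.add_apply]
  congr 1
  refine key.symm.trans ?_
  refine intervalIntegral.integral_congr fun τ _ => ?_
  simp only [forcing, coord_apply]
  change f τ ψ l + (WithLp.toLp 2 ![0, g τ ψ] : CVec) l - c τ ψ l +
    ν * pderiv 0 (pderiv 0 (w τ)) ψ l - gradPairing (p τ) ψ l = _
  rw [pderiv_apply, pderiv_apply]
  have h1 : gradPairing (p τ) ψ l = p τ (tmul (dsym l) ψ) := by
    rw [← pderiv_apply]; rfl
  have h2 : (WithLp.toLp 2 ![0, g τ ψ] : CVec) l = if l = 1 then g τ ψ else 0 := by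
    fin_cases l <;> rfl
  rw [h1, h2]

lemma sum_pressure_eq_zero (k n : ℕ) (i : Fin 2) (q : Dist) (ψ : Test) :
    ∑ l, q (tmul (dsym l) (tmul (symb P k n) (tmul (leray P k n i l) ψ))) = 0 := by
  rw [← map_sum]
  have h1 : ∀ l, tmul (dsym l) (tmul (symb P k n) (tmul (leray P k n i l) ψ)) =
      tmul (symb P k n) (tmul (dsym l * (leray P k n i l : Plane → ℂ)) ψ) := fun l => by
    rw [tmul_comm (hasTemperateGrowth_dsym l) (symb P k n).hasTemperateGrowth,
      tmul_tmul (hasTemperateGrowth_dsym l) (leray P k n i l).hasTemperateGrowth]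
  simp only [h1]
  rw [← map_sum, ← tmul_sum _ fun l _ =>
    (hasTemperateGrowth_dsym l).mul (leray P k n i l).hasTemperateGrowth]
  have h2 : (fun ξ => ∑ l, (dsym l * (leray P k n i l : Plane → ℂ)) ξ) = fun _ => (0 : ℂ) :=
    funext fun ξ => by
      rw [← sum_leray_dsym P k n i ξ]
      exact Finset.sum_congr rfl fun l _ => mul_comm _ _
  rw [h2, tmul_zero, map_zero, map_zero]

/-- The equation is tested against the columns of the projection. Since `w` is divergence free the
left-hand side is unchanged, and since the projection annihilates gradients the pressure disappears.
-/
lemma localized_equation (hT : 0 ≤ T) (h : IsSolution P ν T v w w₀ p f g)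
    (hc : WeaklyIntegrable T c) (heq : ∀ t ∈ Icc 0 T, ∀ ψ : 𝓢(Plane, ℂ),
      w t ψ = w₀ ψ + ∫ τ in (0 : ℝ)..t,
        (f τ ψ + (WithLp.toLp 2 ![0, g τ ψ] : CVec) - c τ ψ
          + (ν : ℂ) • (pderiv 0 (pderiv 0 (w τ))) ψ - gradPairing (p τ) ψ))
    (k n : ℕ) {t : ℝ} (ht : t ∈ Icc 0 T) (i : Fin 2) (ψ : Test) :
    dmul (symb P k n) (coord i (w t)) ψ = dmul (symb P k n) (coord i (w 0)) ψ +
      ∫ τ in (0 : ℝ)..t, ∑ l, forcing ν (fun i => coord i (f τ)) (g τ) (fun i => coord i (c τ))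
        (fun i => coord i (w τ)) l (tmul (symb P k n) (tmul (leray P k n i l) ψ)) := by
  have hsub : uIcc 0 t ⊆ uIcc 0 T := by
    rw [uIcc_of_le ht.1, uIcc_of_le hT]; exact Icc_subset_Icc_right ht.2
  have hint : ∀ l, IntervalIntegrable (fun τ => forcing ν (fun i => coord i (f τ)) (g τ)
      (fun i => coord i (c τ)) (fun i => coord i (w τ)) l
      (tmul (symb P k n) (tmul (leray P k n i l) ψ)) -
      p τ (tmul (dsym l) (tmul (symb P k n) (tmul (leray P k n i l) ψ)))) volume 0 t := fun l => by
    refine ((forcing_intervalIntegrable hT h hc l _).mono_set hsub).sub ?_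
    have := ((h.grad_int l).intervalIntegrable hT
      (tmul (symb P k n) (tmul (leray P k n i l) ψ))).mono_set hsub
    simpa only [pderiv_apply] using this
  rw [dmul_apply, dmul_apply, ← sum_apply_leray (h.div_w t ht).sum_eq_zero,
    ← sum_apply_leray (h.div_w 0 ⟨le_rfl, hT⟩).sum_eq_zero]
  simp only [coord_equation hT h hc heq ht, Finset.sum_add_distrib]
  congr 1
  rw [← intervalIntegral.integral_finsetSum fun l _ => hint l]
  refine intervalIntegral.integral_congr fun τ _ => ?_
  simp only [Finset.sum_sub_distrib, sum_pressure_eq_zero, sub_zero]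

end AnisotropicStokes

/-! ### Real parts of the regularizations as transport fields -/

namespace AnisotropicStokes

open scoped FourierTransform

lemma integral_fourier_chiT (P : DyadicPartition) : ∫ x, 𝓕 (chiT P) x = 1 := by
  have h1 : ∫ x, 𝓕 (chiT P) x = 𝓕⁻ (𝓕 (chiT P)) 0 := by
    have h2 : (𝓕⁻ (𝓕 (chiT P)) : Test) 0 = 𝓕⁻ (⇑(𝓕 (chiT P) : Test)) 0 := by
      rw [SchwartzMap.fourierInv_coe]
    rw [h2, Real.fourierInv_eq']
    simp
  have h3 : (𝓕⁻ (𝓕 (chiT P)) : Test) = chiT P := FourierTransform.fourierInv_fourier_eq _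
  rw [h1, h3, chiT_apply, smul_zero, P.chi_eq_one (by simp), Complex.ofReal_one]

section ReField

variable {P : DyadicPartition} {K V : ℝ} {v : Fin 2 → Dist} {A : ℕ → Fin 2 → Plane → ℂ}

/-- Averaging against the kernel `𝓕 χ`, of integral one, compares the value at the origin with a
pairing of `v`, up to a Lipschitz error. The bound is integrable in time because `v ∈ L¹(𝓢')`; it
serves for integrability only and leaves no trace in the final constants. -/
lemma GoodField.norm_zero_le (h : GoodField P K V v A) (N : ℕ) (j : Fin 2) :
    ‖A N j 0‖ ≤ ‖v j (tmul (lowT P N) (𝓕 (chiT P)))‖ +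
      2 * (V * √(1 + (N : ℝ))) * kerMom (chiT P) := by
  set ψ : Test := 𝓕 (chiT P) with hψ
  have hi0 : Integrable (fun x => ψ x) := ψ.integrable (μ := volume)
  have hi1 : Integrable (fun x => ψ x * A N j x) := integrable_mul_temperate (h.temperate N j) ψ
  have hi2 : Integrable (fun x => ψ x * A N j 0) := hi0.mul_const _
  have h1 : A N j 0 = ∫ x, ψ x * A N j 0 := by
    rw [integral_mul_const, integral_fourier_chiT, one_mul]
  have h2 : ‖(∫ x, ψ x * A N j 0) - ∫ x, ψ x * A N j x‖ ≤
      2 * (V * √(1 + (N : ℝ))) * kerMom (chiT P) := by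
    rw [← integral_sub hi2 hi1, kerMom, ← integral_const_mul]
    refine (norm_integral_le_integral_norm _).trans ?_
    refine integral_mono (hi2.sub hi1).norm ((integrable_kerMom (chiT P)).const_mul _) fun x => ?_
    change ‖ψ x * A N j 0 - ψ x * A N j x‖ ≤ 2 * (V * √(1 + (N : ℝ))) * (‖x‖ * ‖ψ x‖)
    rw [← mul_sub, norm_mul]
    have := h.lipschitz N j 0 x
    rw [zero_sub, norm_neg] at this
    calc _ ≤ ‖ψ x‖ * (2 * (V * √(1 + (N : ℝ))) * ‖x‖) := by gcongr
      _ = _ := by ring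
  rw [← h.integral_eq]
  calc ‖A N j 0‖ = ‖(∫ x, ψ x * A N j x) + ((∫ x, ψ x * A N j 0) - ∫ x, ψ x * A N j x)‖ := by
        rw [add_sub_cancel, ← h1]
    _ ≤ _ := (norm_add_le _ _).trans (add_le_add_right h2 _)

lemma GoodField.transportField (h : GoodField P K V v A) (N : ℕ) :
    TransportField (reField A N) (∑ j, ‖v j (tmul (lowT P N) (𝓕 (chiT P)))‖ +
      2 * (V * √(1 + (N : ℝ))) * kerMom (chiT P)) (2 * (V * √(1 + (N : ℝ)))) where
  temperate j := h.temperate_reField N j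
  conj_eq j x := Complex.conj_ofReal _
  lipschitz j x y := by
    rw [reField, reField, ← Complex.ofReal_sub, ← Complex.sub_re, Complex.norm_real]
    exact (Complex.abs_re_le_norm _).trans (h.lipschitz N j x y)
  norm_zero_le j := by
    rw [reField, Complex.norm_real]
    refine (Complex.abs_re_le_norm _).trans ((h.norm_zero_le N j).trans ?_)
    gcongr
    exact Finset.single_le_sum (f := fun j => ‖v j (tmul (lowT P N) (𝓕 (chiT P)))‖)
      (fun _ _ => norm_nonneg _) (Finset.mem_univ j)
  div_eq x := by
    have h1 : ∀ j, fderiv ℝ (reField A N j) x (e j) = ((fderiv ℝ (A N j) x (e j)).re : ℂ) :=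
      fun j => by
        have hd : DifferentiableAt ℝ (A N j) x :=
          ((h.temperate N j).1.differentiable (by simp)).differentiableAt
        have := ((Complex.ofRealCLM.comp Complex.reCLM).hasFDerivAt.comp x hd.hasFDerivAt).fderiv
        exact congrArg (fun L : Plane →L[ℝ] ℂ => L (e j)) this
    simp only [h1]
    rw [← Complex.ofReal_sum, ← Complex.re_sum, h.div_eq, Complex.zero_re, Complex.ofReal_zero]

end ReField

/-- The square of the `L²` norm of a localized vector field. -/
def blockSq (P : DyadicPartition) (k n : ℕ) (u : 𝓢'(Plane, CVec)) : ℝ :=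
  ∑ i, ‖rep (dmul (symb P k n) (coord i u))‖ ^ 2

lemma blockSq_nonneg (P : DyadicPartition) (k n : ℕ) (u : 𝓢'(Plane, CVec)) :
    0 ≤ blockSq P k n u := Finset.sum_nonneg fun _ _ => by positivity

lemma sum_le_two_mul_sqrt (x : Fin 2 → ℝ) : ∑ i, x i ≤ 2 * √(∑ i, x i ^ 2) := by
  have h1 : (0 : ℝ) ≤ ∑ i, x i ^ 2 := Finset.sum_nonneg fun _ _ => by positivity
  refine (le_abs_self _).trans (abs_le_of_sq_le_sq ?_ (by positivity))
  rw [mul_pow, Real.sq_sqrt h1, Fin.sum_univ_two, Fin.sum_univ_two]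
  nlinarith [sq_nonneg (x 0 - x 1), sq_nonneg (x 0), sq_nonneg (x 1)]

end AnisotropicStokes

/-! ### Energy inequality for a localized block -/

namespace AnisotropicStokes

open scoped FourierTransform

/-- The bound of the convection term in a block, in terms of bounds `U` of the blocks of `w` and of
the bound `S` of the contribution of the high frequencies. -/
def convBound (n : ℕ) (U : ℕ → ℝ) (S : ℝ) : ℝ :=
  √(3 + (n : ℝ)) * (∑ n' ∈ Finset.range (n + 5), 2 ^ n' * ((2 : ℝ) ^ n)⁻¹ * U n') + S

lemma convBound_mono {n : ℕ} {U U' : ℕ → ℝ} {S S' : ℝ} (hU : ∀ n, U n ≤ U' n) (hS : S ≤ S') :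
    convBound n U S ≤ convBound n U' S' := by
  rw [convBound, convBound]
  gcongr
  exact hU _

lemma convBound_nonneg {n : ℕ} {U : ℕ → ℝ} {S : ℝ} (hU : ∀ n, 0 ≤ U n) (hS : 0 ≤ S) :
    0 ≤ convBound n U S :=
  add_nonneg (mul_nonneg (Real.sqrt_nonneg _) (Finset.sum_nonneg fun n' _ =>
    mul_nonneg (by positivity) (hU n'))) hS

/-- The contribution of the high frequencies to the convection term. -/
def convTail (n N : ℕ) (U : ℕ → ℝ) : ℝ :=
  ∑ l ∈ Finset.Ico (n + 2) N, 2 ^ n * ((2 : ℝ) ^ l)⁻¹ * √(3 + (l : ℝ)) *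
    (∑ n' ∈ Finset.Icc (l - 1) (l + 3), U n')

section BlockEnergy

variable {P : DyadicPartition}

lemma l2Bound_lowT {T : Dist} {U : ℕ → ℝ} (hU : ∀ n, L2Bound (dmul (blockT P n) T) (U n)) (N : ℕ) :
    L2Bound (dmul (lowT P N) T) (∑ n ∈ Finset.range (N + 1), U n) := by
  have h1 : dmul (lowT P N) T = ∑ n ∈ Finset.range (N + 1), dmul (blockT P n) T := by
    ext ψ
    rw [_root_.sum_apply, dmul_apply, tmul_lowT_eq_sum, map_sum]; rfl
  rw [h1]
  exact L2Bound.sum _ fun n _ => hU n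

lemma fop_symb_eq_rep {k n : ℕ} {T : Dist} {W : L2}
    (hW : (Lp.toTemperedDistribution W : Dist) = dmul (lowT P (n + 2)) T) {R : ℝ} (hR : 0 ≤ R)
    (h : L2Bound (dmul (symb P k n) T) R) : fop (symb P k n) W = rep (dmul (symb P k n) T) := by
  apply toDist_injective
  change (Lp.toTemperedDistribution _ : Dist) = Lp.toTemperedDistribution _
  rw [h.toDist_rep hR]
  exact toDist_fop_symb (w := fun _ => T) (W := fun _ => W) (fun _ => hW) 0

lemma fop_dsymT_rep {k n : ℕ} {u : 𝓢'(Plane, CVec)} {i : Fin 2} {R : ℝ} (hR : 0 ≤ R)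
    (h : L2Bound (dmul (symb P k n) (coord i u)) R) :
    fop (dsymT P n) (rep (dmul (symb P k n) (coord i u))) =
      rep (dmul (symb P k n) (coord i (pderiv 0 u))) := by
  have h1 : dmul (symb P k n) (coord i (pderiv 0 u)) =
      (Lp.toTemperedDistribution (fop (dsymT P n) (rep (dmul (symb P k n) (coord i u)))) : Dist) := by
    ext ψ
    rw [toDist_fop_apply, h.toDist_rep hR, coord_pderiv, pderiv_eq_dmul, dmul_apply, dmul_apply,
      dmul_apply, tmul_dsymT_symb, tmul_comm (symb P k n).hasTemperateGrowth
        (hasTemperateGrowth_dsym 0)]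
  rw [h1, rep_toDist]

/-- Combination of the fixed-time structure of the equation with the transport energy identity. The
constant depends neither on `k`, which permits the removal of the low frequency cut-off, nor on the
uniform bounds `Ub` and `Sb`, which only ensure integrability in time. The two estimates of `G` are
both kept, the first block and the others using different ones. -/
theorem exists_block_energy (P : DyadicPartition) : ∃ C : ℝ, 0 ≤ C ∧
    ∀ {ν T : ℝ} {v w f : ℝ → 𝓢'(Plane, CVec)} {V : ℝ → ℝ} {w₀ : 𝓢'(Plane, CVec)}
      {p g : ℝ → 𝓢'(Plane, ℂ)}, 0 < ν → 0 ≤ T → IsLosingField P T v V →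
      IsSolution P ν T v w w₀ p f g → ∀ {k n : ℕ}, 1 ≤ k →
    ∀ {U : ℕ → ℝ → ℝ} {S : ℝ → ℝ} {Ub : ℕ → ℝ} {Sb : ℝ} {fN gN : ℝ → ℝ},
      (∀ t ∈ Icc 0 T, ∀ n, 0 ≤ U n t ∧ U n t ≤ Ub n) →
      (∀ t ∈ Icc 0 T, ∀ n i, L2Bound (dmul (blockT P n) (coord i (w t))) (U n t)) →
      (∀ t ∈ Icc 0 T, S t ≤ Sb ∧ 0 ≤ S t ∧ ∀ N, convTail n N (fun n => U n t) ≤ S t) →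
      IntervalIntegrable fN volume 0 T → IntervalIntegrable gN volume 0 T →
      (∀ᵐ τ ∂volume.restrict (Ioc 0 T), 0 ≤ fN τ ∧ ∀ l,
        L2Bound (dmul (blockT P n) (coord l (f τ))) (fN τ)) →
      (∀ᵐ τ ∂volume.restrict (Ioc 0 T), 0 ≤ gN τ ∧ L2Bound (dmul (blockT P n) (g τ)) (gN τ)) →
      ∃ η : ℝ → ℝ, IntervalIntegrable η volume 0 T ∧
        (∀ t ∈ Icc 0 T, blockSq P k n (w t) = blockSq P k n (w 0) + ∫ τ in (0 : ℝ)..t, η τ) ∧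
        ∀ᵐ τ ∂volume.restrict (Ioc 0 T), ∃ G : ℝ,
          η τ ≤ 2 * (2 * √(blockSq P k n (w τ)) * (2 * fN τ +
              2 * (C * V τ * convBound n (fun n => U n τ) (S τ))) + G -
                ν * blockSq P k n (pderiv 0 (w τ))) ∧
          G ≤ 2 * √(blockSq P k n (w τ)) * gN τ ∧
          ∀ n', n = n' + 1 → G ≤ 2 * √(blockSq P k n (pderiv 0 (w τ))) *
            (8 / 3 * ((2 : ℝ) ^ n')⁻¹ * gN τ) := by
  obtain ⟨K, hK, hgood⟩ := exists_goodField P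
  obtain ⟨C, hC, hconv⟩ := exists_convection_bound P hK
  refine ⟨C, hC, ?_⟩
  intro ν T v w f V w₀ p g hν hT hv hsol k n hk U S Ub Sb fN gN hU hUw hS hfN hgN hf hg
  obtain ⟨c, hc, hcae, heq⟩ := hsol.equation
  obtain ⟨K', hK', hrhs⟩ := exists_block_rhs P k n
  have hIoc : Ioc (0 : ℝ) T ⊆ Icc 0 T := Ioc_subset_Icc_self
  have hVi : IntervalIntegrable V volume 0 T :=
    (intervalIntegrable_iff_integrableOn_Icc_of_le hT).2 hv.V_int
  have hu : ∀ t ∈ Icc 0 T, ∀ i, L2Bound (dmul (symb P k n) (coord i (w t))) (U n t) :=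
    fun t ht i => l2Bound_symb hk (hU t ht n).1 (hUw t ht n i)
  have hW : ∀ t ∈ Icc 0 T, ∀ i, (Lp.toTemperedDistribution
      (rep (dmul (lowT P (n + 2)) (coord i (w t)))) : Dist) =
        dmul (lowT P (n + 2)) (coord i (w t)) := fun t ht i =>
    (l2Bound_lowT (fun n => hUw t ht n i) (n + 2)).toDist_rep
      (Finset.sum_nonneg fun n _ => (hU t ht n).1)
  have hfop : ∀ t ∈ Icc 0 T, ∀ i, fop (symb P k n) (rep (dmul (lowT P (n + 2)) (coord i (w t)))) =
      rep (dmul (symb P k n) (coord i (w t))) := fun t ht i =>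
    fop_symb_eq_rep (hW t ht i) (hU t ht n).1 (hu t ht i)
  have hfd : ∀ t ∈ Icc 0 T, ∀ i, fop (dsymT P n) (rep (dmul (symb P k n) (coord i (w t)))) =
      rep (dmul (symb P k n) (coord i (pderiv 0 (w t)))) := fun t ht i =>
    fop_dsymT_rep (hU t ht n).1 (hu t ht i)
  set Rr : ℝ → ℝ := fun τ => C * V τ * convBound n (fun n => U n τ) (S τ) with hRr
  set L : ℝ → ℝ := fun τ => 2 * (V τ * √(1 + ((n + 2 : ℕ) : ℝ))) with hL
  set b : ℝ → ℝ := fun τ => ∑ j, ‖coord j (v τ) (tmul (lowT P (n + 2)) (𝓕 (chiT P)))‖ +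
      2 * (V τ * √(1 + ((n + 2 : ℕ) : ℝ))) * kerMom (chiT P) with hb
  have hex : ∀ᵐ τ ∂volume.restrict (Ioc 0 T), ∃ (B : Fin 2 → Plane → ℂ) (H : Fin 2 → L2) (G : ℝ),
      TransportField B (b τ) (L τ) ∧ 0 ≤ L τ ∧
      (∀ i ψ, (Lp.toTemperedDistribution (H i) : Dist) ψ -
          ∑ j, (Lp.toTemperedDistribution (rep (dmul (symb P k n) (coord i (w τ)))) : Dist)
            (tmul (dsym j) (SchwartzMap.smulLeftCLM ℂ (B j) ψ)) =
        ∑ l, forcing ν (fun i => coord i (f τ)) (g τ) (fun i => coord i (c τ))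
          (fun i => coord i (w τ)) l (tmul (symb P k n) (tmul (leray P k n i l) ψ))) ∧
      (∀ i, ‖H i‖ ≤ 2 * fN τ + gN τ + 2 * Rr τ + K' * (L τ + ν) * U n τ) ∧
      ∑ i, (inner ℂ (rep (dmul (symb P k n) (coord i (w τ)))) (H i)).re ≤
        2 * √(blockSq P k n (w τ)) * (2 * fN τ + 2 * Rr τ) + G -
          ν * blockSq P k n (pderiv 0 (w τ)) ∧
      G ≤ 2 * √(blockSq P k n (w τ)) * gN τ ∧
      ∀ n', n = n' + 1 → G ≤ 2 * √(blockSq P k n (pderiv 0 (w τ))) *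
        (8 / 3 * ((2 : ℝ) ^ n')⁻¹ * gN τ) := by
    filter_upwards [self_mem_ae_restrict measurableSet_Ioc, hf, hg,
      ae_restrict_of_ae_restrict_of_subset hIoc hcae,
      ae_restrict_of_ae_restrict_of_subset hIoc hv.v_real,
      ae_restrict_of_ae_restrict_of_subset hIoc hv.v_div,
      ae_restrict_of_ae_restrict_of_subset hIoc hv.V_nonneg,
      ae_restrict_of_ae_restrict_of_subset hIoc hv.grad_le] with
      τ hτ hfτ hgτ hcτ hreal hdivv hV0 hgrad
    have hτ' := hIoc hτ
    obtain ⟨A, hA, hlim⟩ := hgood (V τ) (v τ) (w τ) (c τ) hV0 hcτ hreal hdivv hgrad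
    have hL0 : 0 ≤ L τ := by simp only [hL]; positivity
    have hU0 : ∀ n, 0 ≤ U n τ := fun n => (hU τ hτ' n).1
    have hRr0 : 0 ≤ Rr τ :=
      mul_nonneg (mul_nonneg hC hV0) (convBound_nonneg hU0 (hS τ hτ').2.1)
    have hr : ∀ l ψ, ‖coord l (c τ) (tmul (symb P k n) ψ) - ∑ j, dmul (symb P k n) (coord l (w τ))
        (tmul (dsym j) (SchwartzMap.smulLeftCLM ℂ (reField A (n + 2) j) ψ))‖ ≤
          Rr τ * ‖ψ.toLp 2 (volume : Measure Plane)‖ := fun l ψ =>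
      hconv (V τ) _ A k n (coord l (w τ)) (coord l (c τ)) (fun n => U n τ) (S τ) hV0 hA hk hU0
        (fun n => hUw τ hτ' n l) (hlim l) (hS τ hτ').2.2 ψ
    obtain ⟨H, G, h1, h2, h3, h4, h5⟩ := hrhs (w := fun i => coord i (w τ))
      (c := fun i => coord i (c τ)) (f := fun i => coord i (f τ)) (g := g τ)
      (W := fun i => rep (dmul (lowT P (n + 2)) (coord i (w τ)))) hν.le hL0 (hU0 n) hfτ.1 hgτ.1 hRr0
      (hW τ hτ') (hsol.div_w τ hτ').sum_eq_zero (hA.transportField (n + 2)) (hu τ hτ')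
      (fun l => l2Bound_symb hk hfτ.1 (hfτ.2 l)) (l2Bound_symb hk hgτ.1 hgτ.2) hr
    simp only [hfop τ hτ', hfd τ hτ'] at h1 h3 h4 h5
    have hs1 : ∑ i, ‖rep (dmul (symb P k n) (coord i (w τ)))‖ ≤ 2 * √(blockSq P k n (w τ)) :=
      sum_le_two_mul_sqrt _
    have hs2 : ∑ i, ‖rep (dmul (symb P k n) (coord i (pderiv 0 (w τ))))‖ ≤
      2 * √(blockSq P k n (pderiv 0 (w τ))) := sum_le_two_mul_sqrt _
    have hf0 := hfτ.1
    have hg0 := hgτ.1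
    refine ⟨reField A (n + 2), H, G, hA.transportField (n + 2), hL0, h1, h2, h3.trans ?_,
      h4.trans ?_, fun n' hn' => (h5 n' hn').trans ?_⟩
    · have := mul_le_mul_of_nonneg_right hs1 (by positivity : 0 ≤ 2 * fN τ + 2 * Rr τ)
      rw [blockSq, blockSq] at *
      linarith
    · exact mul_le_mul_of_nonneg_right hs1 hg0
    · exact mul_le_mul_of_nonneg_right hs2 (by positivity)
  -- The choice at each time is not measurable a priori. This does not matter: the transport
  -- identity asks only for the integrability of pairings with test functions, which the equation
  -- supplies.
  obtain ⟨B, hB1⟩ := Filter.skolem.1 hex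
  obtain ⟨H, hB2⟩ := Filter.skolem.1 hB1
  obtain ⟨G, hBH⟩ := Filter.skolem.1 hB2
  have hLi : IntervalIntegrable L volume 0 T := (hVi.mul_const _).const_mul 2
  have hbi : IntervalIntegrable b volume 0 T := by
    refine IntervalIntegrable.add ?_ (hLi.mul_const _)
    have h1 := fun j => ((hv.v_int.coord j).intervalIntegrable hT
      (tmul (lowT P (n + 2)) (𝓕 (chiT P)))).norm
    simp only [Fin.sum_univ_two]
    exact (h1 0).add (h1 1)
  set ρ : ℝ → ℝ := fun τ => 2 * fN τ + gN τ + 2 * (C * V τ * convBound n Ub Sb) +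
    K' * (L τ + ν) * Ub n with hρ
  have hρi : IntervalIntegrable ρ volume 0 T :=
    (((hfN.const_mul 2).add hgN).add (((hVi.const_mul C).mul_const _).const_mul 2)).add
      (((hLi.add intervalIntegrable_const).const_mul K').mul_const _)
  have hHρ : ∀ i, ∀ᵐ τ ∂volume.restrict (Ioc 0 T), ‖H τ i‖ ≤ ρ τ := fun i => by
    filter_upwards [hBH, self_mem_ae_restrict measurableSet_Ioc,
      ae_restrict_of_ae_restrict_of_subset hIoc hv.V_nonneg] with τ hτ hτT hV0
    have hτ' := hIoc hτT
    refine (hτ.2.2.2.1 i).trans ?_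
    have h1 : Rr τ ≤ C * V τ * convBound n Ub Sb :=
      mul_le_mul_of_nonneg_left (convBound_mono (fun n => (hU τ hτ' n).2) (hS τ hτ').1)
        (mul_nonneg hC hV0)
    have h2 : K' * (L τ + ν) * U n τ ≤ K' * (L τ + ν) * Ub n :=
      mul_le_mul_of_nonneg_left (hU τ hτ' n).2 (mul_nonneg hK' (by linarith [hτ.2.1]))
    simp only [hρ]
    linarith
  have hen : ∀ i, _ := fun i => transport_energy P (u := fun t =>
      rep (dmul (symb P k n) (coord i (w t)))) (H := fun τ => H τ i) (B := B) (ρ := ρ) (b := b)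
      (L := L) (T := T) (M := Ub n) (N := n + 1) hT hρi hbi hLi
    (fun t ht => by
      rw [← hfop t ht i]
      exact fop_fop (lowT_mul_symb P k n) _)
    (fun t ht => ((hu t ht i).norm_rep_le (hU t ht n).1).trans (hU t ht n).2) (hHρ i)
    (hBH.mono fun τ hτ => ⟨hτ.1, hτ.2.1⟩)
    (fun ψ => by
      have h1 : IntervalIntegrable (fun τ => ∑ l, forcing ν (fun i => coord i (f τ)) (g τ)
          (fun i => coord i (c τ)) (fun i => coord i (w τ)) l
            (tmul (symb P k n) (tmul (leray P k n i l) ψ))) volume 0 T := by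
        simp only [Fin.sum_univ_two]
        exact (forcing_intervalIntegrable hT hsol hc 0 _).add
          (forcing_intervalIntegrable hT hsol hc 1 _)
      refine h1.congr_ae ?_
      rw [uIoc_of_le hT]
      exact hBH.mono fun τ hτ => (hτ.2.2.1 i ψ).symm)
    (fun t ht ψ => by
      rw [(hu t ht i).toDist_rep (hU t ht n).1,
        (hu 0 ⟨le_rfl, hT⟩ i).toDist_rep (hU 0 ⟨le_rfl, hT⟩ n).1,
        localized_equation hT hsol hc heq k n ht i ψ]
      congr 1
      refine intervalIntegral.integral_congr_ae_restrict ?_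
      rw [uIoc_of_le ht.1]
      exact (ae_restrict_of_ae_restrict_of_subset (Ioc_subset_Ioc_right ht.2) hBH).mono
        fun τ hτ => (hτ.2.2.1 i ψ).symm)
  refine ⟨fun τ => 2 * ∑ i, (inner ℂ (rep (dmul (symb P k n) (coord i (w τ)))) (H τ i)).re,
    ?_, fun t ht => ?_, ?_⟩
  · simp only [Fin.sum_univ_two]
    exact ((hen 0).1.add (hen 1).1).const_mul 2
  · have hsub : uIcc 0 t ⊆ uIcc 0 T := by
      rw [uIcc_of_le ht.1, uIcc_of_le hT]; exact Icc_subset_Icc_right ht.2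
    rw [intervalIntegral.integral_const_mul, intervalIntegral.integral_finsetSum fun i _ =>
      (hen i).1.mono_set hsub, blockSq, blockSq, Finset.mul_sum, ← Finset.sum_add_distrib]
    exact Finset.sum_congr rfl fun i _ => (hen i).2 t ht
  · filter_upwards [hBH] with τ hτ
    exact ⟨G τ, mul_le_mul_of_nonneg_left hτ.2.2.2.2.1 zero_le_two, hτ.2.2.2.2.2⟩

end BlockEnergy

end AnisotropicStokes

namespace AnisotropicStokes

/-! ### Scalar estimates -/

/-- If the weights vary by at most `2θ` per scale, the factors `2^{n'-n}` of the low frequencies and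
`2^{n-l}` of the high ones leave geometric series of ratio `θ < 1`. The growth of `√(3 + l)` is paid
by the factor `m + 3` in the series. -/
lemma exists_convBound_le {θ : ℝ} (h0 : 1 ≤ 2 * θ) (h1 : θ < 1) : ∃ C₁ C₂ : ℝ, 0 ≤ C₁ ∧ 0 ≤ C₂ ∧
    ∀ {ω : ℕ → ℝ} {Z : ℝ}, 0 ≤ Z → (∀ n, 0 < ω n) →
      (∀ n d, ω (n + d) ≤ (2 * θ) ^ d * ω n) → (∀ n d, ω n ≤ (2 * θ) ^ d * ω (n + d)) → ∀ n,
      (∀ N, convTail n N (fun n => Z / ω n) ≤ C₁ * √(3 + (n : ℝ)) * (Z / ω n)) ∧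
        convBound n (fun n => Z / ω n) (C₁ * √(3 + (n : ℝ)) * (Z / ω n)) ≤
          C₂ * √(3 + (n : ℝ)) * (Z / ω n) := by
  have hθ : 0 < θ := by linarith
  have hsum : Summable (fun m : ℕ => ((m : ℝ) + 3) * θ ^ m) := by
    have h2 : Summable (fun m : ℕ => (m : ℝ) ^ 1 * θ ^ m) :=
      summable_pow_mul_geometric_of_norm_lt_one 1 (by rwa [Real.norm_of_nonneg hθ.le])
    have h3 : Summable (fun m : ℕ => 3 * θ ^ m) :=
      (summable_geometric_of_lt_one hθ.le h1).mul_left 3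
    refine (h2.add h3).congr fun m => ?_
    rw [pow_one]; ring
  set c := ∑' m : ℕ, ((m : ℝ) + 3) * θ ^ m with hc
  have hc0 : 0 ≤ c := tsum_nonneg fun m => by positivity
  -- `40 = 5 · 2³`: five blocks meet each increment, and `2^{-2-m} (2θ)^{m+5} ≤ 2³ θ^m`. The term `4
  -- · 256` counts the four blocks above `n`, each of them at most `2⁴ · 2⁴`.
  refine ⟨40 * c, (1 - θ)⁻¹ + 4 * 256 + 40 * c, by positivity,
    add_nonneg (add_nonneg (inv_nonneg.2 (by linarith)) (by norm_num)) (by positivity), ?_⟩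
  intro ω Z hZ hω hup hdown n
  set x := Z / ω n with hx
  have hx0 : 0 ≤ x := div_nonneg hZ (hω n).le
  have hUd : ∀ d, Z / ω (n + d) ≤ (2 * θ) ^ d * x := fun d => by
    rw [hx, div_le_iff₀ (hω _)]
    calc Z = Z * (ω n / ω n) := by rw [div_self (hω n).ne', mul_one]
      _ ≤ Z * ((2 * θ) ^ d * ω (n + d) / ω n) := by
          gcongr
          · exact (hω n).le
          · exact hdown n d
      _ = _ := by ring
  have hUu : ∀ m d, m + d = n → Z / ω m ≤ (2 * θ) ^ d * x := fun m d hmd => by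
    rw [hx, div_le_iff₀ (hω _)]
    calc Z = Z * (ω n / ω n) := by rw [div_self (hω n).ne', mul_one]
      _ ≤ Z * ((2 * θ) ^ d * ω m / ω n) := by
          gcongr
          · exact (hω n).le
          · rw [← hmd]; exact hup m d
      _ = _ := by ring
  constructor
  · intro N
    rw [convTail, Finset.sum_Ico_eq_sum_range]
    have hterm : ∀ m, 2 ^ n * ((2 : ℝ) ^ (n + 2 + m))⁻¹ * √(3 + ((n + 2 + m : ℕ) : ℝ)) *
        (∑ n' ∈ Finset.Icc (n + 2 + m - 1) (n + 2 + m + 3), Z / ω n') ≤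
        40 * √(3 + (n : ℝ)) * x * (((m : ℝ) + 3) * θ ^ m) := fun m => by
      have e1 : ∑ n' ∈ Finset.Icc (n + 2 + m - 1) (n + 2 + m + 3), Z / ω n' ≤
          5 * ((2 * θ) ^ (m + 5) * x) := by
        have hcard : (Finset.Icc (n + 2 + m - 1) (n + 2 + m + 3)).card = 5 := by
          rw [Nat.card_Icc]; omega
        have := Finset.sum_le_card_nsmul (Finset.Icc (n + 2 + m - 1) (n + 2 + m + 3))
          (fun n' => Z / ω n') ((2 * θ) ^ (m + 5) * x) fun n' hn' => by
            rw [Finset.mem_Icc] at hn'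
            obtain ⟨d, rfl⟩ := Nat.exists_eq_add_of_le (show n ≤ n' by omega)
            exact (hUd d).trans (mul_le_mul_of_nonneg_right
              (pow_le_pow_right₀ h0 (by omega)) hx0)
        rwa [hcard, nsmul_eq_mul, Nat.cast_ofNat] at this
      have e2 : √(3 + ((n + 2 + m : ℕ) : ℝ)) ≤ √(3 + (n : ℝ)) * ((m : ℝ) + 3) := by
        rw [Real.sqrt_le_left (by positivity), mul_pow, Real.sq_sqrt (by positivity)]
        push_cast
        have hm : (0 : ℝ) ≤ m := Nat.cast_nonneg m
        have hn : (0 : ℝ) ≤ n := Nat.cast_nonneg n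
        nlinarith [mul_nonneg hm hn, mul_nonneg hm (mul_nonneg hm hn)]
      have e3 : (0 : ℝ) ≤ 2 ^ n * ((2 : ℝ) ^ (n + 2 + m))⁻¹ := by positivity
      calc _ ≤ 2 ^ n * ((2 : ℝ) ^ (n + 2 + m))⁻¹ * (√(3 + (n : ℝ)) * ((m : ℝ) + 3)) *
            (5 * ((2 * θ) ^ (m + 5) * x)) :=
            mul_le_mul (mul_le_mul_of_nonneg_left e2 e3) e1
              (Finset.sum_nonneg fun n' _ => div_nonneg hZ (hω n').le) (by positivity)
        _ = 40 * √(3 + (n : ℝ)) * x * (((m : ℝ) + 3) * θ ^ m) * θ ^ 5 := by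
            rw [mul_pow, pow_add, pow_add, pow_add, pow_add]; field_simp; ring
        _ ≤ _ := mul_le_of_le_one_right (by positivity) (pow_le_one₀ hθ.le h1.le)
    refine (Finset.sum_le_sum fun m _ => hterm m).trans ?_
    rw [← Finset.mul_sum]
    calc _ ≤ 40 * √(3 + (n : ℝ)) * x * c := by
          gcongr
          exact hsum.sum_le_tsum _ fun m _ => by positivity
      _ = _ := by ring
  · have e1 : ∑ n' ∈ Finset.range (n + 5), 2 ^ n' * ((2 : ℝ) ^ n)⁻¹ * (Z / ω n') ≤
        ((1 - θ)⁻¹ + 4 * 256) * x := by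
      rw [show n + 5 = (n + 1) + 4 by ring, Finset.sum_range_add, add_mul]
      refine add_le_add ?_ ?_
      · have h2 : ∀ n' ∈ Finset.range (n + 1), 2 ^ n' * ((2 : ℝ) ^ n)⁻¹ * (Z / ω n') ≤
            θ ^ (n - n') * x := fun n' hn' => by
          obtain ⟨d, hd⟩ := Nat.exists_eq_add_of_le (Nat.lt_succ_iff.1 (Finset.mem_range.1 hn'))
          rw [show n - n' = d by omega]
          calc _ ≤ 2 ^ n' * ((2 : ℝ) ^ n)⁻¹ * ((2 * θ) ^ d * x) := by
                gcongr; exact hUu n' d hd.symm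
            _ = θ ^ d * x := by rw [hd, mul_pow, pow_add]; field_simp
        refine (Finset.sum_le_sum h2).trans ?_
        rw [← Finset.sum_mul]
        refine mul_le_mul_of_nonneg_right ?_ hx0
        rw [← Finset.sum_range_reflect]
        have h3 : ∀ j ∈ Finset.range (n + 1), θ ^ (n - (n + 1 - 1 - j)) = θ ^ j := fun j hj => by
          congr 1
          have := Finset.mem_range.1 hj
          omega
        rw [Finset.sum_congr rfl h3, ← tsum_geometric_of_lt_one hθ.le h1]
        exact (summable_geometric_of_lt_one hθ.le h1).sum_le_tsum _ fun m _ => by positivity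
      · have h2 : ∀ j ∈ Finset.range 4, 2 ^ (n + 1 + j) * ((2 : ℝ) ^ n)⁻¹ * (Z / ω (n + 1 + j)) ≤
            256 * x := fun j hj => by
          have hj' := Finset.mem_range.1 hj
          calc _ ≤ 2 ^ (n + 1 + j) * ((2 : ℝ) ^ n)⁻¹ * ((2 * θ) ^ (1 + j) * x) := by
                gcongr
                have := hUd (1 + j)
                rwa [← add_assoc] at this
            _ = 2 ^ (1 + j) * (2 * θ) ^ (1 + j) * x := by
                rw [add_assoc, pow_add]; field_simp
            _ ≤ 2 ^ 4 * 2 ^ 4 * x := by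
                gcongr
                · norm_num
                · omega
                · calc (2 * θ) ^ (1 + j) ≤ 2 ^ (1 + j) := by
                        gcongr; linarith
                    _ ≤ 2 ^ 4 := by
                        gcongr
                        · norm_num
                        · omega
            _ = 256 * x := by norm_num
        refine (Finset.sum_le_sum h2).trans (le_of_eq ?_)
        rw [Finset.sum_const, Finset.card_range, nsmul_eq_mul]; push_cast; ring
    rw [convBound]
    calc _ ≤ √(3 + (n : ℝ)) * (((1 - θ)⁻¹ + 4 * 256) * x) + 40 * c * √(3 + (n : ℝ)) * x := by
          gcongr
      _ = _ := by ring

lemma integral_zero_mono {h : ℝ → ℝ} {r t T : ℝ} (hi : IntervalIntegrable h volume 0 T)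
    (h0 : ∀ᵐ τ ∂volume.restrict (Ioc 0 T), 0 ≤ h τ) (hr : r ∈ Icc 0 t) (ht : t ∈ Icc 0 T) :
    ∫ τ in (0 : ℝ)..r, h τ ≤ ∫ τ in (0 : ℝ)..t, h τ := by
  have hsub : ∀ {x y : ℝ}, 0 ≤ x → x ≤ y → y ≤ T → uIcc x y ⊆ uIcc 0 T := fun {x y} hx hxy hy => by
    rw [uIcc_of_le hxy, uIcc_of_le (hx.trans (hxy.trans hy))]; exact Icc_subset_Icc hx hy
  have h1 : (∫ τ in (0 : ℝ)..t, h τ) - ∫ τ in (0 : ℝ)..r, h τ = ∫ τ in r..t, h τ :=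
    intervalIntegral.integral_interval_sub_left (hi.mono_set (hsub le_rfl ht.1 ht.2))
      (hi.mono_set (hsub le_rfl hr.1 (hr.2.trans ht.2)))
  have h2 : 0 ≤ ∫ τ in r..t, h τ := by
    refine intervalIntegral.integral_nonneg_of_ae_restrict hr.2 ?_
    rw [← restrict_Ioc_eq_restrict_Icc]
    exact ae_restrict_of_ae_restrict_of_subset (Ioc_subset_Ioc hr.1 ht.2) h0
  linarith

/-- A weighted Gronwall estimate. -/
lemma weighted_energy_le {E V ψ a b d : ℝ → ℝ} {T κ c Z B E₀ : ℝ} (hT : 0 ≤ T) (hκ : 0 < κ)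
    (hc : 0 ≤ c) (hB : 0 < B) (hE : ∀ t ∈ Icc 0 T, 0 ≤ E t)
    (hV : IntervalIntegrable V volume 0 T) (hψ : IntervalIntegrable ψ volume 0 T)
    (ha : IntervalIntegrable a volume 0 T) (hb : IntervalIntegrable b volume 0 T)
    (hV0 : ∀ᵐ τ ∂volume.restrict (Ioc 0 T), 0 ≤ V τ)
    (hEq : ∀ t ∈ Icc 0 T, E t = E₀ + ∫ τ in (0 : ℝ)..t, ψ τ)
    (hd0 : ∀ᵐ τ ∂volume.restrict (Ioc 0 T), 0 ≤ a τ ∧ 0 ≤ b τ ∧ 0 ≤ d τ)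
    (hdm : AEStronglyMeasurable d (volume.restrict (Ioc 0 T)))
    (hZ : ∀ t ∈ Icc 0 T, B * Real.exp (-κ * ∫ τ in (0 : ℝ)..t, V τ) * √(E t) ≤ Z)
    (hle : ∀ᵐ τ ∂volume.restrict (Ioc 0 T), ψ τ ≤ 4 * √(E τ) * (a τ +
      c * V τ * (Z / (B * Real.exp (-κ * ∫ σ in (0 : ℝ)..τ, V σ)))) - d τ + b τ) :
    IntervalIntegrable d volume 0 T ∧ ∀ t ∈ Icc 0 T,
      B ^ 2 * Real.exp (-κ * ∫ τ in (0 : ℝ)..t, V τ) * E t +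
        B ^ 2 * Real.exp (-κ * ∫ τ in (0 : ℝ)..t, V τ) * (∫ τ in (0 : ℝ)..t, d τ) ≤
        B ^ 2 * E₀ + 4 * B * Z * (∫ τ in (0 : ℝ)..T, a τ) + B ^ 2 * (∫ τ in (0 : ℝ)..T, b τ) +
          4 * c ^ 2 / κ ^ 2 * Z ^ 2 * Real.exp (κ * ∫ τ in (0 : ℝ)..t, V τ) := by
  set W : ℝ → ℝ := fun t => ∫ τ in (0 : ℝ)..t, V τ with hW
  set X : ℝ → ℝ := fun t => Real.exp (-κ * W t) with hX
  have hX0 : ∀ t, 0 < X t := fun t => Real.exp_pos _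
  have hsub : ∀ {r t : ℝ}, r ∈ Icc 0 t → t ∈ Icc 0 T → uIcc r t ⊆ uIcc 0 T := fun {r t} hr ht => by
    rw [uIcc_of_le hr.2, uIcc_of_le hT]; exact Icc_subset_Icc hr.1 ht.2
  have h0T : ∀ {t : ℝ}, t ∈ Icc 0 T → (0 : ℝ) ∈ Icc 0 t := fun ht => ⟨le_rfl, ht.1⟩
  have hWmono : ∀ {r t : ℝ}, r ∈ Icc 0 t → t ∈ Icc 0 T → W r ≤ W t :=
    integral_zero_mono hV hV0
  have hW0 : ∀ {t : ℝ}, t ∈ Icc 0 T → 0 ≤ W t := fun {t} ht => by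
    have := hWmono (h0T ht) ht
    rwa [show W 0 = 0 from intervalIntegral.integral_same] at this
  have hX1 : ∀ {t : ℝ}, t ∈ Icc 0 T → X t ≤ 1 := fun {t} ht =>
    Real.exp_le_one_iff.2 (mul_nonpos_of_nonpos_of_nonneg (by linarith) (hW0 ht))
  have hXmono : ∀ {r t : ℝ}, r ∈ Icc 0 t → t ∈ Icc 0 T → X t ≤ X r := fun hr ht =>
    Real.exp_le_exp.2 (mul_le_mul_of_nonpos_left (hWmono hr ht) (by linarith))
  have hZ0 : 0 ≤ Z := le_trans (by positivity) (hZ 0 ⟨le_rfl, hT⟩)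
  have hTT : T ∈ Icc 0 T := ⟨hT, le_rfl⟩
  have hIoc : Ioc (0 : ℝ) T ⊆ Icc 0 T := Ioc_subset_Icc_self
  have hWc : ContinuousOn W (uIcc 0 T) :=
    intervalIntegral.continuousOn_primitive_interval' hV left_mem_uIcc
  have hXc : ContinuousOn X (uIcc 0 T) := (continuousOn_const.mul hWc).rexp
  have hXic : ContinuousOn (fun t => (X t)⁻¹) (uIcc 0 T) := hXc.inv₀ fun t _ => (hX0 t).ne'
  set M := Z / (B * X T) with hM
  have hBX : 0 < B * X T := mul_pos hB (hX0 T)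
  have hM' : ∀ {τ}, τ ∈ Icc 0 T → Z / (B * X τ) ≤ M := fun {τ} hτ =>
    div_le_div_of_nonneg_left hZ0 hBX (mul_le_mul_of_nonneg_left (hXmono hτ hTT) hB.le)
  have hEM : ∀ {τ}, τ ∈ Icc 0 T → √(E τ) ≤ M := fun {τ} hτ => by
    refine le_trans ?_ (hM' hτ)
    rw [le_div_iff₀ (mul_pos hB (hX0 τ)), mul_comm]
    exact hZ τ hτ
  have hM0 : 0 ≤ M := (Real.sqrt_nonneg _).trans (hEM hTT)
  -- The dissipation is not assumed integrable: the differential inequality itself dominates it by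
  -- an integrable function, once `E` has been bounded through `Z`.
  have hdi : IntervalIntegrable d volume 0 T := by
    have hbd : IntervalIntegrable (fun τ => 4 * M * (a τ + c * V τ * M) + b τ - ψ τ) volume 0 T :=
      (((ha.add ((hV.const_mul c).mul_const M)).const_mul (4 * M)).add hb).sub hψ
    refine hbd.mono_fun' (by rwa [uIoc_of_le hT]) ?_
    rw [uIoc_of_le hT]
    filter_upwards [hle, hd0, hV0, self_mem_ae_restrict measurableSet_Ioc] with τ h1 h2 h3 h4
    have hτ := hIoc h4
    rw [Real.norm_of_nonneg h2.2.2]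
    have h5 : 4 * √(E τ) * (a τ + c * V τ * (Z / (B * X τ))) ≤ 4 * M * (a τ + c * V τ * M) := by
      have hcV : 0 ≤ c * V τ := mul_nonneg hc h3
      have := hM' hτ
      have h6 : 0 ≤ Z / (B * X τ) := div_nonneg hZ0 (mul_pos hB (hX0 τ)).le
      refine mul_le_mul (by linarith [hEM hτ]) ?_ (add_nonneg h2.1 (mul_nonneg hcV h6))
        (by positivity)
      exact add_le_add le_rfl (mul_le_mul_of_nonneg_left this hcV)
    change ψ τ ≤ 4 * √(E τ) * (a τ + c * V τ * (Z / (B * X τ))) - d τ + b τ at h1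
    linarith
  refine ⟨hdi, fun t ht => ?_⟩
  have h0t : uIcc 0 t ⊆ uIcc 0 T := hsub (h0T ht) ht
  have hVt := hV.mono_set h0t
  have hψt := hψ.mono_set h0t
  have hdt := hdi.mono_set h0t
  have hXct := hXc.mono h0t
  have hIt : Ioc 0 t ⊆ Ioc 0 T := Ioc_subset_Ioc_right ht.2
  have hα : IntervalIntegrable (fun τ => -κ * V τ * X τ) volume 0 t :=
    (hVt.const_mul (-κ)).mul_continuousOn hXct
  have hexp : ∀ r ∈ Icc 0 t, X r = 1 + ∫ τ in (0 : ℝ)..r, -κ * V τ * X τ := fun r hr =>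
    exp_primitive (hV.mono_set (hsub (h0T ⟨hr.1, hr.2.trans ht.2⟩) ⟨hr.1, hr.2.trans ht.2⟩)) (-κ)
  have hprod := primitive_mul hα hψt 1 E₀
  rw [← hexp t ⟨ht.1, le_rfl⟩, ← hEq t ht, one_mul] at hprod
  have hαE : IntervalIntegrable (fun τ => -κ * V τ * X τ * (E₀ + ∫ σ in (0 : ℝ)..τ, ψ σ))
      volume 0 t :=
    hα.mul_continuousOn (continuousOn_const.add
      (intervalIntegral.continuousOn_primitive_interval' hψt left_mem_uIcc))
  have hXψ : IntervalIntegrable (fun τ => (1 + ∫ σ in (0 : ℝ)..τ, -κ * V σ * X σ) * ψ τ)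
      volume 0 t :=
    hψt.continuousOn_mul (continuousOn_const.add
      (intervalIntegral.continuousOn_primitive_interval' hα left_mem_uIcc))
  have hVX : IntervalIntegrable (fun τ => κ * V τ * (X τ)⁻¹) volume 0 t :=
    (hVt.const_mul κ).mul_continuousOn (hXic.mono h0t)
  have hXd : IntervalIntegrable (fun τ => X τ * d τ) volume 0 t := hdt.continuousOn_mul hXct
  have hat := ha.mono_set h0t
  have hbt := hb.mono_set h0t
  set K := 4 * c ^ 2 / κ ^ 2 * Z ^ 2 with hK
  have key : ∫ τ in (0 : ℝ)..t, (B ^ 2 * (-κ * V τ * X τ * (E₀ + ∫ σ in (0 : ℝ)..τ, ψ σ) +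
      (1 + ∫ σ in (0 : ℝ)..τ, -κ * V σ * X σ) * ψ τ)) ≤
      ∫ τ in (0 : ℝ)..t, (4 * B * Z * a τ + B ^ 2 * b τ + K * (κ * V τ * (X τ)⁻¹) -
        B ^ 2 * (X τ * d τ)) := by
    refine intervalIntegral.integral_mono_ae_restrict ht.1 ((hαE.add hXψ).const_mul _)
      ((((hat.const_mul _).add (hbt.const_mul _)).add (hVX.const_mul _)).sub (hXd.const_mul _)) ?_
    rw [← restrict_Ioc_eq_restrict_Icc]
    filter_upwards [ae_restrict_of_ae_restrict_of_subset hIt hle,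
      ae_restrict_of_ae_restrict_of_subset hIt hd0, ae_restrict_of_ae_restrict_of_subset hIt hV0,
      self_mem_ae_restrict measurableSet_Ioc] with τ h1 h2 h3 h4
    have hτt : τ ∈ Icc 0 t := Ioc_subset_Icc_self h4
    have hτ : τ ∈ Icc 0 T := hIoc (hIt h4)
    rw [← hexp τ hτt, ← hEq τ hτ]
    change ψ τ ≤ 4 * √(E τ) * (a τ + c * V τ * (Z / (B * X τ))) - d τ + b τ at h1
    have hx := hX0 τ
    have hx1 := hX1 hτ
    have hZτ : B * X τ * √(E τ) ≤ Z := hZ τ hτ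
    set y := √(E τ) with hy
    have hy0 : 0 ≤ y := Real.sqrt_nonneg _
    have hyE : E τ = y ^ 2 := (Real.sq_sqrt (hE τ hτ)).symm
    rw [hyE]
    have e1 : B ^ 2 * (X τ * ψ τ) ≤ B ^ 2 * (X τ * (4 * y * (a τ + c * V τ * (Z / (B * X τ))) -
        d τ + b τ)) := by gcongr
    have e2 : B ^ 2 * (X τ * (4 * y * (a τ + c * V τ * (Z / (B * X τ))) - d τ + b τ)) =
        4 * B * (B * X τ * y) * a τ + 4 * c * V τ * Z * (B * y) - B ^ 2 * (X τ * d τ) +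
          X τ * (B ^ 2 * b τ) := by
      field_simp
    have e3 : 4 * B * (B * X τ * y) * a τ ≤ 4 * B * Z * a τ := by
      have := h2.1
      gcongr
    have e4 : X τ * (B ^ 2 * b τ) ≤ B ^ 2 * b τ :=
      mul_le_of_le_one_left (mul_nonneg (by positivity) h2.2.1) hx1
    -- Young's inequality. The first term is exactly the damping produced by the derivative of the
    -- weight `X`; the second is `K` times the derivative of `exp(κ W)`, since `X⁻¹ = exp(κ W)`.
    have e5 : 4 * c * V τ * Z * (B * y) ≤ κ * V τ * X τ * (B * y) ^ 2 + K * (κ * V τ * (X τ)⁻¹) := by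
      have e6 : κ * V τ * X τ * (B * y) ^ 2 + K * (κ * V τ * (X τ)⁻¹) - 4 * c * V τ * Z * (B * y) =
          V τ * ((κ * X τ * (B * y) - 2 * c * Z) ^ 2 / (κ * X τ)) := by
        rw [hK]; field_simp; ring
      have e7 : 0 ≤ V τ * ((κ * X τ * (B * y) - 2 * c * Z) ^ 2 / (κ * X τ)) := by positivity
      linarith
    have e8 : κ * V τ * X τ * (B * y) ^ 2 = B ^ 2 * (κ * V τ * X τ * y ^ 2) := by ring
    linarith
  have hE1 : B ^ 2 * (X t * E t) = B ^ 2 * E₀ + ∫ τ in (0 : ℝ)..t,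
      (B ^ 2 * (-κ * V τ * X τ * (E₀ + ∫ σ in (0 : ℝ)..τ, ψ σ) +
      (1 + ∫ σ in (0 : ℝ)..τ, -κ * V σ * X σ) * ψ τ)) := by
    rw [hprod, intervalIntegral.integral_const_mul]; ring
  have hR : ∫ τ in (0 : ℝ)..t, (4 * B * Z * a τ + B ^ 2 * b τ + K * (κ * V τ * (X τ)⁻¹) -
        B ^ 2 * (X τ * d τ)) = 4 * B * Z * (∫ τ in (0 : ℝ)..t, a τ) +
          B ^ 2 * (∫ τ in (0 : ℝ)..t, b τ) + K * (∫ τ in (0 : ℝ)..t, κ * V τ * (X τ)⁻¹) -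
          B ^ 2 * ∫ τ in (0 : ℝ)..t, X τ * d τ := by
    rw [intervalIntegral.integral_sub (((hat.const_mul _).add (hbt.const_mul _)).add
      (hVX.const_mul _)) (hXd.const_mul _), intervalIntegral.integral_add
      ((hat.const_mul _).add (hbt.const_mul _)) (hVX.const_mul _), intervalIntegral.integral_add
      (hat.const_mul _) (hbt.const_mul _), intervalIntegral.integral_const_mul,
      intervalIntegral.integral_const_mul, intervalIntegral.integral_const_mul,
      intervalIntegral.integral_const_mul]
  have hexp2 : ∫ τ in (0 : ℝ)..t, κ * V τ * (X τ)⁻¹ = Real.exp (κ * W t) - 1 := by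
    have h1 := exp_primitive hVt κ
    have h2 : ∀ τ, (X τ)⁻¹ = Real.exp (κ * W τ) := fun τ => by
      rw [hX, ← Real.exp_neg]; congr 1; ring
    simp only [h2]
    linarith
  have hXdle : X t * (∫ τ in (0 : ℝ)..t, d τ) ≤ ∫ τ in (0 : ℝ)..t, X τ * d τ := by
    rw [← intervalIntegral.integral_const_mul]
    refine intervalIntegral.integral_mono_ae_restrict ht.1 (hdt.const_mul _) hXd ?_
    rw [← restrict_Ioc_eq_restrict_Icc]
    filter_upwards [ae_restrict_of_ae_restrict_of_subset hIt hd0,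
      self_mem_ae_restrict measurableSet_Ioc] with τ h2 h4
    exact mul_le_mul_of_nonneg_right (hXmono (Ioc_subset_Icc_self h4) ht) h2.2.2
  have hK0 : 0 ≤ K := by positivity
  have f1 := mul_le_mul_of_nonneg_left (integral_zero_mono ha (hd0.mono fun τ h => h.1) ht hTT)
    (by positivity : 0 ≤ 4 * B * Z)
  have f2 := mul_le_mul_of_nonneg_left (integral_zero_mono hb (hd0.mono fun τ h => h.2.1) ht hTT)
    (by positivity : 0 ≤ B ^ 2)
  have f3 := mul_le_mul_of_nonneg_left hXdle (by positivity : 0 ≤ B ^ 2)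
  rw [hR, hexp2] at key
  change B ^ 2 * X t * E t + B ^ 2 * X t * (∫ τ in (0 : ℝ)..t, d τ) ≤ B ^ 2 * E₀ +
    4 * B * Z * (∫ τ in (0 : ℝ)..T, a τ) + B ^ 2 * (∫ τ in (0 : ℝ)..T, b τ) +
      K * Real.exp (κ * W t)
  have f4 : B ^ 2 * X t * E t = B ^ 2 * (X t * E t) := by ring
  have f5 : B ^ 2 * X t * (∫ τ in (0 : ℝ)..t, d τ) = B ^ 2 * (X t * ∫ τ in (0 : ℝ)..t, d τ) := by
    ring
  rw [f4, f5, hE1]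
  linarith

end AnisotropicStokes

/-! ### Removal of the low frequency cut-off -/

namespace AnisotropicStokes

open scoped FourierTransform

variable {P : DyadicPartition}

/-- The square of the `L²` norm of `Δ_{n-1} u`. -/
def blockEnergy (P : DyadicPartition) (n : ℕ) (u : 𝓢'(Plane, CVec)) : ℝ :=
  ∑ i, ‖rep (dmul (blockT P n) (coord i u))‖ ^ 2

lemma blockEnergy_nonneg (n : ℕ) (u : 𝓢'(Plane, CVec)) : 0 ≤ blockEnergy P n u :=
  Finset.sum_nonneg fun _ _ => by positivity

lemma norm_rep_le_sqrt_blockEnergy (n : ℕ) (u : 𝓢'(Plane, CVec)) (i : Fin 2) :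
    ‖rep (dmul (blockT P n) (coord i u))‖ ≤ √(blockEnergy P n u) :=
  Real.le_sqrt_of_sq_le (Finset.single_le_sum
    (f := fun i => ‖rep (dmul (blockT P n) (coord i u))‖ ^ 2) (fun _ _ => by positivity)
    (Finset.mem_univ i))

lemma l2Bound_rep {T : Dist} {R : ℝ} (hR : 0 ≤ R) (h : L2Bound T R) : L2Bound T ‖rep T‖ := by
  have := l2Bound_toDist (rep T)
  rwa [h.toDist_rep hR] at this

lemma l2Bound_block_pderiv {T : Dist} {n : ℕ} {R : ℝ} (hR : 0 ≤ R)
    (h : L2Bound (dmul (blockT P n) T) R) (j : Fin 2) :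
    L2Bound (dmul (blockT P n) (pderiv j T)) (R * (8 / 3 * 2 ^ n)) := fun ψ => by
  rw [dmul_apply, pderiv_apply, tmul_comm (hasTemperateGrowth_dsym j)
    (blockT P n).hasTemperateGrowth, mul_assoc]
  exact norm_apply_blockT_dsym_le (P := P) hR (blockT P n).hasTemperateGrowth
    (fun ξ => blockT_eq_zero_of_gt P) h j ψ

/-- Only the first block depends on `k`. The symbol of the removed part is bounded and tends to zero
except at the origin, so the removed part tends to zero strongly in `L²`. -/
lemma tendsto_rep_symb {T : Dist} {n : ℕ} {R : ℝ} (hR : 0 ≤ R)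
    (h : L2Bound (dmul (blockT P n) T) R) :
    Tendsto (fun k => rep (dmul (symb P k n) T)) atTop (𝓝 (rep (dmul (blockT P n) T))) := by
  cases n with
  | succ n => exact tendsto_const_nhds
  | zero =>
    set u := rep (dmul (blockT P 0) T) with hu
    have hK : ∀ k ξ, ‖contr k (chiT P) ξ‖ ≤ 1 := fun k ξ => norm_blockT_le P 0 _
    have h0 : ∀ᵐ x ∂(volume : Measure Plane),
        Tendsto (fun k => contr k (chiT P) (-x)) atTop (𝓝 0) := by
      filter_upwards [compl_mem_ae_iff.2 (measure_singleton (0 : Plane))] with x hx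
      have hx' : 0 < ‖x‖ := norm_pos_iff.2 hx
      have h1 : Tendsto (fun k : ℕ => (2 : ℝ) ^ k * (2 * Real.pi * ‖-x‖)) atTop atTop :=
        (tendsto_pow_atTop_atTop_of_one_lt one_lt_two).atTop_mul_const
          (by rw [norm_neg]; positivity)
      refine tendsto_const_nhds.congr' ?_
      filter_upwards [h1.eventually_gt_atTop (4 / 3)] with k hk
      exact (contr_chiT_eq_zero P k hk).symm
    have h1 := (tendsto_fop_zero (fun k => (contr k (chiT P)).hasTemperateGrowth) hK h0 u).const_sub u
    rw [sub_zero] at h1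
    refine h1.congr' ?_
    filter_upwards [eventually_ge_atTop 1] with k hk
    have h2 : (symb P k 0 : Plane → ℂ) =
        (blockT P 0 : Plane → ℂ) - (blockT P 0 : Plane → ℂ) * (contr k (chiT P) : Plane → ℂ) :=
      funext fun ξ => by
        rw [Pi.sub_apply, Pi.mul_apply, symb_zero_apply, blockT]
        congr 1
        by_cases h : 4 / 3 < 2 ^ k * (2 * Real.pi * ‖ξ‖)
        · rw [contr_chiT_eq_zero P k h, mul_zero]
        · rw [chiT_apply, P.chi_eq_one, Complex.ofReal_one, one_mul]
          rw [not_lt] at h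
          have : (2 : ℝ) ^ 1 ≤ 2 ^ k := pow_le_pow_right₀ (by norm_num) hk
          have h0 : 0 ≤ 2 * Real.pi * ‖ξ‖ := by positivity
          rw [norm_two_pi_smul]
          nlinarith
    have h3 : dmul (symb P k 0) T =
        (Lp.toTemperedDistribution (u - fop (contr k (chiT P)) u) : Dist) := by
      rw [toDist_sub]
      ext ψ
      change _ = (Lp.toTemperedDistribution u : Dist) ψ -
        (Lp.toTemperedDistribution (fop (contr k (chiT P)) u) : Dist) ψ
      rw [toDist_fop_apply, hu, h.toDist_rep hR, dmul_apply, dmul_apply, dmul_apply, h2,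
        tmul_sub (blockT P 0).hasTemperateGrowth
          ((blockT P 0).hasTemperateGrowth.mul (contr k (chiT P)).hasTemperateGrowth), map_sub,
        tmul_tmul (blockT P 0).hasTemperateGrowth (contr k (chiT P)).hasTemperateGrowth]
    rw [h3, rep_toDist]

lemma blockSq_le_blockEnergy {k n : ℕ} (hk : 1 ≤ k) {u : 𝓢'(Plane, CVec)} {R : ℝ} (hR : 0 ≤ R)
    (h : ∀ i, L2Bound (dmul (blockT P n) (coord i u)) R) :
    blockSq P k n u ≤ blockEnergy P n u :=
  Finset.sum_le_sum fun i _ => pow_le_pow_left₀ (norm_nonneg _)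
    ((l2Bound_symb hk (norm_nonneg _) (l2Bound_rep hR (h i))).norm_rep_le (norm_nonneg _)) 2

lemma tendsto_blockSq {n : ℕ} {u : 𝓢'(Plane, CVec)} {R : ℝ} (hR : 0 ≤ R)
    (h : ∀ i, L2Bound (dmul (blockT P n) (coord i u)) R) :
    Tendsto (fun k => blockSq P k n u) atTop (𝓝 (blockEnergy P n u)) :=
  tendsto_finsetSum _ fun i _ => (tendsto_rep_symb hR (h i)).norm.pow 2

lemma aemeasurable_blockSq {T : ℝ} {w : ℝ → 𝓢'(Plane, CVec)} (hw : WeaklyIntegrable T w)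
    {k n : ℕ} (hk : 1 ≤ k) {R : ℝ} (hR : 0 ≤ R)
    (h : ∀ t ∈ Icc 0 T, ∀ i, L2Bound (dmul (blockT P n) (coord i (w t))) R) :
    AEMeasurable (fun τ => blockSq P k n (w τ)) (volume.restrict (Ioc 0 T)) := by
  refine Finset.aemeasurable_fun_sum _ fun i _ => AEMeasurable.pow_const ?_ 2
  refine aemeasurable_norm_of_weak fun ψ => ?_
  have h1 := ((hw.coord i (tmul (symb P k n) ψ)).mono_set Ioc_subset_Icc_self).aemeasurable
  refine h1.congr ?_
  filter_upwards [self_mem_ae_restrict measurableSet_Ioc] with τ hτ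
  rw [(l2Bound_symb hk hR (h τ (Ioc_subset_Icc_self hτ) i)).toDist_rep hR]; rfl

lemma WeaklyIntegrable.pderiv {T : ℝ} {w : ℝ → 𝓢'(Plane, CVec)} (hw : WeaklyIntegrable T w)
    (j : Fin 2) : WeaklyIntegrable T (fun τ => pderiv j (w τ)) := fun ψ => by
  simpa only [pderiv_apply] using hw (tmul (dsym j) ψ)

end AnisotropicStokes

/-! ### Weighted estimate of all the blocks -/

namespace AnisotropicStokes

open scoped FourierTransform

/-- For the first block the work of `g` goes into `a`. For the others Young's inequality absorbs it
with one half of the dissipation `2 ν D`; the constant `116 = 4 · 29` comes from `29 ≥ (16/3)²`. -/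
lemma source_le {E D a f g r G ν ψ : ℝ} {n : ℕ} (hν : 0 < ν) (hD : 0 ≤ D)
    (ha : a = 2 * f + if n = 0 then g else 0)
    (h1 : ψ ≤ 2 * (2 * √E * (2 * f + 2 * r) + G - ν * D)) (h2 : G ≤ 2 * √E * g)
    (h3 : ∀ n', n = n' + 1 → G ≤ 2 * √D * (8 / 3 * ((2 : ℝ) ^ n')⁻¹ * g)) :
    ψ ≤ 4 * √E * (a + 2 * r) - ν * D + 116 / ν * ((4 : ℝ) ^ n)⁻¹ * g ^ 2 := by
  have hb : 0 ≤ 116 / ν * ((4 : ℝ) ^ n)⁻¹ * g ^ 2 := by positivity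
  have hνD : 0 ≤ ν * D := by positivity
  cases n with
  | zero => rw [if_pos rfl] at ha; subst ha; linarith
  | succ n =>
    rw [if_neg n.succ_ne_zero, add_zero] at ha
    subst ha
    have h4 := h3 n rfl
    set q : ℝ := ((2 : ℝ) ^ n)⁻¹ with hq
    have h5 : ((4 : ℝ) ^ (n + 1))⁻¹ = q ^ 2 / 4 := by
      rw [hq, pow_succ, show (4 : ℝ) = 2 ^ 2 by norm_num, ← pow_mul, mul_comm 2 n, pow_mul]
      field_simp
    rw [h5] at hb ⊢
    have h6 : D = √D ^ 2 := (Real.sq_sqrt hD).symm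
    have h7 : 4 * √D * (8 / 3 * q * g) ≤ ν * D + 116 / ν * (q ^ 2 / 4) * g ^ 2 := by
      have h8 : ν * √D ^ 2 + 116 / ν * (q ^ 2 / 4) * g ^ 2 - 4 * √D * (8 / 3 * q * g) =
          ((ν * √D - 16 / 3 * q * g) ^ 2 + 5 / 9 * (q * g) ^ 2) / ν := by
        field_simp; ring
      have h9 : 0 ≤ ((ν * √D - 16 / 3 * q * g) ^ 2 + 5 / 9 * (q * g) ^ 2) / ν := by positivity
      rw [← h6] at h8
      linarith
    linarith

set_option maxHeartbeats 800000 in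
/-- Energy estimates on the blocks with the loss of derivatives `B n * exp (-κ n * W t)`. -/
theorem exists_weighted_estimate (P : DyadicPartition) {θ : ℝ} (hθ : 1 ≤ 2 * θ) (hθ1 : θ < 1) :
    ∃ c₀ : ℝ, 0 ≤ c₀ ∧
    ∀ {ν T : ℝ} {v w f : ℝ → 𝓢'(Plane, CVec)} {V : ℝ → ℝ} {w₀ : 𝓢'(Plane, CVec)}
      {p g : ℝ → 𝓢'(Plane, ℂ)}, 0 < ν → 0 ≤ T → IsLosingField P T v V →
      IsSolution P ν T v w w₀ p f g →
    ∀ {B : ℕ → ℝ} {ρ η D M : ℝ} {fN gN : ℕ → ℝ → ℝ}, 0 < η → 0 ≤ ρ → 0 ≤ M → (∀ n, 0 < B n) →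
      (∀ n d, B (n + d) ≤ (2 * θ) ^ d * B n) → (∀ n d, B n ≤ ρ ^ d * B (n + d)) →
      ρ * Real.exp (η * ∫ τ in (0 : ℝ)..T, V τ) ≤ 2 * θ →
      (∀ t ∈ Icc 0 T, ∀ n i, L2Bound (dmul (blockT P n) (coord i (w t))) (M / B n)) →
      (∀ n, IntervalIntegrable (fN n) volume 0 T) → (∀ n, IntervalIntegrable (gN n) volume 0 T) →
      (∀ n, IntervalIntegrable (fun τ => gN n τ ^ 2) volume 0 T) →
      (∀ n, ∀ᵐ τ ∂volume.restrict (Ioc 0 T), 0 ≤ fN n τ ∧ ∀ l,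
        L2Bound (dmul (blockT P n) (coord l (f τ))) (fN n τ)) →
      (∀ n, ∀ᵐ τ ∂volume.restrict (Ioc 0 T), 0 ≤ gN n τ ∧
        L2Bound (dmul (blockT P n) (g τ)) (gN n τ)) →
      (∀ n, B n * √(blockEnergy P n (w 0)) ≤ D) →
      (∀ n, B n * (∫ τ in (0 : ℝ)..T, (2 * fN n τ + if n = 0 then gN n τ else 0)) ≤ D) →
      (∀ n, B n ^ 2 * (∫ τ in (0 : ℝ)..T, 116 / ν * ((4 : ℝ) ^ n)⁻¹ * gN n τ ^ 2) ≤ D ^ 2) →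
      ∀ n, (∀ t ∈ Icc 0 T, B n * √(blockEnergy P n (w t)) ≤
          6 * D * Real.exp ((η * (n + 1) + 12 * c₀ ^ 2 / η) * ∫ τ in (0 : ℝ)..t, V τ)) ∧
        ∀ k, 1 ≤ k → IntervalIntegrable (fun τ => ν * blockSq P k n (pderiv 0 (w τ))) volume 0 T ∧
          B n ^ 2 * (∫ τ in (0 : ℝ)..T, ν * blockSq P k n (pderiv 0 (w τ))) ≤
            35 * D ^ 2 * Real.exp ((η * (n + 1) + 12 * c₀ ^ 2 / η) * ∫ τ in (0 : ℝ)..T, V τ) ^ 2 := by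
  obtain ⟨C₁, C₂, hC₁, hC₂, hconv⟩ := exists_convBound_le hθ hθ1
  obtain ⟨C, hC, henergy⟩ := exists_block_energy P
  refine ⟨2 * C * C₂, by positivity, ?_⟩
  set c₀ := 2 * C * C₂ with hc₀
  have hc₀0 : 0 ≤ c₀ := by positivity
  intro ν T v w f V w₀ p g hν hT hv hsol B ρ η D M fN gN hη hρ hM hB hB1 hB2 hρη hap hfN hgN hgN2
    hf hg hi0 hif hig
  have hVi : IntervalIntegrable V volume 0 T :=
    (intervalIntegrable_iff_integrableOn_Icc_of_le hT).2 hv.V_int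
  have hV0 : ∀ᵐ τ ∂volume.restrict (Ioc 0 T), 0 ≤ V τ :=
    ae_restrict_of_ae_restrict_of_subset Ioc_subset_Icc_self hv.V_nonneg
  set W : ℝ → ℝ := fun t => ∫ τ in (0 : ℝ)..t, V τ with hWdef
  have hTT : T ∈ Icc 0 T := ⟨hT, le_rfl⟩
  have h0T : (0 : ℝ) ∈ Icc 0 T := ⟨le_rfl, hT⟩
  have hW0 : ∀ t ∈ Icc 0 T, 0 ≤ W t := fun t ht => by
    have := integral_zero_mono hVi hV0 ⟨le_rfl, ht.1⟩ ht
    rwa [intervalIntegral.integral_same] at this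
  have hWT : ∀ t ∈ Icc 0 T, W t ≤ W T := fun t ht => integral_zero_mono hVi hV0 ht hTT
  -- By the inequality of arithmetic and geometric means, `κ_n² ≥ 48 c₀² (n + 1) ≥ 16 c₀² (n + 3)`,
  -- which makes the remainder left by the Gronwall estimate at most `Z² / 4`. The slope `η` is the
  -- rate at which regularity is lost.
  set κ : ℕ → ℝ := fun n => η * (n + 1) + 12 * c₀ ^ 2 / η with hκ
  have hκ0 : ∀ n, 0 < κ n := fun n => by positivity
  set ω : ℕ → ℝ → ℝ := fun n t => B n * Real.exp (-κ n * W t) with hω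
  have hω0 : ∀ n t, 0 < ω n t := fun n t => mul_pos (hB n) (Real.exp_pos _)
  have hωB : ∀ n, ∀ t ∈ Icc 0 T, ω n t ≤ B n := fun n t ht =>
    mul_le_of_le_one_right (hB n).le (Real.exp_le_one_iff.2
      (mul_nonpos_of_nonpos_of_nonneg (by linarith [hκ0 n]) (hW0 t ht)))
  have hωT : ∀ n, ∀ t ∈ Icc 0 T, ω n T ≤ ω n t := fun n t ht =>
    mul_le_mul_of_nonneg_left (Real.exp_le_exp.2
      (mul_le_mul_of_nonpos_left (hWT t ht) (by linarith [hκ0 n]))) (hB n).le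
  have hκd : ∀ n d : ℕ, κ (n + d) = κ n + η * d := fun n d => by simp only [hκ]; push_cast; ring
  have hω1 : ∀ t ∈ Icc 0 T, ∀ n d, ω (n + d) t ≤ (2 * θ) ^ d * ω n t := fun t ht n d => by
    have h1 : Real.exp (-κ (n + d) * W t) ≤ Real.exp (-κ n * W t) := by
      refine Real.exp_le_exp.2 (mul_le_mul_of_nonneg_right ?_ (hW0 t ht))
      rw [hκd]
      have : 0 ≤ η * (d : ℝ) := by positivity
      linarith
    calc ω (n + d) t ≤ ((2 * θ) ^ d * B n) * Real.exp (-κ n * W t) :=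
          mul_le_mul (hB1 n d) h1 (Real.exp_pos _).le ((hB _).le.trans (hB1 n d))
      _ = _ := by rw [hω]; ring
  -- The slope of `κ` makes the weights decrease by a further factor `exp(η W)` at each scale. This
  -- is the condition that limits `η`.
  have hω2 : ∀ t ∈ Icc 0 T, ∀ n d, ω n t ≤ (2 * θ) ^ d * ω (n + d) t := fun t ht n d => by
    have h1 : Real.exp (-κ n * W t) = Real.exp (η * W t) ^ d * Real.exp (-κ (n + d) * W t) := by
      rw [← Real.exp_nat_mul, ← Real.exp_add, hκd]; congr 1; ring
    have h2 : ρ * Real.exp (η * W t) ≤ 2 * θ := le_trans (by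
      have := hWT t ht
      gcongr) hρη
    calc ω n t ≤ (ρ ^ d * B (n + d)) * Real.exp (-κ n * W t) :=
          mul_le_mul_of_nonneg_right (hB2 n d) (Real.exp_pos _).le
      _ = (ρ * Real.exp (η * W t)) ^ d * ω (n + d) t := by rw [h1, hω]; ring
      _ ≤ _ := by
          have := hω0 (n + d) t
          gcongr
  have hD : 0 ≤ D := le_trans (mul_nonneg (hB 0).le (Real.sqrt_nonneg _)) (hi0 0)
  have hMB : ∀ n, 0 ≤ M / B n := fun n => div_nonneg hM (hB n).le
  set z : ℕ → ℝ → ℝ := fun n t => ω n t * √(blockEnergy P n (w t)) with hz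
  have hz0 : ∀ n t, 0 ≤ z n t := fun n t => mul_nonneg (hω0 n t).le (Real.sqrt_nonneg _)
  have hzM : ∀ n, ∀ t ∈ Icc 0 T, z n t ≤ 2 * M := fun n t ht => by
    have h1 : √(blockEnergy P n (w t)) ≤ 2 * (M / B n) := by
      refine Real.sqrt_le_iff.2 ⟨by linarith [hMB n], ?_⟩
      have h2 : ∀ i, ‖rep (dmul (blockT P n) (coord i (w t)))‖ ^ 2 ≤ (M / B n) ^ 2 := fun i =>
        pow_le_pow_left₀ (norm_nonneg _) ((hap t ht n i).norm_rep_le (hMB n)) 2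
      calc blockEnergy P n (w t) ≤ ∑ _i : Fin 2, (M / B n) ^ 2 := Finset.sum_le_sum fun i _ => h2 i
        _ ≤ (2 * (M / B n)) ^ 2 := by
          rw [Finset.sum_const, Finset.card_univ, Fintype.card_fin, nsmul_eq_mul]
          push_cast
          nlinarith [sq_nonneg (M / B n)]
    calc z n t ≤ B n * (2 * (M / B n)) :=
          mul_le_mul (hωB n t ht) h1 (Real.sqrt_nonneg _) (hB n).le
      _ = 2 * M := by have := (hB n).ne'; field_simp
  -- The supremum is over all blocks and all times. The a priori bound makes it finite; its size `M`
  -- does not enter the conclusion.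
  set Sz : Set ℝ := {x | ∃ n, ∃ t ∈ Icc 0 T, x = z n t} with hSz
  have hbdd : BddAbove Sz := ⟨2 * M, by rintro _ ⟨n, t, ht, rfl⟩; exact hzM n t ht⟩
  have hne : Sz.Nonempty := ⟨_, 0, 0, h0T, rfl⟩
  set Z := sSup Sz with hZ
  have hzZ : ∀ n, ∀ t ∈ Icc 0 T, z n t ≤ Z := fun n t ht => le_csSup hbdd ⟨n, t, ht, rfl⟩
  have hZ0 : 0 ≤ Z := (hz0 0 0).trans (hzZ 0 0 h0T)
  have hUw : ∀ t ∈ Icc 0 T, ∀ n i, L2Bound (dmul (blockT P n) (coord i (w t))) (Z / ω n t) :=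
    fun t ht n i => by
      refine (l2Bound_rep (hMB n) (hap t ht n i)).mono
        ((norm_rep_le_sqrt_blockEnergy n (w t) i).trans ?_)
      rw [le_div_iff₀ (hω0 n t), mul_comm]
      exact hzZ n t ht
  have hstep : ∀ n k, 1 ≤ k →
      IntervalIntegrable (fun τ => ν * blockSq P k n (pderiv 0 (w τ))) volume 0 T ∧
      ∀ t ∈ Icc 0 T, ω n t * B n * blockSq P k n (w t) +
        ω n t * B n * (∫ τ in (0 : ℝ)..t, ν * blockSq P k n (pderiv 0 (w τ))) ≤
          2 * D ^ 2 + 4 * Z * D + Z ^ 2 / 4 * Real.exp (κ n * W t) := fun n k hk => by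
    obtain ⟨ψ, hψi, hψ, hψle⟩ := henergy hν hT hv hsol (k := k) (n := n) hk
      (U := fun n t => Z / ω n t) (S := fun t => C₁ * √(3 + (n : ℝ)) * (Z / ω n t))
      (Ub := fun n => Z / ω n T) (Sb := C₁ * √(3 + (n : ℝ)) * (Z / ω n T))
      (fun t ht m => ⟨div_nonneg hZ0 (hω0 m t).le,
        div_le_div_of_nonneg_left hZ0 (hω0 m T) (hωT m t ht)⟩) hUw
      (fun t ht => ⟨mul_le_mul_of_nonneg_left
        (div_le_div_of_nonneg_left hZ0 (hω0 n T) (hωT n t ht)) (by positivity),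
        mul_nonneg (by positivity) (div_nonneg hZ0 (hω0 n t).le),
        (hconv hZ0 (fun m => hω0 m t) (hω1 t ht) (hω2 t ht) n).1⟩)
      (hfN n) (hgN n) (hf n) (hg n)
    have hmeas : AEStronglyMeasurable (fun τ => ν * blockSq P k n (pderiv 0 (w τ)))
        (volume.restrict (Ioc 0 T)) :=
      ((aemeasurable_blockSq (hsol.w_int.pderiv 0) hk
        (mul_nonneg (hMB n) (by positivity : (0 : ℝ) ≤ 8 / 3 * 2 ^ n)) fun t ht i => by
          rw [coord_pderiv]
          exact l2Bound_block_pderiv (hMB n) (hap t ht n i) 0).const_mul ν).aestronglyMeasurable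
    have hag : IntervalIntegrable (fun τ => if n = 0 then gN n τ else 0) volume 0 T := by
      split_ifs
      · exact hgN n
      · exact intervalIntegrable_const
    have hest := weighted_energy_le (E := fun t => blockSq P k n (w t)) (V := V) (ψ := ψ)
      (a := fun τ => 2 * fN n τ + if n = 0 then gN n τ else 0)
      (b := fun τ => 116 / ν * ((4 : ℝ) ^ n)⁻¹ * gN n τ ^ 2)
      (d := fun τ => ν * blockSq P k n (pderiv 0 (w τ))) (κ := κ n) (c := c₀ * √(3 + (n : ℝ)))
      (Z := Z) (B := B n) (E₀ := blockSq P k n (w 0)) hT (hκ0 n) (by positivity) (hB n)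
      (fun t _ => blockSq_nonneg P k n (w t)) hVi hψi
      (((hfN n).const_mul 2).add hag) ((hgN2 n).const_mul _) hV0 hψ ?_ hmeas ?_ ?_
    · refine ⟨hest.1, fun t ht => ?_⟩
      have h1 := hest.2 t ht
      change B n ^ 2 * Real.exp (-κ n * W t) * blockSq P k n (w t) + B n ^ 2 *
        Real.exp (-κ n * W t) * (∫ τ in (0 : ℝ)..t, ν * blockSq P k n (pderiv 0 (w τ))) ≤ _ at h1
      have e1 : B n ^ 2 * Real.exp (-κ n * W t) = ω n t * B n := by rw [hω]; ring
      rw [e1] at h1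
      refine h1.trans ?_
      have f1 : B n ^ 2 * blockSq P k n (w 0) ≤ D ^ 2 := by
        have h2 := pow_le_pow_left₀ (mul_nonneg (hB n).le (Real.sqrt_nonneg _)) (hi0 n) 2
        rw [mul_pow, Real.sq_sqrt (blockEnergy_nonneg n _)] at h2
        refine le_trans (mul_le_mul_of_nonneg_left ?_ (by positivity)) h2
        exact blockSq_le_blockEnergy hk (hMB n) (hap 0 h0T n)
      have f2 := mul_le_mul_of_nonneg_left (hif n) (by positivity : 0 ≤ 4 * Z)
      have f3 := hig n
      have f4 : 4 * (c₀ * √(3 + (n : ℝ))) ^ 2 / κ n ^ 2 ≤ 1 / 4 := by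
        rw [div_le_iff₀ (by have := hκ0 n; positivity), mul_pow, Real.sq_sqrt (by positivity)]
        have g1 : 4 * (η * (n + 1)) * (12 * c₀ ^ 2 / η) ≤ κ n ^ 2 := by
          simp only [hκ]; nlinarith [sq_nonneg (η * (n + 1) - 12 * c₀ ^ 2 / η)]
        have g2 : 4 * (η * (n + 1)) * (12 * c₀ ^ 2 / η) = 48 * c₀ ^ 2 * (n + 1) := by
          field_simp; ring
        have g3 : 0 ≤ c₀ ^ 2 * (n : ℝ) := by positivity
        nlinarith
      have f5 : 4 * (c₀ * √(3 + (n : ℝ))) ^ 2 / κ n ^ 2 * Z ^ 2 * Real.exp (κ n * W t) ≤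
          1 / 4 * Z ^ 2 * Real.exp (κ n * W t) := by gcongr
      change _ + _ + _ + 4 * (c₀ * √(3 + (n : ℝ))) ^ 2 / κ n ^ 2 * Z ^ 2 *
        Real.exp (κ n * W t) ≤ _
      linarith
    · filter_upwards [hf n, hg n] with τ h1 h2
      refine ⟨?_, by positivity, mul_nonneg hν.le (blockSq_nonneg _ _ _ _)⟩
      have := h1.1
      have := h2.1
      split_ifs <;> linarith
    · intro t ht
      refine le_trans (mul_le_mul_of_nonneg_left (Real.sqrt_le_sqrt ?_) (hω0 n t).le) (hzZ n t ht)
      exact blockSq_le_blockEnergy hk (hMB n) (hap t ht n)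
    · filter_upwards [hψle, hV0, self_mem_ae_restrict measurableSet_Ioc] with τ h1 h2 h3
      have hτ : τ ∈ Icc 0 T := Ioc_subset_Icc_self h3
      obtain ⟨G, hG1, hG2, hG3⟩ := h1
      refine (source_le hν (blockSq_nonneg _ _ _ _) rfl hG1 hG2 hG3).trans ?_
      have h4 := (hconv hZ0 (fun m => hω0 m τ) (hω1 τ hτ) (hω2 τ hτ) n).2
      have h5 : 2 * (C * V τ * convBound n (fun n => Z / ω n τ)
          (C₁ * √(3 + (n : ℝ)) * (Z / ω n τ))) ≤ c₀ * √(3 + (n : ℝ)) * V τ * (Z / ω n τ) := by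
        calc _ ≤ 2 * (C * V τ * (C₂ * √(3 + (n : ℝ)) * (Z / ω n τ))) := by gcongr
          _ = _ := by rw [hc₀]; ring
      have h6 := mul_le_mul_of_nonneg_left h5
        (by positivity : 0 ≤ 4 * √(blockSq P k n (w τ)))
      change _ ≤ 4 * √(blockSq P k n (w τ)) * ((2 * fN n τ + if n = 0 then gN n τ else 0) +
        c₀ * √(3 + (n : ℝ)) * V τ * (Z / ω n τ)) - _ + _
      linarith
  have hexp : ∀ n t, ω n t * Real.exp (κ n * W t) = B n := fun n t => by
    simp only [hω]
    rw [mul_assoc, ← Real.exp_add, neg_mul, neg_add_cancel, Real.exp_zero, mul_one]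
  -- A finite `Z` with `Z² ≤ 2 D² + 4 Z D + Z² / 4` satisfies `Z ≤ 6 D`.
  have hZ6 : Z ≤ 6 * D := by
    have h1 : ∀ n, ∀ t ∈ Icc 0 T, z n t ^ 2 ≤ 2 * D ^ 2 + 4 * Z * D + Z ^ 2 / 4 := fun n t ht => by
      -- The available inequality carries the weight `ω B`, with one exponential only. Multiplying
      -- by `exp(-κ W)` turns it into `ω²` and removes the exponential in front of `Z² / 4`.
      have h2 : ∀ k, 1 ≤ k → ω n t ^ 2 * blockSq P k n (w t) ≤
          2 * D ^ 2 + 4 * Z * D + Z ^ 2 / 4 := fun k hk => by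
        have h3 := (hstep n k hk).2 t ht
        have h4 : 0 ≤ ∫ τ in (0 : ℝ)..t, ν * blockSq P k n (pderiv 0 (w τ)) :=
          intervalIntegral.integral_nonneg ht.1 fun τ _ =>
            mul_nonneg hν.le (blockSq_nonneg _ _ _ _)
        have h5 := hω0 n t
        have h6 : ω n t * B n * blockSq P k n (w t) ≤
            2 * D ^ 2 + 4 * Z * D + Z ^ 2 / 4 * Real.exp (κ n * W t) := by
          have := mul_nonneg (mul_pos h5 (hB n)).le h4
          linarith
        have hx : 1 ≤ Real.exp (κ n * W t) :=
          Real.one_le_exp (mul_nonneg (hκ0 n).le (hW0 t ht))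
        refine le_of_mul_le_mul_right ?_ (Real.exp_pos (κ n * W t))
        calc ω n t ^ 2 * blockSq P k n (w t) * Real.exp (κ n * W t) =
              ω n t * (ω n t * Real.exp (κ n * W t)) * blockSq P k n (w t) := by ring
          _ ≤ 2 * D ^ 2 + 4 * Z * D + Z ^ 2 / 4 * Real.exp (κ n * W t) := by rw [hexp]; exact h6
          _ ≤ _ := by
              have : 0 ≤ 2 * D ^ 2 + 4 * Z * D := by positivity
              nlinarith
      have h3 := le_of_tendsto ((tendsto_blockSq (hMB n) (hap t ht n)).const_mul (ω n t ^ 2))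
        ((eventually_ge_atTop 1).mono h2)
      rwa [hz, mul_pow, Real.sq_sqrt (blockEnergy_nonneg n _)]
    have h2 : Z ≤ √(2 * D ^ 2 + 4 * Z * D + Z ^ 2 / 4) := csSup_le hne (by
      rintro _ ⟨n, t, ht, rfl⟩
      exact Real.le_sqrt_of_sq_le (h1 n t ht))
    have h3 := pow_le_pow_left₀ hZ0 h2 2
    rw [Real.sq_sqrt (by positivity)] at h3
    nlinarith
  refine fun n => ⟨fun t ht => ?_, fun k hk => ⟨(hstep n k hk).1, ?_⟩⟩
  · have h1 := (hzZ n t ht).trans hZ6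
    calc B n * √(blockEnergy P n (w t)) = z n t * Real.exp (κ n * W t) := by
          rw [← hexp n t, hz]; ring
      _ ≤ _ := mul_le_mul_of_nonneg_right h1 (Real.exp_pos _).le
  · have h1 := (hstep n k hk).2 T hTT
    set I := ∫ τ in (0 : ℝ)..T, ν * blockSq P k n (pderiv 0 (w τ)) with hI
    change B n ^ 2 * I ≤ 35 * D ^ 2 * Real.exp (κ n * W T) ^ 2
    set X := Real.exp (κ n * W T) with hX
    have hX1 : 1 ≤ X := Real.one_le_exp (mul_nonneg (hκ0 n).le (hW0 T hTT))
    have h2 : 0 ≤ ω n T * B n * blockSq P k n (w T) :=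
      mul_nonneg (mul_pos (hω0 n T) (hB n)).le (blockSq_nonneg _ _ _ _)
    -- With `Z ≤ 6 D`: `35 = 2 + 4 · 6 + 6² / 4`.
    have h3 : ω n T * B n * I ≤ 35 * D ^ 2 * X := by
      have g1 : Z ^ 2 ≤ (6 * D) ^ 2 := pow_le_pow_left₀ hZ0 hZ6 2
      have g2 : Z * D ≤ 6 * D * D := mul_le_mul_of_nonneg_right hZ6 hD
      have g3 : 26 * D ^ 2 ≤ 26 * D ^ 2 * X := le_mul_of_one_le_right (by positivity) hX1
      have g4 : Z ^ 2 / 4 * X ≤ 9 * D ^ 2 * X := by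
        refine mul_le_mul_of_nonneg_right ?_ (by linarith)
        linarith
      linarith
    calc B n ^ 2 * I = (ω n T * B n * I) * X := by rw [← hexp n T, hX]; ring
      _ ≤ 35 * D ^ 2 * X * X := mul_le_mul_of_nonneg_right h3 (by linarith)
      _ = _ := by ring

end AnisotropicStokes

/-! ### Propagation of regularity with a loss -/

namespace AnisotropicStokes

open scoped FourierTransform

/-- Fatou's lemma as `k → ∞`; the bounds of the truncated dissipations are uniform in `k`. -/
lemma lintegral_blockEnergy_le {P : DyadicPartition} {n : ℕ} {T M : ℝ} (hT : 0 ≤ T) (hM : 0 ≤ M)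
    {u : ℝ → 𝓢'(Plane, CVec)} {ν I : ℝ} (hν : 0 ≤ ν)
    (hb : ∀ t ∈ Icc 0 T, ∀ i, L2Bound (dmul (blockT P n) (coord i (u t))) M)
    (h : ∀ k, 1 ≤ k → IntervalIntegrable (fun τ => ν * blockSq P k n (u τ)) volume 0 T ∧
      ∫ τ in (0 : ℝ)..T, ν * blockSq P k n (u τ) ≤ I) :
    ∫⁻ τ in Ioc 0 T, ENNReal.ofReal (ν * blockEnergy P n (u τ)) ≤ ENNReal.ofReal I := by
  have hlim : ∀ᵐ τ ∂volume.restrict (Ioc 0 T), ENNReal.ofReal (ν * blockEnergy P n (u τ)) =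
      liminf (fun k => ENNReal.ofReal (ν * blockSq P (k + 1) n (u τ))) atTop := by
    filter_upwards [self_mem_ae_restrict measurableSet_Ioc] with τ hτ
    refine (Tendsto.liminf_eq (ENNReal.tendsto_ofReal ?_)).symm
    exact (((tendsto_add_atTop_iff_nat 1).2
      (tendsto_blockSq hM (hb τ (Ioc_subset_Icc_self hτ)))).const_mul ν)
  rw [lintegral_congr_ae hlim]
  refine (lintegral_liminf_le' fun k => ?_).trans (liminf_le_of_le ?_ fun b hb => ?_)
  · exact ((intervalIntegrable_iff_integrableOn_Ioc_of_le hT).1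
      (h (k + 1) (by omega)).1).aemeasurable.ennreal_ofReal
  · isBoundedDefault
  · obtain ⟨k, hk⟩ := hb.exists
    refine hk.trans ?_
    have h1 := h (k + 1) (by omega)
    rw [← ofReal_integral_eq_lintegral_ofReal
      ((intervalIntegrable_iff_integrableOn_Ioc_of_le hT).1 h1.1)
      (ae_of_all _ fun τ => mul_nonneg hν (blockSq_nonneg _ _ _ _)),
      ← intervalIntegral.integral_of_le hT]
    exact ENNReal.ofReal_le_ofReal h1.2

/-- Propagation of the regularity `s`, with a loss of `ε` derivatives, for solutions which are
bounded with values in `B^α_{2,∞}`. -/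
theorem exists_propagation (P : DyadicPartition) {δ : ℝ} (hδ : 0 < δ) (hδ1 : δ ≤ 1) :
    ∃ C : ℝ, 0 ≤ C ∧
    ∀ {ν T : ℝ} {v w f : ℝ → 𝓢'(Plane, CVec)} {V : ℝ → ℝ} {w₀ : 𝓢'(Plane, CVec)}
      {p g : ℝ → 𝓢'(Plane, ℂ)}, 0 < ν → 0 ≤ T → IsLosingField P T v V →
      IsSolution P ν T v w w₀ p f g →
    ∀ {s α ε D M : ℝ} {fN gN : ℕ → ℝ → ℝ}, 0 < ε → α ≤ s → s ≤ 1 - δ → ε - α ≤ 1 - δ → 0 ≤ M →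
      (∀ t ∈ Icc 0 T, ∀ n : ℕ, ∀ i, L2Bound (dmul (blockT P n) (coord i (w t)))
        (M / 2 ^ (α * ((n : ℝ) - 1)))) →
      (∀ n, IntervalIntegrable (fN n) volume 0 T) → (∀ n, IntervalIntegrable (gN n) volume 0 T) →
      (∀ n, IntervalIntegrable (fun τ => gN n τ ^ 2) volume 0 T) →
      (∀ n, ∀ᵐ τ ∂volume.restrict (Ioc 0 T), 0 ≤ fN n τ ∧ ∀ l,
        L2Bound (dmul (blockT P n) (coord l (f τ))) (fN n τ)) →
      (∀ n, ∀ᵐ τ ∂volume.restrict (Ioc 0 T), 0 ≤ gN n τ ∧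
        L2Bound (dmul (blockT P n) (g τ)) (gN n τ)) →
      (∀ n : ℕ, 2 ^ (s * ((n : ℝ) - 1)) * √(blockEnergy P n (w 0)) ≤ D) →
      (∀ n : ℕ, 2 ^ (s * ((n : ℝ) - 1)) *
        (∫ τ in (0 : ℝ)..T, (2 * fN n τ + if n = 0 then gN n τ else 0)) ≤ D) →
      (∀ n : ℕ, ((2 : ℝ) ^ (s * ((n : ℝ) - 1))) ^ 2 *
        (∫ τ in (0 : ℝ)..T, 116 / ν * ((4 : ℝ) ^ n)⁻¹ * gN n τ ^ 2) ≤ D ^ 2) →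
      ∀ n : ℕ, (∀ t ∈ Icc 0 T, 2 ^ (s * ((n : ℝ) - 1)) * √(blockEnergy P n (w t)) ≤
          6 * D * (2 ^ (ε * ((n : ℝ) + 1)) *
            Real.exp (C / ε * (∫ τ in (0 : ℝ)..T, V τ) ^ 2))) ∧
        ∫⁻ τ in Ioc 0 T, ENNReal.ofReal (ν * blockEnergy P n (pderiv 0 (w τ))) ≤
          ENNReal.ofReal (35 * D ^ 2 * (2 ^ (ε * ((n : ℝ) + 1)) *
            Real.exp (C / ε * (∫ τ in (0 : ℝ)..T, V τ) ^ 2)) ^ 2 /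
              ((2 : ℝ) ^ (s * ((n : ℝ) - 1))) ^ 2) := by
  have h2θ : 2 * (2 : ℝ) ^ (-δ) = 2 ^ (1 - δ) := by
    rw [sub_eq_add_neg, Real.rpow_add two_pos, Real.rpow_one]
  obtain ⟨c₀, hc₀, hmain⟩ := exists_weighted_estimate P (θ := (2 : ℝ) ^ (-δ))
    (by rw [h2θ]; exact Real.one_le_rpow one_le_two (by linarith))
    (Real.rpow_lt_one_of_one_lt_of_neg one_lt_two (by linarith))
  rw [h2θ] at hmain
  have hlog : 0 < Real.log 2 := Real.log_pos one_lt_two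
  refine ⟨12 * c₀ ^ 2 / Real.log 2, by positivity, ?_⟩
  intro ν T v w f V w₀ p g hν hT hv hsol s α ε D M fN gN hε hαs hs hα hM hap hfN hgN hgN2 hf hg
    hi0 hif hig n
  have hVi : IntervalIntegrable V volume 0 T :=
    (intervalIntegrable_iff_integrableOn_Icc_of_le hT).2 hv.V_int
  have hV0 : ∀ᵐ τ ∂volume.restrict (Ioc 0 T), 0 ≤ V τ :=
    ae_restrict_of_ae_restrict_of_subset Ioc_subset_Icc_self hv.V_nonneg
  set W := ∫ τ in (0 : ℝ)..T, V τ with hW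
  have hW0 : 0 ≤ W := by
    have := integral_zero_mono hVi hV0 ⟨le_rfl, hT⟩ ⟨hT, le_rfl⟩
    rwa [intervalIntegral.integral_same] at this
  -- With `η = ε log 2 / W`, the weight `exp(η (n + 1) W)` becomes `2^{ε(n+1)}`, and `12 c₀² W / η`
  -- becomes `12 c₀² W² / (ε log 2)`, the exponent of the theorem. If `W = 0` any `η` works.
  obtain ⟨η, hη, hη1, hη2⟩ : ∃ η : ℝ, 0 < η ∧ η * W ≤ ε * Real.log 2 ∧
      12 * c₀ ^ 2 / η * W ≤ 12 * c₀ ^ 2 / Real.log 2 / ε * W ^ 2 := by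
    rcases hW0.eq_or_lt with h | h
    · exact ⟨1, one_pos, by rw [← h]; simp; positivity, by rw [← h]; simp⟩
    · refine ⟨ε * Real.log 2 / W, by positivity, by rw [div_mul_cancel₀ _ h.ne'], le_of_eq ?_⟩
      field_simp
  set A : ℝ → ℕ → ℝ := fun r m => (2 : ℝ) ^ (r * ((m : ℝ) - 1)) with hA
  have hA0 : ∀ r m, 0 < A r m := fun r m => Real.rpow_pos_of_pos two_pos _
  have hAd : ∀ r (m d : ℕ), A r (m + d) = ((2 : ℝ) ^ r) ^ d * A r m := fun r m d => by
    simp only [hA]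
    rw [← Real.rpow_mul_natCast two_pos.le, ← Real.rpow_add two_pos]
    congr 1; push_cast; ring
  -- `K` depends on the block `n` under study. The minimum of the two weights equals `2^{s(n-1)}` at
  -- that block, and the bound `K 2^{α(m-1)}` at all frequencies keeps the supremum finite for `w`
  -- in `B^α`. The conclusion at `n` no longer involves `K`.
  obtain ⟨K, hK0, hK⟩ : ∃ K : ℝ, 0 < K ∧ A s n ≤ K * A α n :=
    ⟨A s n / A α n, div_pos (hA0 _ _) (hA0 _ _), by rw [div_mul_cancel₀ _ (hA0 _ _).ne']⟩
  set B : ℕ → ℝ := fun m => min (A s m) (K * A α m) with hB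
  have hB0 : ∀ m, 0 < B m := fun m => lt_min (hA0 _ _) (mul_pos hK0 (hA0 _ _))
  have hBn : B n = A s n := min_eq_left hK
  have hBs : ∀ m, B m ≤ A s m := fun m => min_le_left _ _
  have hscale : ∀ {a b x y c : ℝ}, 0 ≤ c → a ≤ c * x → b ≤ c * y → min a b ≤ c * min x y :=
    fun {a b x y c} hc h1 h2 => by
      rw [mul_min_of_nonneg _ _ hc]; exact min_le_min h1 h2
  have hq : ∀ r : ℝ, 0 < (2 : ℝ) ^ r := fun r => Real.rpow_pos_of_pos two_pos r
  -- A minimum inherits the growth bounds of its two terms. Here `s < 1` intervenes, through `s ≤ 1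
  -- - δ`: the low frequency part of the commutator must be summable.
  have hB1 : ∀ m d, B (m + d) ≤ ((2 : ℝ) ^ (1 - δ)) ^ d * B m := fun m d => by
    have key : ∀ r, r ≤ 1 - δ → A r (m + d) ≤ ((2 : ℝ) ^ (1 - δ)) ^ d * A r m := fun r hr => by
      rw [hAd]
      exact mul_le_mul_of_nonneg_right (pow_le_pow_left₀ (hq r).le
        (Real.rpow_le_rpow_of_exponent_le one_le_two hr) d) (hA0 _ _).le
    refine hscale (pow_nonneg (hq _).le d) (key s hs) ?_
    rw [mul_left_comm]
    exact mul_le_mul_of_nonneg_left (key α (hαs.trans hs)) hK0.le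
  have hB2 : ∀ m d, B m ≤ ((2 : ℝ) ^ (-α)) ^ d * B (m + d) := fun m d => by
    have key : ∀ r, α ≤ r → A r m ≤ ((2 : ℝ) ^ (-α)) ^ d * A r (m + d) := fun r hr => by
      rw [hAd, ← mul_assoc, ← mul_pow, ← Real.rpow_add two_pos]
      exact le_mul_of_one_le_left (hA0 _ _).le
        (one_le_pow₀ (Real.one_le_rpow one_le_two (by linarith)))
    refine hscale (pow_nonneg (hq _).le d) (key s hαs) ?_
    rw [mul_left_comm]
    exact mul_le_mul_of_nonneg_left (key α le_rfl) hK0.le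
  -- The regularity `α` diminished by the loss has to stay above `-1`, for the high frequency part
  -- to be summable.
  have hρη : (2 : ℝ) ^ (-α) * Real.exp (η * W) ≤ 2 ^ (1 - δ) := by
    calc (2 : ℝ) ^ (-α) * Real.exp (η * W) ≤ (2 : ℝ) ^ (-α) * 2 ^ ε := by
          refine mul_le_mul_of_nonneg_left ?_ (hq _).le
          rw [Real.rpow_def_of_pos two_pos, mul_comm (Real.log 2)]
          exact Real.exp_le_exp.2 hη1
      _ = (2 : ℝ) ^ (ε - α) := by rw [← Real.rpow_add two_pos]; congr 1; ring
      _ ≤ _ := Real.rpow_le_rpow_of_exponent_le one_le_two hα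
  have hD : 0 ≤ D := (mul_nonneg (hA0 s 0).le (Real.sqrt_nonneg _)).trans (hi0 0)
  have hfn : ∀ m, 0 ≤ ∫ τ in (0 : ℝ)..T, (2 * fN m τ + if m = 0 then gN m τ else 0) := fun m => by
    refine intervalIntegral.integral_nonneg_of_ae_restrict hT ?_
    rw [← restrict_Ioc_eq_restrict_Icc]
    filter_upwards [hf m, hg m] with τ h1 h2
    have := h1.1
    have := h2.1
    change 0 ≤ _ + _
    split_ifs <;> linarith
  have hgn : ∀ m, 0 ≤ ∫ τ in (0 : ℝ)..T, 116 / ν * ((4 : ℝ) ^ m)⁻¹ * gN m τ ^ 2 := fun m =>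
    intervalIntegral.integral_nonneg hT fun τ _ => by positivity
  have hres := hmain hν hT hv hsol (B := B) (ρ := (2 : ℝ) ^ (-α)) (η := η) (D := D) (M := K * M)
    hη (hq _).le (mul_nonneg hK0.le hM) hB0 hB1 hB2 hρη
    (fun t ht m i => (hap t ht m i).mono (by
      rw [div_le_div_iff₀ (hA0 α m) (hB0 m)]
      calc M * B m ≤ M * (K * A α m) := mul_le_mul_of_nonneg_left (min_le_right _ _) hM
        _ = _ := by ring))
    hfN hgN hgN2 hf hg
    (fun m => (mul_le_mul_of_nonneg_right (hBs m) (Real.sqrt_nonneg _)).trans (hi0 m))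
    (fun m => (mul_le_mul_of_nonneg_right (hBs m) (hfn m)).trans (hif m))
    (fun m => (mul_le_mul_of_nonneg_right
      (pow_le_pow_left₀ (hB0 m).le (hBs m) 2) (hgn m)).trans (hig m)) n
  rw [hBn] at hres
  set Y : ℝ := 2 ^ (ε * ((n : ℝ) + 1)) *
    Real.exp (12 * c₀ ^ 2 / Real.log 2 / ε * W ^ 2) with hY
  have hexp : Real.exp ((η * (n + 1) + 12 * c₀ ^ 2 / η) * W) ≤ Y := by
    rw [hY, Real.rpow_def_of_pos two_pos, ← Real.exp_add]
    refine Real.exp_le_exp.2 ?_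
    have := mul_le_mul_of_nonneg_right hη1 (by positivity : (0 : ℝ) ≤ (n : ℝ) + 1)
    linarith
  refine ⟨fun t ht => (hres.1 t ht).trans (mul_le_mul_of_nonneg_left (le_trans
    (Real.exp_le_exp.2 (mul_le_mul_of_nonneg_left
      (integral_zero_mono hVi hV0 ht ⟨hT, le_rfl⟩) (by positivity))) hexp) (by positivity)), ?_⟩
  refine lintegral_blockEnergy_le hT (mul_nonneg (div_nonneg hM (hA0 α n).le)
    (by positivity : (0 : ℝ) ≤ 8 / 3 * 2 ^ n)) hν.le (fun t ht i => ?_)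
    fun k hk => ⟨(hres.2 k hk).1, ?_⟩
  · rw [coord_pderiv]
    exact l2Bound_block_pderiv (div_nonneg hM (hA0 α n).le) (hap t ht n i) 0
  · rw [le_div_iff₀ (by have := hA0 s n; positivity), mul_comm]
    refine (hres.2 k hk).2.trans (mul_le_mul_of_nonneg_left ?_ (by positivity))
    exact pow_le_pow_left₀ (Real.exp_pos _).le hexp 2

end AnisotropicStokes

/-! ### Besov norms, restriction in time, integrals in time -/

namespace AnisotropicStokes

open scoped FourierTransform

section Norms

variable {P : DyadicPartition}

lemma distLpNorm_coord_le (u : 𝓢'(Plane, CVec)) (i : Fin 2) :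
    distLpNorm 2 (coord i u) ≤ distLpNorm 2 u := by
  rcases eq_or_ne (distLpNorm 2 u) ∞ with h | h
  · rw [h]; exact le_top
  · have h1 := l2Bound_coord_of_distLpNorm_le ENNReal.toReal_nonneg (ENNReal.ofReal_toReal h).ge i
    exact (h1.distLpNorm_le ENNReal.toReal_nonneg).trans (ENNReal.ofReal_toReal h).le

section

variable {F : Type*} [NormedAddCommGroup F] [NormedSpace ℂ F] [CompleteSpace F]

lemma distLpNorm_block_le (r : ℝ) (n : ℕ) (u : 𝓢'(Plane, F)) :
    distLpNorm 2 (block P ((n : ℤ) - 1) u) ≤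
      ENNReal.ofReal (2 ^ (-(r * ((n : ℝ) - 1)))) * besovNorm P r u := by
  have h1 : ENNReal.ofReal ((2 : ℝ) ^ (r * ((n : ℝ) - 1))) *
      distLpNorm 2 (block P ((n : ℤ) - 1) u) ≤ besovNorm P r u := by
    have := le_iSup₂ (f := fun (q : ℤ) (_ : -1 ≤ q) =>
      ENNReal.ofReal ((2 : ℝ) ^ ((q : ℝ) * r)) * distLpNorm 2 (block P q u)) ((n : ℤ) - 1) (by omega)
    push_cast at this
    rwa [mul_comm ((n : ℝ) - 1) r] at this
  calc _ = ENNReal.ofReal (2 ^ (-(r * ((n : ℝ) - 1)))) * (ENNReal.ofReal (2 ^ (r * ((n : ℝ) - 1))) *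
        distLpNorm 2 (block P ((n : ℤ) - 1) u)) := by
        rw [← mul_assoc, ← ENNReal.ofReal_mul (by positivity), ← Real.rpow_add two_pos,
          neg_add_cancel, Real.rpow_zero, ENNReal.ofReal_one, one_mul]
    _ ≤ _ := by gcongr

lemma iSup_block_le {a : ℤ → ℝ≥0∞} {K : ℝ≥0∞} (h : ∀ n : ℕ, a ((n : ℤ) - 1) ≤ K) :
    ⨆ (q : ℤ) (_ : -1 ≤ q), a q ≤ K := by
  refine iSup₂_le fun q hq => ?_
  have h1 := h (q + 1).toNat
  rwa [show (((q + 1).toNat : ℕ) : ℤ) - 1 = q by omega] at h1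

end

lemma l2Bound_block_of_besovNorm_le {r M : ℝ} (hM : 0 ≤ M) {u : 𝓢'(Plane, CVec)}
    (h : besovNorm P r u ≤ ENNReal.ofReal M) (n : ℕ) (i : Fin 2) :
    L2Bound (dmul (blockT P n) (coord i u)) (M / 2 ^ (r * ((n : ℝ) - 1))) := by
  rw [← coord_block]
  refine l2Bound_coord_of_distLpNorm_le (by positivity) ?_ i
  refine (distLpNorm_block_le r n u).trans ?_
  rw [div_eq_inv_mul, ← Real.rpow_neg zero_le_two, ENNReal.ofReal_mul (by positivity)]
  gcongr

lemma distLpNorm_block_le_blockEnergy {n : ℕ} {u : 𝓢'(Plane, CVec)} {R : ℝ} (hR : 0 ≤ R)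
    (h : ∀ i, L2Bound (dmul (blockT P n) (coord i u)) R) :
    distLpNorm 2 (block P ((n : ℤ) - 1) u) ≤ ENNReal.ofReal (2 * √(blockEnergy P n u)) := by
  refine (distLpNorm_le_of_coord (R := fun i => ‖rep (dmul (blockT P n) (coord i u))‖)
    (fun i => norm_nonneg _) fun i => ?_).trans (ENNReal.ofReal_le_ofReal
      (sum_le_two_mul_sqrt _))
  rw [coord_block]
  exact l2Bound_rep hR (h i)

lemma sqrt_blockEnergy_le {n : ℕ} {u : 𝓢'(Plane, CVec)} {R : ℝ} (hR : 0 ≤ R)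
    (h : ∀ i, L2Bound (dmul (blockT P n) (coord i u)) R) : √(blockEnergy P n u) ≤ 2 * R := by
  refine Real.sqrt_le_iff.2 ⟨by linarith, ?_⟩
  calc blockEnergy P n u ≤ ∑ _i : Fin 2, R ^ 2 := Finset.sum_le_sum fun i _ =>
        pow_le_pow_left₀ (norm_nonneg _) ((h i).norm_rep_le hR) 2
    _ ≤ (2 * R) ^ 2 := by
      rw [Finset.sum_const, Finset.card_univ, Fintype.card_fin, nsmul_eq_mul]
      push_cast
      nlinarith [sq_nonneg R]

lemma aemeasurable_blockEnergy {T : ℝ} {w : ℝ → 𝓢'(Plane, CVec)} (hw : WeaklyIntegrable T w)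
    {n : ℕ} {R : ℝ} (hR : 0 ≤ R)
    (h : ∀ t ∈ Icc 0 T, ∀ i, L2Bound (dmul (blockT P n) (coord i (w t))) R) :
    AEMeasurable (fun τ => blockEnergy P n (w τ)) (volume.restrict (Ioc 0 T)) := by
  refine aemeasurable_of_tendsto_metrizable_ae atTop (f := fun k τ => blockSq P (k + 1) n (w τ))
    (fun k => aemeasurable_blockSq hw (by omega) hR h) ?_
  filter_upwards [self_mem_ae_restrict measurableSet_Ioc] with τ hτ
  exact (tendsto_add_atTop_iff_nat 1).2 (tendsto_blockSq hR (h τ (Ioc_subset_Icc_self hτ)))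

end Norms

section Restriction

variable {P : DyadicPartition} {ν T t : ℝ} {v w f : ℝ → 𝓢'(Plane, CVec)} {V : ℝ → ℝ}
  {w₀ : 𝓢'(Plane, CVec)} {p g : ℝ → 𝓢'(Plane, ℂ)}

lemma WeaklyIntegrable.restrict {F : Type*} [NormedAddCommGroup F] [NormedSpace ℂ F]
    {u : ℝ → 𝓢'(Plane, F)} (h : WeaklyIntegrable T u) (ht : t ≤ T) : WeaklyIntegrable t u :=
  fun ψ => (h ψ).mono_set (Icc_subset_Icc_right ht)

lemma IsLosingField.restrict (h : IsLosingField P T v V) (ht : t ≤ T) : IsLosingField P t v V :=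
  have hs : Icc 0 t ⊆ Icc 0 T := Icc_subset_Icc_right ht
  ⟨h.v_int.restrict ht, ae_restrict_of_ae_restrict_of_subset hs h.v_real,
    ae_restrict_of_ae_restrict_of_subset hs h.v_div, h.V_int.mono_set hs,
    ae_restrict_of_ae_restrict_of_subset hs h.V_nonneg,
    ae_restrict_of_ae_restrict_of_subset hs h.grad_le⟩

lemma IsSolution.restrict (h : IsSolution P ν T v w w₀ p f g) (ht : t ≤ T) :
    IsSolution P ν t v w w₀ p f g :=
  have hs : Icc 0 t ⊆ Icc 0 T := Icc_subset_Icc_right ht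
  ⟨h.w_int.restrict ht, fun i => (h.grad_int i).restrict ht, h.f_int.restrict ht,
    h.g_int.restrict ht, fun r hr => h.div_w r (hs hr), by
      obtain ⟨c, hc, hc1, hc2⟩ := h.equation
      exact ⟨c, hc.restrict ht, ae_restrict_of_ae_restrict_of_subset hs hc1,
        fun r hr => hc2 r (hs hr)⟩⟩

lemma IsSolution.initial (h : IsSolution P ν T v w w₀ p f g) (hT : 0 ≤ T) : w 0 = w₀ := by
  obtain ⟨c, _, _, hc⟩ := h.equation
  ext1 ψ
  rw [hc 0 ⟨le_rfl, hT⟩ ψ, intervalIntegral.integral_same, add_zero]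

end Restriction

section Integrals

variable {T R : ℝ} {h : ℝ → ℝ≥0∞}

lemma integral_toReal_le (hT : 0 ≤ T) (hm : AEMeasurable h (volume.restrict (Ioc 0 T)))
    (hR : 0 ≤ R) (hle : ∫⁻ τ in Ioc 0 T, h τ ≤ ENNReal.ofReal R) :
    IntervalIntegrable (fun τ => (h τ).toReal) volume 0 T ∧
      ∫ τ in (0 : ℝ)..T, (h τ).toReal ≤ R ∧ ∀ᵐ τ ∂volume.restrict (Ioc 0 T), h τ < ∞ := by
  have hne : ∫⁻ τ in Ioc 0 T, h τ ≠ ∞ := (hle.trans_lt ENNReal.ofReal_lt_top).ne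
  have hfin := ae_lt_top' hm hne
  refine ⟨(intervalIntegrable_iff_integrableOn_Ioc_of_le hT).2
    (integrable_toReal_of_lintegral_ne_top hm hne), ?_, hfin⟩
  rw [intervalIntegral.integral_of_le hT, integral_toReal hm hfin]
  exact ENNReal.toReal_le_of_le_ofReal hR hle

/-- Cauchy-Schwarz in time. The factor `√T` becomes the `√(νT)` of the theorem, through the first
block of `g`. -/
lemma lintegral_le_sqrt (hm : AEMeasurable h (volume.restrict (Ioc 0 T))) (hR : 0 ≤ R)
    (hle : ∫⁻ τ in Ioc 0 T, h τ ^ 2 ≤ ENNReal.ofReal (R ^ 2)) :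
    ∫⁻ τ in Ioc 0 T, h τ ≤ ENNReal.ofReal (√T * R) := by
  have h1 := ENNReal.lintegral_mul_le_Lp_mul_Lq (volume.restrict (Ioc 0 T))
    Real.HolderConjugate.two_two hm (aemeasurable_const (b := (1 : ℝ≥0∞)))
  simp only [Pi.mul_apply, mul_one, one_pow, lintegral_const, one_mul,
    Measure.restrict_apply_univ, Real.volume_Ioc, sub_zero, ENNReal.rpow_two] at h1
  refine h1.trans ?_
  have h2 : (ENNReal.ofReal (R ^ 2)) ^ (1 / 2 : ℝ) = ENNReal.ofReal R := by
    rw [ENNReal.ofReal_rpow_of_nonneg (by positivity) (by norm_num), ← Real.sqrt_eq_rpow,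
      Real.sqrt_sq hR]
  rw [mul_comm, ENNReal.ofReal_mul (Real.sqrt_nonneg _), ← h2]
  refine mul_le_mul' ?_ (ENNReal.rpow_le_rpow hle (by norm_num))
  rcases le_total 0 T with hT | hT
  · rw [Real.sqrt_eq_rpow, ENNReal.ofReal_rpow_of_nonneg hT (by norm_num)]
  · rw [ENNReal.ofReal_of_nonpos hT, ENNReal.zero_rpow_of_pos (by norm_num)]; exact zero_le

end Integrals

end AnisotropicStokes

/-! ### The losing estimate on blocks -/

namespace AnisotropicStokes

open scoped FourierTransform

variable {P : DyadicPartition} {ν T s d : ℝ} {v w f : ℝ → 𝓢'(Plane, CVec)} {V : ℝ → ℝ}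
  {w₀ : 𝓢'(Plane, CVec)} {p g : ℝ → 𝓢'(Plane, ℂ)}

/-- The sum of the norms of the two components serves as a common majorant; each norm is measurable
by duality and finite almost everywhere. The sum is responsible for the factor two. -/
lemma exists_forcing_bound (hT : 0 ≤ T) (hd : 0 ≤ d) (hf : WeaklyIntegrable T f)
    (h : timeL1Besov P s T f ≤ ENNReal.ofReal d) (n : ℕ) : ∃ fN : ℝ → ℝ,
    IntervalIntegrable fN volume 0 T ∧
    (∀ᵐ τ ∂volume.restrict (Ioc 0 T), 0 ≤ fN τ ∧ ∀ l,
      L2Bound (dmul (blockT P n) (coord l (f τ))) (fN τ)) ∧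
    ∫ τ in (0 : ℝ)..T, fN τ ≤ 2 * (((2 : ℝ) ^ (s * ((n : ℝ) - 1)))⁻¹ * d) := by
  set F : Fin 2 → ℝ → ℝ≥0∞ := fun l τ => distLpNorm 2 (dmul (blockT P n) (coord l (f τ))) with hF
  have hm : ∀ l, AEMeasurable (F l) (volume.restrict (Ioc 0 T)) := fun l =>
    aemeasurable_distLpNorm fun ψ =>
      ((hf.coord l (tmul (blockT P n) ψ)).mono_set Ioc_subset_Icc_self).aemeasurable
  have hle : ∀ l, ∫⁻ τ in Ioc 0 T, F l τ ≤
      ENNReal.ofReal (((2 : ℝ) ^ (s * ((n : ℝ) - 1)))⁻¹ * d) := fun l => by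
    have h1 : ∀ τ, F l τ ≤ ENNReal.ofReal (((2 : ℝ) ^ (s * ((n : ℝ) - 1)))⁻¹) *
        besovNorm P s (f τ) := fun τ => by
      rw [← Real.rpow_neg zero_le_two, hF]
      dsimp only
      rw [← coord_block]
      exact (distLpNorm_coord_le _ l).trans (distLpNorm_block_le s n _)
    refine (lintegral_mono h1).trans ?_
    rw [lintegral_const_mul' _ _ ENNReal.ofReal_ne_top, ENNReal.ofReal_mul (by positivity),
      restrict_Ioc_eq_restrict_Icc]
    exact mul_le_mul' le_rfl h
  have hR : 0 ≤ ((2 : ℝ) ^ (s * ((n : ℝ) - 1)))⁻¹ * d := by positivity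
  have hl := fun l => integral_toReal_le hT (hm l) hR (hle l)
  refine ⟨fun τ => (F 0 τ).toReal + (F 1 τ).toReal, (hl 0).1.add (hl 1).1, ?_, ?_⟩
  · filter_upwards [(hl 0).2.2, (hl 1).2.2] with τ h0 h1
    refine ⟨by positivity, ?_⟩
    rw [Fin.forall_fin_two]
    exact ⟨(l2Bound_of_distLpNorm_le ENNReal.toReal_nonneg (ENNReal.ofReal_toReal h0.ne).ge).mono
      (le_add_of_nonneg_right ENNReal.toReal_nonneg),
      (l2Bound_of_distLpNorm_le ENNReal.toReal_nonneg (ENNReal.ofReal_toReal h1.ne).ge).mono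
      (le_add_of_nonneg_left ENNReal.toReal_nonneg)⟩
  · rw [intervalIntegral.integral_add (hl 0).1 (hl 1).1, two_mul]
    exact add_le_add (hl 0).2.1 (hl 1).2.1

lemma exists_scalar_forcing_bound (hT : 0 ≤ T) (hd : 0 ≤ d) (hg : WeaklyIntegrable T g)
    (h : timeL2Besov P s T g ≤ ENNReal.ofReal d) (n : ℕ) : ∃ gN : ℝ → ℝ,
    IntervalIntegrable gN volume 0 T ∧ IntervalIntegrable (fun τ => gN τ ^ 2) volume 0 T ∧
    (∀ᵐ τ ∂volume.restrict (Ioc 0 T), 0 ≤ gN τ ∧ L2Bound (dmul (blockT P n) (g τ)) (gN τ)) ∧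
    ∫ τ in (0 : ℝ)..T, gN τ ≤ √T * (((2 : ℝ) ^ (s * ((n : ℝ) - 1)))⁻¹ * d) ∧
    ∫ τ in (0 : ℝ)..T, gN τ ^ 2 ≤ (((2 : ℝ) ^ (s * ((n : ℝ) - 1)))⁻¹ * d) ^ 2 := by
  set G : ℝ → ℝ≥0∞ := fun τ => distLpNorm 2 (dmul (blockT P n) (g τ)) with hG
  have hm : AEMeasurable G (volume.restrict (Ioc 0 T)) := aemeasurable_distLpNorm fun ψ =>
    ((hg (tmul (blockT P n) ψ)).mono_set Ioc_subset_Icc_self).aemeasurable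
  have hR : 0 ≤ ((2 : ℝ) ^ (s * ((n : ℝ) - 1)))⁻¹ * d := by positivity
  have hle : ∫⁻ τ in Ioc 0 T, G τ ^ 2 ≤
      ENNReal.ofReal ((((2 : ℝ) ^ (s * ((n : ℝ) - 1)))⁻¹ * d) ^ 2) := by
    have h1 : ∀ τ, G τ ^ 2 ≤ ENNReal.ofReal ((((2 : ℝ) ^ (s * ((n : ℝ) - 1)))⁻¹) ^ 2) *
        besovNorm P s (g τ) ^ 2 := fun τ => by
      rw [ENNReal.ofReal_pow (by positivity), ← mul_pow, ← Real.rpow_neg zero_le_two, hG]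
      dsimp only
      rw [← block_scalar]
      exact pow_le_pow_left' (distLpNorm_block_le s n _) 2
    refine (lintegral_mono h1).trans ?_
    rw [lintegral_const_mul' _ _ ENNReal.ofReal_ne_top, mul_pow, ENNReal.ofReal_mul (by positivity),
      restrict_Ioc_eq_restrict_Icc]
    refine mul_le_mul' le_rfl ?_
    have h2 := pow_le_pow_left' h 2
    rwa [timeL2Besov, ← ENNReal.rpow_natCast, ← ENNReal.rpow_mul,
      show (1 / 2 : ℝ) * ((2 : ℕ) : ℝ) = 1 by norm_num, ENNReal.rpow_one,
      ← ENNReal.ofReal_pow hd] at h2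
  have h1 := integral_toReal_le hT hm (mul_nonneg (Real.sqrt_nonneg T) hR) (lintegral_le_sqrt hm hR hle)
  have h2 := integral_toReal_le hT (hm.pow_const 2) (sq_nonneg _) hle
  simp only [ENNReal.toReal_pow] at h2
  refine ⟨fun τ => (G τ).toReal, h1.1, h2.1, ?_, h1.2.1, h2.2.1⟩
  filter_upwards [h1.2.2] with τ h0
  exact ⟨ENNReal.toReal_nonneg,
    l2Bound_of_distLpNorm_le ENNReal.toReal_nonneg (ENNReal.ofReal_toReal h0.ne).ge⟩

/-- The factor `2^{σ-α}` is needed for the first block only, where the exponent `n - 1` is negative.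
-/
lemma l2Bound_mono_exponent {α σ M : ℝ} (hM : 0 ≤ M) (h : α ≤ σ) {n : ℕ} {S : Dist}
    (hS : L2Bound S (M / 2 ^ (σ * ((n : ℝ) - 1)))) :
    L2Bound S (2 ^ (σ - α) * M / 2 ^ (α * ((n : ℝ) - 1))) := by
  refine hS.mono ?_
  rw [div_le_div_iff₀ (by positivity) (by positivity)]
  have h1 : (2 : ℝ) ^ (α * ((n : ℝ) - 1)) ≤ 2 ^ (σ - α) * 2 ^ (σ * ((n : ℝ) - 1)) := by
    rw [← Real.rpow_add two_pos]
    refine Real.rpow_le_rpow_of_exponent_le one_le_two ?_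
    nlinarith [mul_nonneg (sub_nonneg.2 h) (Nat.cast_nonneg (α := ℝ) n)]
  calc M * 2 ^ (α * ((n : ℝ) - 1)) ≤ M * (2 ^ (σ - α) * 2 ^ (σ * ((n : ℝ) - 1))) := by gcongr
    _ = _ := by ring

/-- The estimate on each block, in which `d` bounds the size of the data. -/
theorem exists_losing_estimate (P : DyadicPartition) {s : ℝ} (hs : s ∈ Ioo (-1 : ℝ) 1) :
    ∃ C : ℝ, 0 ≤ C ∧
    ∀ {ν T : ℝ} {v w f : ℝ → 𝓢'(Plane, CVec)} {V : ℝ → ℝ} {w₀ : 𝓢'(Plane, CVec)}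
      {p g : ℝ → 𝓢'(Plane, ℂ)} {d σ M : ℝ}, 0 < ν → 0 ≤ T → IsLosingField P T v V →
      IsSolution P ν T v w w₀ p f g → 0 ≤ d → besovNorm P s w₀ ≤ ENNReal.ofReal d →
      timeL1Besov P s T f ≤ ENNReal.ofReal d →
      timeL2Besov P (s - 1) T g ≤ ENNReal.ofReal (√ν * d) → -1 < σ →
      (∀ t ∈ Icc 0 T, besovNorm P σ (w t) ≤ ENNReal.ofReal M) →
      ∀ n : ℕ, (∃ R : ℝ, 0 ≤ R ∧ ∀ t ∈ Icc 0 T, ∀ i, L2Bound (dmul (blockT P n) (coord i (w t))) R) ∧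
      ∀ ε ∈ Ioo 0 ((s + 1) / 2),
        (∀ t ∈ Icc 0 T, √(blockEnergy P n (w t)) ≤
          6 * (6 * (1 + √(ν * T)) * d) * (2 ^ (ε * ((n : ℝ) + 1)) *
            Real.exp (C / ε * (∫ τ in (0 : ℝ)..T, V τ) ^ 2)) / 2 ^ (s * ((n : ℝ) - 1))) ∧
        ∫⁻ τ in Ioc 0 T, ENNReal.ofReal (ν * blockEnergy P n (pderiv 0 (w τ))) ≤
          ENNReal.ofReal (35 * (6 * (1 + √(ν * T)) * d) ^ 2 * (2 ^ (ε * ((n : ℝ) + 1)) *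
            Real.exp (C / ε * (∫ τ in (0 : ℝ)..T, V τ) ^ 2)) ^ 2 /
              ((2 : ℝ) ^ (s * ((n : ℝ) - 1))) ^ 2) := by
  obtain ⟨hs1, hs2⟩ := hs
  -- Constant of the second pass, fixed in terms of `s` alone. With `α = s - (s + 1) / 4` and `ε <
  -- (s + 1) / 2` one has `ε - α ≤ 1 - (s + 1) / 4`.
  obtain ⟨C, hC, hprop⟩ := exists_propagation P (δ := min (1 - s) ((s + 1) / 4))
    (lt_min (by linarith) (by linarith)) ((min_le_right _ _).trans (by linarith))
  refine ⟨C, hC, ?_⟩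
  intro ν T v w f V w₀ p g d σ M hν hT hv hsol hd hw0 hfd hgd hσ hbd
  choose fN hfN hfb hfi using exists_forcing_bound hT hd hsol.f_int hfd
  choose gN hgN hgN2 hgb hgi hgi2 using exists_scalar_forcing_bound hT
    (by positivity : 0 ≤ √ν * d) hsol.g_int hgd
  -- The factor `6` covers `2 d` for the initial data, `(4 + √(νT)) d` for `f` and the first block
  -- of `g`, and `√29 d` for the integration by parts of `g`.
  set D := 6 * (1 + √(ν * T)) * d with hD
  have hdD : 6 * d ≤ D := by
    rw [hD]; have := mul_nonneg (Real.sqrt_nonneg (ν * T)) hd; linarith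
  have hD0 : 0 ≤ D := by linarith
  have ha : ∀ n : ℕ, 0 < (2 : ℝ) ^ (s * ((n : ℝ) - 1)) := fun n => Real.rpow_pos_of_pos two_pos _
  have hi0 : ∀ n : ℕ, 2 ^ (s * ((n : ℝ) - 1)) * √(blockEnergy P n (w 0)) ≤ D := fun n => by
    rw [← hsol.initial hT] at hw0
    have h1 := sqrt_blockEnergy_le (div_nonneg hd (ha n).le)
      (l2Bound_block_of_besovNorm_le hd hw0 n)
    refine (mul_le_mul_of_nonneg_left h1 (ha n).le).trans ?_
    have := (ha n).ne'
    field_simp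
    linarith
  have hpow : ∀ n : ℕ, ((2 : ℝ) ^ ((s - 1) * ((n : ℝ) - 1)))⁻¹ =
      ((2 : ℝ) ^ (s * ((n : ℝ) - 1)))⁻¹ * (2 ^ n / 2) := fun n => by
    rw [← Real.rpow_neg zero_le_two, ← Real.rpow_neg zero_le_two,
      show -((s - 1) * ((n : ℝ) - 1)) = -(s * ((n : ℝ) - 1)) + (n - 1) by ring,
      Real.rpow_add two_pos, Real.rpow_sub two_pos, Real.rpow_natCast, Real.rpow_one]
  have hif : ∀ n : ℕ, 2 ^ (s * ((n : ℝ) - 1)) *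
      (∫ τ in (0 : ℝ)..T, (2 * fN n τ + if n = 0 then gN n τ else 0)) ≤ D := fun n => by
    have h1 := hfi n
    have h2 : ∫ τ in (0 : ℝ)..T, (if n = 0 then gN n τ else 0) ≤
        ((2 : ℝ) ^ (s * ((n : ℝ) - 1)))⁻¹ * (√(ν * T) * d) := by
      split_ifs with hn
      · have h3 := hgi n
        rw [hpow, hn] at h3
        rw [hn]
        refine h3.trans ?_
        rw [Real.sqrt_mul hν.le]
        have h4 : 0 ≤ ((2 : ℝ) ^ (s * (((0 : ℕ) : ℝ) - 1)))⁻¹ * (√ν * √T * d) := by positivity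
        calc _ = 1 / 2 * (((2 : ℝ) ^ (s * (((0 : ℕ) : ℝ) - 1)))⁻¹ * (√ν * √T * d)) := by ring
          _ ≤ _ := by linarith
      · rw [intervalIntegral.integral_zero]; positivity
    have hgi' : IntervalIntegrable (fun τ => if n = 0 then gN n τ else 0) volume 0 T := by
      split_ifs
      · exact hgN n
      · exact intervalIntegrable_const
    rw [intervalIntegral.integral_add ((hfN n).const_mul 2) hgi',
      intervalIntegral.integral_const_mul]
    calc _ ≤ 2 ^ (s * ((n : ℝ) - 1)) * (2 * (2 * (((2 : ℝ) ^ (s * ((n : ℝ) - 1)))⁻¹ * d)) +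
          ((2 : ℝ) ^ (s * ((n : ℝ) - 1)))⁻¹ * (√(ν * T) * d)) :=
          mul_le_mul_of_nonneg_left (by linarith) (ha n).le
      _ = 4 * d + √(ν * T) * d := by have := (ha n).ne'; field_simp; ring
      _ ≤ D := by rw [hD]; have := mul_nonneg (Real.sqrt_nonneg (ν * T)) hd; linarith
  have hig : ∀ n : ℕ, ((2 : ℝ) ^ (s * ((n : ℝ) - 1))) ^ 2 *
      (∫ τ in (0 : ℝ)..T, 116 / ν * ((4 : ℝ) ^ n)⁻¹ * gN n τ ^ 2) ≤ D ^ 2 := fun n => by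
    have h1 := hgi2 n
    rw [hpow] at h1
    rw [intervalIntegral.integral_const_mul]
    have h4 : (4 : ℝ) ^ n = (2 ^ n) ^ 2 := by rw [← pow_mul, mul_comm n 2, pow_mul]; norm_num
    calc _ ≤ ((2 : ℝ) ^ (s * ((n : ℝ) - 1))) ^ 2 * (116 / ν * ((4 : ℝ) ^ n)⁻¹ *
          (((2 : ℝ) ^ (s * ((n : ℝ) - 1)))⁻¹ * (2 ^ n / 2) * (√ν * d)) ^ 2) := by
          have := ha n
          gcongr
      _ = 29 * d ^ 2 := by
          rw [h4, mul_pow _ (√ν * d), mul_pow √ν, Real.sq_sqrt hν.le]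
          have := (ha n).ne'
          field_simp; ring
      _ ≤ D ^ 2 := by nlinarith
  -- a first application, which loses less than `(s + 1) / 4` derivatives
  obtain ⟨M', hM', hap⟩ : ∃ M', 0 ≤ M' ∧ ∀ t ∈ Icc 0 T, ∀ n : ℕ, ∀ i,
      L2Bound (dmul (blockT P n) (coord i (w t)))
        (M' / 2 ^ ((s - (s + 1) / 4) * ((n : ℝ) - 1))) := by
    set α := min σ s with hα
    have hα1 : -1 < α := lt_min hσ hs1
    have hαs : α ≤ s := min_le_right _ _
    set ε := min ((s + 1) / 4) ((1 + α) / 2) with hε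
    have hε0 : 0 < ε := lt_min (by linarith) (by linarith)
    have hε1 : ε ≤ (1 + α) / 2 := min_le_right _ _
    -- This constant depends on `σ`. It enters `M'` only, which the second pass uses to have a
    -- finite supremum and which disappears from its conclusion.
    obtain ⟨C', hC', hprop'⟩ := exists_propagation P (δ := min (1 - s) ((1 + α) / 2))
      (lt_min (by linarith) (by linarith)) ((min_le_right _ _).trans (by linarith))
    have h1 := fun n => (hprop' hν hT hv hsol (s := s) (α := α) (ε := ε) (D := D)
      (M := 2 ^ (σ - α) * max M 0) hε0 hαs
      (by linarith [min_le_left (1 - s) ((1 + α) / 2)])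
      (by linarith [min_le_right (1 - s) ((1 + α) / 2)]) (by positivity)
      (fun t ht n i => l2Bound_mono_exponent (le_max_right _ _) (min_le_left _ _)
        (l2Bound_block_of_besovNorm_le (le_max_right _ _)
          ((hbd t ht).trans (ENNReal.ofReal_le_ofReal (le_max_left _ _))) n i))
      hfN hgN hgN2 hfb hgb hi0 hif hig n).1
    set X := Real.exp (C' / ε * (∫ τ in (0 : ℝ)..T, V τ) ^ 2) with hX
    refine ⟨2 ^ (s - ε - (s - (s + 1) / 4)) * (6 * D * (2 ^ (2 * ε) * X)), by positivity,
      fun t ht n i => l2Bound_mono_exponent (by positivity)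
        (by linarith [min_le_left ((s + 1) / 4) ((1 + α) / 2)]) ?_⟩
    refine (l2Bound_rep (mul_nonneg (by positivity) (le_max_right M 0))
      ((l2Bound_block_of_besovNorm_le (r := σ) (le_max_right M 0)
        ((hbd t ht).trans (ENNReal.ofReal_le_ofReal (le_max_left M 0))) n i).mono
          (le_of_eq (div_eq_inv_mul _ _)))).mono
      ((norm_rep_le_sqrt_blockEnergy n (w t) i).trans ?_)
    rw [le_div_iff₀ (by positivity)]
    have h2 := h1 n t ht
    have h3 : (2 : ℝ) ^ (s * ((n : ℝ) - 1)) = 2 ^ ((s - ε) * ((n : ℝ) - 1)) * 2 ^ (ε * ((n : ℝ) - 1)) := by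
      rw [← Real.rpow_add two_pos]; congr 1; ring
    have h4 : (2 : ℝ) ^ (ε * ((n : ℝ) + 1)) = 2 ^ (2 * ε) * 2 ^ (ε * ((n : ℝ) - 1)) := by
      rw [← Real.rpow_add two_pos]; congr 1; ring
    rw [h3, h4] at h2
    refine le_of_mul_le_mul_right (le_trans (le_of_eq ?_) (h2.trans (le_of_eq ?_)))
      (Real.rpow_pos_of_pos two_pos (ε * ((n : ℝ) - 1)))
    · ring
    · ring
  intro n
  refine ⟨⟨_, div_nonneg hM' (by positivity), fun t ht i => hap t ht n i⟩, fun ε hε => ?_⟩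
  have h1 := hprop hν hT hv hsol (s := s) (α := s - (s + 1) / 4) (ε := ε) (D := D) (M := M') hε.1
    (by linarith) (by linarith [min_le_left (1 - s) ((s + 1) / 4)])
    (by linarith [min_le_right (1 - s) ((s + 1) / 4), hε.2]) hM' hap hfN hgN hgN2 hfb hgb
    hi0 hif hig n
  refine ⟨fun t ht => ?_, h1.2⟩
  rw [le_div_iff₀ (ha n), mul_comm]
  exact h1.1 t ht

end AnisotropicStokes

/-! ### From blocks to Besov norms -/

namespace AnisotropicStokes

open scoped FourierTransform

variable {P : DyadicPartition}

lemma besovNorm_le_of_blockEnergy {r K : ℝ} {u : 𝓢'(Plane, CVec)}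
    (hb : ∀ n : ℕ, ∃ R : ℝ, 0 ≤ R ∧ ∀ i, L2Bound (dmul (blockT P n) (coord i u)) R)
    (h : ∀ n : ℕ, √(blockEnergy P n u) ≤ K / 2 ^ (r * ((n : ℝ) - 1))) :
    besovNorm P r u ≤ ENNReal.ofReal (2 * K) := iSup_block_le fun n => by
  obtain ⟨R, hR, hRb⟩ := hb n
  push_cast
  rw [mul_comm ((n : ℝ) - 1) r]
  refine (mul_le_mul' le_rfl (distLpNorm_block_le_blockEnergy hR hRb)).trans ?_
  rw [← ENNReal.ofReal_mul (by positivity)]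
  refine ENNReal.ofReal_le_ofReal ?_
  have h1 := h n
  rw [le_div_iff₀ (by positivity)] at h1
  linarith

lemma sqrt_mul_lintegral_le {h : ℝ → ℝ≥0∞} {ν t K : ℝ} (hν : 0 < ν)
    (hK : 0 ≤ K) (hle : ∫⁻ τ in Ioc 0 t, ENNReal.ofReal ν * h τ ≤ ENNReal.ofReal K) :
    ENNReal.ofReal (ν ^ (1 / 2 : ℝ)) * (∫⁻ τ in Icc 0 t, h τ) ^ (1 / 2 : ℝ) ≤
      ENNReal.ofReal √K := by
  rw [lintegral_const_mul' _ _ ENNReal.ofReal_ne_top, restrict_Ioc_eq_restrict_Icc] at hle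
  rw [← ENNReal.ofReal_rpow_of_pos hν, ← ENNReal.mul_rpow_of_nonneg _ _ (by norm_num),
    Real.sqrt_eq_rpow, ← ENNReal.ofReal_rpow_of_nonneg hK (by norm_num)]
  exact ENNReal.rpow_le_rpow hle (by norm_num)

section Time

variable {ν t r K ε : ℝ} {u : ℝ → 𝓢'(Plane, CVec)}

lemma distLpNorm_block_sq_le {n : ℕ} {u : 𝓢'(Plane, CVec)} {R : ℝ} (hR : 0 ≤ R)
    (h : ∀ i, L2Bound (dmul (blockT P n) (coord i u)) R) :
    distLpNorm 2 (block P ((n : ℤ) - 1) u) ^ 2 ≤ ENNReal.ofReal (4 * blockEnergy P n u) := by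
  refine (pow_le_pow_left' (distLpNorm_block_le_blockEnergy hR h) 2).trans (le_of_eq ?_)
  rw [← ENNReal.ofReal_pow (by positivity), mul_pow, Real.sq_sqrt (blockEnergy_nonneg n u)]
  norm_num

lemma blockTimeL2Besov_le (hν : 0 < ν) (hK : 0 ≤ K) (hb : ∀ n : ℕ, ∃ R : ℝ, 0 ≤ R ∧
      ∀ τ ∈ Icc 0 t, ∀ i, L2Bound (dmul (blockT P n) (coord i (u τ))) R)
    (h : ∀ n : ℕ, ∫⁻ τ in Ioc 0 t, ENNReal.ofReal (ν * blockEnergy P n (u τ)) ≤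
      ENNReal.ofReal (K ^ 2 / ((2 : ℝ) ^ (r * ((n : ℝ) - 1))) ^ 2)) :
    ENNReal.ofReal (ν ^ (1 / 2 : ℝ)) * blockTimeL2Besov P r t u ≤ ENNReal.ofReal (2 * K) := by
  rw [blockTimeL2Besov]
  simp only [ENNReal.mul_iSup]
  refine iSup_block_le fun n => ?_
  obtain ⟨R, hR, hRb⟩ := hb n
  push_cast
  rw [mul_comm ((n : ℝ) - 1) r, mul_left_comm]
  set a := (2 : ℝ) ^ (r * ((n : ℝ) - 1)) with ha
  have ha0 : 0 < a := by positivity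
  have h1 : ∫⁻ τ in Ioc 0 t, ENNReal.ofReal ν * distLpNorm 2 (block P ((n : ℤ) - 1) (u τ)) ^ 2 ≤
      ENNReal.ofReal ((2 * K / a) ^ 2) := by
    calc _ ≤ ∫⁻ τ in Ioc 0 t, ENNReal.ofReal 4 * ENNReal.ofReal (ν * blockEnergy P n (u τ)) := by
          refine setLIntegral_mono' measurableSet_Ioc fun τ hτ => ?_
          refine (mul_le_mul' le_rfl (distLpNorm_block_sq_le hR
            (hRb τ (Ioc_subset_Icc_self hτ)))).trans (le_of_eq ?_)
          rw [← ENNReal.ofReal_mul hν.le, ← ENNReal.ofReal_mul (by norm_num)]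
          congr 1; ring
      _ ≤ ENNReal.ofReal 4 * ENNReal.ofReal (K ^ 2 / a ^ 2) := by
          rw [lintegral_const_mul' _ _ ENNReal.ofReal_ne_top]
          exact mul_le_mul' le_rfl (h n)
      _ = _ := by rw [← ENNReal.ofReal_mul (by norm_num)]; congr 1; ring
  refine (mul_le_mul' le_rfl (sqrt_mul_lintegral_le hν (sq_nonneg _) h1)).trans (le_of_eq ?_)
  rw [Real.sqrt_sq (by positivity), ← ENNReal.ofReal_mul ha0.le]
  congr 1; field_simp

/-- From `exp x ≥ 1 + x` one gets `1 - 2^{-ε} ≥ 2^{-ε} ε log 2 ≥ ε / 3`, using `2^{-ε} ≥ 1/2` and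
`log 2 ≥ 2/3`. The square root of this sum is the `1/√ε` of the second estimate. -/
lemma tsum_two_rpow_le (hε : 0 < ε) (hε1 : ε ≤ 1) :
    ∑' n : ℕ, ENNReal.ofReal ((2 : ℝ) ^ (-(ε * n))) ≤ ENNReal.ofReal (3 / ε) := by
  set q : ℝ := 2 ^ (-ε) with hq
  have hq0 : 0 < q := by positivity
  have h1 : ∀ n : ℕ, (2 : ℝ) ^ (-(ε * n)) = q ^ n := fun n => by
    rw [hq, ← Real.rpow_mul_natCast zero_le_two]; congr 1; ring
  have h2 : ε / 3 ≤ 1 - q := by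
    have h3 : 2⁻¹ ≤ q := by
      rw [hq, ← Real.rpow_neg_one]
      exact Real.rpow_le_rpow_of_exponent_le one_le_two (by linarith)
    have h4 : q * Real.exp (ε * Real.log 2) = 1 := by
      rw [hq, Real.rpow_def_of_pos two_pos, ← Real.exp_add, ← Real.exp_zero]; congr 1; ring
    have h5 := Real.add_one_le_exp (ε * Real.log 2)
    have h6 := Real.log_two_gt_d9
    have h7 : q * (ε * Real.log 2 + 1) ≤ 1 :=
      (mul_le_mul_of_nonneg_left h5 hq0.le).trans h4.le
    have h8 : 2⁻¹ * (ε * (2 / 3)) ≤ q * (ε * Real.log 2) := by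
      refine mul_le_mul h3 (mul_le_mul_of_nonneg_left (by linarith) hε.le) (by positivity) hq0.le
    linarith
  simp only [h1]
  have hq1 : q < 1 := by linarith [div_pos hε (by norm_num : (0 : ℝ) < 3)]
  rw [← ENNReal.ofReal_tsum_of_nonneg (fun n => by positivity)
    (summable_geometric_of_lt_one hq0.le hq1), tsum_geometric_of_lt_one hq0.le hq1]
  refine ENNReal.ofReal_le_ofReal ?_
  rw [inv_le_comm₀ (by linarith) (by positivity), inv_div]
  exact h2

/-- The supremum over blocks, being inside the time integral, is dominated by an `ℓ²` sum, which
commutes with the integral. The extra decay `2^{-εn}` in the hypothesis makes the sum converge. -/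
lemma timeL2Besov_le (hν : 0 < ν) (hK : 0 ≤ K) (hε : 0 < ε) (hε1 : ε ≤ 1)
    (hu : WeaklyIntegrable t u) (hb : ∀ n : ℕ, ∃ R : ℝ, 0 ≤ R ∧
      ∀ τ ∈ Icc 0 t, ∀ i, L2Bound (dmul (blockT P n) (coord i (u τ))) R)
    (h : ∀ n : ℕ, ∫⁻ τ in Ioc 0 t, ENNReal.ofReal (ν * blockEnergy P n (u τ)) ≤
      ENNReal.ofReal (K ^ 2 * 2 ^ (-(ε * n)) / ((2 : ℝ) ^ (r * ((n : ℝ) - 1))) ^ 2)) :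
    ENNReal.ofReal (ν ^ (1 / 2 : ℝ)) * timeL2Besov P r t u ≤ ENNReal.ofReal (4 * K / √ε) := by
  set a : ℕ → ℝ := fun n => (2 : ℝ) ^ (r * ((n : ℝ) - 1)) with ha
  have ha0 : ∀ n, 0 < a n := fun n => by positivity
  have h1 : ∀ τ ∈ Icc 0 t, besovNorm P r (u τ) ^ 2 ≤
      ∑' n, ENNReal.ofReal (4 * a n ^ 2 * blockEnergy P n (u τ)) := fun τ hτ => by
    set S := ∑' n, ENNReal.ofReal (4 * a n ^ 2 * blockEnergy P n (u τ)) with hS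
    have h2 : besovNorm P r (u τ) ≤ S ^ (((2 : ℕ) : ℝ)⁻¹) := iSup_block_le fun n => by
      obtain ⟨R, hR, hRb⟩ := hb n
      push_cast
      rw [mul_comm ((n : ℝ) - 1) r]
      change ENNReal.ofReal (a n) * _ ≤ _
      rw [← ENNReal.pow_rpow_inv_natCast two_ne_zero (ENNReal.ofReal (a n) * _)]
      refine ENNReal.rpow_le_rpow ?_ (by norm_num)
      refine le_trans ?_ (ENNReal.le_tsum n)
      rw [mul_pow]
      refine (mul_le_mul' le_rfl (distLpNorm_block_sq_le hR (hRb τ hτ))).trans (le_of_eq ?_)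
      rw [← ENNReal.ofReal_pow (ha0 n).le, ← ENNReal.ofReal_mul (by positivity)]
      congr 1; ring
    refine (pow_le_pow_left' h2 2).trans (le_of_eq ?_)
    rw [ENNReal.rpow_inv_natCast_pow two_ne_zero]
  have h2 : ∫⁻ τ in Ioc 0 t, ENNReal.ofReal ν * besovNorm P r (u τ) ^ 2 ≤
      ENNReal.ofReal (4 * K ^ 2 * (3 / ε)) := by
    calc _ ≤ ∫⁻ τ in Ioc 0 t, ∑' n, ENNReal.ofReal (4 * a n ^ 2) *
          ENNReal.ofReal (ν * blockEnergy P n (u τ)) := by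
          refine setLIntegral_mono' measurableSet_Ioc fun τ hτ => ?_
          refine (mul_le_mul' le_rfl (h1 τ (Ioc_subset_Icc_self hτ))).trans (le_of_eq ?_)
          rw [← ENNReal.tsum_mul_left]
          refine tsum_congr fun n => ?_
          rw [← ENNReal.ofReal_mul hν.le, ← ENNReal.ofReal_mul (by positivity)]
          congr 1; ring
      _ = ∑' n, ENNReal.ofReal (4 * a n ^ 2) *
          ∫⁻ τ in Ioc 0 t, ENNReal.ofReal (ν * blockEnergy P n (u τ)) := by
          rw [lintegral_tsum fun n => ?_]
          · simp_rw [lintegral_const_mul' _ _ ENNReal.ofReal_ne_top]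
          · obtain ⟨R, hR, hRb⟩ := hb n
            exact ((aemeasurable_blockEnergy hu hR hRb).const_mul ν).ennreal_ofReal.const_mul _
      _ ≤ ∑' n : ℕ, ENNReal.ofReal (4 * K ^ 2) * ENNReal.ofReal (2 ^ (-(ε * n))) := by
          refine ENNReal.tsum_le_tsum fun n => (mul_le_mul' le_rfl (h n)).trans (le_of_eq ?_)
          rw [← ENNReal.ofReal_mul (by positivity), ← ENNReal.ofReal_mul (by positivity)]
          congr 1
          have := (ha0 n).ne'
          change 4 * a n ^ 2 * (K ^ 2 * 2 ^ (-(ε * n)) / a n ^ 2) = _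
          field_simp
      _ ≤ _ := by
          rw [ENNReal.tsum_mul_left, ENNReal.ofReal_mul (p := 4 * K ^ 2) (by positivity)]
          exact mul_le_mul' le_rfl (tsum_two_rpow_le hε hε1)
  refine (sqrt_mul_lintegral_le hν (by positivity) h2).trans (ENNReal.ofReal_le_ofReal ?_)
  refine Real.sqrt_le_iff.2 ⟨by positivity, ?_⟩
  rw [div_pow, Real.sq_sqrt hε.le, mul_div_assoc', div_le_div_iff_of_pos_right hε]
  nlinarith [sq_nonneg K]

end Time

/-- The losing estimates, in which `d` bounds the size of the data. -/
theorem exists_besov_estimate (P : DyadicPartition) {s : ℝ} (hs : s ∈ Ioo (-1 : ℝ) 1) :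
    ∃ C : ℝ, 0 ≤ C ∧
    ∀ {ν T : ℝ} {v w f : ℝ → 𝓢'(Plane, CVec)} {V : ℝ → ℝ} {w₀ : 𝓢'(Plane, CVec)}
      {p g : ℝ → 𝓢'(Plane, ℂ)} {d σ M : ℝ}, 0 < ν → 0 ≤ T → IsLosingField P T v V →
      IsSolution P ν T v w w₀ p f g → 0 ≤ d → besovNorm P s w₀ ≤ ENNReal.ofReal d →
      timeL1Besov P s T f ≤ ENNReal.ofReal d →
      timeL2Besov P (s - 1) T g ≤ ENNReal.ofReal (√ν * d) → -1 < σ →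
      (∀ t ∈ Icc 0 T, besovNorm P σ (w t) ≤ ENNReal.ofReal M) →
      ∀ ε ∈ Ioo 0 ((s + 1) / 2), ∀ Y : ℝ,
        Y = 6 * (1 + √(ν * T)) * d * Real.exp (C / ε * (∫ τ in (0 : ℝ)..T, V τ) ^ 2) →
        besovNorm P (s - ε) (w T) ≤ ENNReal.ofReal (48 * Y) ∧
        ENNReal.ofReal (ν ^ (1 / 2 : ℝ)) *
          blockTimeL2Besov P (s - ε) T (fun τ => pderiv 0 (w τ)) ≤ ENNReal.ofReal (48 * Y) ∧
        ENNReal.ofReal (ν ^ (1 / 2 : ℝ)) *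
          timeL2Besov P (s - ε) T (fun τ => pderiv 0 (w τ)) ≤ ENNReal.ofReal (72 * Y / √ε) := by
  obtain ⟨C, hC, hest⟩ := exists_losing_estimate P hs
  -- The block estimate is also applied with `ε / 2`, which doubles the constant in the exponential.
  refine ⟨2 * C, by positivity, ?_⟩
  intro ν T v w f V w₀ p g d σ M hν hT hv hsol hd hw0 hfd hgd hσ hbd ε hε Y hY
  have hres := hest hν hT hv hsol hd hw0 hfd hgd hσ hbd
  have hε0 : 0 < ε := hε.1
  have hε1 : ε ≤ 1 := by linarith [hε.2, hs.2]
  set D := 6 * (1 + √(ν * T)) * d with hD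
  have hD0 : 0 ≤ D := by positivity
  set X := Real.exp (2 * C / ε * (∫ τ in (0 : ℝ)..T, V τ) ^ 2) with hX
  have hX0 : 0 < X := Real.exp_pos _
  have hXle : Real.exp (C / ε * (∫ τ in (0 : ℝ)..T, V τ) ^ 2) ≤ X := by
    refine Real.exp_le_exp.2 (mul_le_mul_of_nonneg_right ?_ (sq_nonneg _))
    gcongr; linarith
  have hXhalf : Real.exp (C / (ε / 2) * (∫ τ in (0 : ℝ)..T, V τ) ^ 2) = X := by
    rw [hX]; congr 2; field_simp
  have hY0 : 0 ≤ Y := by rw [hY]; positivity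
  have h4 : (2 : ℝ) ^ (2 * ε) ≤ 4 := by
    calc (2 : ℝ) ^ (2 * ε) ≤ 2 ^ (2 : ℝ) :=
          Real.rpow_le_rpow_of_exponent_le one_le_two (by linarith)
      _ = 4 := by norm_num
  have h8 : (2 : ℝ) ^ (3 * ε) ≤ 8 := by
    calc (2 : ℝ) ^ (3 * ε) ≤ 2 ^ (3 : ℝ) :=
          Real.rpow_le_rpow_of_exponent_le one_le_two (by linarith)
      _ = 8 := by norm_num
  have hsplit : ∀ n : ℕ, (2 : ℝ) ^ (ε * ((n : ℝ) + 1)) / 2 ^ (s * ((n : ℝ) - 1)) =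
      2 ^ (2 * ε) / 2 ^ ((s - ε) * ((n : ℝ) - 1)) := fun n => by
    rw [← Real.rpow_sub two_pos, ← Real.rpow_sub two_pos]; congr 1; ring
  have hsplit' : ∀ n : ℕ, ((2 : ℝ) ^ (ε / 2 * ((n : ℝ) + 1))) ^ 2 / (2 ^ (s * ((n : ℝ) - 1))) ^ 2 =
      2 ^ (3 * ε) * 2 ^ (-(ε * n)) / (2 ^ ((s - ε) * ((n : ℝ) - 1))) ^ 2 := fun n => by
    rw [← Real.rpow_mul_natCast zero_le_two, ← Real.rpow_mul_natCast zero_le_two,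
      ← Real.rpow_mul_natCast zero_le_two, ← Real.rpow_sub two_pos, ← Real.rpow_add two_pos,
      ← Real.rpow_sub two_pos]
    congr 1; push_cast; ring
  have hTT : T ∈ Icc 0 T := ⟨hT, le_rfl⟩
  have hbp : ∀ n : ℕ, ∃ R : ℝ, 0 ≤ R ∧ ∀ τ ∈ Icc 0 T, ∀ i,
      L2Bound (dmul (blockT P n) (coord i (pderiv 0 (w τ)))) R := fun n => by
    obtain ⟨R, hR, hRb⟩ := (hres n).1
    refine ⟨R * (8 / 3 * 2 ^ n), by positivity, fun τ hτ i => ?_⟩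
    rw [coord_pderiv]
    exact l2Bound_block_pderiv hR (hRb τ hτ i) 0
  refine ⟨?_, ?_, ?_⟩
  · have h1 := besovNorm_le_of_blockEnergy (P := P) (r := s - ε) (K := 24 * Y) (u := w T)
      (fun n => by
        obtain ⟨R, hR, hRb⟩ := (hres n).1
        exact ⟨R, hR, hRb T hTT⟩)
      (fun n => ((hres n).2 ε hε).1 T hTT |>.trans (by
        rw [mul_div_assoc, mul_div_right_comm, hsplit]
        calc _ ≤ 6 * D * (4 / 2 ^ ((s - ε) * ((n : ℝ) - 1)) * X) := by gcongr
          _ = _ := by rw [hY]; ring))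
    rwa [← mul_assoc, show (2 : ℝ) * 24 = 48 by norm_num] at h1
  -- `24² ≥ 35 · 4²`, where `4` bounds `2^{2ε}`.
  · have h1 := blockTimeL2Besov_le (P := P) (r := s - ε) (K := 24 * Y) hν (by positivity) hbp
      (fun n => ((hres n).2 ε hε).2.trans (ENNReal.ofReal_le_ofReal (by
        rw [mul_pow _ (Real.exp _), mul_div_assoc, mul_div_right_comm, ← div_pow, hsplit, div_pow]
        calc _ ≤ 35 * D ^ 2 * (4 ^ 2 / (2 ^ ((s - ε) * ((n : ℝ) - 1))) ^ 2 * X ^ 2) := by gcongr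
          _ = 560 * (D * X) ^ 2 / (2 ^ ((s - ε) * ((n : ℝ) - 1))) ^ 2 := by ring
          _ ≤ (24 * Y) ^ 2 / (2 ^ ((s - ε) * ((n : ℝ) - 1))) ^ 2 := by
              rw [hY]; gcongr; nlinarith [sq_nonneg (D * X)])))
    rwa [← mul_assoc, show (2 : ℝ) * 24 = 48 by norm_num] at h1
  -- Losing `ε / 2` on the blocks instead of `ε` leaves the factor `2^{-εn}` for the summation. The
  -- constant comes from `18² ≥ 35 · 8`, where `8` bounds `2^{3ε}`.
  · have h1 := timeL2Besov_le (P := P) (r := s - ε) (K := 18 * Y) hν (by positivity) hε0 hε1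
      (hsol.w_int.pderiv 0) hbp
      (fun n => ((hres n).2 (ε / 2) ⟨by linarith, by linarith [hε.2]⟩).2.trans
        (ENNReal.ofReal_le_ofReal (by
        rw [hXhalf, mul_pow _ X, mul_div_assoc, mul_div_right_comm, hsplit']
        calc _ ≤ 35 * D ^ 2 * (8 * 2 ^ (-(ε * n)) /
              (2 ^ ((s - ε) * ((n : ℝ) - 1))) ^ 2 * X ^ 2) := by gcongr
          _ = 280 * (D * X) ^ 2 * 2 ^ (-(ε * n)) / (2 ^ ((s - ε) * ((n : ℝ) - 1))) ^ 2 := by ring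
          _ ≤ (18 * Y) ^ 2 * 2 ^ (-(ε * n)) / (2 ^ ((s - ε) * ((n : ℝ) - 1))) ^ 2 := by
              rw [hY]; gcongr; nlinarith [sq_nonneg (D * X)])))
    rwa [← mul_assoc, show (4 : ℝ) * 18 = 72 by norm_num] at h1

end AnisotropicStokes

end

/-! ### The theorem -/

theorem proposition17 (P : DyadicPartition) (s : ℝ) (hs : s ∈ Ioo (-1 : ℝ) 1) :
    ∃ C : ℝ, 0 < C ∧
      ∀ (ν T : ℝ) (_ : 0 < ν) (_ : 0 < T)
        (v : ℝ → 𝓢'(Plane, CVec)) (V : ℝ → ℝ) (_ : IsLosingField P T v V)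
        (w₀ : 𝓢'(Plane, CVec)) (f : ℝ → 𝓢'(Plane, CVec)) (g : ℝ → 𝓢'(Plane, ℂ))
        (_ : besovNorm P s w₀ < ∞) (_ : timeL1Besov P s T f < ∞)
        (_ : timeL2Besov P (s - 1) T g < ∞)
        (w : ℝ → 𝓢'(Plane, CVec)) (p : ℝ → 𝓢'(Plane, ℂ))
        (_ : IsSolution P ν T v w w₀ p f g)
        (_ : ∃ σ M : ℝ, -1 < σ ∧ ∀ t ∈ Icc 0 T, besovNorm P σ (w t) ≤ ENNReal.ofReal M)
        (ε : ℝ) (_ : ε ∈ Ioo 0 ((s + 1) / 2)) (t : ℝ) (_ : t ∈ Icc 0 T),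
        besovNorm P (s - ε) (w t)
            + ENNReal.ofReal (ν ^ (1 / 2 : ℝ))
              * blockTimeL2Besov P (s - ε) t (fun τ => pderiv 0 (w τ))
          ≤ ENNReal.ofReal (C * (1 + √(ν * t))
              * Real.exp (C / ε * (∫ τ in (0 : ℝ)..t, V τ) ^ 2))
            * dataSize P s ν t w₀ f g ∧
        besovNorm P (s - ε) (w t)
            + ENNReal.ofReal (ν ^ (1 / 2 : ℝ))
              * timeL2Besov P (s - ε) t (fun τ => pderiv 0 (w τ))
          ≤ ENNReal.ofReal (C / √ε * (1 + √(ν * t))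
              * Real.exp (C / ε * (∫ τ in (0 : ℝ)..t, V τ) ^ 2))
            * dataSize P s ν t w₀ f g := by
  obtain ⟨C, hC, hest⟩ := exists_besov_estimate P hs
  -- A single constant serves in the exponential and in front of it: `720 = 6 · (48 + 72)` dominates
  -- the prefactors of both estimates.
  refine ⟨C + 720, by positivity, ?_⟩
  intro ν T hν hT v V hv w₀ f g hw0 hf hg w p hsol hbd ε hε t ht
  obtain ⟨σ, M, hσ, hM⟩ := hbd
  have hft : timeL1Besov P s t f ≠ ∞ :=
    ((lintegral_mono_set (Icc_subset_Icc_right ht.2)).trans_lt hf).ne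
  have hgt : timeL2Besov P (s - 1) t g ≠ ∞ :=
    ((ENNReal.rpow_le_rpow (lintegral_mono_set (Icc_subset_Icc_right ht.2))
      (by norm_num)).trans_lt hg).ne
  have hdata : dataSize P s ν t w₀ f g ≠ ∞ := ENNReal.add_ne_top.2
    ⟨ENNReal.add_ne_top.2 ⟨hw0.ne, hft⟩, ENNReal.mul_ne_top ENNReal.ofReal_ne_top hgt⟩
  have hd0 : 0 ≤ (dataSize P s ν t w₀ f g).toReal := ENNReal.toReal_nonneg
  have hd : ENNReal.ofReal (dataSize P s ν t w₀ f g).toReal = dataSize P s ν t w₀ f g :=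
    ENNReal.ofReal_toReal hdata
  have hg' : timeL2Besov P (s - 1) t g ≤
      ENNReal.ofReal (√ν * (dataSize P s ν t w₀ f g).toReal) := by
    calc timeL2Besov P (s - 1) t g = ENNReal.ofReal √ν *
          (ENNReal.ofReal (ν ^ (-(1 / 2) : ℝ)) * timeL2Besov P (s - 1) t g) := by
          rw [← mul_assoc, ← ENNReal.ofReal_mul (Real.sqrt_nonneg ν), Real.sqrt_eq_rpow,
            ← Real.rpow_add hν, add_neg_cancel, Real.rpow_zero, ENNReal.ofReal_one, one_mul]
      _ ≤ _ := by
          rw [ENNReal.ofReal_mul (Real.sqrt_nonneg ν), hd]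
          exact mul_le_mul' le_rfl le_add_self
  set d := (dataSize P s ν t w₀ f g).toReal with hddef
  -- The estimate at the final time is applied on `[0, t]`, so that `∫₀ᵗ V`, `√(νt)` and the size of
  -- the data on `[0, t]` appear rather than their values at `T`.
  obtain ⟨h1, h2, h3⟩ := hest hν ht.1 (hv.restrict ht.2) (hsol.restrict ht.2) hd0
    (hd ▸ le_self_add.trans le_self_add) (hd ▸ le_add_self.trans le_self_add) hg' hσ
    (fun r hr => hM r ⟨hr.1, hr.2.trans ht.2⟩) ε hε _ rfl
  have hε0 : 0 < ε := hε.1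
  have hε1 : √ε ≤ 1 := Real.sqrt_le_one.2 (by linarith [hε.2, hs.2])
  have hsε : 0 < √ε := Real.sqrt_pos.2 hε0
  set Λ := 1 + √(ν * t) with hΛ
  have hΛ0 : 0 ≤ Λ := by positivity
  have hX : Real.exp (C / ε * (∫ τ in (0 : ℝ)..t, V τ) ^ 2) ≤
      Real.exp ((C + 720) / ε * (∫ τ in (0 : ℝ)..t, V τ) ^ 2) := by
    refine Real.exp_le_exp.2 (mul_le_mul_of_nonneg_right ?_ (sq_nonneg _))
    gcongr; linarith
  set X := Real.exp (C / ε * (∫ τ in (0 : ℝ)..t, V τ) ^ 2) with hXdef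
  set X' := Real.exp ((C + 720) / ε * (∫ τ in (0 : ℝ)..t, V τ) ^ 2) with hXdef'
  have hX0 : 0 < X := Real.exp_pos _
  have hmain : 6 * Λ * d * X ≤ 6 * (Λ * X' * d) := by
    calc 6 * Λ * d * X ≤ 6 * Λ * d * X' := mul_le_mul_of_nonneg_left hX (by positivity)
      _ = _ := by ring
  have hq : 0 ≤ Λ * X' * d := mul_nonneg (mul_nonneg hΛ0 (Real.exp_pos _).le) hd0
  have hY0 : 0 ≤ 6 * Λ * d * X := by positivity
  rw [← hd, ← ENNReal.ofReal_mul' hd0, ← ENNReal.ofReal_mul' hd0]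
  constructor
  · refine (add_le_add h1 h2).trans ?_
    rw [← ENNReal.ofReal_add (by positivity) (by positivity)]
    refine ENNReal.ofReal_le_ofReal ?_
    have := mul_nonneg hC hq
    calc _ ≤ 720 * (Λ * X' * d) := by linarith
      _ ≤ (C + 720) * Λ * X' * d := by linarith
  · refine (add_le_add h1 h3).trans ?_
    rw [← ENNReal.ofReal_add (by positivity) (by positivity)]
    refine ENNReal.ofReal_le_ofReal ?_
    have h4 : 48 * (6 * Λ * d * X) ≤ 48 * (6 * Λ * d * X) / √ε := by
      rw [le_div_iff₀ hsε]
      exact mul_le_of_le_one_right (by positivity) hε1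
    have := mul_nonneg hC hq
    calc _ ≤ 48 * (6 * Λ * d * X) / √ε + 72 * (6 * Λ * d * X) / √ε := by linarith
      _ = 120 * (6 * Λ * d * X) / √ε := by ring
      _ ≤ (C + 720) * (Λ * X' * d) / √ε :=
          div_le_div_of_nonneg_right (by linarith) hsε.le
      _ = _ := by ring
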